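/- **Setting.** Let $T>0$, $R>\rho_0>0$, $\alpha\ge 0$, and let $\rho:[0,T]\to[\rho_0,R)$ be Lipschitz with $\rho(0)=\rho_0$ and $0\le\dot\rho(t)<1$ for a.e. $t\in[0,T]$. Put $\Omega=\{(t,r): 0<t<T,\ 0<r<\rho(t)\}$, $\mathcal C_{a,R}=\{x\in\mathbb R^2: a<|x|<R\}$ and $\mathcal O_\rho=\{(t,x): 0<t<T,\ x\in\mathcal C_{R-\rho(t),R}\}$. Functions in $W^{1,2}$ of an interval are identified with their continuous representatives. "Solution" always means: a function in $W^{1,2}$ of the space-time domain that satisfies the equation in the sense of distributions, the boundary conditions in the sense of traces, the initial condition on the function in the sense of $L^2$, and the initial condition on its time derivative in the sense of $W^{-1,2}$ of the initial space domain. Uniqueness is up to equality almost everywhere. For $b\in\{0,1\}$ and $a\ge0$ consider the problem $(P_{b,a})$ $$\begin{cases} v_{tt}-v_{rr}+\dfrac{b}{R-r}\,v_r+a\,v_t=0 & \text{in }\Omega,\\ v(t,0)=w(t),\quad v(t,\rho(t))=0 & 0<t<T,\\ v(0,r)=v_0(r),\quad v_t(0,r)=v_1(r) & 0<r<\rho_0.\end{cases}$$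 Let $\psi(t)=t+\rho(t)$, and let $\omega(s)=\psi^{-1}(s)-\rho(\psi^{-1}(s))$ for $s\in[\rho_0,T+\rho(T)]$. Let $\Omega'=\Omega_1'\cup\Omega_2'\cup\Omega_3'$, where $\Omega_1'$, $\Omega_2'$, $\Omega_3'$ are the sets of the points $(t,r)\in\Omega$ such that, respectively, $t\le r$ and $t+r\le\rho_0$; $t>r$ and $t+r<\rho_0$; $t<r$ and $t+r>\rho_0$. Let $$C(t,r)=\{(\tau,\sigma)\in\Omega: 0\le\tau\le t,\ r-t+\tau\le\sigma\le r+t-\tau\},$$ and let $P(t,r)$ be $C(t,r)$ if $t<r$ and $t+r<\rho_0$; $C(t,r)\setminus C(t-r,0)$ if $t>r$ and $t+r<\rho_0$; and $C(t,r)\setminus C\big(\psi^{-1}(t+r),\rho(\psi^{-1}(t+r))\big)$ if $t<r$ and $t+r>\rho_0$. **(i)** Let $w\in W^{1,2}(0,T)$, $v_0\in W^{1,2}(0,\rho_0)$, $v_1\in L^2(0,\rho_0)$ with $v_0(0)=w(0)$ and $v_0(\rho_0)=0$. Then $(P_{1,\alpha})$ has a unique solution $v\in W^{1,2}(\Omega)$.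 Moreover, the undamped problem $(P_{0,0})$ with the same data has a unique solution $\mathring v\in W^{1,2}(\Omega)$, which for a.e. $(t,r)\in\Omega'$ is given by $$\mathring v(t,r)=\begin{cases}\frac12v_0(r-t)+\frac12v_0(r+t)+\frac12\int_{r-t}^{r+t}v_1(s)\,ds & (t,r)\in\Omega_1',\\[2pt] w(t-r)-\frac12v_0(t-r)+\frac12v_0(r+t)+\frac12\int_{t-r}^{t+r}v_1(s)\,ds & (t,r)\in\Omega_2',\\[2pt] \frac12v_0(r-t)-\frac12v_0(-\omega(r+t))+\frac12\int_{r-t}^{-\omega(r+t)}v_1(s)\,ds & (t,r)\in\Omega_3',\end{cases}$$ and $$v(t,r)=\mathring v(t,r)+\frac12\iint_{P(t,r)}\Big(-\frac{v_r(\tau,\sigma)}{R-\sigma}-\alpha\,v_t(\tau,\sigma)\Big)\,d\sigma\,d\tau\qquad\text{for a.e. }(t,r)\in\Omega'.$$ Finally, $v$ has a continuous representative on $\overline\Omega$, and, when this representative is extended by $0$ outside $\overline\Omega$, $$v\in C^0([0,T];W^{1,2}(0,R))\cap C^1([0,T];L^2(0,R)).$$ **(ii)** Let $w\in W^{1,2}(0,T)$,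 and let $u_0\in W^{1,2}(\mathcal C_{R-\rho_0,R})$ and $u_1\in L^2(\mathcal C_{R-\rho_0,R})$ be radial (a.e. equal to a function of $|x|$), such that the continuous radial profile of $u_0$, still denoted by $u_0$, satisfies $u_0(R)=w(0)$ and $u_0(R-\rho_0)=0$. Then the problem $$\begin{cases}u_{tt}-\Delta_xu+\alpha u_t=0 & \text{in }\mathcal O_\rho,\\ u(t,x)=w(t) & 0<t<T,\ |x|=R,\\ u(t,x)=0 & 0<t<T,\ |x|=R-\rho(t),\\ u(0,x)=u_0(x),\quad u_t(0,x)=u_1(x) & R-\rho_0<|x|<R\end{cases}$$ has a unique radial solution $u\in W^{1,2}(\mathcal O_\rho)$, that is, a unique solution such that for a.e. $t\in[0,T]$ the function $u(t,\cdot)$ lies in $W^{1,2}(\mathcal C_{R-\rho(t),R})$ and is a.e. equal to a function of $|x|$. -/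

import Mathlib

open MeasureTheory Set Filter Topology
open scoped ContDiff ENNReal

noncomputable section

/-- The Euclidean plane. -/
abbrev Plane : Type := EuclideanSpace ℝ (Fin 2)

section Sobolev

variable {E : Type*} [NormedAddCommGroup E] [NormedSpace ℝ E]

/-- `φ` is a test function on `U`: smooth, with compact support contained in `U`. -/
structure IsTestFun (U : Set E) (φ : E → ℝ) : Prop where
  contDiff : ContDiff ℝ ∞ φ
  hasCompactSupport : HasCompactSupport φ
  tsupport_subset : tsupport φ ⊆ U

variable [MeasureSpace E]

/-- `g` is the weak derivative of `f` on the open set `U` in the direction `e`. -/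
structure HasWeakDeriv (U : Set E) (e : E) (f g : E → ℝ) : Prop where
  locallyIntegrableOn : LocallyIntegrableOn f U volume
  locallyIntegrableOn_deriv : LocallyIntegrableOn g U volume
  integral_eq : ∀ φ : E → ℝ, IsTestFun U φ →
    ∫ x in U, f x * fderiv ℝ φ x e = - ∫ x in U, g x * φ x

/-- The Sobolev space `W^{1,2}(U)`. -/
def MemW12 (U : Set E) (f : E → ℝ) : Prop :=
  MemLp f 2 (volume.restrict U) ∧
    ∀ e : E, ∃ g : E → ℝ, HasWeakDeriv U e f g ∧ MemLp g 2 (volume.restrict U)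

/-- The sequence `f n` tends to zero in `W^{1,2}(U)`. -/
def TendstoZeroW12 (U : Set E) (f : ℕ → E → ℝ) : Prop :=
  Tendsto (fun n => eLpNorm (f n) 2 (volume.restrict U)) atTop (𝓝 0) ∧
    ∀ e : E, ∃ g : ℕ → E → ℝ, (∀ n, HasWeakDeriv U e (f n) (g n)) ∧
      Tendsto (fun n => eLpNorm (g n) 2 (volume.restrict U)) atTop (𝓝 0)

/-- The trace of `f ∈ W^{1,2}(U)` on a piece of the boundary of `U`. The piece is parametrized by
`γ : P → E`, the measure `ν` on `P` plays the role of the surface measure, and `g`, a function of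
the parameter, is the trace. As usual the trace is the continuous extension of the restriction map
from functions in `W^{1,2}(U)` that are continuous up to the boundary, with values in `L²`. -/
def HasTrace {P : Type*} [MeasurableSpace P] (U : Set E) (ν : Measure P) (γ : P → E)
    (f : E → ℝ) (g : P → ℝ) : Prop :=
  ∃ φ : ℕ → E → ℝ, (∀ n, ContinuousOn (φ n) (closure U) ∧ MemW12 U (φ n)) ∧
    TendstoZeroW12 U (fun n x => φ n x - f x) ∧
    Tendsto (fun n => eLpNorm (fun p => φ n (γ p) - g p) 2 ν) atTop (𝓝 0)

/-- The norm of `f` in `W^{-1,2}(U)`, the dual of `W^{1,2}_0(U)`, where `f` acts by integration;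
`W^{1,2}_0(U)` is the closure of the test functions, and its norm is taken to be the maximum of the
`L²` norms of the function and of its gradient. -/
def negOneNorm (U : Set E) (f : E → ℝ) : ℝ≥0∞ :=
  ⨆ (ψ : E → ℝ) (_ : IsTestFun U ψ) (_ : eLpNorm ψ 2 (volume.restrict U) ≤ 1)
    (_ : eLpNorm (fderiv ℝ ψ) 2 (volume.restrict U) ≤ 1), ‖∫ x in U, f x * ψ x‖ₑ

/-- The essential limit from the right at time `0`: neighbourhoods of `0⁺` up to null sets. -/
def essZeroPlus : Filter ℝ := 𝓝[>] (0 : ℝ) ⊓ ae (volume : Measure ℝ)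

/-- `f(0) = f₀` in `L²(D)`, for a function `f` of time and space with a representative in
`C⁰([0,T]; L²(D))`. -/
def InitialL2 (D : Set E) (f : ℝ × E → ℝ) (f₀ : E → ℝ) : Prop :=
  Tendsto (fun t : ℝ => eLpNorm (fun x => f (t, x) - f₀ x) 2 (volume.restrict D)) essZeroPlus (𝓝 0)

/-- `f(0) = f₁` in `W^{-1,2}(D)`, for a function `f` of time and space with a representative in
`C⁰([0,T]; W^{-1,2}(D))`. -/
def InitialNegOne (D : Set E) (f : ℝ × E → ℝ) (f₁ : E → ℝ) : Prop :=
  Tendsto (fun t : ℝ => negOneNorm D (fun x => f (t, x) - f₁ x)) essZeroPlus (𝓝 0)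

end Sobolev

/-- The assumptions on the front: `ρ : [0,T] → [ρ₀,R)` is Lipschitz, `ρ(0) = ρ₀`, and
`0 ≤ ρ' < 1` almost everywhere. -/
structure IsFront (R ρ₀ T : ℝ) (ρ : ℝ → ℝ) : Prop where
  lipschitz : ∃ K : NNReal, LipschitzOnWith K ρ (Icc 0 T)
  mapsTo : MapsTo ρ (Icc 0 T) (Ico ρ₀ R)
  zero : ρ 0 = ρ₀
  deriv_mem : ∀ᵐ t ∂(volume.restrict (Icc 0 T)), 0 ≤ deriv ρ t ∧ deriv ρ t < 1

/-! ### The one-dimensional problem -/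

/-- The set `Ω = {(t,r) : 0 < t < T, 0 < r < ρ(t)}`. -/
def stripDomain (T : ℝ) (ρ : ℝ → ℝ) : Set (ℝ × ℝ) :=
  {p | 0 < p.1 ∧ p.1 < T ∧ 0 < p.2 ∧ p.2 < ρ p.1}

/-- `v ∈ W^{1,2}(Ω)` is a solution of
`v_tt - v_rr + b (R-r)⁻¹ v_r + α v_t = 0` in `Ω` (in the sense of distributions),
`v(t,0) = w(t)` and `v(t,ρ(t)) = 0` for `t ∈ (0,T)` (in the sense of traces),
`v(0,·) = v₀` in `L²(0,ρ₀)` and `v_t(0,·) = v₁` in `W^{-1,2}(0,ρ₀)`.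
The problem of interest has `b = 1`; the undamped wave equation has `b = α = 0`. -/
structure IsStripSolution (b α R ρ₀ T : ℝ) (ρ w v₀ v₁ : ℝ → ℝ) (v : ℝ × ℝ → ℝ) : Prop where
  memW12 : MemW12 (stripDomain T ρ) v
  trace_zero : HasTrace (stripDomain T ρ) (volume.restrict (Ioo 0 T)) (fun t => (t, (0 : ℝ))) v w
  trace_front : HasTrace (stripDomain T ρ) (volume.restrict (Ioo 0 T)) (fun t => (t, ρ t)) v
    (fun _ => 0)
  initial : InitialL2 (Ioo 0 ρ₀) v v₀
  equation : ∃ vt vr : ℝ × ℝ → ℝ,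
    HasWeakDeriv (stripDomain T ρ) (1, 0) v vt ∧ HasWeakDeriv (stripDomain T ρ) (0, 1) v vr ∧
    (∀ φ : ℝ × ℝ → ℝ, IsTestFun (stripDomain T ρ) φ →
      ∫ p in stripDomain T ρ,
        (v p * (iteratedDeriv 2 (fun t => φ (t, p.2)) p.1 - iteratedDeriv 2 (fun r => φ (p.1, r)) p.2)
          + b / (R - p.2) * vr p * φ p + α * vt p * φ p) = 0) ∧
    InitialNegOne (Ioo 0 ρ₀) vt v₁

/-- The dependence cone `C(t,r)`. -/
def depCone (T : ℝ) (ρ : ℝ → ℝ) (t r : ℝ) : Set (ℝ × ℝ) :=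
  {q ∈ stripDomain T ρ | 0 ≤ q.1 ∧ q.1 ≤ t ∧ r - t + q.1 ≤ q.2 ∧ q.2 ≤ r + t - q.1}

/-- The inverse of the (strictly increasing) function `ψ(t) = t + ρ(t)`, `t ∈ [0,T]`. -/
def psiInv (T : ℝ) (ρ : ℝ → ℝ) : ℝ → ℝ :=
  Function.invFunOn (fun t => t + ρ t) (Icc 0 T)

/-- `ω(s) = φ(ψ⁻¹(s))` for `s ≥ ρ₀` and `ω(s) = -ρ₀` for `s < ρ₀`, where `φ(t) = t - ρ(t)`. -/
def omegaRefl (ρ₀ T : ℝ) (ρ : ℝ → ℝ) (s : ℝ) : ℝ :=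
  if ρ₀ ≤ s then psiInv T ρ s - ρ (psiInv T ρ s) else -ρ₀

/-- The set `Ω'₁`: points reached by no reflected characteristic. -/
def omegaOne (ρ₀ T : ℝ) (ρ : ℝ → ℝ) : Set (ℝ × ℝ) :=
  {p ∈ stripDomain T ρ | p.1 ≤ p.2 ∧ p.1 + p.2 ≤ ρ₀}

/-- The set `Ω'₂`: one characteristic is reflected at `r = 0`. -/
def omegaTwo (ρ₀ T : ℝ) (ρ : ℝ → ℝ) : Set (ℝ × ℝ) :=
  {p ∈ stripDomain T ρ | p.2 < p.1 ∧ p.1 + p.2 < ρ₀}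

/-- The set `Ω'₃`: one characteristic is reflected at the front. -/
def omegaThree (ρ₀ T : ℝ) (ρ : ℝ → ℝ) : Set (ℝ × ℝ) :=
  {p ∈ stripDomain T ρ | p.1 < p.2 ∧ ρ₀ < p.1 + p.2}

/-- The set `Ω' = Ω'₁ ∪ Ω'₂ ∪ Ω'₃`. -/
def omegaPrime (ρ₀ T : ℝ) (ρ : ℝ → ℝ) : Set (ℝ × ℝ) :=
  omegaOne ρ₀ T ρ ∪ omegaTwo ρ₀ T ρ ∪ omegaThree ρ₀ T ρ

open Classical in
/-- The set `P(t,r)` (left as the empty set on the null set of the points where `t = r` or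
`t + r = ρ₀`, and outside `Ω'`). -/
def coneP (ρ₀ T : ℝ) (ρ : ℝ → ℝ) (t r : ℝ) : Set (ℝ × ℝ) :=
  if t < r ∧ t + r < ρ₀ then depCone T ρ t r
  else if r < t ∧ t + r < ρ₀ then depCone T ρ t r \ depCone T ρ (t - r) 0
  else if t < r ∧ ρ₀ < t + r then
    depCone T ρ t r \ depCone T ρ (psiInv T ρ (t + r)) (ρ (psiInv T ρ (t + r)))
  else ∅

open Classical in
/-- D'Alembert's formula in `Ω'` for the undamped wave equation with data `w`, `v₀`, `v₁`. -/
def dAlembert (ρ₀ T : ℝ) (ρ w v₀ v₁ : ℝ → ℝ) (p : ℝ × ℝ) : ℝ :=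
  if p ∈ omegaOne ρ₀ T ρ then
    v₀ (p.2 - p.1) / 2 + v₀ (p.2 + p.1) / 2 + (∫ s in (p.2 - p.1)..(p.2 + p.1), v₁ s) / 2
  else if p ∈ omegaTwo ρ₀ T ρ then
    w (p.1 - p.2) - v₀ (p.1 - p.2) / 2 + v₀ (p.2 + p.1) / 2
      + (∫ s in (p.1 - p.2)..(p.1 + p.2), v₁ s) / 2
  else if p ∈ omegaThree ρ₀ T ρ then
    v₀ (p.2 - p.1) / 2 - v₀ (-omegaRefl ρ₀ T ρ (p.2 + p.1)) / 2
      + (∫ s in (p.2 - p.1)..(-omegaRefl ρ₀ T ρ (p.2 + p.1)), v₁ s) / 2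
  else 0

/-- `v ∈ C⁰([0,T]; W^{1,2}(0,R))`. -/
def IsC0W12 (R T : ℝ) (v : ℝ × ℝ → ℝ) : Prop :=
  ∃ V D : ℝ → Lp ℝ 2 (volume.restrict (Ioo 0 R)),
    ContinuousOn V (Icc 0 T) ∧ ContinuousOn D (Icc 0 T) ∧
    ∀ t ∈ Icc 0 T, (V t =ᵐ[volume.restrict (Ioo 0 R)] fun r => v (t, r)) ∧
      HasWeakDeriv (Ioo 0 R) (1 : ℝ) (fun r => v (t, r)) (D t)

/-- `v ∈ C¹([0,T]; L²(0,R))`. -/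
def IsC1L2 (R T : ℝ) (v : ℝ × ℝ → ℝ) : Prop :=
  ∃ V : ℝ → Lp ℝ 2 (volume.restrict (Ioo 0 R)),
    ContDiffOn ℝ 1 V (Icc 0 T) ∧
    ∀ t ∈ Icc 0 T, V t =ᵐ[volume.restrict (Ioo 0 R)] fun r => v (t, r)

/-! ### The problem on the growing annulus -/

/-- The open annulus `{x : a < |x| < R}` in the plane. -/
def annulus (a R : ℝ) : Set Plane := {x | a < ‖x‖ ∧ ‖x‖ < R}

/-- The set `{(t,x) : 0 < t < T, R - ρ(t) < |x| < R}`. -/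
def annularDomain (R T : ℝ) (ρ : ℝ → ℝ) : Set (ℝ × Plane) :=
  {p | 0 < p.1 ∧ p.1 < T ∧ p.2 ∈ annulus (R - ρ p.1) R}

/-- `f` agrees almost everywhere on the annulus with a function of `|x|`. -/
def IsRadialAE (a R : ℝ) (f : Plane → ℝ) : Prop :=
  ∃ F : ℝ → ℝ, ∀ᵐ x ∂(volume.restrict (annulus a R)), f x = F ‖x‖

/-- The space `L²_rad` of the annulus. -/
def MemL2rad (a R : ℝ) (f : Plane → ℝ) : Prop :=
  MemLp f 2 (volume.restrict (annulus a R)) ∧ IsRadialAE a R f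

/-- The space `W^{1,2}_rad` of the annulus. -/
def MemW12rad (a R : ℝ) (f : Plane → ℝ) : Prop :=
  MemW12 (annulus a R) f ∧ IsRadialAE a R f

/-- The point of the plane with polar coordinates `(s, θ)`. -/
def polarPoint (s θ : ℝ) : Plane := !₂[s * Real.cos θ, s * Real.sin θ]

/-- The product measure `dt dθ` on `(0,T) × (0,2π)`, equivalent, with bounded densities, to the
surface measure on the lateral boundaries, parametrized by time and angle. -/
def lateralMeasure (T : ℝ) : Measure (ℝ × ℝ) :=
  (volume.restrict (Ioo 0 T)).prod (volume.restrict (Ioo 0 (2 * Real.pi)))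

/-- `u ∈ W^{1,2}` is a solution of `u_tt - Δ u + α u_t = 0` in the growing annulus (in the sense of
distributions), `u = w(t)` for `|x| = R` and `u = 0` for `|x| = R - ρ(t)` (in the sense of traces),
`u(0,·) = u₀` in `L²` and `u_t(0,·) = u₁` in `W^{-1,2}` of the initial annulus. -/
structure IsAnnularSolution (α R ρ₀ T : ℝ) (ρ w : ℝ → ℝ) (u₀ u₁ : Plane → ℝ)
    (u : ℝ × Plane → ℝ) : Prop where
  memW12 : MemW12 (annularDomain R T ρ) u
  trace_outer : HasTrace (annularDomain R T ρ) (lateralMeasure T)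
    (fun q => (q.1, polarPoint R q.2)) u (fun q => w q.1)
  trace_front : HasTrace (annularDomain R T ρ) (lateralMeasure T)
    (fun q => (q.1, polarPoint (R - ρ q.1) q.2)) u (fun _ => 0)
  initial : InitialL2 (annulus (R - ρ₀) R) u u₀
  equation : ∃ ut : ℝ × Plane → ℝ, HasWeakDeriv (annularDomain R T ρ) (1, 0) u ut ∧
    (∀ φ : ℝ × Plane → ℝ, IsTestFun (annularDomain R T ρ) φ →
      ∫ p in annularDomain R T ρ,
        (u p * (iteratedDeriv 2 (fun t => φ (t, p.2)) p.1
            - Laplacian.laplacian (fun x => φ (p.1, x)) p.2) + α * ut p * φ p) = 0) ∧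
    InitialNegOne (annulus (R - ρ₀) R) ut u₁

/-- A radial solution: in addition `u(t,·)` lies in `W^{1,2}_rad` for almost every `t`. -/
structure IsRadialSolution (α R ρ₀ T : ℝ) (ρ w : ℝ → ℝ) (u₀ u₁ : Plane → ℝ)
    (u : ℝ × Plane → ℝ) : Prop extends IsAnnularSolution α R ρ₀ T ρ w u₀ u₁ u where
  radial : ∀ᵐ t ∂(volume.restrict (Icc 0 T)), MemW12rad (R - ρ t) R (fun x => u (t, x))

end

noncomputable section
set_option linter.unusedSectionVars false
open ENNReal (ofReal ofReal_add ofReal_coe_nnreal ofReal_eq_zero ofReal_inv_of_pos ofReal_le_ofReal ofReal_le_ofReal_iff ofReal_le_one ofReal_lt_one ofReal_lt_top ofReal_mul ofReal_natCast ofReal_ne_top ofReal_ofNat ofReal_one ofReal_pow ofReal_sum_of_nonneg ofReal_toReal ofReal_zero)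
open intervalIntegral (integral_of_le integral_interval_sub_left integral_comp_add_left integral_eq_sub_of_hasDerivAt)
open Real (exp two_pi_pos norm_of_nonneg enorm_of_nonneg enorm_eq_ofReal_abs smoothTransition)
open MeasureTheory.Measure (volume_eq_prod restrict_apply_univ restrict_mono_set prod_restrict ae_ae_of_ae_prod absolutelyContinuous_of_le_smul measurePreserving_neg)
open Eventually (of_forall)
local notation "vol" => volume.restrict
local notation "Ω" => stripDomain
local notation "𝒪" => annularDomain
local notation "𝟘" => fun _ => 0
local notation "□" φ:max x:max => iteratedDeriv 2 (fun t => φ (t, Prod.snd x)) (Prod.fst x) -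
  iteratedDeriv 2 (fun r => φ (Prod.fst x, r)) (Prod.snd x)
local notation "π" => Real.pi
local notation "ℝ²" => ℝ × ℝ
instance isAddHaarMeasure_volume_time_plane : (volume : Measure (ℝ × Plane)).IsAddHaarMeasure :=
  Measure.prod.instIsAddHaarMeasure _ _

lemma tendsto_zero_of_le {ι : Type*} {l : Filter ι} {a b : ι → ℝ≥0∞} (hb : Tendsto b l (𝓝 0))
    (h : ∀ᶠ t in l, a t ≤ b t) : Tendsto a l (𝓝 0) :=
  tendsto_of_tendsto_of_tendsto_of_le_of_le' tendsto_const_nhds hb (of_forall fun _ => zero_le) h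

lemma tendsto_zero_of_le_mul {ι : Type*} {l : Filter ι} {a b : ι → ℝ≥0∞} {c : ℝ≥0∞} (hc : c ≠ ⊤)
    (hb : Tendsto b l (𝓝 0)) (h : ∀ᶠ t in l, a t ≤ c * b t) : Tendsto a l (𝓝 0) :=
  tendsto_zero_of_le (by simpa using ENNReal.Tendsto.const_mul hb (Or.inr hc)) h

lemma ofReal_sq_eq_enorm (x : ℝ) : ofReal (x ^ 2) = ‖x‖ₑ ^ 2 := by
  rw [← sq_abs, ofReal_pow (abs_nonneg _), ← enorm_eq_ofReal_abs]

section WeakDerivTools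

variable {E : Type*} [NormedAddCommGroup E] [NormedSpace ℝ E] {U V : Set E} {e e' : E}
  {f f' g g' φ : E → ℝ}

namespace IsTestFun

lemma continuous (h : IsTestFun U φ) : Continuous φ := h.contDiff.continuous

lemma differentiable (h : IsTestFun U φ) : Differentiable ℝ φ := h.contDiff.differentiable (by simp)

lemma contDiff_fderiv (h : IsTestFun U φ) (e : E) : ContDiff ℝ ∞ fun x => fderiv ℝ φ x e :=
  (h.contDiff.fderiv_right (m := ∞) (by simp)).clm_apply contDiff_const

lemma fderiv (h : IsTestFun U φ) (e : E) : IsTestFun U fun x => fderiv ℝ φ x e where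
  contDiff := h.contDiff_fderiv e
  hasCompactSupport := h.hasCompactSupport.fderiv_apply (𝕜 := ℝ) e
  tsupport_subset := (tsupport_fderiv_apply_subset ℝ e).trans h.tsupport_subset

lemma mono (h : IsTestFun U φ) (hUV : U ⊆ V) : IsTestFun V φ :=
  ⟨h.contDiff, h.hasCompactSupport, h.tsupport_subset.trans hUV⟩

lemma eq_zero (h : IsTestFun U φ) {x : E} (hx : x ∉ U) : φ x = 0 :=
  image_eq_zero_of_notMem_tsupport fun hx' => hx (h.tsupport_subset hx')

lemma exists_bound (h : IsTestFun U φ) : ∃ C, ∀ x, ‖φ x‖ ≤ C :=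
  h.hasCompactSupport.exists_bound_of_continuous h.continuous

lemma mul_left (h : IsTestFun U φ) {χ : E → ℝ} (hχ : ContDiff ℝ ∞ χ) :
    IsTestFun U fun x => χ x * φ x where
  contDiff := hχ.mul h.contDiff
  hasCompactSupport := h.hasCompactSupport.mul_left
  tsupport_subset := (tsupport_mul_subset_right (f := χ)).trans h.tsupport_subset

lemma comp_sub (h : IsTestFun U φ) (a : E) (hV : ∀ x ∈ tsupport φ, x + a ∈ V) :
    IsTestFun V fun x => φ (x - a) := by
  have hs : tsupport (fun x => φ (x - a)) ⊆ (fun x => x - a) ⁻¹' tsupport φ :=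
    tsupport_comp_subset_preimage φ (by fun_prop)
  refine ⟨h.contDiff.comp (contDiff_id.sub contDiff_const), ?_, fun x hx => ?_⟩
  · exact h.hasCompactSupport.comp_homeomorph (Homeomorph.subRight a)
  · simpa using hV _ (hs hx)

end IsTestFun

variable [MeasureSpace E] [BorelSpace E]

lemma IsTestFun.integrable_mul [FiniteDimensional ℝ E] (h : IsTestFun U φ) (hf : LocallyIntegrableOn f U volume) :
    Integrable fun x => f x * φ x := by
  have h1 : IntegrableOn f (tsupport φ) volume :=
    hf.integrableOn_compact_subset h.tsupport_subset h.hasCompactSupport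
  have h2 : IntegrableOn (fun x => f x * φ x) (tsupport φ) volume :=
    h1.mul_continuousOn h.continuous.continuousOn h.hasCompactSupport
  refine (integrableOn_iff_integrable_of_support_subset ?_).1 h2
  exact (Function.support_mul_subset_right _ _).trans (subset_tsupport φ)

lemma IsTestFun.setIntegral_mul (h : IsTestFun U φ) (f : E → ℝ) :
    ∫ x in U, f x * φ x = ∫ x, f x * φ x :=
  setIntegral_eq_integral_of_forall_compl_eq_zero fun x hx => by rw [h.eq_zero hx, mul_zero]

lemma MeasureTheory.LocallyIntegrableOn.congr_restrict [FiniteDimensional ℝ E]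
    (h : LocallyIntegrableOn f U) (hU : IsOpen U) (hf : f =ᵐ[vol U] f') :
    LocallyIntegrableOn f' U := by
  rw [locallyIntegrableOn_iff hU.isLocallyClosed] at *
  exact fun k hk hk' => (h k hk hk').congr (ae_restrict_of_ae_restrict_of_subset hk hf)

lemma MeasureTheory.MemLp.locallyIntegrableOn_two [FiniteDimensional ℝ E]
    [IsLocallyFiniteMeasure (volume : Measure E)] (hf : MemLp f 2 (vol U)) :
    LocallyIntegrableOn f U :=
  locallyIntegrableOn_of_locallyIntegrable_restrict (hf.locallyIntegrable one_le_two)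

namespace HasWeakDeriv

lemma integral_eq' (h : HasWeakDeriv U e f g) (hφ : IsTestFun U φ) :
    ∫ x, f x * fderiv ℝ φ x e = - ∫ x, g x * φ x := by
  rw [← hφ.setIntegral_mul, ← (hφ.fderiv e).setIntegral_mul]
  exact h.integral_eq φ hφ

lemma mono (h : HasWeakDeriv U e f g) (hVU : V ⊆ U) : HasWeakDeriv V e f g where
  locallyIntegrableOn := h.1.mono_set hVU
  locallyIntegrableOn_deriv := h.2.mono_set hVU
  integral_eq φ hφ := by
    rw [hφ.setIntegral_mul, (hφ.fderiv e).setIntegral_mul]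
    exact h.integral_eq' (hφ.mono hVU)

lemma of_integral_eq' (hf : LocallyIntegrableOn f U volume) (hg : LocallyIntegrableOn g U volume)
    (h : ∀ φ, IsTestFun U φ → ∫ x, f x * fderiv ℝ φ x e = - ∫ x, g x * φ x) :
    HasWeakDeriv U e f g where
  locallyIntegrableOn := hf
  locallyIntegrableOn_deriv := hg
  integral_eq φ hφ := by
    rw [hφ.setIntegral_mul, (hφ.fderiv e).setIntegral_mul]
    exact h φ hφ

lemma congr_ae [FiniteDimensional ℝ E] (h : HasWeakDeriv U e f g) (hU : IsOpen U)
    (hf : f =ᵐ[vol U] f')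
    (hg : g =ᵐ[vol U] g') : HasWeakDeriv U e f' g' where
  locallyIntegrableOn := h.1.congr_restrict hU hf
  locallyIntegrableOn_deriv := h.2.congr_restrict hU hg
  integral_eq φ hφ := by
    rw [← integral_congr_ae (hf.mono fun x hx => congrArg (· * fderiv ℝ φ x e) hx),
      ← integral_congr_ae (hg.mono fun x hx => congrArg (· * φ x) hx)]
    exact h.integral_eq φ hφ

variable [FiniteDimensional ℝ E]

lemma const_mul (h : HasWeakDeriv U e f g) (c : ℝ) :
    HasWeakDeriv U e (fun x => c * f x) fun x => c * g x := by
  refine of_integral_eq' (h.1.smul c) (h.2.smul c) fun φ hφ => ?_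
  simp_rw [mul_assoc, integral_const_mul, h.integral_eq' hφ]
  ring

lemma add (h : HasWeakDeriv U e f g) (h' : HasWeakDeriv U e f' g') :
    HasWeakDeriv U e (fun x => f x + f' x) fun x => g x + g' x := by
  refine of_integral_eq' (h.1.add h'.1) (h.2.add h'.2) fun φ hφ => ?_
  simp_rw [add_mul]
  rw [integral_add ((hφ.fderiv e).integrable_mul h.1) ((hφ.fderiv e).integrable_mul h'.1),
    integral_add (hφ.integrable_mul h.2) (hφ.integrable_mul h'.2), h.integral_eq' hφ,
    h'.integral_eq' hφ]
  ring

lemma sub (h : HasWeakDeriv U e f g) (h' : HasWeakDeriv U e f' g') :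
    HasWeakDeriv U e (fun x => f x - f' x) fun x => g x - g' x := by
  simpa [sub_eq_add_neg] using h.add (h'.const_mul (-1))

lemma comb (h : HasWeakDeriv U e f g) (h' : HasWeakDeriv U e' f g') (a b : ℝ) :
    HasWeakDeriv U (a • e + b • e') f fun x => a * g x + b * g' x := by
  refine of_integral_eq' h.1 ((h.2.smul a).add (h'.2.smul b)) fun φ hφ => ?_
  simp_rw [map_add, map_smul, smul_eq_mul, mul_add, add_mul, mul_left_comm, mul_assoc]
  rw [integral_add (((hφ.fderiv e).integrable_mul h.1).const_mul a)
      (((hφ.fderiv e').integrable_mul h.1).const_mul b),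
    integral_add ((hφ.integrable_mul h.2).const_mul a) ((hφ.integrable_mul h'.2).const_mul b)]
  simp_rw [integral_const_mul, h.integral_eq' hφ, h'.integral_eq' hφ]
  ring

lemma ae_unique (hU : IsOpen U) (h : HasWeakDeriv U e f g) (h' : HasWeakDeriv U e f g') :
    g =ᵐ[vol U] g' := by
  have := hU.ae_eq_zero_of_integral_contDiff_smul_eq_zero (h.2.sub h'.2) fun φ h1 h2 h3 => by
    have hφ : IsTestFun U φ := ⟨h1, h2, h3⟩
    simp only [smul_eq_mul, Pi.sub_apply]
    simp_rw [mul_comm (φ _), sub_mul]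
    rw [integral_sub (hφ.integrable_mul h.2) (hφ.integrable_mul h'.2)]
    linarith [h.integral_eq' hφ, h'.integral_eq' hφ]
  refine (ae_restrict_iff' hU.measurableSet).2 (this.mono fun x hx hxU => ?_)
  simpa [sub_eq_zero] using hx hxU

end HasWeakDeriv

variable [FiniteDimensional ℝ E] [(volume : Measure E).IsAddHaarMeasure]

lemma measurePreserving_shear (ν : Measure ℝ) [SFinite ν] (e : E) :
    MeasurePreserving (fun p : E × ℝ => (p.1 + p.2 • e, p.2)) (volume.prod ν) (volume.prod ν) := by
  have h : MeasurePreserving (fun p : ℝ × E => (p.1, p.2 + p.1 • e)) (ν.prod volume)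
      (ν.prod volume) := by
    refine (MeasurePreserving.id ν).skew_product (g := fun s x => x + s • e) ?_ ?_
    · exact (by fun_prop : Continuous fun p : ℝ × E => p.2 + p.1 • e).measurable
    · exact of_forall fun s => map_add_right_eq_self volume (s • e)
  exact Measure.measurePreserving_swap.comp (h.comp Measure.measurePreserving_swap)

lemma MeasureTheory.Integrable.comp_shear {g : E → ℝ} (hg : Integrable g) (ν : Measure ℝ)
    [IsFiniteMeasure ν] (e : E) :
    Integrable (fun p : E × ℝ => g (p.1 + p.2 • e)) (volume.prod ν) :=
  (measurePreserving_shear ν e).integrable_comp_of_integrable (g := fun p : E × ℝ => g p.1)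
    (hg.comp_fst ν)

/-- The set of points whose translates along a segment stay in `U`. -/
def segmentInside (U : Set E) (e : E) (h : ℝ) : Set E := {x | ∀ s ∈ Icc 0 h, x + s • e ∈ U}

lemma isOpen_segmentInside (hU : IsOpen U) (e : E) (h : ℝ) : IsOpen (segmentInside U e h) := by
  rw [isOpen_iff_mem_nhds]
  intro x hx
  obtain ⟨u, v, hu, hv, hxu, hsv, huv⟩ := generalized_tube_lemma (isCompact_singleton (x := x))
    (isCompact_Icc (a := (0 : ℝ)) (b := h))
    (n := (fun p : E × ℝ => p.1 + p.2 • e) ⁻¹' U) (hU.preimage (by fun_prop)) (by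
      rintro ⟨y, s⟩ ⟨hy, hs⟩
      obtain rfl : y = x := hy
      exact hx s hs)
  filter_upwards [hu.mem_nhds (hxu rfl)] with y hy s hs
  exact huv (mk_mem_prod hy (hsv hs))

theorem HasWeakDeriv.increment (hU : IsOpen U) (hw : HasWeakDeriv U e f g) {h : ℝ} (hh : 0 ≤ h) :
    ∀ᵐ x : E, x ∈ segmentInside U e h → f (x + h • e) - f x = ∫ s in (0 : ℝ)..h, g (x + s • e) := by
  have key : ∀ K ⊆ segmentInside U e h, IsCompact K → ∃ F G : E → ℝ, Integrable F ∧ Integrable G ∧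
      (∀ x ∈ K, ∀ s ∈ Icc 0 h, F (x + s • e) = f (x + s • e) ∧ G (x + s • e) = g (x + s • e)) ∧
      ∀ φ, IsTestFun U φ → (∀ y ∈ tsupport φ, ∃ x ∈ K, ∃ s ∈ Icc 0 h, y = x + s • e) →
        ∫ x, F x * fderiv ℝ φ x e = - ∫ x, G x * φ x := by
    intro K hK hKc
    set K' : Set E := (fun p : E × ℝ => p.1 + p.2 • e) '' (K ×ˢ Icc 0 h) with hK'
    have hK'c : IsCompact K' := (hKc.prod isCompact_Icc).image (by fun_prop)
    have hK'U : K' ⊆ U := by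
      rintro _ ⟨⟨x, s⟩, ⟨hx, hs⟩, rfl⟩
      exact hK hx s hs
    refine ⟨K'.indicator f, K'.indicator g, ?_, ?_, ?_, ?_⟩
    · exact (hw.1.integrableOn_compact_subset hK'U hK'c).integrable_indicator hK'c.measurableSet
    · exact (hw.2.integrableOn_compact_subset hK'U hK'c).integrable_indicator hK'c.measurableSet
    · intro x hx s hs
      have : x + s • e ∈ K' := ⟨(x, s), ⟨hx, hs⟩, rfl⟩
      simp [this]
    · intro φ hφ hsupp
      have hz : ∀ y ∉ K', y ∉ tsupport φ := fun y hy hy' => by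
        obtain ⟨x, hx, s, hs, rfl⟩ := hsupp y hy'
        exact hy ⟨(x, s), ⟨hx, hs⟩, rfl⟩
      have e1 : ∀ x, K'.indicator f x * fderiv ℝ φ x e = f x * fderiv ℝ φ x e := by
        intro x
        by_cases hx : x ∈ K'
        · simp [hx]
        · have : fderiv ℝ φ x e = 0 :=
            image_eq_zero_of_notMem_tsupport (f := fun x => fderiv ℝ φ x e)
              fun h' => hz x hx (tsupport_fderiv_apply_subset ℝ e h')
          simp [this]
      have e2 : ∀ x, K'.indicator g x * φ x = g x * φ x := by
        intro x
        by_cases hx : x ∈ K'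
        · simp [hx]
        · simp [image_eq_zero_of_notMem_tsupport (hz x hx)]
      simp_rw [e1, e2]
      exact hw.integral_eq' hφ
  have hW := isOpen_segmentInside hU e h
  have main := hW.ae_eq_zero_of_integral_contDiff_smul_eq_zero (μ := volume)
    (f := fun x => f (x + h • e) - f x - ∫ s in (0 : ℝ)..h, g (x + s • e)) ?_ ?_
  · exact main.mono fun x hx hxU => sub_eq_zero.1 (hx hxU)
  · rw [locallyIntegrableOn_iff hW.isLocallyClosed]
    intro K hK hKc
    obtain ⟨F, G, hF, hG, hFG, -⟩ := key K hK hKc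
    have hi : Integrable fun x => F (x + h • e) - F x - ∫ s in (0 : ℝ)..h, G (x + s • e) := by
      refine ((hF.comp_add_right _).sub hF).sub ?_
      simp_rw [integral_of_le hh]
      exact (hG.comp_shear (vol (Ioc 0 h)) e).integral_prod_left
    refine hi.integrableOn.congr_fun (fun x hx => ?_) hKc.measurableSet
    have h0 := (hFG x hx 0 ⟨le_rfl, hh⟩).1
    simp only [zero_smul, add_zero] at h0
    simp only [(hFG x hx h ⟨hh, le_rfl⟩).1, h0]
    congr 1
    refine intervalIntegral.integral_congr fun s hs => (hFG x hx s ?_).2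
    rwa [uIcc_of_le hh] at hs
  · intro φ h1 h2 h3
    obtain ⟨F, G, hF, hG, hFG, hint⟩ := key _ h3 h2
    have hφ : IsTestFun (segmentInside U e h) φ := ⟨h1, h2, h3⟩
    have hφs : ∀ s ∈ Icc 0 h, IsTestFun U fun x => φ (x - s • e) := fun s hs =>
      hφ.comp_sub _ fun x hx => h3 hx s hs
    have e0 : ∀ x, φ x • (f (x + h • e) - f x - ∫ s in (0 : ℝ)..h, g (x + s • e)) =
        F (x + h • e) * φ x - F x * φ x - ∫ s in (0 : ℝ)..h, G (x + s • e) * φ x := by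
      intro x
      by_cases hx : x ∈ tsupport φ
      · have h0 := (hFG x hx 0 ⟨le_rfl, hh⟩).1
        simp only [zero_smul, add_zero] at h0
        rw [(hFG x hx h ⟨hh, le_rfl⟩).1, h0, intervalIntegral.integral_mul_const,
          intervalIntegral.integral_congr (g := fun s => g (x + s • e)) fun s hs =>
            (hFG x hx s (by rwa [uIcc_of_le hh] at hs)).2]
        simp only [smul_eq_mul]; ring
      · simp [image_eq_zero_of_notMem_tsupport hx]
    simp_rw [e0]
    obtain ⟨C, hC⟩ := hφ.exists_bound
    obtain ⟨C', hC'⟩ := (hφ.fderiv e).exists_bound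
    have i1 : Integrable fun x => F (x + h • e) * φ x :=
      (hF.comp_add_right _).mul_bdd (c := C) hφ.continuous.aestronglyMeasurable (of_forall hC)
    have i2 : Integrable fun x => F x * φ x :=
      hF.mul_bdd (c := C) hφ.continuous.aestronglyMeasurable (of_forall hC)
    have i3 : Integrable (fun p : E × ℝ => G (p.1 + p.2 • e) * φ p.1)
        (volume.prod (vol (Ioc 0 h))) :=
      (hG.comp_shear _ e).mul_bdd (c := C) (hφ.continuous.comp continuous_fst).aestronglyMeasurable
        (of_forall fun p => hC p.1)
    have i4 : Integrable (fun p : E × ℝ => F p.1 * fderiv ℝ φ (p.1 - p.2 • e) e)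
        (volume.prod (vol (Ioc 0 h))) :=
      (hF.comp_fst _).mul_bdd (c := C') ((hφ.fderiv e).continuous.comp
        (by fun_prop : Continuous fun p : E × ℝ => p.1 - p.2 • e)).aestronglyMeasurable
        (of_forall fun p => hC' _)
    have i3' : Integrable fun x => ∫ s in (0 : ℝ)..h, G (x + s • e) * φ x := by
      simp_rw [integral_of_le hh]
      exact i3.integral_prod_left
    have i12 : Integrable fun x => F (x + h • e) * φ x - F x * φ x := i1.sub i2
    rw [integral_sub i12 i3', integral_sub i1 i2]
    have s1 : ∫ x, F (x + h • e) * φ x = ∫ x, F x * φ (x - h • e) := by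
      rw [← integral_add_right_eq_self (fun x => F x * φ (x - h • e)) (h • e)]
      simp
    have s2 : ∫ x, ∫ s in (0 : ℝ)..h, G (x + s • e) * φ x =
        ∫ x, (F x * φ (x - h • e) - F x * φ x) := by
      simp_rw [integral_of_le hh]
      rw [integral_integral_swap i3]
      have : ∀ s ∈ Ioc 0 h, ∫ x, G (x + s • e) * φ x =
          ∫ x, - (F x * fderiv ℝ φ (x - s • e) e) := by
        intro s hs
        have hs' : s ∈ Icc 0 h := ⟨hs.1.le, hs.2⟩
        rw [← integral_sub_right_eq_self (fun x => G (x + s • e) * φ x) (s • e)]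
        have := hint _ (hφs s hs') fun y hy => ⟨y - s • e, by
          have := tsupport_comp_subset_preimage φ
            (by fun_prop : Continuous fun x : E => x - s • e) hy
          exact this, s, hs', by simp⟩
        have hd : ∀ x, fderiv ℝ (fun x => φ (x - s • e)) x = fderiv ℝ φ (x - s • e) :=
          fun x => fderiv_comp_sub _
        simp_rw [hd] at this
        simp only [sub_add_cancel]
        rw [integral_neg, this, neg_neg]
      rw [setIntegral_congr_fun measurableSet_Ioc this, ← integral_integral_swap i4.neg]
      refine integral_congr_ae (of_forall fun x => ?_)
      simp only
      have hder : ∀ s ∈ uIcc 0 h, HasDerivAt (fun s : ℝ => F x * φ (x - s • e))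
          (-(F x * fderiv ℝ φ (x - s • e) e)) s := by
        intro s _
        have h1' : HasDerivAt (fun s : ℝ => x - s • e) (-e) s := by
          simpa using ((hasDerivAt_id s).smul_const e).const_sub x
        have := ((hφ.differentiable (x - s • e)).hasFDerivAt.comp_hasDerivAt s h1').const_mul (F x)
        simpa using this
      rw [← integral_of_le hh]
      have := integral_eq_sub_of_hasDerivAt hder (by
        apply Continuous.intervalIntegrable
        exact (continuous_const.mul ((hφ.fderiv e).continuous.comp
          (by fun_prop : Continuous fun s : ℝ => x - s • e))).neg)
      simpa using this
    have i5 : Integrable fun x => F x * φ (x - h • e) := by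
      have := i1.comp_sub_right (h • e)
      simpa using this
    rw [s1, s2, integral_sub i5 i2]
    ring

theorem HasWeakDeriv.increment_all (hU : IsOpen U) (hw : HasWeakDeriv U e f g)
    (hf : ContinuousOn f U) (hg : IntegrableOn g U) :
    ∀ᵐ x : E, ∀ h : ℝ, 0 ≤ h → x ∈ segmentInside U e h →
      IntervalIntegrable (fun s => g (x + s • e)) volume 0 h ∧
      f (x + h • e) - f x = ∫ s in (0 : ℝ)..h, g (x + s • e) := by
  have hG : Integrable (U.indicator g) := hg.integrable_indicator hU.measurableSet
  have h1 : ∀ᵐ x : E, ∀ n : ℕ,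
      IntegrableOn (fun s : ℝ => U.indicator g (x + s • e)) (Ioc 0 (n : ℝ)) :=
    ae_all_iff.2 fun n => (hG.comp_shear (vol (Ioc 0 (n : ℝ))) e).prod_right_ae
  have h2 : ∀ᵐ x : E, ∀ q : ℚ, 0 ≤ (q : ℝ) → x ∈ segmentInside U e q →
      f (x + (q : ℝ) • e) - f x = ∫ s in (0 : ℝ)..q, g (x + s • e) := by
    refine ae_all_iff.2 fun q => ?_
    by_cases hq : 0 ≤ (q : ℝ)
    · exact (hw.increment hU hq).mono fun x hx _ => hx
    · exact of_forall fun x hx => absurd hx hq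
  filter_upwards [h1, h2] with x hx1 hx2 h hh hx
  have hint : IntervalIntegrable (fun s => g (x + s • e)) volume 0 h := by
    obtain ⟨n, hn⟩ := exists_nat_ge h
    rw [intervalIntegrable_iff_integrableOn_Ioc_of_le hh]
    refine ((hx1 n).mono_set (Ioc_subset_Ioc_right hn)).congr_fun (fun s hs => ?_) measurableSet_Ioc
    simp [hx s ⟨hs.1.le, hs.2⟩]
  refine ⟨hint, ?_⟩
  rcases hh.eq_or_lt with rfl | hh'
  · simp
  have hc1 : ContinuousOn (fun s : ℝ => f (x + s • e) - f x) (Icc 0 h) :=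
    (hf.comp (by fun_prop) fun s hs => hx s hs).sub continuousOn_const
  have hc2 : ContinuousOn (fun s : ℝ => ∫ u in (0 : ℝ)..s, g (x + u • e)) (Icc 0 h) := by
    have := intervalIntegral.continuousOn_primitive_interval' hint (left_mem_uIcc)
    rwa [uIcc_of_le hh] at this
  have hd : Icc 0 h ⊆ closure (Ioo 0 h ∩ range ((↑) : ℚ → ℝ)) := by
    rw [← closure_Ioo hh'.ne]
    exact closure_minimal (Rat.denseRange_cast.open_subset_closure_inter isOpen_Ioo)
      isClosed_closure
  refine EqOn.of_subset_closure ?_ hc1 hc2 (inter_subset_left.trans Ioo_subset_Icc_self) hd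
    ⟨hh, le_rfl⟩
  rintro _ ⟨hs, q, rfl⟩
  exact hx2 q hs.1.le fun s hs' => hx s ⟨hs'.1, hs'.2.trans hs.2.le⟩

end WeakDerivTools

/-- `h` is an `H¹` function of one variable whose squared derivative is controlled by the increments
of the monotone function `E`. -/
structure HolderEnergy (h E : ℝ → ℝ) : Prop where
  mono : Monotone E
  sq_le : ∀ a b, a ≤ b → (h b - h a) ^ 2 ≤ (b - a) * (E b - E a)

namespace HolderEnergy

variable {h h' E E' : ℝ → ℝ}

lemma const (c : ℝ) : HolderEnergy (fun _ => c) 𝟘 := ⟨monotone_const, fun a b _ => by simp⟩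

lemma add (H : HolderEnergy h E) (H' : HolderEnergy h' E') :
    HolderEnergy (fun x => h x + h' x) fun x => 2 * E x + 2 * E' x where
  mono := (H.mono.const_mul zero_le_two).add (H'.mono.const_mul zero_le_two)
  sq_le a b hab := by
    nlinarith [H.sq_le a b hab, H'.sq_le a b hab, sq_nonneg ((h b - h a) - (h' b - h' a))]

lemma neg (H : HolderEnergy h E) : HolderEnergy (fun x => - h x) E where
  mono := H.mono
  sq_le a b hab := by nlinarith [H.sq_le a b hab]

lemma sub (H : HolderEnergy h E) (H' : HolderEnergy h' E') :
    HolderEnergy (fun x => h x - h' x) fun x => 2 * E x + 2 * E' x := by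
  simpa [sub_eq_add_neg] using H.add H'.neg

lemma const_mul (H : HolderEnergy h E) (c : ℝ) :
    HolderEnergy (fun x => c * h x) fun x => c ^ 2 * E x where
  mono := H.mono.const_mul (sq_nonneg c)
  sq_le a b hab := by nlinarith [mul_le_mul_of_nonneg_left (H.sq_le a b hab) (sq_nonneg c)]

lemma comp (H : HolderEnergy h E) {θ : ℝ → ℝ} (hθ : Monotone θ)
    (hθ1 : ∀ a b, a ≤ b → θ b - θ a ≤ b - a) :
    HolderEnergy (fun x => h (θ x)) fun x => E (θ x) where
  mono := H.mono.comp hθ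
  sq_le a b hab := (H.sq_le _ _ (hθ hab)).trans
    (mul_le_mul_of_nonneg_right (hθ1 a b hab) (sub_nonneg.2 (H.mono (hθ hab))))

lemma reflect (H : HolderEnergy h E) : HolderEnergy (fun x => h (-x)) fun x => - E (-x) where
  mono a b hab := neg_le_neg (H.mono (neg_le_neg hab))
  sq_le a b hab := by
    have := H.sq_le _ _ (neg_le_neg hab)
    nlinarith

lemma sum {n : ℕ} {h E : ℕ → ℝ → ℝ} (H : ∀ j, HolderEnergy (h j) (E j)) :
    HolderEnergy (fun x => ∑ j ∈ Finset.range n, h j x) fun x => n * ∑ j ∈ Finset.range n, E j x where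
  mono a b hab := mul_le_mul_of_nonneg_left (Finset.sum_le_sum fun j _ => (H j).mono hab)
    n.cast_nonneg
  sq_le a b hab := by
    rw [← Finset.sum_sub_distrib, ← mul_sub, ← Finset.sum_sub_distrib]
    calc _ ≤ (Finset.range n).card * ∑ j ∈ Finset.range n, (h j b - h j a) ^ 2 :=
          sq_sum_le_card_mul_sum_sq
      _ ≤ n * ∑ j ∈ Finset.range n, (b - a) * (E j b - E j a) := by
          rw [Finset.card_range]
          exact mul_le_mul_of_nonneg_left (Finset.sum_le_sum fun j _ => (H j).sq_le a b hab)
            n.cast_nonneg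
      _ = _ := by rw [← Finset.mul_sum]; ring

lemma continuous (H : HolderEnergy h E) : Continuous h := by
  rw [continuous_iff_continuousAt]
  intro x
  have hb : ∀ᶠ y in 𝓝 x, (h y - h x) ^ 2 ≤ |y - x| * (E (x + 1) - E (x - 1)) := by
    filter_upwards [Icc_mem_nhds (by linarith : x - 1 < x) (by linarith : x < x + 1)] with y hy
    have h1 := H.mono hy.1
    have h2 := H.mono hy.2
    have h3 := H.mono (by linarith : x ≤ x + 1)
    have h4 := H.mono (by linarith : x - 1 ≤ x)
    rcases le_total x y with hxy | hxy
    · rw [abs_of_nonneg (by linarith)]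
      exact (H.sq_le x y hxy).trans (mul_le_mul_of_nonneg_left (by linarith) (by linarith))
    · rw [abs_of_nonpos (by linarith)]
      have := H.sq_le y x hxy
      have h5 : (x - y) * (E x - E y) ≤ (x - y) * (E (x + 1) - E (x - 1)) :=
        mul_le_mul_of_nonneg_left (by linarith) (by linarith)
      nlinarith
  have ht : Tendsto (fun y => |y - x| * (E (x + 1) - E (x - 1))) (𝓝 x) (𝓝 0) := by
    have : Continuous fun y => |y - x| * (E (x + 1) - E (x - 1)) := by fun_prop
    simpa using this.tendsto x
  have h0 : Tendsto (fun y => (h y - h x) ^ 2) (𝓝 x) (𝓝 0) :=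
    squeeze_zero' (of_forall fun y => sq_nonneg _) hb ht
  have h1 : Tendsto (fun y => |h y - h x|) (𝓝 x) (𝓝 0) := by
    have := (Real.continuous_sqrt.tendsto 0).comp h0
    simpa [Function.comp_def, Real.sqrt_sq_eq_abs] using this
  exact tendsto_sub_nhds_zero_iff.1 ((tendsto_zero_iff_abs_tendsto_zero _).2 h1)

lemma sum_increments_le (hE : Monotone E) (hr : ∀ x, ContinuousWithinAt E (Ici x) x) {a b : ℝ}
    (hab : a ≤ b) {n : ℕ} {I : ℕ → ℝ²}
    (hI : (n, I) ∈ AbsolutelyContinuousOnInterval.disjWithin a b) :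
    ∑ i ∈ Finset.range n, |E (I i).2 - E (I i).1| ≤ E b - E a := by
  let S : StieltjesFunction ℝ := ⟨E, hE, hr⟩
  have h1 : ∀ i, ofReal |E (I i).2 - E (I i).1| = S.measure (uIoc (I i).1 (I i).2) := by
    intro i
    rcases le_total (I i).1 (I i).2 with h | h
    · rw [uIoc_of_le h, S.measure_Ioc, abs_of_nonneg (sub_nonneg.2 (hE h))]
    · rw [uIoc_of_ge h, S.measure_Ioc, abs_of_nonpos (sub_nonpos.2 (hE h)), neg_sub]
  have h2 : ∑ i ∈ Finset.range n, S.measure (uIoc (I i).1 (I i).2) ≤ S.measure (Ioc a b) := by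
    rw [← measure_biUnion_finset hI.2 fun i _ => measurableSet_uIoc, ← uIoc_of_le hab]
    exact measure_mono (AbsolutelyContinuousOnInterval.biUnion_uIoc_subset_of_mem_disjWithin hI)
  simp_rw [← h1] at h2
  rw [S.measure_Ioc, ← ofReal_sum_of_nonneg fun _ _ => abs_nonneg _,
    ofReal_le_ofReal_iff (sub_nonneg.2 (hE hab))] at h2
  exact h2

lemma absolutelyContinuous (H : HolderEnergy h E) (a b : ℝ) :
    AbsolutelyContinuousOnInterval h a b := by
  wlog hab : a ≤ b generalizing a b
  · exact (this b a (le_of_not_ge hab)).symm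
  set S := H.mono.stieltjesFunction with hS
  have hSle : ∀ x y, x ≤ y → (h y - h x) ^ 2 ≤ (y - x) * (S y - S x) := by
    intro x y hxy
    have tS : ∀ x, Tendsto (fun s => E (x + s)) (𝓝[>] 0) (𝓝 (S x)) := fun x => by
      refine (H.mono.tendsto_rightLim x).comp (tendsto_nhdsWithin_iff.2 ⟨?_, ?_⟩)
      · have : Continuous fun s : ℝ => x + s := by fun_prop
        simpa using (this.tendsto 0).mono_left nhdsWithin_le_nhds
      · filter_upwards [self_mem_nhdsWithin] with s hs
        simpa using hs
    have t3 : Tendsto (fun s => (h (y + s) - h (x + s)) ^ 2) (𝓝[>] 0) (𝓝 ((h y - h x) ^ 2)) := by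
      have hc := H.continuous
      have : Continuous fun s => (h (y + s) - h (x + s)) ^ 2 := by fun_prop
      simpa using (this.tendsto 0).mono_left (nhdsWithin_le_nhds (s := Ioi 0))
    refine le_of_tendsto_of_tendsto t3 (((tS y).sub (tS x)).const_mul (y - x))
      (of_forall fun s => ?_)
    have := H.sq_le (x + s) (y + s) (by linarith)
    simpa using this
  rw [absolutelyContinuousOnInterval_iff]
  intro ε hε
  set M := S b - S a with hM
  have hM0 : 0 ≤ M := sub_nonneg.2 (S.mono hab)
  refine ⟨ε ^ 2 / (M + 1), by positivity, ?_⟩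
  rintro ⟨n, I⟩ hI hlen
  have hsum := sum_increments_le S.mono S.right_continuous hab hI
  have hterm : ∀ i, dist (h (I i).1) (h (I i).2) ^ 2 ≤
      dist (I i).1 (I i).2 * |S (I i).2 - S (I i).1| := by
    intro i
    rw [Real.dist_eq, Real.dist_eq, sq_abs]
    rcases le_total (I i).1 (I i).2 with h' | h'
    · rw [abs_sub_comm (I i).1, abs_of_nonneg (sub_nonneg.2 h'),
        abs_of_nonneg (sub_nonneg.2 (S.mono h'))]
      nlinarith [hSle _ _ h']
    · rw [abs_of_nonneg (sub_nonneg.2 h'), abs_of_nonpos (sub_nonpos.2 (S.mono h'))]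
      nlinarith [hSle _ _ h']
  have hcs : (∑ i ∈ Finset.range n, dist (h (I i).1) (h (I i).2)) ^ 2 ≤
      (∑ i ∈ Finset.range n, dist (I i).1 (I i).2) *
        ∑ i ∈ Finset.range n, |S (I i).2 - S (I i).1| :=
    Finset.sum_sq_le_sum_mul_sum_of_sq_le_mul _ (fun i _ => dist_nonneg)
      (fun i _ => abs_nonneg _) fun i _ => hterm i
  have hlen' : (∑ i ∈ Finset.range n, dist (I i).1 (I i).2) * (M + 1) < ε ^ 2 :=
    (lt_div_iff₀ (by linarith)).1 hlen
  have h0 : 0 ≤ ∑ i ∈ Finset.range n, dist (I i).1 (I i).2 :=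
    Finset.sum_nonneg fun _ _ => dist_nonneg
  refine lt_of_pow_lt_pow_left₀ 2 hε.le ?_
  refine lt_of_le_of_lt (hcs.trans (mul_le_mul_of_nonneg_left (hsum.trans ?_) h0)) hlen'
  show S b - S a ≤ M + 1
  linarith

lemma intervalIntegrable_deriv (H : HolderEnergy h E) (a b : ℝ) :
    IntervalIntegrable (deriv h) volume a b :=
  (H.absolutelyContinuous a b).intervalIntegrable_deriv

lemma integral_deriv (H : HolderEnergy h E) (a b : ℝ) : ∫ x in a..b, deriv h x = h b - h a :=
  (H.absolutelyContinuous a b).integral_deriv_eq_sub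

lemma ae_differentiableAt (H : HolderEnergy h E) : ∀ᵐ x, DifferentiableAt ℝ h x := by
  have : ∀ᵐ x, ∀ n : ℕ, x ∈ uIcc (-(n : ℝ)) n → DifferentiableAt ℝ h x :=
    ae_all_iff.2 fun n => (H.absolutelyContinuous (-n) n).ae_differentiableAt
  filter_upwards [this] with x hx
  obtain ⟨n, hn⟩ := exists_nat_ge |x|
  refine hx n ?_
  rw [uIcc_of_le (by linarith [abs_nonneg x])]
  exact abs_le.1 hn

lemma sq_deriv_le (H : HolderEnergy h E) : ∀ᵐ x, (deriv h x) ^ 2 ≤ deriv E x := by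
  filter_upwards [H.ae_differentiableAt, H.mono.ae_differentiableAt] with x hx1 hx2
  have t1 := (hx1.hasDerivAt.tendsto_slope_zero_right).pow 2
  have t2 := hx2.hasDerivAt.tendsto_slope_zero_right
  refine le_of_tendsto_of_tendsto t1 t2 ?_
  filter_upwards [self_mem_nhdsWithin] with t (ht : 0 < t)
  have := H.sq_le x (x + t) (by linarith)
  simp only [smul_eq_mul]
  rw [mul_pow, inv_pow, inv_mul_eq_div, inv_mul_eq_div, div_le_div_iff₀ (by positivity) ht]
  nlinarith [sq_nonneg t]

lemma lintegral_deriv_sq_le (H : HolderEnergy h E) {a b : ℝ} (hab : a ≤ b) :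
    ∫⁻ x in Ioc a b, ofReal ((deriv h x) ^ 2) ≤ ofReal (E b - E a) := by
  have hmE : MonotoneOn E (uIcc a b) := H.mono.monotoneOn _
  have hi := hmE.intervalIntegrable_deriv
  rw [intervalIntegrable_iff_integrableOn_Ioc_of_le hab] at hi
  calc _ ≤ ∫⁻ x in Ioc a b, ofReal (deriv E x) :=
        lintegral_mono_ae (ae_restrict_of_ae (H.sq_deriv_le.mono fun x hx => ofReal_le_ofReal hx))
    _ = ofReal (∫ x in Ioc a b, deriv E x) := by
        rw [ofReal_integral_eq_lintegral_ofReal hi]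
        exact ae_restrict_of_ae (H.sq_deriv_le.mono fun x hx => (sq_nonneg _).trans hx)
    _ ≤ _ := by
        refine ofReal_le_ofReal ?_
        have := hmE.intervalIntegral_deriv_mem_uIcc
        rw [integral_of_le hab, uIcc_of_le (sub_nonneg.2 (H.mono hab))] at this
        exact this.2

lemma of_primitive {g : ℝ → ℝ} (hg : MemLp g 2) (hh : ∀ a b, h b - h a = ∫ x in a..b, g x) :
    HolderEnergy h fun x => ∫ s in Iic x, g s ^ 2 := by
  have hsq : Integrable fun x => g x ^ 2 := hg.integrable_sq
  have hd : ∀ a b, a ≤ b → (∫ s in Iic b, g s ^ 2) - ∫ s in Iic a, g s ^ 2 = ∫ s in a..b, g s ^ 2 :=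
    fun a b _ => intervalIntegral.integral_Iic_sub_Iic hsq.integrableOn hsq.integrableOn
  refine ⟨fun a b hab => ?_, fun a b hab => ?_⟩
  · have := hd a b hab
    have h0 : 0 ≤ ∫ s in a..b, g s ^ 2 :=
      intervalIntegral.integral_nonneg hab fun _ _ => sq_nonneg _
    rw [← this] at h0
    exact sub_nonneg.1 h0
  · rw [hd a b hab, hh a b]
    have hgi : IntervalIntegrable g volume a b := by
      rw [intervalIntegrable_iff_integrableOn_Ioc_of_le hab]
      exact (hg.restrict (Ioc a b)).integrable (by norm_num)
    set I := ∫ x in a..b, g x with hI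
    set J := ∫ x in a..b, g x ^ 2 with hJ
    -- expand the square
    rcases hab.eq_or_lt with rfl | hlt
    · simp [hI]
    have : 0 ≤ ∫ x in a..b, (g x - I / (b - a)) ^ 2 :=
      intervalIntegral.integral_nonneg hab fun _ _ => sq_nonneg _
    have e : ∫ x in a..b, (g x - I / (b - a)) ^ 2 = J - I ^ 2 / (b - a) := by
      have : ∀ x, (g x - I / (b - a)) ^ 2 =
          g x ^ 2 - 2 * (I / (b - a)) * g x + (I / (b - a)) ^ 2 := fun x => by ring
      simp_rw [this]
      rw [intervalIntegral.integral_add, intervalIntegral.integral_sub,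
        intervalIntegral.integral_const_mul, intervalIntegral.integral_const]
      · rw [← hI, ← hJ]
        have : b - a ≠ 0 := by linarith
        field_simp
        simp only [smul_eq_mul]
        field_simp
        ring
      · exact hsq.intervalIntegrable
      · exact hgi.const_mul _
      · exact hsq.intervalIntegrable.sub (hgi.const_mul _)
      · exact intervalIntegrable_const
    rw [e, sub_nonneg, div_le_iff₀ (by linarith)] at this
    linarith

end HolderEnergy

lemma hasCompactSupport_exists_Icc {φ : ℝ → ℝ} {α β : ℝ} (hφ : IsTestFun (Ioo α β) φ) (hαβ : α < β) :
    ∃ a b, α < a ∧ a ≤ b ∧ b < β ∧ ∀ x, x ∉ Ioo a b → φ x = 0 := by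
  rcases (tsupport φ).eq_empty_or_nonempty with h | h
  · refine ⟨(α + β) / 2, (α + β) / 2, by linarith, le_rfl, by linarith, fun x _ => ?_⟩
    exact image_eq_zero_of_notMem_tsupport (by simp [h])
  · have hc : IsCompact (tsupport φ) := hφ.hasCompactSupport
    have h1 := hφ.tsupport_subset (hc.sInf_mem h)
    have h2 := hφ.tsupport_subset (hc.sSup_mem h)
    refine ⟨(α + sInf (tsupport φ)) / 2, (sSup (tsupport φ) + β) / 2, by linarith [h1.1], ?_,
      by linarith [h2.2], fun x hx => image_eq_zero_of_notMem_tsupport fun hx' => hx ?_⟩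
    · linarith [h1.1, h2.2, (csInf_le hc.bddBelow h.some_mem).trans (le_csSup hc.bddAbove h.some_mem)]
    · exact ⟨by linarith [csInf_le hc.bddBelow hx', h1.1],
        by linarith [le_csSup hc.bddAbove hx', h2.2]⟩

lemma hasWeakDeriv_of_increment {h g : ℝ → ℝ} {α β : ℝ}
    (hg : LocallyIntegrableOn g (Ioo α β) volume)
    (hh : ∀ a b, α < a → a ≤ b → b < β → h b - h a = ∫ x in a..b, g x) :
    HasWeakDeriv (Ioo α β) (1 : ℝ) h g := by
  rcases le_or_gt β α with hαβ | hαβ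
  · rw [Ioo_eq_empty (not_lt.2 hαβ)]
    exact ⟨fun x hx => hx.elim, fun x hx => hx.elim, fun φ _ => by simp⟩
  have hgi : ∀ a b, α < a → a ≤ b → b < β → IntervalIntegrable g volume a b := by
    intro a b ha hab hb
    rw [intervalIntegrable_iff_integrableOn_Icc_of_le hab]
    exact hg.integrableOn_compact_subset (fun x hx => ⟨ha.trans_le hx.1, hx.2.trans_lt hb⟩)
      isCompact_Icc
  have hc : ContinuousOn h (Ioo α β) := by
    intro x hx
    obtain ⟨a, ha, hax⟩ := exists_between hx.1
    obtain ⟨b, hxb, hb⟩ := exists_between hx.2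
    have h1 : ContinuousOn (fun y => h a + ∫ s in a..y, g s) (Icc a b) := by
      have := intervalIntegral.continuousOn_primitive_interval'
        (hgi a b ha (hax.trans hxb).le hb) left_mem_uIcc
      rw [uIcc_of_le (hax.trans hxb).le] at this
      exact continuousOn_const.add this
    have h2 : ContinuousOn h (Icc a b) := h1.congr fun y hy => by
      show h y = h a + _
      rw [← hh a y ha hy.1 (hy.2.trans_lt hb)]; ring
    exact (h2.continuousAt (Icc_mem_nhds hax hxb)).continuousWithinAt
  refine HasWeakDeriv.of_integral_eq' (hc.locallyIntegrableOn measurableSet_Ioo) hg fun φ hφ => ?_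
  obtain ⟨a, b, ha, hab, hb, hz⟩ := hasCompactSupport_exists_Icc hφ hαβ
  have hz' : ∀ x, x ∉ Icc a b → fderiv ℝ φ x 1 = 0 := by
    intro x hx
    have : φ =ᶠ[𝓝 x] 𝟘 := by
      filter_upwards [isClosed_Icc.isOpen_compl.mem_nhds hx] with y hy
      exact hz y fun h' => hy (Ioo_subset_Icc_self h')
    rw [this.fderiv_eq]; simp
  have hgi' := hgi a b ha hab hb
  set H : ℝ → ℝ := fun y => h a + ∫ s in a..y, g s with hH
  have hac : AbsolutelyContinuousOnInterval H a b := by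
    have h1 := hgi'.absolutelyContinuousOnInterval_intervalIntegral (c := a) left_mem_uIcc
    have h2 : AbsolutelyContinuousOnInterval (fun _ : ℝ => h a) a b :=
      (contDiff_const (𝕜 := ℝ) (n := 1)).contDiffOn.absolutelyContinuousOnInterval
    exact h2.add h1
  have hφac : AbsolutelyContinuousOnInterval φ a b :=
    ((hφ.contDiff.of_le (by simp)).contDiffOn (n := 1)).absolutelyContinuousOnInterval
  have hip := hac.integral_mul_deriv_eq_deriv_mul hφac
  rw [hz a (by simp), hz b (by simp), mul_zero, mul_zero, sub_zero, zero_sub] at hip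
  have hder : ∀ᵐ x, x ∈ uIoc a b → deriv H x * φ x = g x * φ x := by
    filter_upwards [hgi'.ae_hasDerivAt_integral] with x hx hx'
    have := (hx (uIoc_subset_uIcc hx') a left_mem_uIcc).const_add (h a)
    rw [this.deriv]
  rw [intervalIntegral.integral_congr_ae hder] at hip
  have e1 : ∫ x, h x * fderiv ℝ φ x 1 = ∫ x in a..b, H x * deriv φ x := by
    rw [integral_of_le hab, ← integral_Icc_eq_integral_Ioc,
      ← setIntegral_eq_integral_of_forall_compl_eq_zero (s := Icc a b)
        fun x hx => by rw [hz' x hx, mul_zero]]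
    refine setIntegral_congr_fun measurableSet_Icc fun x hx => ?_
    simp only [hH, ← hh a x ha hx.1 (hx.2.trans_lt hb), fderiv_eq_smul_deriv]
    simp
  have e2 : ∫ x, g x * φ x = ∫ x in a..b, g x * φ x := by
    rw [integral_of_le hab, ← integral_Icc_eq_integral_Ioc,
      ← setIntegral_eq_integral_of_forall_compl_eq_zero (s := Icc a b)
        fun x hx => by rw [hz x fun h' => hx (Ioo_subset_Icc_self h'), mul_zero]]
  rw [e1, e2, hip]

lemma exists_primitive_of_memW12 {a b : ℝ} {h : ℝ → ℝ} (hh : MemW12 (Ioo a b) h)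
    (hc : ContinuousOn h (Icc a b)) (hab : a ≤ b) :
    ∃ g : ℝ → ℝ, MemLp g 2 ∧ (∀ x, x ∉ Ioo a b → g x = 0) ∧
      ∀ x ∈ Icc a b, h x = h a + ∫ s in a..x, g s := by
  obtain ⟨g, hg, hg2⟩ := hh.2 1
  refine ⟨(Ioo a b).indicator g, (memLp_indicator_iff_restrict measurableSet_Ioo).2 hg2,
    fun x hx => by simp [hx], ?_⟩
  set G := (Ioo a b).indicator g with hG
  have hgI : IntegrableOn g (Ioo a b) := hg2.integrable (by norm_num)
  have hGi : Integrable G := hgI.integrable_indicator measurableSet_Ioo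
  rcases hab.eq_or_lt with rfl | hlt
  · intro x hx
    obtain rfl : x = a := le_antisymm hx.2 hx.1
    simp
  have hall := hg.increment_all isOpen_Ioo (hc.mono Ioo_subset_Icc_self)
    (hg2.integrable (by norm_num))
  have hG0 : ContinuousOn (fun x => ∫ s in a..x, G s) (Icc a b) :=
    (intervalIntegral.continuous_primitive (fun _ _ => hGi.intervalIntegrable) a).continuousOn
  have hpair : ∀ x ∈ Ioo a b, ∀ᵐ y, y ∈ Ioo a x → h x - h y = ∫ s in y..x, G s := by
    intro x hx
    filter_upwards [hall] with y hy hyx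
    have hs : y ∈ segmentInside (Ioo a b) (1 : ℝ) (x - y) := fun s hs => by
      simp only [smul_eq_mul, mul_one]
      exact ⟨by linarith [hyx.1, hs.1], by linarith [hx.2, hs.2]⟩
    have := (hy (x - y) (by linarith [hyx.2]) hs).2
    simp only [smul_eq_mul, mul_one, add_sub_cancel] at this
    rw [this, integral_comp_add_left (fun s => g s) y]
    simp only [add_zero, add_sub_cancel]
    refine intervalIntegral.integral_congr fun s hs => ?_
    rw [uIcc_of_le hyx.2.le] at hs
    have : s ∈ Ioo a b := ⟨hyx.1.trans_le hs.1, hs.2.trans_lt hx.2⟩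
    simp [hG, this]
  have hopen : ∀ x ∈ Ioo a b, h x = h a + ∫ s in a..x, G s := by
    intro x hx
    have hd : Dense {y | y ∈ Ioo a x → h x - h y = ∫ s in y..x, G s} :=
      Measure.dense_of_ae (hpair x hx)
    have hcl : Icc a x ⊆ closure (Ioo a x ∩ {y | y ∈ Ioo a x → h x - h y = ∫ s in y..x, G s}) := by
      rw [← closure_Ioo hx.1.ne]
      exact closure_minimal (hd.open_subset_closure_inter isOpen_Ioo) isClosed_closure
    have hsub : Icc a x ⊆ Icc a b := Icc_subset_Icc_right hx.2.le
    have : EqOn (fun y => h x - h y) (fun y => (∫ s in a..x, G s) - ∫ s in a..y, G s) (Icc a x) := by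
      refine EqOn.of_subset_closure ?_ (continuousOn_const.sub (hc.mono hsub))
        (continuousOn_const.sub (hG0.mono hsub)) (inter_subset_left.trans Ioo_subset_Icc_self) hcl
      rintro y ⟨hy1, hy2⟩
      simp only
      rw [hy2 hy1, integral_interval_sub_left hGi.intervalIntegrable hGi.intervalIntegrable]
    have := this ⟨le_rfl, hx.1.le⟩
    simp only [intervalIntegral.integral_same, sub_zero] at this
    linarith
  have hclos : EqOn h (fun x => h a + ∫ s in a..x, G s) (Icc a b) :=
    EqOn.of_subset_closure hopen hc (continuousOn_const.add hG0) Ioo_subset_Icc_self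
      (closure_Ioo hlt.ne).superset
  exact hclos

/-- A front that is defined for all times. -/
structure Front (R ρ₀ T : ℝ) (ρ : ℝ → ℝ) : Prop where
  pos : 0 < ρ₀
  pos_time : 0 < T
  mono : Monotone ρ
  lip : ∀ a b, a ≤ b → ρ b - ρ a ≤ b - a
  init : ∀ t, t ≤ 0 → ρ t = ρ₀
  final : ∀ t, T ≤ t → ρ t = ρ T
  lt : ρ T < R

lemma IsFront.increment_mem {R ρ₀ T : ℝ} {ρ : ℝ → ℝ} (h : IsFront R ρ₀ T ρ) {a b : ℝ} (ha : 0 ≤ a)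
    (hab : a ≤ b) (hb : b ≤ T) : 0 ≤ ρ b - ρ a ∧ ρ b - ρ a ≤ b - a := by
  obtain ⟨K, hK⟩ := h.lipschitz
  have hac : AbsolutelyContinuousOnInterval ρ a b := by
    refine (hK.mono ?_).absolutelyContinuousOnInterval
    rw [uIcc_of_le hab]
    exact Icc_subset_Icc ha hb
  rw [← hac.integral_deriv_eq_sub]
  have hd : ∀ᵐ t ∂vol (Icc a b), 0 ≤ deriv ρ t ∧ deriv ρ t < 1 :=
    ae_restrict_of_ae_restrict_of_subset (Icc_subset_Icc ha hb) h.deriv_mem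
  refine ⟨intervalIntegral.integral_nonneg_of_ae_restrict hab (hd.mono fun t ht => ht.1), ?_⟩
  have := intervalIntegral.integral_mono_ae_restrict (g := fun _ => (1 : ℝ)) hab
    hac.intervalIntegrable_deriv intervalIntegrable_const (hd.mono fun t ht => ht.2.le)
  simpa using this

/-- The front, extended by constants. -/
def frontExt (T : ℝ) (ρ : ℝ → ℝ) (t : ℝ) : ℝ := ρ (max 0 (min t T))

lemma frontExt_eq {T : ℝ} {ρ : ℝ → ℝ} {t : ℝ} (ht : t ∈ Icc 0 T) : frontExt T ρ t = ρ t := by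
  rw [frontExt, min_eq_left ht.2, max_eq_right ht.1]

lemma IsFront.front {R ρ₀ T : ℝ} {ρ : ℝ → ℝ} (h : IsFront R ρ₀ T ρ) (hρ₀ : 0 < ρ₀)
    (hT : 0 < T) : Front R ρ₀ T (frontExt T ρ) := by
  have key : ∀ a b : ℝ, a ≤ b → 0 ≤ frontExt T ρ b - frontExt T ρ a ∧
      frontExt T ρ b - frontExt T ρ a ≤ b - a := by
    intro a b hab
    have h1 : max 0 (min a T) ≤ max 0 (min b T) := max_le_max le_rfl (min_le_min hab le_rfl)
    have := h.increment_mem (le_max_left _ _) h1 (max_le hT.le (min_le_right _ _))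
    refine ⟨this.1, this.2.trans ?_⟩
    rcases le_total a T with h2 | h2 <;> rcases le_total b T with h3 | h3 <;>
    rcases le_total 0 a with h4 | h4 <;> rcases le_total 0 b with h5 | h5 <;>
    simp only [min_eq_left, min_eq_right, max_eq_left, max_eq_right, h2, h3, h4, h5, hT.le] <;>
    linarith
  refine ⟨hρ₀, hT, fun a b hab => sub_nonneg.1 (key a b hab).1, fun a b hab => (key a b hab).2,
    fun t ht => ?_, fun t ht => ?_, ?_⟩
  · rw [frontExt, max_eq_left ((min_le_left _ _).trans ht), h.zero]
  · simp [frontExt, ht]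
  · rw [frontExt_eq ⟨hT.le, le_rfl⟩]
    exact (h.mapsTo ⟨hT.le, le_rfl⟩).2

lemma stripDomain_congr {T : ℝ} {ρ ρ' : ℝ → ℝ} (h : ∀ t ∈ Icc 0 T, ρ t = ρ' t) :
    Ω T ρ = Ω T ρ' := by
  ext p
  simp only [stripDomain, mem_ofPred_eq]
  constructor <;> rintro ⟨h1, h2, h3, h4⟩ <;> refine ⟨h1, h2, h3, ?_⟩
  · rwa [← h p.1 ⟨h1.le, h2.le⟩]
  · rwa [h p.1 ⟨h1.le, h2.le⟩]

namespace Front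

variable {R ρ₀ T : ℝ} {ρ : ℝ → ℝ} (hF : Front R ρ₀ T ρ)

include hF

lemma lipschitz : LipschitzWith 1 ρ := by
  refine LipschitzWith.of_dist_le_mul fun a b => ?_
  rw [Real.dist_eq, Real.dist_eq, NNReal.coe_one, one_mul]
  rcases le_total a b with h | h
  · rw [abs_sub_comm, abs_sub_comm a, abs_of_nonneg (sub_nonneg.2 (hF.mono h)),
      abs_of_nonneg (sub_nonneg.2 h)]
    exact hF.lip a b h
  · rw [abs_of_nonneg (sub_nonneg.2 (hF.mono h)), abs_of_nonneg (sub_nonneg.2 h)]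
    exact hF.lip b a h

lemma continuous : Continuous ρ := hF.lipschitz.continuous

lemma ge (t : ℝ) : ρ₀ ≤ ρ t := by
  rw [← hF.init (min t 0) (min_le_right _ _)]
  exact hF.mono (min_le_left _ _)

lemma front_pos (t : ℝ) : 0 < ρ t := hF.pos.trans_le (hF.ge t)

lemma le (t : ℝ) : ρ t ≤ ρ T := by
  rw [← hF.final (max t T) (le_max_right _ _)]
  exact hF.mono (le_max_left _ _)

lemma lt_R (t : ℝ) : ρ t < R := (hF.le t).trans_lt hF.lt

lemma strictMono_psi : StrictMono fun t => t + ρ t := fun a b hab => by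
  have := hF.mono hab.le
  simp only
  linarith

lemma surjective_psi : Function.Surjective fun t => t + ρ t := by
  refine Continuous.surjective (continuous_id.add hF.continuous) ?_ ?_
  · exact tendsto_atTop_mono (fun t => by simpa using (hF.front_pos t).le) tendsto_id
  · exact tendsto_atBot_mono (fun t => by simpa using hF.le t)
      (tendsto_atBot_add_const_right _ (ρ T) tendsto_id)

omit hF in
/-- The time at which the incoming characteristic `t + r = s` leaves the front. -/
def frontTime (ρ : ℝ → ℝ) (s : ℝ) : ℝ := Function.invFun (fun t => t + ρ t) s

omit hF in
/-- The value of `t - r` at the front point of the characteristic `t + r = s`. -/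
def reflected (ρ : ℝ → ℝ) (s : ℝ) : ℝ := frontTime ρ s - ρ (frontTime ρ s)

lemma frontTime_spec (s : ℝ) : frontTime ρ s + ρ (frontTime ρ s) = s :=
  Function.invFun_eq (hF.surjective_psi s)

lemma frontTime_psi (t : ℝ) : frontTime ρ (t + ρ t) = t :=
  Function.leftInverse_invFun hF.strictMono_psi.injective t

lemma frontTime_increment {a b : ℝ} (hab : a ≤ b) :
    0 ≤ frontTime ρ b - frontTime ρ a ∧ frontTime ρ b - frontTime ρ a ≤ b - a := by
  have h1 := hF.frontTime_spec a
  have h2 := hF.frontTime_spec b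
  have h3 : frontTime ρ a ≤ frontTime ρ b := by
    by_contra! h
    have := hF.strictMono_psi h
    simp only at this
    linarith
  have := hF.mono h3
  constructor <;> linarith

lemma monotone_frontTime : Monotone (frontTime ρ) := fun _ _ hab =>
  sub_nonneg.1 (hF.frontTime_increment hab).1

lemma frontTime_init : frontTime ρ ρ₀ = 0 := by
  have := hF.frontTime_psi 0
  rwa [hF.init 0 le_rfl, zero_add] at this

lemma reflected_eq (s : ℝ) : reflected ρ s = 2 * frontTime ρ s - s := by
  have := hF.frontTime_spec s
  rw [reflected]
  linarith

lemma reflected_psi (t : ℝ) : reflected ρ (t + ρ t) = t - ρ t := by rw [reflected, hF.frontTime_psi]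

lemma reflected_increment {a b : ℝ} (hab : a ≤ b) : reflected ρ b - reflected ρ a ≤ b - a := by
  rw [hF.reflected_eq, hF.reflected_eq]
  linarith [(hF.frontTime_increment hab).2]

lemma monotone_reflected : Monotone (reflected ρ) := fun a b hab => by
  have := hF.lip _ _ (hF.monotone_frontTime hab)
  simp only [reflected]
  linarith

lemma reflected_le (s : ℝ) : reflected ρ s ≤ s - 2 * ρ₀ := by
  have := hF.frontTime_spec s
  have := hF.ge (frontTime ρ s)
  rw [reflected]
  linarith

lemma frontTime_nonpos {s : ℝ} (hs : s ≤ ρ₀) : frontTime ρ s ≤ 0 := by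
  rw [← hF.frontTime_init]
  exact hF.monotone_frontTime hs

lemma frontTime_nonneg {s : ℝ} (hs : ρ₀ ≤ s) : 0 ≤ frontTime ρ s := by
  rw [← hF.frontTime_init]
  exact hF.monotone_frontTime hs

lemma frontTime_le {t r : ℝ} (h : r ≤ ρ t) : frontTime ρ (t + r) ≤ t := by
  rw [← hF.frontTime_psi t]
  exact hF.monotone_frontTime (by rw [hF.frontTime_psi]; linarith)

lemma isOpen_strip : IsOpen (Ω T ρ) := by
  have := hF.continuous
  exact (isOpen_lt continuous_const continuous_fst).inter
    ((isOpen_lt continuous_fst continuous_const).inter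
      ((isOpen_lt continuous_const continuous_snd).inter (isOpen_lt continuous_snd (by fun_prop))))

lemma measurableSet_strip : MeasurableSet (Ω T ρ) := hF.isOpen_strip.measurableSet

lemma ae_mem : ∀ᵐ x ∂vol (Ω T ρ), x ∈ Ω T ρ := ae_restrict_mem hF.measurableSet_strip

lemma integral_congr {f g : ℝ² → ℝ} (h : EqOn f g (Ω T ρ)) :
    ∫ x in Ω T ρ, f x = ∫ x in Ω T ρ, g x := setIntegral_congr_fun hF.measurableSet_strip h

lemma closure_strip : closure (Ω T ρ) = {p | 0 ≤ p.1 ∧ p.1 ≤ T ∧ 0 ≤ p.2 ∧ p.2 ≤ ρ p.1} := by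
  have hc := hF.continuous
  refine Subset.antisymm (closure_minimal ?_ ?_) ?_
  · exact fun p hp => ⟨hp.1.le, hp.2.1.le, hp.2.2.1.le, hp.2.2.2.le⟩
  · exact (isClosed_le continuous_const continuous_fst).inter
      ((isClosed_le continuous_fst continuous_const).inter
        ((isClosed_le continuous_const continuous_snd).inter
          (isClosed_le continuous_snd (by fun_prop))))
  · rintro ⟨t, r⟩ ⟨h1, h2, h3, h4⟩
    simp only at h1 h2 h3 h4
    have hT := hF.pos_time
    -- approach the point from inside
    set γ : ℝ → ℝ² := fun s => (t + s * (T / 2 - t),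
      (1 - s) * (r * (ρ (t + s * (T / 2 - t)) / ρ t)) + s * (ρ (t + s * (T / 2 - t)) / 2)) with hγ
    have hγc : Continuous γ := by fun_prop
    have hpos := hF.front_pos t
    have hγ0 : γ 0 = (t, r) := by simp [hγ, hpos.ne']
    have ht : Tendsto γ (𝓝[>] 0) (𝓝 (t, r)) := by
      rw [← hγ0]
      exact (hγc.tendsto 0).mono_left nhdsWithin_le_nhds
    refine mem_closure_of_tendsto ht ?_
    filter_upwards [Ioo_mem_nhdsGT (zero_lt_one' ℝ)] with s hs
    have hp := hF.front_pos (t + s * (T / 2 - t))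
    have hq : r * (ρ (t + s * (T / 2 - t)) / ρ t) ≤ ρ (t + s * (T / 2 - t)) := by
      rw [mul_div_assoc', div_le_iff₀ hpos]
      nlinarith
    have hq0 : 0 ≤ r * (ρ (t + s * (T / 2 - t)) / ρ t) := by positivity
    have hs1 := hs.1
    have hs2 := hs.2
    refine ⟨?_, ?_, ?_, ?_⟩ <;> simp only [hγ]
    · nlinarith
    · nlinarith
    · have : 0 < s * (ρ (t + s * (T / 2 - t)) / 2) := by positivity
      nlinarith [mul_nonneg (sub_nonneg.2 hs2.le) hq0]
    · nlinarith [mul_le_mul_of_nonneg_left hq (sub_nonneg.2 hs2.le), mul_pos hs1 hp]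

lemma strip_subset_box : Ω T ρ ⊆ Icc 0 T ×ˢ Icc 0 R := fun _ hp =>
  ⟨⟨hp.1.le, hp.2.1.le⟩, ⟨hp.2.2.1.le, (hp.2.2.2.trans (hF.lt_R _)).le⟩⟩

lemma volume_strip_lt_top : volume (Ω T ρ) < ⊤ :=
  (measure_mono hF.strip_subset_box).trans_lt (isCompact_Icc.prod isCompact_Icc).measure_lt_top

end Front

/-- The integral of `f` along the backward ray in the direction `e`. -/
def rayInt (e : ℝ²) (f : ℝ² → ℝ) (x : ℝ²) : ℝ := ∫ s in Ioi (0 : ℝ), f (x - s • e)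

section Ray

variable {e : ℝ²} {f : ℝ² → ℝ}

lemma rayInt_eq_zero (he : e.1 = 1) (h0 : ∀ x : ℝ², x.1 ≤ 0 → f x = 0) {x : ℝ²} (hx : x.1 ≤ 0) :
    rayInt e f x = 0 := by
  rw [rayInt]
  refine setIntegral_eq_zero_of_forall_eq_zero fun s hs => h0 _ ?_
  have : (0 : ℝ) < s := hs
  simp only [Prod.fst_sub, Prod.smul_fst, he, smul_eq_mul, mul_one]
  linarith

lemma rayInt_eq_Ioc (he : e.1 = 1) (h0 : ∀ x : ℝ², x.1 ≤ 0 → f x = 0) {x : ℝ²} {S : ℝ}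
    (hx : x.1 ≤ S) : rayInt e f x = ∫ s in Ioc 0 S, f (x - s • e) := by
  rw [rayInt]
  refine setIntegral_eq_of_subset_of_forall_sdiff_eq_zero measurableSet_Ioi
    (fun s hs => hs.1) fun s hs => h0 _ ?_
  have h1 : (0 : ℝ) < s := hs.1
  have h2 : S < s := by
    by_contra! h
    exact hs.2 ⟨h1, h⟩
  simp only [Prod.fst_sub, Prod.smul_fst, he, smul_eq_mul, mul_one]
  linarith

lemma exists_integrable_ray (he : e.1 = 1) (hf : LocallyIntegrable f)
    (h0 : ∀ x : ℝ², x.1 ≤ 0 → f x = 0) {K : Set ℝ²} (hK : IsCompact K) :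
    ∃ S : ℝ, 0 < S ∧ (∀ x ∈ K, x.1 < S) ∧ ∃ F : ℝ² → ℝ, Integrable F ∧ (∀ x, F x = f x ∨ F x = 0) ∧
      (∀ x ∈ K, F x = f x) ∧ ∀ x ∈ K, rayInt e f x = ∫ s in Ioc 0 S, F (x + s • (-e)) := by
  obtain ⟨S, hS⟩ := (hK.image continuous_fst).bddAbove
  have hS' : ∀ x ∈ K, x.1 < max S 0 + 1 := fun x hx =>
    ((hS (mem_image_of_mem _ hx)).trans (le_max_left _ _)).trans_lt (lt_add_one _)
  set S' := max S 0 + 1 with hSdef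
  have hS0 : 0 < S' := by positivity
  set K' : Set ℝ² := (fun p : ℝ² × ℝ => p.1 - p.2 • e) '' (K ×ˢ Icc 0 S') with hK'
  have hK'c : IsCompact K' := (hK.prod isCompact_Icc).image (by fun_prop)
  refine ⟨S', hS0, hS', K'.indicator f, ?_, ?_, ?_, ?_⟩
  · exact (hf.integrableOn_isCompact hK'c).integrable_indicator hK'c.measurableSet
  · intro x
    by_cases hx : x ∈ K' <;> simp [hx]
  · intro x hx
    have : x ∈ K' := ⟨(x, 0), ⟨hx, le_rfl, hS0.le⟩, by simp⟩
    simp [this]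
  · intro x hx
    rw [rayInt_eq_Ioc he h0 (hS' x hx).le]
    refine setIntegral_congr_fun measurableSet_Ioc fun s hs => ?_
    have : x - s • e ∈ K' := ⟨(x, s), ⟨hx, hs.1.le, hs.2⟩, rfl⟩
    simp only [smul_neg, ← sub_eq_add_neg]
    simp [this]

lemma locallyIntegrable_rayInt (he : e.1 = 1) (hf : LocallyIntegrable f)
    (h0 : ∀ x : ℝ², x.1 ≤ 0 → f x = 0) : LocallyIntegrable (rayInt e f) := by
  rw [locallyIntegrable_iff]
  intro K hK
  obtain ⟨S, -, -, F, hF, -, -, hr⟩ := exists_integrable_ray he hf h0 hK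
  have : Integrable fun x => ∫ s in Ioc 0 S, F (x + s • (-e)) :=
    (hF.comp_shear (vol (Ioc 0 S)) (-e)).integral_prod_left
  exact this.integrableOn.congr_fun (fun x hx => (hr x hx).symm) hK.measurableSet

theorem hasWeakDeriv_rayInt (he : e.1 = 1) (hf : LocallyIntegrable f)
    (h0 : ∀ x : ℝ², x.1 ≤ 0 → f x = 0) : HasWeakDeriv univ e (rayInt e f) f := by
  refine HasWeakDeriv.of_integral_eq' ((locallyIntegrable_rayInt he hf h0).locallyIntegrableOn _)
    (hf.locallyIntegrableOn _) fun φ hφ => ?_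
  obtain ⟨S, hS, hKS, F, hF, hFf, hFK, hr⟩ :=
    exists_integrable_ray he hf h0 (K := tsupport φ) hφ.hasCompactSupport
  obtain ⟨C, hC⟩ := (hφ.fderiv e).exists_bound
  have e1 : ∀ x, rayInt e f x * fderiv ℝ φ x e =
      ∫ s in Ioc 0 S, F (x + s • (-e)) * fderiv ℝ φ x e := by
    intro x
    by_cases hx : x ∈ tsupport φ
    · rw [hr x hx, integral_mul_const]
    · have : fderiv ℝ φ x e = 0 := image_eq_zero_of_notMem_tsupport
        (f := fun x => fderiv ℝ φ x e) fun h' => hx (tsupport_fderiv_apply_subset ℝ e h')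
      simp [this]
  simp_rw [e1]
  have i1 : Integrable (fun p : ℝ² × ℝ => F (p.1 + p.2 • (-e)) * fderiv ℝ φ p.1 e)
      (volume.prod (vol (Ioc 0 S))) :=
    (hF.comp_shear _ (-e)).mul_bdd (c := C)
      ((hφ.fderiv e).continuous.comp continuous_fst).aestronglyMeasurable
      (of_forall fun p => hC p.1)
  have i2 : Integrable (fun p : ℝ² × ℝ => F p.1 * fderiv ℝ φ (p.1 + p.2 • e) e)
      (volume.prod (vol (Ioc 0 S))) :=
    (hF.comp_fst _).mul_bdd (c := C) ((hφ.fderiv e).continuous.comp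
      (by fun_prop : Continuous fun p : ℝ² × ℝ => p.1 + p.2 • e)).aestronglyMeasurable
      (of_forall fun p => hC _)
  rw [integral_integral_swap i1]
  have e2 : ∀ s : ℝ, ∫ x, F (x + s • (-e)) * fderiv ℝ φ x e =
      ∫ x, F x * fderiv ℝ φ (x + s • e) e := by
    intro s
    rw [← integral_add_right_eq_self (fun x => F (x + s • (-e)) * fderiv ℝ φ x e) (s • e)]
    simp
  simp_rw [e2]
  rw [← integral_integral_swap i2, ← integral_neg]
  refine integral_congr_ae (of_forall fun x => ?_)
  simp only
  rw [← integral_of_le hS.le]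
  have hder : ∀ s ∈ uIcc 0 S, HasDerivAt (fun s : ℝ => F x * φ (x + s • e))
      (F x * fderiv ℝ φ (x + s • e) e) s := by
    intro s _
    have h1' : HasDerivAt (fun s : ℝ => x + s • e) e s := by
      simpa using ((hasDerivAt_id s).smul_const e).const_add x
    exact ((hφ.differentiable (x + s • e)).hasFDerivAt.comp_hasDerivAt s h1').const_mul (F x)
  rw [integral_eq_sub_of_hasDerivAt hder (by
    apply Continuous.intervalIntegrable
    exact continuous_const.mul ((hφ.fderiv e).continuous.comp
      (by fun_prop : Continuous fun s : ℝ => x + s • e)))]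
  have z1 : F x * φ (x + S • e) = 0 := by
    rcases hFf x with h | h
    · by_cases hx : x.1 ≤ 0
      · rw [h, h0 x hx, zero_mul]
      · rw [image_eq_zero_of_notMem_tsupport (f := φ) fun h' => ?_, mul_zero]
        have := hKS _ h'
        simp only [Prod.fst_add, Prod.smul_fst, he, smul_eq_mul, mul_one] at this
        linarith [not_le.1 hx]
    · rw [h, zero_mul]
  have z2 : F x * φ x = f x * φ x := by
    by_cases hx : x ∈ tsupport φ
    · rw [hFK x hx]
    · rw [image_eq_zero_of_notMem_tsupport hx, mul_zero, mul_zero]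
  simp [z1, z2]

end Ray

/-- Square integrable sources supported in a rectangle. -/
structure IsSource (T R : ℝ) (f : ℝ² → ℝ) : Prop where
  measurable : Measurable f
  memLp : MemLp f 2
  zero : ∀ p, p ∉ Ioo 0 T ×ˢ Ioo 0 R → f p = 0

/-- The backward characteristic cone. -/
def cone (p : ℝ²) : Set ℝ² := {q | q.1 + q.2 ≤ p.1 + p.2 ∧ q.1 - q.2 ≤ p.1 - p.2}

lemma isClosed_cone (p : ℝ²) : IsClosed (cone p) := by
  have h1 : IsClosed {q : ℝ² | q.1 + q.2 ≤ p.1 + p.2} := isClosed_le (by fun_prop) (by fun_prop)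
  have h2 : IsClosed {q : ℝ² | q.1 - q.2 ≤ p.1 - p.2} := isClosed_le (by fun_prop) (by fun_prop)
  exact h1.inter h2

lemma measurableSet_cone (p : ℝ²) : MeasurableSet (cone p) := (isClosed_cone p).measurableSet

lemma cone_mono {p q : ℝ²} (h1 : p.1 + p.2 ≤ q.1 + q.2) (h2 : p.1 - p.2 ≤ q.1 - q.2) :
    cone p ⊆ cone q := fun _ hx => ⟨hx.1.trans h1, hx.2.trans h2⟩

lemma fst_le_of_mem_cone {p q : ℝ²} (h : q ∈ cone p) : q.1 ≤ p.1 := by linarith [h.1, h.2]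

/-- The retarded potential: the solution of the wave equation with source `f`. -/
def retarded (f : ℝ² → ℝ) (p : ℝ²) : ℝ := (∫ q in cone p, f q) / 2

def coneEnergy (f : ℝ² → ℝ) (p : ℝ²) : ℝ := ∫ q in cone p, f q ^ 2

/-- The energy of the source up to time `t`. -/
def pastEnergy (f : ℝ² → ℝ) (t : ℝ) : ℝ := ∫ q in {q : ℝ² | q.1 ≤ t}, f q ^ 2

/-- The derivative of the retarded potential in the direction `(1, ε)`. -/
def charDeriv (ε : ℝ) (f : ℝ² → ℝ) : ℝ² → ℝ := rayInt (1, -ε) f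

/-- The characteristic map `(a, b) ↦ a • (1, 1) + b • (1, -1)`. -/
def charMap : ℝ² →ₗ[ℝ] ℝ² :=
  Matrix.toLin (Module.Basis.finTwoProd ℝ) (Module.Basis.finTwoProd ℝ) !![1, 1; 1, -1]

lemma charMap_apply (a b : ℝ) : charMap (a, b) = (a + b, a - b) := by
  simp [charMap, Matrix.toLin_finTwoProd_apply, sub_eq_add_neg]

lemma det_charMap : LinearMap.det charMap = -2 := by
  rw [charMap, LinearMap.det_toLin, Matrix.det_fin_two_of]
  norm_num

lemma continuous_charMap : Continuous charMap := LinearMap.continuous_of_finiteDimensional _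

lemma map_charMap : Measure.map (fun c => charMap c) (volume : Measure ℝ²) =
    ofReal (1 / 2) • volume := by
  rw [Measure.map_linearMap_addHaar_eq_smul_addHaar volume (by rw [det_charMap]; norm_num),
    det_charMap]
  congr 2
  rw [abs_inv, abs_neg, abs_two, one_div]

lemma injective_charMap : Function.Injective charMap := by
  rintro ⟨a, b⟩ ⟨c, d⟩ h
  rw [charMap_apply, charMap_apply, Prod.mk.injEq] at h
  ext <;> simp only <;> linarith [h.1, h.2]

lemma measurableEmbedding_charMap : MeasurableEmbedding fun c => charMap c :=
  continuous_charMap.measurableEmbedding injective_charMap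

lemma retarded_eq_quadrant (f : ℝ² → ℝ) (p : ℝ²) :
    retarded f p = ∫ c in Ici (0 : ℝ) ×ˢ Ici (0 : ℝ), f (p - charMap c) := by
  have h1 : ∫ q in cone p, f q = ∫ q in {q | p - q ∈ cone p}, f (p - q) := by
    have hm : MeasurableSet {q | p - q ∈ cone p} :=
      ((isClosed_cone p).preimage (by fun_prop : Continuous fun q => p - q)).measurableSet
    rw [← integral_indicator (measurableSet_cone p), ← integral_indicator hm]
    rw [← integral_sub_left_eq_self (fun q => (cone p).indicator f q) volume p]
    rfl
  have h2 : ∫ q in {q | p - q ∈ cone p}, f (p - q) ∂(Measure.map (fun c => charMap c) volume) =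
      ∫ c in Ici (0 : ℝ) ×ˢ Ici (0 : ℝ), f (p - charMap c) := by
    rw [measurableEmbedding_charMap.setIntegral_map]
    congr 2
    ext ⟨a, b⟩
    simp only [mem_preimage, mem_ofPred_eq, charMap_apply, cone, Prod.fst_sub, Prod.snd_sub,
      mem_prod, mem_Ici]
    constructor <;> rintro ⟨h, h'⟩ <;> constructor <;> linarith
  rw [map_charMap, Measure.restrict_smul, integral_smul_measure] at h2
  rw [retarded, h1, ← h2, ENNReal.toReal_ofReal (by norm_num)]
  simp only [smul_eq_mul]
  ring

namespace IsSource

variable {T R : ℝ} {f : ℝ² → ℝ} (hf : IsSource T R f)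

include hf

lemma integrable_sq : Integrable fun q => f q ^ 2 := hf.memLp.integrable_sq

lemma integrable : Integrable f := by
  have hfin : volume (Ioo 0 T ×ˢ Ioo 0 R : Set ℝ²) < ⊤ := by
    rw [volume_eq_prod, Measure.prod_prod]
    exact ENNReal.mul_lt_top measure_Ioo_lt_top measure_Ioo_lt_top
  have : IntegrableOn f (Ioo 0 T ×ˢ Ioo 0 R) := by
    have : IsFiniteMeasure (vol (Ioo 0 T ×ˢ Ioo 0 R : Set ℝ²)) := ⟨by rwa [restrict_apply_univ]⟩
    exact (hf.memLp.restrict _).integrable (by norm_num)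
  refine (integrableOn_iff_integrable_of_support_subset fun p hp => ?_).1 this
  by_contra h
  exact hp (hf.zero p h)

lemma zero_of_nonpos {x : ℝ²} (hx : x.1 ≤ 0) : f x = 0 := hf.zero x fun h => (not_lt.2 hx) h.1.1

lemma retarded_eq_rayInt {ε : ℝ} (hε : ε = 1 ∨ ε = -1) (p : ℝ²) :
    retarded f p = rayInt (1, ε) (charDeriv ε f) p := by
  have hi : Integrable (fun c : ℝ² => f (p - charMap c)) := by
    have h1 : Integrable (fun q => f (p - q)) (Measure.map (fun c => charMap c) volume) := by
      rw [map_charMap]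
      exact (hf.integrable.comp_sub_left p).smul_measure ofReal_ne_top
    exact measurableEmbedding_charMap.integrable_map_iff.1 h1
  rw [retarded_eq_quadrant]
  have hio : IntegrableOn (fun c : ℝ² => f (p - charMap c)) (Ici (0 : ℝ) ×ˢ Ici (0 : ℝ))
      (volume.prod volume) := hi.integrableOn
  simp only [rayInt, charDeriv]
  rcases hε with rfl | rfl
  on_goal 1 => rw [volume_eq_prod, setIntegral_prod _ hio, integral_Ici_eq_integral_Ioi]
  on_goal 2 =>
    have hio' : IntegrableOn (fun c : ℝ² => f (p - charMap c.swap)) (Ici (0 : ℝ) ×ˢ Ici (0 : ℝ))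
      (volume.prod volume) := hio.swap
    rw [volume_eq_prod, ← setIntegral_prod_swap, setIntegral_prod _ hio', integral_Ici_eq_integral_Ioi]
  all_goals
    refine setIntegral_congr_fun measurableSet_Ioi fun a _ => ?_
    simp only [integral_Ici_eq_integral_Ioi]
    refine setIntegral_congr_fun measurableSet_Ioi fun b _ => ?_
    simp only [charMap_apply, Prod.swap]
    congr 1
    ext <;> simp <;> ring

lemma hasWeakDeriv_charDeriv (ε : ℝ) : HasWeakDeriv univ (1, -ε) (charDeriv ε f) f :=
  hasWeakDeriv_rayInt rfl hf.integrable.locallyIntegrable fun _ => hf.zero_of_nonpos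

lemma charDeriv_eq_zero (ε : ℝ) {x : ℝ²} (hx : x.1 ≤ 0) : charDeriv ε f x = 0 :=
  rayInt_eq_zero rfl (fun _ => hf.zero_of_nonpos) hx

lemma hasWeakDeriv_retarded {ε : ℝ} (hε : ε = 1 ∨ ε = -1) :
    HasWeakDeriv univ (1, ε) (retarded f) (charDeriv ε f) := by
  have : retarded f = rayInt (1, ε) (charDeriv ε f) := funext fun p => hf.retarded_eq_rayInt hε p
  rw [this]
  exact hasWeakDeriv_rayInt rfl
    (locallyIntegrable_rayInt rfl hf.integrable.locallyIntegrable fun _ => hf.zero_of_nonpos)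
    fun _ => hf.charDeriv_eq_zero ε

lemma retarded_eq_zero {x : ℝ²} (hx : x.1 ≤ 0) : retarded f x = 0 := by
  rw [hf.retarded_eq_rayInt (Or.inl rfl)]
  exact rayInt_eq_zero rfl (fun _ => hf.charDeriv_eq_zero 1) hx

end IsSource

section Inequalities

variable {α : Type*} [MeasurableSpace α] {μ : Measure α}

lemma sq_lintegral_le {f : α → ℝ≥0∞} (hf : AEMeasurable f μ) :
    (∫⁻ x, f x ∂μ) ^ 2 ≤ μ univ * ∫⁻ x, f x ^ 2 ∂μ := by
  have h := ENNReal.lintegral_mul_le_Lp_mul_Lq μ Real.HolderConjugate.two_two hf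
    (aemeasurable_const (b := (1 : ℝ≥0∞)))
  simp only [Pi.mul_apply, mul_one, ENNReal.rpow_two, one_pow, lintegral_const, one_mul] at h
  calc (∫⁻ x, f x ∂μ) ^ 2 ≤
        ((∫⁻ x, f x ^ 2 ∂μ) ^ (1 / 2 : ℝ) * μ univ ^ (1 / 2 : ℝ)) ^ 2 := by gcongr
    _ = _ := by
      rw [mul_pow, ← ENNReal.rpow_two, ← ENNReal.rpow_two, ← ENNReal.rpow_mul, ← ENNReal.rpow_mul]
      norm_num
      rw [mul_comm]

lemma lintegral_enorm_sq {f : α → ℝ} (hf : MemLp f 2 μ) :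
    ∫⁻ x, ‖f x‖ₑ ^ 2 ∂μ = ofReal (∫ x, f x ^ 2 ∂μ) := by
  rw [ofReal_integral_eq_lintegral_ofReal hf.integrable_sq (of_forall fun x => sq_nonneg _)]
  simp_rw [ofReal_sq_eq_enorm]

lemma sq_integral_le [IsFiniteMeasure μ] {f : α → ℝ} (hf : MemLp f 2 μ) :
    (∫ x, f x ∂μ) ^ 2 ≤ μ.real univ * ∫ x, f x ^ 2 ∂μ := by
  have h := sq_lintegral_le (μ := μ) hf.1.aemeasurable.enorm
  have h1 : ‖∫ x, f x ∂μ‖ₑ ^ 2 ≤ μ univ * ∫⁻ x, ‖f x‖ₑ ^ 2 ∂μ :=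
    (by gcongr; exact enorm_integral_le_lintegral_enorm f : _ ≤ (∫⁻ x, ‖f x‖ₑ ∂μ) ^ 2).trans h
  have h4 : 0 ≤ ∫ x, f x ^ 2 ∂μ := integral_nonneg fun x => sq_nonneg _
  rw [lintegral_enorm_sq hf, ← ofReal_sq_eq_enorm, ← ofReal_measureReal, ← ofReal_mul measureReal_nonneg,
    ofReal_le_ofReal_iff (mul_nonneg measureReal_nonneg h4)] at h1
  exact h1

lemma eLpNorm_two_sq (f : α → ℝ) : eLpNorm f 2 μ ^ 2 = ∫⁻ x, ‖f x‖ₑ ^ 2 ∂μ := by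
  have := eLpNorm_nnreal_pow_eq_lintegral (μ := μ) (f := f) (p := 2) two_ne_zero
  simpa using this

end Inequalities

lemma measurePreserving_skew (ε : ℝ) :
    MeasurePreserving (fun p : ℝ² => (p.1, p.2 + ε * p.1)) volume volume := by
  refine (MeasurePreserving.id volume).skew_product (g := fun s x => x + ε * s) ?_ ?_
  · exact (by fun_prop : Continuous fun p : ℝ² => p.2 + ε * p.1).measurable
  · exact of_forall fun s => map_add_right_eq_self volume (ε * s)

/-- A function of time and space with continuous trajectory in `L²(ℝ)`. -/
def IsL2Curve (p : ℝ² → ℝ) : Prop :=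
  ∃ V : ℝ → Lp ℝ 2 (volume : Measure ℝ), Continuous V ∧ ∀ t, V t =ᵐ[volume] fun r => p (t, r)

namespace IsL2Curve

variable {p q : ℝ² → ℝ}

lemma memLp (h : IsL2Curve p) (t : ℝ) : MemLp (fun r => p (t, r)) 2 := by
  obtain ⟨V, -, hV⟩ := h
  exact (Lp.memLp (V t)).ae_eq (hV t)

lemma add (hp : IsL2Curve p) (hq : IsL2Curve q) : IsL2Curve fun x => p x + q x := by
  obtain ⟨V, hV, hV'⟩ := hp
  obtain ⟨W, hW, hW'⟩ := hq
  refine ⟨fun t => V t + W t, hV.add hW, fun t => ?_⟩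
  filter_upwards [Lp.coeFn_add (V t) (W t), hV' t, hW' t] with r h1 h2 h3
  rw [h1, Pi.add_apply, h2, h3]

lemma const_mul (hp : IsL2Curve p) (c : ℝ) : IsL2Curve fun x => c * p x := by
  obtain ⟨V, hV, hV'⟩ := hp
  refine ⟨fun t => c • V t, hV.const_smul c, fun t => ?_⟩
  filter_upwards [Lp.coeFn_smul c (V t), hV' t] with r h1 h2
  rw [h1, Pi.smul_apply, h2, smul_eq_mul]

lemma of_static {h : ℝ → ℝ} (hh : MemLp h 2) : IsL2Curve fun x => h x.2 :=
  ⟨fun _ => hh.toLp h, continuous_const, fun _ => hh.coeFn_toLp⟩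

lemma translate (hp : IsL2Curve p) (ε : ℝ) : IsL2Curve fun x => p (x.1, x.2 + ε * x.1) := by
  obtain ⟨V, hV, hV'⟩ := hp
  let g : ℝ → C(ℝ, ℝ) := fun t => ⟨fun r => r + ε * t, by fun_prop⟩
  have hg : Continuous g := ContinuousMap.continuous_of_continuous_uncurry _ (by
      show Continuous fun x : ℝ² => x.2 + ε * x.1
      fun_prop)
  have hgm : ∀ t, MeasurePreserving (g t) volume volume := fun t =>
    measurePreserving_add_right volume (ε * t)
  refine ⟨_, hV.compMeasurePreservingLp hg hgm (by norm_num), fun t => ?_⟩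
  filter_upwards [Lp.coeFn_compMeasurePreserving (V t) (hgm t),
    (hgm t).quasiMeasurePreserving.ae (hV' t)] with r h1 h2
  rw [h1]
  exact h2

lemma of_holder (hp : ∀ t, MemLp (fun r => p (t, r)) 2) {C : ℝ}
    (h : ∀ s t, s ≤ t → ∫⁻ r, ‖p (t, r) - p (s, r)‖ₑ ^ 2 ≤ ofReal (C * (t - s))) :
    IsL2Curve p := by
  refine ⟨fun t => (hp t).toLp _, ?_, fun t => (hp t).coeFn_toLp⟩
  have key : ∀ s t, s ≤ t → ‖(hp t).toLp _ - (hp s).toLp _‖ ^ 2 ≤ |C| * |t - s| := by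
    intro s t hst
    rw [← MemLp.toLp_sub, Lp.norm_toLp, ← ENNReal.toReal_pow, eLpNorm_two_sq]
    refine ENNReal.toReal_le_of_le_ofReal (by positivity) ((h s t hst).trans ?_)
    refine ofReal_le_ofReal ?_
    rw [← abs_mul]
    exact le_abs_self _
  have key' : ∀ s t, ‖(hp t).toLp _ - (hp s).toLp _‖ ^ 2 ≤ |C| * |t - s| := by
    intro s t
    rcases le_total s t with hst | hst
    · exact key s t hst
    · rw [norm_sub_rev, abs_sub_comm]
      exact key t s hst
  rw [continuous_iff_continuousAt]
  intro s
  rw [ContinuousAt, tendsto_iff_norm_sub_tendsto_zero]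
  have h0 : Tendsto (fun t => ‖(hp t).toLp _ - (hp s).toLp _‖ ^ 2) (𝓝 s) (𝓝 0) := by
    refine squeeze_zero (fun t => sq_nonneg _) (fun t => key' s t) ?_
    have : Continuous fun t => |C| * |t - s| := by fun_prop
    simpa using this.tendsto s
  have := (Real.continuous_sqrt.tendsto 0).comp h0
  simpa [Function.comp_def, Real.sqrt_sq] using this

lemma tendsto_eLpNorm (hp : IsL2Curve p) (t₀ : ℝ) :
    Tendsto (fun t => eLpNorm (fun r => p (t, r) - p (t₀, r)) 2) (𝓝 t₀) (𝓝 0) := by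
  obtain ⟨V, hV, hV'⟩ := hp
  have h1 := (Lp.tendsto_Lp_iff_tendsto_eLpNorm' V (V t₀)).1 (hV.tendsto t₀)
  refine h1.congr fun t => eLpNorm_congr_ae ?_
  filter_upwards [hV' t, hV' t₀] with r h2 h3
  simp only [Pi.sub_apply, h2, h3]

end IsL2Curve

namespace IsSource

variable {T R : ℝ} {f : ℝ² → ℝ} (hf : IsSource T R f)

lemma integral_Ioi_sub_left (g : ℝ → ℝ) (t : ℝ) :
    ∫ s in Ioi (0 : ℝ), g (t - s) = ∫ s in Iio t, g s := by
  rw [← integral_indicator measurableSet_Ioi, ← integral_indicator measurableSet_Iio,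
    ← integral_sub_left_eq_self _ volume t]
  congr 1
  ext s
  by_cases h : s < t
  · rw [indicator_of_mem (by simpa using h), indicator_of_mem (by exact h), sub_sub_cancel]
  · rw [indicator_of_notMem (by simpa using h), indicator_of_notMem (by exact h)]

lemma charDeriv_moving (ε t y : ℝ) :
    charDeriv ε f (t, y - ε * t) = ∫ s in Iio t, f (s, y - ε * s) := by
  rw [← integral_Ioi_sub_left, charDeriv, rayInt]
  refine setIntegral_congr_fun measurableSet_Ioi fun s _ => ?_
  congr 1
  ext <;> simp
  ring

include hf

lemma lintegral_moving (ε : ℝ) {S : Set ℝ} (hS : MeasurableSet S) :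
    ∫⁻ y, ∫⁻ s in S, ‖f (s, y - ε * s)‖ₑ ^ 2 = ∫⁻ q in {q : ℝ² | q.1 ∈ S}, ‖f q‖ₑ ^ 2 := by
  have hm : Measurable fun q : ℝ² => ‖f q‖ₑ ^ 2 := hf.measurable.enorm.pow_const 2
  have hS' : MeasurableSet {q : ℝ² | q.1 ∈ S} := measurable_fst hS
  rw [← lintegral_indicator hS', ← (measurePreserving_skew (-ε)).lintegral_comp
    (hm.indicator hS'), volume_eq_prod, lintegral_prod_symm]
  · refine lintegral_congr fun y => ?_
    rw [← lintegral_indicator hS]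
    refine lintegral_congr fun s => ?_
    by_cases h : s ∈ S
    · rw [indicator_of_mem h, indicator_of_mem (by exact h)]
      simp [sub_eq_add_neg]
    · rw [indicator_of_notMem h, indicator_of_notMem (by exact h)]
  · exact ((hm.indicator hS').comp (measurePreserving_skew (-ε)).measurable).aemeasurable

lemma lintegral_charDeriv_sub_le (ε : ℝ) {t₁ t₂ : ℝ} (ht : t₁ ≤ t₂) :
    ∫⁻ y, ‖charDeriv ε f (t₂, y - ε * t₂) - charDeriv ε f (t₁, y - ε * t₁)‖ₑ ^ 2 ≤
      ofReal (t₂ - t₁) * ∫⁻ q in {q : ℝ² | q.1 ∈ Ico t₁ t₂}, ‖f q‖ₑ ^ 2 := by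
  have hint : ∀ᵐ y : ℝ, Integrable fun s => f (s, y - ε * s) := by
    have h1 := ((measurePreserving_skew (-ε)).integrable_comp_of_integrable hf.integrable)
    rw [volume_eq_prod] at h1
    filter_upwards [h1.prod_left_ae] with y hy
    simpa [sub_eq_add_neg, Function.comp_def] using hy
  rw [← hf.lintegral_moving ε measurableSet_Ico, ← lintegral_const_mul']
  · refine lintegral_mono_ae (hint.mono fun y hy => ?_)
    have hu : (∫ s in Iio t₂, f (s, y - ε * s)) - ∫ s in Iio t₁, f (s, y - ε * s) =
        ∫ s in Ico t₁ t₂, f (s, y - ε * s) := by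
      rw [← Iio_union_Ico_eq_Iio ht, setIntegral_union (by
        rw [disjoint_left]; exact fun s h1 h2 => (not_lt.2 h2.1) h1) measurableSet_Ico
        hy.integrableOn hy.integrableOn]
      ring
    rw [charDeriv_moving, charDeriv_moving, hu]
    calc ‖∫ s in Ico t₁ t₂, f (s, y - ε * s)‖ₑ ^ 2 ≤
          (∫⁻ s in Ico t₁ t₂, ‖f (s, y - ε * s)‖ₑ) ^ 2 := by
            gcongr; exact enorm_integral_le_lintegral_enorm _
      _ ≤ _ := by
        refine (sq_lintegral_le hy.1.aemeasurable.enorm.restrict).trans ?_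
        rw [restrict_apply_univ, Real.volume_Ico]
  · exact ofReal_ne_top

lemma lintegral_sq_eq (s : Set ℝ²) : ∫⁻ q in s, ‖f q‖ₑ ^ 2 = ofReal (∫ q in s, f q ^ 2) :=
  lintegral_enorm_sq (hf.memLp.restrict s)

lemma pastEnergy_nonneg (t : ℝ) : 0 ≤ pastEnergy f t := integral_nonneg fun _ => sq_nonneg _

lemma lintegral_charDeriv_le (ε : ℝ) {t : ℝ} (ht : 0 ≤ t) :
    ∫⁻ r, ‖charDeriv ε f (t, r)‖ₑ ^ 2 ≤ ofReal (t * pastEnergy f t) := by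
  have h := hf.lintegral_charDeriv_sub_le ε ht
  have h0 : ∀ y, charDeriv ε f (0, y - ε * 0) = 0 := fun y => hf.charDeriv_eq_zero ε le_rfl
  simp only [h0, sub_zero] at h
  rw [lintegral_sub_right_eq_self (fun r => ‖charDeriv ε f (t, r)‖ₑ ^ 2) (ε * t)] at h
  refine h.trans ?_
  rw [ofReal_mul ht, pastEnergy, ← hf.lintegral_sq_eq]
  gcongr
  exact fun hq => hq.2.le

lemma memLp_charDeriv (ε t : ℝ) : MemLp (fun r => charDeriv ε f (t, r)) 2 := by
  rcases le_total t 0 with ht | ht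
  · have : (fun r => charDeriv ε f (t, r)) = 𝟘 :=
      funext fun r => hf.charDeriv_eq_zero ε (x := (t, r)) ht
    rw [this]
    exact MemLp.zero'
  · refine ⟨?_, ?_⟩
    · have hm : StronglyMeasurable fun q : ℝ² => f ((t, q.1) - q.2 • ((1, -ε) : ℝ²)) :=
        (hf.measurable.comp (by fun_prop : Continuous fun q : ℝ² =>
          ((t, q.1) - q.2 • ((1, -ε) : ℝ²) : ℝ²)).measurable).stronglyMeasurable
      exact (hm.integral_prod_right (ν := vol (Ioi 0))).aestronglyMeasurable
    · have h2 := (hf.lintegral_charDeriv_le ε ht).trans_lt ofReal_lt_top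
      rw [← eLpNorm_two_sq, ENNReal.pow_lt_top_iff] at h2
      exact h2.resolve_right two_ne_zero

lemma isL2Curve_charDeriv (ε : ℝ) : IsL2Curve (charDeriv ε f) := by
  have h1 : IsL2Curve fun x => charDeriv ε f (x.1, x.2 - ε * x.1) := by
    refine IsL2Curve.of_holder (C := ∫ q, f q ^ 2) (fun t => ?_) fun s t hst => ?_
    · exact (hf.memLp_charDeriv ε t).comp_measurePreserving
        (measurePreserving_sub_right volume (ε * t))
    · refine (hf.lintegral_charDeriv_sub_le ε hst).trans ?_
      rw [mul_comm (∫ q, f q ^ 2), ofReal_mul (sub_nonneg.2 hst), ← setIntegral_univ,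
        ← hf.lintegral_sq_eq]
      gcongr
      exact subset_univ _
  have := h1.translate ε
  simpa using this

lemma coneEnergy_nonneg (p : ℝ²) : 0 ≤ coneEnergy f p := integral_nonneg fun _ => sq_nonneg _

lemma coneEnergy_le_pastEnergy (p : ℝ²) : coneEnergy f p ≤ pastEnergy f p.1 :=
  setIntegral_mono_set hf.integrable_sq.integrableOn (of_forall fun _ => sq_nonneg _)
    (of_forall fun _ => fst_le_of_mem_cone)

lemma pastEnergy_mono : Monotone (pastEnergy f) := fun _ _ hst =>
  setIntegral_mono_set hf.integrable_sq.integrableOn (of_forall fun _ => sq_nonneg _)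
    (of_forall fun _ hq => le_trans (show _ ≤ _ from hq) hst)

lemma pastEnergy_le (t : ℝ) : pastEnergy f t ≤ ∫ q, f q ^ 2 :=
  setIntegral_le_integral hf.integrable_sq (of_forall fun _ => sq_nonneg _)

lemma coneEnergy_diff {p q : ℝ²} (h1 : p.1 + p.2 ≤ q.1 + q.2) (h2 : p.1 - p.2 ≤ q.1 - q.2) :
    coneEnergy f q - coneEnergy f p = ∫ x in cone q \ cone p, f x ^ 2 := by
  rw [setIntegral_sdiff (measurableSet_cone p) hf.integrable_sq.integrableOn (cone_mono h1 h2)]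
  rfl

omit hf in
lemma volume_cone_diff_le (hT : 0 ≤ T) {p q : ℝ²} (h1 : p.1 + p.2 ≤ q.1 + q.2)
    (h2 : p.1 - p.2 ≤ q.1 - q.2) :
    volume ((cone q \ cone p) ∩ Ioo 0 T ×ˢ Ioo 0 R) ≤
      ofReal (T * ((q.1 + q.2 - (p.1 + p.2)) + (q.1 - q.2 - (p.1 - p.2)))) := by
  have hs : ∀ ε a b : ℝ, a ≤ b → volume ((fun x : ℝ² => (x.1, x.2 + ε * x.1)) ⁻¹'
      (Ioo 0 T ×ˢ Icc a b)) = ofReal (T * (b - a)) := by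
    intro ε a b hab
    rw [(measurePreserving_skew ε).measure_preimage
      (measurableSet_Ioo.prod measurableSet_Icc).nullMeasurableSet, volume_eq_prod,
      Measure.prod_prod, Real.volume_Ioo, Real.volume_Icc, sub_zero, ofReal_mul hT]
  calc _ ≤ volume (((fun x : ℝ² => (x.1, x.2 + 1 * x.1)) ⁻¹'
          (Ioo 0 T ×ˢ Icc (p.1 + p.2) (q.1 + q.2))) ∪
        ((fun x : ℝ² => (x.1, x.2 + (-1) * x.1)) ⁻¹'
          (Ioo 0 T ×ˢ Icc (-(q.1 - q.2)) (-(p.1 - p.2))))) := by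
        refine measure_mono ?_
        rintro x ⟨⟨⟨hx1, hx2⟩, hx3⟩, hx4⟩
        by_cases h : p.1 + p.2 ≤ x.1 + x.2
        · exact Or.inl ⟨hx4.1, by simp only [one_mul]; linarith, by simp only [one_mul]; linarith⟩
        · refine Or.inr ⟨hx4.1, ?_, ?_⟩
          · simp only; linarith
          · by_contra h'
            refine hx3 ⟨(not_le.1 h).le, ?_⟩
            simp only at h'
            linarith
    _ ≤ _ := by
        refine (measure_union_le _ _).trans ?_
        rw [hs _ _ _ h1, hs _ _ _ (by linarith), ← ofReal_add]
        · refine ofReal_le_ofReal (le_of_eq ?_)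
          ring
        · exact mul_nonneg hT (sub_nonneg.2 h1)
        · exact mul_nonneg hT (by linarith)

lemma retarded_diff_sq_le (hT : 0 ≤ T) {p q : ℝ²} (h1 : p.1 + p.2 ≤ q.1 + q.2)
    (h2 : p.1 - p.2 ≤ q.1 - q.2) :
    (retarded f q - retarded f p) ^ 2 ≤
      (T * ((q.1 + q.2 - (p.1 + p.2)) + (q.1 - q.2 - (p.1 - p.2)))) *
        (coneEnergy f q - coneEnergy f p) := by
  set D := (cone q \ cone p) ∩ Ioo 0 T ×ˢ Ioo 0 R with hD
  have hDm : MeasurableSet D := ((measurableSet_cone q).diff (measurableSet_cone p)).inter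
    (measurableSet_Ioo.prod measurableSet_Ioo)
  have hvol := volume_cone_diff_le (R := R) hT h1 h2
  rw [← hD] at hvol
  have e1 : retarded f q - retarded f p = (∫ x in D, f x) / 2 := by
    have : ∫ x in D, f x = ∫ x in cone q \ cone p, f x := by
      refine (setIntegral_eq_of_subset_of_forall_sdiff_eq_zero
        ((measurableSet_cone q).diff (measurableSet_cone p)) inter_subset_left fun x hx => ?_).symm
      exact hf.zero x fun h => hx.2 ⟨hx.1, h⟩
    rw [this, setIntegral_sdiff (measurableSet_cone p) hf.integrable.integrableOn (cone_mono h1 h2),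
      retarded, retarded]
    ring
  have e2 : ∫ x in D, f x ^ 2 ≤ coneEnergy f q - coneEnergy f p := by
    rw [hf.coneEnergy_diff h1 h2]
    exact setIntegral_mono_set hf.integrable_sq.integrableOn
      (of_forall fun _ => sq_nonneg _) (of_forall inter_subset_left)
  have hc : 0 ≤ T * ((q.1 + q.2 - (p.1 + p.2)) + (q.1 - q.2 - (p.1 - p.2))) :=
    mul_nonneg hT (by linarith)
  have : IsFiniteMeasure (vol D) := ⟨by rw [restrict_apply_univ]; exact hvol.trans_lt ofReal_lt_top⟩
  have hcs := sq_integral_le (μ := vol D) (hf.memLp.restrict D)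
  have hv : (vol D).real univ ≤ T * ((q.1 + q.2 - (p.1 + p.2)) + (q.1 - q.2 - (p.1 - p.2))) := by
    rw [measureReal_restrict_apply_univ]
    exact ENNReal.toReal_le_of_le_ofReal hc hvol
  have h0 : 0 ≤ ∫ x in D, f x ^ 2 := integral_nonneg fun _ => sq_nonneg _
  rw [e1]
  calc ((∫ x in D, f x) / 2) ^ 2 ≤ (∫ x in D, f x) ^ 2 := by nlinarith [sq_nonneg (∫ x in D, f x)]
    _ ≤ _ := hcs.trans (mul_le_mul hv e2 h0 hc)

lemma holderEnergy_path (hT : 0 ≤ T) {X : ℝ → ℝ²}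
    (h1 : Monotone fun x => (X x).1 + (X x).2) (h2 : Monotone fun x => (X x).1 - (X x).2)
    (h1' : ∀ a b, a ≤ b → (X b).1 + (X b).2 - ((X a).1 + (X a).2) ≤ b - a)
    (h2' : ∀ a b, a ≤ b → (X b).1 - (X b).2 - ((X a).1 - (X a).2) ≤ b - a) :
    HolderEnergy (fun x => retarded f (X x)) fun x => 2 * T * coneEnergy f (X x) := by
  have hE : ∀ a b, a ≤ b → 0 ≤ coneEnergy f (X b) - coneEnergy f (X a) := fun a b hab => by
    rw [hf.coneEnergy_diff (h1 hab) (h2 hab)]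
    exact integral_nonneg fun _ => sq_nonneg _
  refine ⟨fun a b hab => mul_le_mul_of_nonneg_left (sub_nonneg.1 (hE a b hab)) (by positivity),
    fun a b hab => (hf.retarded_diff_sq_le hT (h1 hab) (h2 hab)).trans ?_⟩
  nlinarith [mul_le_mul_of_nonneg_right (mul_le_mul_of_nonneg_left (add_le_add (h1' a b hab)
    (h2' a b hab)) hT) (hE a b hab)]

lemma continuous_retarded (hT : 0 ≤ T) : Continuous (retarded f) := by
  set M := ∫ q, f q ^ 2 with hM
  have hEM : ∀ p, coneEnergy f p ≤ M := fun p =>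
    setIntegral_le_integral hf.integrable_sq (of_forall fun _ => sq_nonneg _)
  have hM0 : 0 ≤ M := integral_nonneg fun _ => sq_nonneg _
  have step : ∀ p q : ℝ², p.1 + p.2 ≤ q.1 + q.2 → p.1 - p.2 ≤ q.1 - q.2 →
      |retarded f q - retarded f p| ≤
        √(T * ((q.1 + q.2 - (p.1 + p.2)) + (q.1 - q.2 - (p.1 - p.2))) * M) := by
    intro p q h1 h2
    refine Real.abs_le_sqrt ((hf.retarded_diff_sq_le hT h1 h2).trans ?_)
    exact mul_le_mul_of_nonneg_left (by linarith [hEM q, hf.coneEnergy_nonneg p])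
      (mul_nonneg hT (by linarith))
  have two : ∀ p q : ℝ², |retarded f q - retarded f p| ≤
      2 * √(T * (|q.1 + q.2 - (p.1 + p.2)| + |q.1 - q.2 - (p.1 - p.2)|) * M) := by
    intro p q
    set a := max (p.1 + p.2) (q.1 + q.2)
    set b := max (p.1 - p.2) (q.1 - q.2)
    set m : ℝ² := ((a + b) / 2, (a - b) / 2)
    have hm1 : m.1 + m.2 = a := by simp only [m]; ring
    have hm2 : m.1 - m.2 = b := by simp only [m]; ring
    have s1 := step p m (by rw [hm1]; exact le_max_left _ _) (by rw [hm2]; exact le_max_left _ _)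
    have s2 := step q m (by rw [hm1]; exact le_max_right _ _) (by rw [hm2]; exact le_max_right _ _)
    rw [hm1, hm2] at s1 s2
    have ha1 : a - (p.1 + p.2) ≤ |q.1 + q.2 - (p.1 + p.2)| := by
      rcases max_cases (p.1 + p.2) (q.1 + q.2) with ⟨h, _⟩ | ⟨h, _⟩ <;> simp only [a, h]
      · simp
      · exact le_abs_self _
    have ha2 : a - (q.1 + q.2) ≤ |q.1 + q.2 - (p.1 + p.2)| := by
      rcases max_cases (p.1 + p.2) (q.1 + q.2) with ⟨h, _⟩ | ⟨h, _⟩ <;> simp only [a, h]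
      · rw [abs_sub_comm]; exact le_abs_self _
      · simp
    have hb1 : b - (p.1 - p.2) ≤ |q.1 - q.2 - (p.1 - p.2)| := by
      rcases max_cases (p.1 - p.2) (q.1 - q.2) with ⟨h, _⟩ | ⟨h, _⟩ <;> simp only [b, h]
      · simp
      · exact le_abs_self _
    have hb2 : b - (q.1 - q.2) ≤ |q.1 - q.2 - (p.1 - p.2)| := by
      rcases max_cases (p.1 - p.2) (q.1 - q.2) with ⟨h, _⟩ | ⟨h, _⟩ <;> simp only [b, h]
      · rw [abs_sub_comm]; exact le_abs_self _
      · simp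
    have t1 : |retarded f m - retarded f p| ≤
        √(T * (|q.1 + q.2 - (p.1 + p.2)| + |q.1 - q.2 - (p.1 - p.2)|) * M) :=
      s1.trans (Real.sqrt_le_sqrt (by gcongr))
    have t2 : |retarded f m - retarded f q| ≤
        √(T * (|q.1 + q.2 - (p.1 + p.2)| + |q.1 - q.2 - (p.1 - p.2)|) * M) :=
      s2.trans (Real.sqrt_le_sqrt (by gcongr))
    have := abs_sub_le (retarded f q) (retarded f m) (retarded f p)
    rw [abs_sub_comm (retarded f q) (retarded f m)] at this
    linarith
  rw [continuous_iff_continuousAt]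
  intro p
  rw [ContinuousAt, tendsto_iff_norm_sub_tendsto_zero]
  refine squeeze_zero (fun q => norm_nonneg _) (fun q => two p q) ?_
  have : Continuous fun q : ℝ² =>
      2 * √(T * (|q.1 + q.2 - (p.1 + p.2)| + |q.1 - q.2 - (p.1 - p.2)|) * M) := by fun_prop
  simpa using this.tendsto p

end IsSource

/-- Functions on the line with square integrable derivative. -/
def IsH1 (h : ℝ → ℝ) : Prop := ∃ (E : ℝ → ℝ) (M : ℝ), HolderEnergy h E ∧ ∀ x, |E x| ≤ M

namespace IsH1

variable {h h' : ℝ → ℝ}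

lemma const (c : ℝ) : IsH1 fun _ => c := ⟨_, 0, HolderEnergy.const c, fun _ => by simp⟩

lemma add (H : IsH1 h) (H' : IsH1 h') : IsH1 fun x => h x + h' x := by
  obtain ⟨E, M, h1, h2⟩ := H
  obtain ⟨E', M', h1', h2'⟩ := H'
  refine ⟨_, 2 * M + 2 * M', h1.add h1', fun x => (abs_add_le _ _).trans ?_⟩
  rw [abs_mul, abs_mul, abs_two]
  linarith [h2 x, h2' x]

lemma const_mul (H : IsH1 h) (c : ℝ) : IsH1 fun x => c * h x := by
  obtain ⟨E, M, h1, h2⟩ := H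
  refine ⟨_, c ^ 2 * M, h1.const_mul c, fun x => ?_⟩
  rw [abs_mul, abs_of_nonneg (sq_nonneg c)]
  exact mul_le_mul_of_nonneg_left (h2 x) (sq_nonneg c)

lemma sub (H : IsH1 h) (H' : IsH1 h') : IsH1 fun x => h x - h' x := by
  simpa [sub_eq_add_neg] using H.add (H'.const_mul (-1))

lemma comp (H : IsH1 h) {θ : ℝ → ℝ} (hθ : Monotone θ) (hθ1 : ∀ a b, a ≤ b → θ b - θ a ≤ b - a) :
    IsH1 fun x => h (θ x) := by
  obtain ⟨E, M, h1, h2⟩ := H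
  exact ⟨_, M, h1.comp hθ hθ1, fun x => h2 _⟩

lemma reflect (H : IsH1 h) : IsH1 fun x => h (-x) := by
  obtain ⟨E, M, h1, h2⟩ := H
  exact ⟨_, M, h1.reflect, fun x => by rw [abs_neg]; exact h2 _⟩

lemma sum {h : ℕ → ℝ → ℝ} (H : ∀ j, IsH1 (h j)) (n : ℕ) :
    IsH1 fun x => ∑ j ∈ Finset.range n, h j x := by
  induction n with
  | zero => simpa using const 0
  | succ n ih => simpa [Finset.sum_range_succ] using ih.add (H n)

lemma continuous (H : IsH1 h) : Continuous h := by
  obtain ⟨E, M, h1, -⟩ := H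
  exact h1.continuous

lemma integral_deriv (H : IsH1 h) (a b : ℝ) : ∫ x in a..b, deriv h x = h b - h a := by
  obtain ⟨E, M, h1, -⟩ := H
  exact h1.integral_deriv a b

lemma of_primitive {g : ℝ → ℝ} (hg : MemLp g 2) (hh : ∀ a b, h b - h a = ∫ x in a..b, g x) :
    IsH1 h := by
  refine ⟨_, ∫ s, g s ^ 2, HolderEnergy.of_primitive hg hh, fun x => ?_⟩
  rw [abs_of_nonneg (integral_nonneg fun _ => sq_nonneg _)]
  exact setIntegral_le_integral hg.integrable_sq (of_forall fun _ => sq_nonneg _)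

end IsH1

lemma HolderEnergy.lintegral_Iic_le {h E : ℝ → ℝ} (H : HolderEnergy h E) (b : ℝ) {m : ℝ}
    (hm : ∀ x, x ≤ b → E b - E x ≤ m) :
    ∫⁻ x in Iic b, ofReal ((deriv h x) ^ 2) ≤ ofReal m := by
  have hU : Iic b = ⋃ n : ℕ, Ioc (b - n) b := by
    ext x
    simp only [mem_Iic, mem_iUnion, mem_Ioc]
    constructor
    · intro hx
      obtain ⟨n, hn⟩ := exists_nat_gt (b - x)
      exact ⟨n, by linarith, hx⟩
    · rintro ⟨n, -, hx⟩
      exact hx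
  rw [hU, setLIntegral_iUnion_of_directed]
  · refine iSup_le fun n => ?_
    have hn : b - n ≤ b := by linarith [(Nat.cast_nonneg n : (0 : ℝ) ≤ n)]
    exact (H.lintegral_deriv_sq_le hn).trans (ofReal_le_ofReal (hm _ hn))
  · refine Monotone.directed_le fun m n hmn => Ioc_subset_Ioc_left ?_
    have : (m : ℝ) ≤ n := by exact_mod_cast hmn
    linarith

lemma IsH1.memLp_deriv {h : ℝ → ℝ} (H : IsH1 h) : MemLp (deriv h) 2 := by
  obtain ⟨E, M, h1, h2⟩ := H
  refine ⟨(measurable_deriv h).aestronglyMeasurable, ?_⟩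
  have hb : ∀ n : ℕ, ∫⁻ x in Iic (n : ℝ), ‖deriv h x‖ₑ ^ 2 ≤ ofReal (2 * M) := by
    intro n
    simp_rw [← ofReal_sq_eq_enorm]
    refine h1.lintegral_Iic_le n fun x _ => ?_
    linarith [abs_le.1 (h2 n), abs_le.1 (h2 x)]
  have hU : (univ : Set ℝ) = ⋃ n : ℕ, Iic (n : ℝ) := by
    symm
    rw [eq_univ_iff_forall]
    intro x
    obtain ⟨n, hn⟩ := exists_nat_ge x
    exact mem_iUnion.2 ⟨n, hn⟩
  have : eLpNorm (deriv h) 2 ^ 2 ≤ ofReal (2 * M) := by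
    rw [eLpNorm_two_sq, ← setLIntegral_univ, hU, setLIntegral_iUnion_of_directed]
    · exact iSup_le hb
    · exact Monotone.directed_le fun m n hmn => Iic_subset_Iic.2 (by exact_mod_cast hmn)
  have h3 := this.trans_lt ofReal_lt_top
  rw [ENNReal.pow_lt_top_iff] at h3
  exact h3.resolve_right two_ne_zero

/-- Compatible data for the wave equation on the strip; `V₁` is a primitive of the initial
velocity. -/
structure IsWaveData (ρ₀ : ℝ) (W V₀ V₁ : ℝ → ℝ) : Prop where
  isH1_load : IsH1 W
  isH1_pos : IsH1 V₀
  isH1_vel : IsH1 V₁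
  load_const : ∀ t, t ≤ 0 → W t = W 0
  pos_left : ∀ x, x ≤ 0 → V₀ x = V₀ 0
  pos_right : ∀ x, ρ₀ ≤ x → V₀ x = 0
  vel_left : ∀ x, x ≤ 0 → V₁ x = 0
  vel_right : ∀ x, ρ₀ ≤ x → V₁ x = V₁ ρ₀
  compat : W 0 = V₀ 0

lemma IsWaveData.zero (ρ₀ : ℝ) : IsWaveData ρ₀ 𝟘 𝟘 𝟘 := by
  constructor <;> intros <;> first | exact IsH1.const 0 | rfl

section Construction

variable (ρ₀ T : ℝ) (ρ W V₀ V₁ : ℝ → ℝ) (f : ℝ² → ℝ)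

def axisTrace (t : ℝ) : ℝ := retarded f (t, 0)

open Front in
def frontTrace (s : ℝ) : ℝ := retarded f (frontTime ρ s, ρ (frontTime ρ s))

/-- The part of the incoming wave that comes from the initial data. -/
def incomingInit (x : ℝ) : ℝ := (V₀ x + V₁ x) / 2 - V₁ ρ₀ / 2

/-- The part of the outgoing wave that comes from the initial data. -/
def outgoingInit (x : ℝ) : ℝ := (V₀ (-x) - V₁ (-x)) / 2 + V₁ ρ₀ / 2

/-- The delay between two reflections. -/
def reflectBack (x : ℝ) : ℝ := Front.reflected ρ (max x 0)

/-- The jump of the outgoing wave between two reflections. -/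
def outgoingJump (x : ℝ) : ℝ :=
  outgoingInit ρ₀ V₀ V₁ x + W x - W 0 - axisTrace f x - incomingInit ρ₀ V₀ V₁ (max x 0)
    + incomingInit ρ₀ V₀ V₁ 0 + frontTrace ρ f (max x 0)

/-- The maximal number of reflections. -/
def reflectionCount : ℕ := ⌈T / (2 * ρ₀)⌉₊ + 1

/-- The outgoing wave. -/
def outgoing (x : ℝ) : ℝ :=
  ∑ j ∈ Finset.range (reflectionCount ρ₀ T), outgoingJump ρ₀ ρ W V₀ V₁ f ((reflectBack ρ)^[j] x)

/-- The incoming wave. -/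
def incoming (x : ℝ) : ℝ :=
  incomingInit ρ₀ V₀ V₁ x - frontTrace ρ f x - outgoing ρ₀ T ρ W V₀ V₁ f (Front.reflected ρ x)

/-- The solution of the wave equation with source `f`. -/
def waveSol (p : ℝ²) : ℝ :=
  retarded f p + incoming ρ₀ T ρ W V₀ V₁ f (p.1 + p.2) + outgoing ρ₀ T ρ W V₀ V₁ f (p.1 - p.2)

end Construction

section ConstructionLemmas

variable {R ρ₀ T : ℝ} {ρ W V₀ V₁ : ℝ → ℝ} {f : ℝ² → ℝ}
local notation "𝒢" => outgoing ρ₀ T ρ W V₀ V₁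
local notation "𝔫" => reflectionCount
local notation "𝔍" => outgoingJump ρ₀ ρ W V₀ V₁ f
local notation "𝒥" => incoming ρ₀ T ρ W V₀ V₁
local notation "𝒲" => waveSol ρ₀ T ρ W V₀ V₁

open Front

lemma max_zero_increment {a b : ℝ} (hab : a ≤ b) : max b 0 - max a 0 ≤ b - a := by
  rcases le_total a 0 with h1 | h1 <;> rcases le_total b 0 with h2 | h2 <;>
    simp only [max_eq_left, max_eq_right, h1, h2] <;> linarith

lemma monotone_max_zero : Monotone fun x : ℝ => max x 0 := fun _ _ h => max_le_max h le_rfl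

variable (hF : Front R ρ₀ T ρ)
include hF

lemma Front.monotone_reflectBack : Monotone (reflectBack ρ) :=
  hF.monotone_reflected.comp fun _ _ h => max_le_max h le_rfl

lemma Front.reflectBack_increment {a b : ℝ} (hab : a ≤ b) :
    reflectBack ρ b - reflectBack ρ a ≤ b - a :=
  (hF.reflected_increment (max_le_max hab le_rfl)).trans (max_zero_increment hab)

lemma Front.monotone_iterate (j : ℕ) :
    Monotone (reflectBack ρ)^[j] := hF.monotone_reflectBack.iterate j

lemma Front.iterate_increment (j : ℕ) :
    ∀ a b, a ≤ b → (reflectBack ρ)^[j] b - (reflectBack ρ)^[j] a ≤ b - a := by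
  induction j with
  | zero => intro a b _; simp
  | succ j ih =>
    intro a b hab
    simp only [Function.iterate_succ, Function.comp_apply]
    exact (ih _ _ (hF.monotone_reflectBack hab)).trans (hF.reflectBack_increment hab)

lemma Front.reflectBack_le (x : ℝ) :
    reflectBack ρ x ≤ max x 0 - 2 * ρ₀ := hF.reflected_le _

lemma Front.iterate_le (k : ℕ) :
    ∀ x, x ≤ 2 * ρ₀ * k → (reflectBack ρ)^[k + 1] x ≤ -(2 * ρ₀) := by
  induction k with
  | zero =>
    intro x hx
    have := hF.reflectBack_le x
    simp only [Nat.cast_zero, mul_zero] at hx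
    rw [max_eq_right hx] at this
    simpa using this
  | succ k ih =>
    intro x hx
    rw [Function.iterate_succ, Function.comp_apply]
    refine ih _ ((hF.reflectBack_le x).trans ?_)
    have h0 := hF.pos
    push_cast at hx
    have : max x 0 ≤ 2 * ρ₀ * (k + 1) := max_le hx (by positivity)
    linarith

lemma Front.iterate_count_le {x : ℝ} (hx : x ≤ T) :
    (reflectBack ρ)^[𝔫 ρ₀ T] x ≤ -(2 * ρ₀) := by
  refine hF.iterate_le _ x (hx.trans ?_)
  have h0 := hF.pos
  have := Nat.le_ceil (T / (2 * ρ₀))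
  rwa [div_le_iff₀' (by positivity)] at this

lemma Front.iterate_le_max (j : ℕ) (x : ℝ) :
    (reflectBack ρ)^[j] x ≤ max x 0 := by
  induction j with
  | zero => exact le_max_left _ _
  | succ j ih =>
    rw [Function.iterate_succ_apply']
    have := hF.reflectBack_le ((reflectBack ρ)^[j] x)
    have h0 := hF.pos
    have := max_le ih (le_max_right x 0)
    linarith

variable (hf : IsSource T R f)
include hf

lemma holderEnergy_axisTrace : HolderEnergy (axisTrace f) fun x => 2 * T * coneEnergy f (x, 0) := by
  refine hf.holderEnergy_path hF.pos_time.le (X := fun x => (x, 0)) ?_ ?_ ?_ ?_ <;>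
    intro a b hab <;> simp [hab]

lemma holderEnergy_frontTrace : HolderEnergy (frontTrace ρ f)
    fun x => 2 * T * coneEnergy f (frontTime ρ x, ρ (frontTime ρ x)) := by
  refine hf.holderEnergy_path hF.pos_time.le
    (X := fun x => (frontTime ρ x, ρ (frontTime ρ x))) ?_ ?_ ?_ ?_
  · simp [hF.frontTime_spec, Monotone]
  · exact hF.monotone_reflected
  · simp [hF.frontTime_spec]
  · exact fun a b => hF.reflected_increment

omit hF in
lemma coneEnergy_bound (hT : 0 ≤ T) (p : ℝ²) : |2 * T * coneEnergy f p| ≤ 2 * T * ∫ q, f q ^ 2 := by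
  rw [abs_of_nonneg (mul_nonneg (by positivity) (hf.coneEnergy_nonneg p))]
  exact mul_le_mul_of_nonneg_left ((hf.coneEnergy_le_pastEnergy p).trans (hf.pastEnergy_le _))
    (by positivity)

lemma isH1_axisTrace : IsH1 (axisTrace f) :=
  ⟨_, _, holderEnergy_axisTrace hF hf, fun _ => coneEnergy_bound hf hF.pos_time.le _⟩

lemma isH1_frontTrace : IsH1 (frontTrace ρ f) :=
  ⟨_, _, holderEnergy_frontTrace hF hf, fun _ => coneEnergy_bound hf hF.pos_time.le _⟩

omit hF in
lemma axisTrace_of_nonpos {x : ℝ} (hx : x ≤ 0) : axisTrace f x = 0 := hf.retarded_eq_zero hx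

lemma frontTrace_of_le {x : ℝ} (hx : x ≤ ρ₀) : frontTrace ρ f x = 0 :=
  hf.retarded_eq_zero (hF.frontTime_nonpos hx)

section

variable (hD : IsWaveData ρ₀ W V₀ V₁)
include hD

omit hF hf in
lemma isH1_incomingInit : IsH1 (incomingInit ρ₀ V₀ V₁) := by
  have := ((hD.isH1_pos.add hD.isH1_vel).const_mul (1 / 2)).add (IsH1.const (-(V₁ ρ₀ / 2)))
  convert! this using 1
  ext x
  rw [incomingInit]
  ring

omit hF hf in
lemma isH1_outgoingInit : IsH1 (outgoingInit ρ₀ V₀ V₁) := by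
  have := ((hD.isH1_pos.sub hD.isH1_vel).reflect.const_mul (1 / 2)).add (IsH1.const (V₁ ρ₀ / 2))
  convert! this using 1
  ext x
  rw [outgoingInit]
  ring

lemma isH1_outgoingJump : IsH1 (𝔍) := by
  have h1 := (isH1_incomingInit hD).comp monotone_max_zero fun _ _ => max_zero_increment
  have h2 := (isH1_frontTrace hF hf).comp monotone_max_zero fun _ _ => max_zero_increment
  exact ((((((isH1_outgoingInit hD).add hD.isH1_load).sub (IsH1.const _)).sub
    (isH1_axisTrace hF hf)).sub h1).add (IsH1.const _)).add h2

lemma isH1_outgoing : IsH1 (𝒢 f) :=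
  IsH1.sum (fun j => (isH1_outgoingJump hF hf hD).comp (hF.monotone_iterate j)
    (hF.iterate_increment j)) _

lemma isH1_incoming : IsH1 (𝒥 f) :=
  ((isH1_incomingInit hD).sub (isH1_frontTrace hF hf)).sub
    ((isH1_outgoing hF hf hD).comp hF.monotone_reflected fun _ _ => hF.reflected_increment)

lemma outgoingJump_of_nonpos {x : ℝ} (hx : x ≤ 0) :
    𝔍 x = outgoingInit ρ₀ V₀ V₁ x := by
  rw [outgoingJump, max_eq_right hx, hD.load_const x hx, axisTrace_of_nonpos hf hx,
    frontTrace_of_le hF hf hF.pos.le]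
  ring

omit hf hF in
lemma outgoingInit_of_le {x : ℝ} (hx : x ≤ -ρ₀) :
    outgoingInit ρ₀ V₀ V₁ x = 0 := by
  rw [outgoingInit, hD.pos_right _ (by linarith), hD.vel_right _ (by linarith)]
  ring

lemma outgoingJump_of_le {x : ℝ} (hx : x ≤ -ρ₀) :
    𝔍 x = 0 := by
  rw [outgoingJump_of_nonpos hF hf hD (by linarith [hF.pos]), outgoingInit_of_le hD hx]

lemma outgoing_eq {x : ℝ} (hx : x ≤ T) :
    𝒢 f x = 𝔍 x + 𝒢 f (reflectBack ρ x) := by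
  have h1 := Finset.sum_range_succ (fun j => 𝔍 ((reflectBack ρ)^[j] x))
    (𝔫 ρ₀ T)
  have h2 := Finset.sum_range_succ' (fun j => 𝔍 ((reflectBack ρ)^[j] x))
    (𝔫 ρ₀ T)
  rw [outgoingJump_of_le hF hf hD
    ((hF.iterate_count_le hx).trans (by linarith [hF.pos])), add_zero] at h1
  rw [outgoing, outgoing, ← h1, h2, Function.iterate_zero, id, add_comm]
  rfl

lemma outgoing_of_le {x : ℝ} (hx : x ≤ -ρ₀) : 𝒢 f x = 0 := by
  refine Finset.sum_eq_zero fun j _ => outgoingJump_of_le hF hf hD ?_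
  have h0 := hF.pos
  rcases j with _ | j
  · simpa using hx
  · refine (hF.iterate_le j x (hx.trans ?_)).trans (by linarith)
    have : 0 ≤ 2 * ρ₀ * j := by positivity
    linarith

lemma outgoing_of_nonpos {x : ℝ} (hx : x ≤ 0) :
    𝒢 f x = outgoingInit ρ₀ V₀ V₁ x := by
  have h0 := hF.pos
  rw [outgoing_eq hF hf hD (hx.trans hF.pos_time.le), outgoingJump_of_nonpos hF hf hD hx,
    outgoing_of_le hF hf hD, add_zero]
  have := hF.reflectBack_le x
  rw [max_eq_right hx] at this
  linarith

lemma incoming_of_le {x : ℝ} (hx : x ≤ ρ₀) :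
    𝒥 f x = incomingInit ρ₀ V₀ V₁ x := by
  rw [incoming, frontTrace_of_le hF hf hx, outgoing_of_le hF hf hD]
  · ring
  · linarith [hF.reflected_le x]

lemma incoming_of_ge {x : ℝ} (hx : ρ₀ ≤ x) : 𝒥 f x =
      - frontTrace ρ f x - 𝒢 f (reflected ρ x) := by
  rw [incoming, incomingInit, hD.pos_right x hx, hD.vel_right x hx]
  ring

lemma waveSol_axis {t : ℝ} (ht : t ∈ Icc 0 T) : 𝒲 f (t, 0) = W t := by
  have h1 := hD.vel_left (-t) (by linarith [ht.1])
  have h2 := hD.pos_left (-t) (by linarith [ht.1])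
  have h3 := hD.vel_left 0 le_rfl
  simp only [waveSol, add_zero, sub_zero]
  rw [outgoing_eq hF hf hD ht.2, incoming, outgoingJump, reflectBack, max_eq_left ht.1]
  simp only [outgoingInit, incomingInit, axisTrace, h1, h2, h3, hD.compat]
  ring

lemma waveSol_front {t : ℝ} (ht : 0 ≤ t) : 𝒲 f (t, ρ t) = 0 := by
  simp only [waveSol]
  rw [incoming_of_ge hF hf hD (by linarith [hF.ge t]), hF.reflected_psi, frontTrace,
    hF.frontTime_psi]
  ring

lemma waveSol_init {r : ℝ} (h0 : 0 ≤ r) (hr : r ≤ ρ₀) :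
    𝒲 f (0, r) = V₀ r := by
  simp only [waveSol, zero_add, zero_sub]
  rw [hf.retarded_eq_zero le_rfl, incoming_of_le hF hf hD hr,
    outgoing_of_nonpos hF hf hD (by linarith), incomingInit, outgoingInit, neg_neg]
  ring

lemma continuous_waveSol : Continuous (𝒲 f) :=
  ((hf.continuous_retarded hF.pos_time.le).add
    ((isH1_incoming hF hf hD).continuous.comp (by fun_prop))).add
    ((isH1_outgoing hF hf hD).continuous.comp (by fun_prop))

end

omit hf in
lemma outgoingJump_zero (x : ℝ) : outgoingJump ρ₀ ρ 𝟘 𝟘 𝟘 f x =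
      frontTrace ρ f (max x 0) - axisTrace f x := by
  simp only [outgoingJump, outgoingInit, incomingInit]
  ring

lemma holderEnergy_outgoingJump_zero : ∃ E, HolderEnergy (outgoingJump ρ₀ ρ 𝟘 𝟘 𝟘 f) E ∧
      ∀ x, 0 ≤ E x ∧ E x ≤ 8 * T * pastEnergy f (max x 0) := by
  have hT := hF.pos_time.le
  have H := ((holderEnergy_frontTrace hF hf).comp monotone_max_zero fun _ _ => max_zero_increment).sub
    (holderEnergy_axisTrace hF hf)
  have he : outgoingJump ρ₀ ρ 𝟘 𝟘 𝟘 f = fun x =>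
      frontTrace ρ f (max x 0) - axisTrace f x := funext fun x => outgoingJump_zero hF x
  rw [he]
  refine ⟨_, H, fun x => ?_⟩
  have h1 := hf.coneEnergy_nonneg (frontTime ρ (max x 0), ρ (frontTime ρ (max x 0)))
  have h2 := hf.coneEnergy_nonneg (x, 0)
  have h3 := (hf.coneEnergy_le_pastEnergy (frontTime ρ (max x 0), ρ (frontTime ρ (max x 0)))).trans
    (hf.pastEnergy_mono (by
      have := hF.frontTime_spec (max x 0)
      have := hF.front_pos (frontTime ρ (max x 0))
      show frontTime ρ (max x 0) ≤ max x 0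
      linarith))
  have h4 := (hf.coneEnergy_le_pastEnergy (x, 0)).trans (hf.pastEnergy_mono (le_max_left x 0))
  constructor
  · positivity
  · nlinarith [mul_le_mul_of_nonneg_left h3 hT, mul_le_mul_of_nonneg_left h4 hT]

lemma holderEnergy_outgoing_zero : ∃ E, HolderEnergy (outgoing ρ₀ T ρ 𝟘 𝟘 𝟘 f) E ∧
      ∀ x, 0 ≤ E x ∧ E x ≤ 8 * T * (𝔫 ρ₀ T) ^ 2 * pastEnergy f (max x 0) := by
  obtain ⟨E, hE, hE'⟩ := holderEnergy_outgoingJump_zero hF hf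
  have hT := hF.pos_time.le
  refine ⟨_, HolderEnergy.sum (n := 𝔫 ρ₀ T) fun j =>
    hE.comp (hF.monotone_iterate j) (hF.iterate_increment j), fun x => ⟨?_, ?_⟩⟩
  · exact mul_nonneg (Nat.cast_nonneg _) (Finset.sum_nonneg fun j _ => (hE' _).1)
  · have : ∑ j ∈ Finset.range (𝔫 ρ₀ T), E ((reflectBack ρ)^[j] x) ≤
        ∑ j ∈ Finset.range (𝔫 ρ₀ T), 8 * T * pastEnergy f (max x 0) := by
      refine Finset.sum_le_sum fun j _ => (hE' _).2.trans ?_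
      refine mul_le_mul_of_nonneg_left (hf.pastEnergy_mono ?_) (by positivity)
      exact max_le (hF.iterate_le_max j x) (le_max_right _ _)
    rw [Finset.sum_const, Finset.card_range, nsmul_eq_mul] at this
    calc _ ≤ (𝔫 ρ₀ T : ℝ) *
          ((𝔫 ρ₀ T : ℝ) * (8 * T * pastEnergy f (max x 0))) :=
          mul_le_mul_of_nonneg_left this (Nat.cast_nonneg _)
      _ = _ := by ring

lemma holderEnergy_incoming_zero : ∃ E, HolderEnergy (incoming ρ₀ T ρ 𝟘 𝟘 𝟘 f) E ∧
      ∀ x, 0 ≤ E x ∧ E x ≤ (4 * T + 16 * T * (𝔫 ρ₀ T) ^ 2) *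
        pastEnergy f (max (frontTime ρ x) 0) := by
  obtain ⟨E, hE, hE'⟩ := holderEnergy_outgoing_zero hF hf
  have hT := hF.pos_time.le
  have H := (holderEnergy_frontTrace hF hf).neg.sub
    (hE.comp hF.monotone_reflected fun _ _ => hF.reflected_increment)
  have he : incoming ρ₀ T ρ 𝟘 𝟘 𝟘 f = fun x =>
      - frontTrace ρ f x - outgoing ρ₀ T ρ 𝟘 𝟘 𝟘 f (reflected ρ x) := by
    ext x
    simp only [incoming, incomingInit]
    ring
  rw [he]
  refine ⟨_, H, fun x => ?_⟩
  have h1 := hf.coneEnergy_nonneg (frontTime ρ x, ρ (frontTime ρ x))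
  have h2 := hE' (reflected ρ x)
  have h3 := (hf.coneEnergy_le_pastEnergy (frontTime ρ x, ρ (frontTime ρ x))).trans
    (hf.pastEnergy_mono (le_max_left (frontTime ρ x) 0))
  have h4 : pastEnergy f (max (reflected ρ x) 0) ≤ pastEnergy f (max (frontTime ρ x) 0) := by
    refine hf.pastEnergy_mono (max_le_max ?_ le_rfl)
    have := hF.front_pos (frontTime ρ x)
    rw [reflected]
    linarith
  constructor
  · have := h2.1
    positivity
  · have h5 : 8 * T * (𝔫 ρ₀ T) ^ 2 * pastEnergy f (max (reflected ρ x) 0) ≤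
        8 * T * (𝔫 ρ₀ T) ^ 2 * pastEnergy f (max (frontTime ρ x) 0) :=
      mul_le_mul_of_nonneg_left h4 (by positivity)
    have h6 := mul_le_mul_of_nonneg_left h3 hT
    nlinarith [h2.2]

omit hF hf in
theorem exists_travelling_bound (ρ₀ T : ℝ) : ∃ C : ℝ, 0 ≤ C ∧ ∀ {R : ℝ} {ρ : ℝ → ℝ} {f : ℝ² → ℝ},
    Front R ρ₀ T ρ → IsSource T R f → ∀ t, 0 ≤ t → (∫⁻ x in Iic (t + ρ t),
        ‖deriv (incoming ρ₀ T ρ 𝟘 𝟘 𝟘 f) x‖ₑ ^ 2 ≤ ofReal (C * pastEnergy f t)) ∧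
      ∫⁻ x in Iic t, ‖deriv (outgoing ρ₀ T ρ 𝟘 𝟘 𝟘 f) x‖ₑ ^ 2 ≤ ofReal (C * pastEnergy f t) := by
  refine ⟨|4 * T + 16 * T * (𝔫 ρ₀ T) ^ 2|, abs_nonneg _, ?_⟩
  intro R ρ f hF hf t ht
  have hT := hF.pos_time.le
  rw [abs_of_nonneg (by positivity)]
  simp_rw [← ofReal_sq_eq_enorm]
  constructor
  · obtain ⟨E, hE, hE'⟩ := holderEnergy_incoming_zero hF hf
    refine hE.lintegral_Iic_le _ fun x _ => ?_
    have := (hE' (t + ρ t)).2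
    rw [hF.frontTime_psi, max_eq_left ht] at this
    linarith [(hE' x).1]
  · obtain ⟨E, hE, hE'⟩ := holderEnergy_outgoing_zero hF hf
    refine hE.lintegral_Iic_le _ fun x _ => ?_
    have h1 := (hE' t).2
    rw [max_eq_left ht] at h1
    have h2 := (hE' x).1
    have h3 : 8 * T * (𝔫 ρ₀ T) ^ 2 * pastEnergy f t ≤
      (4 * T + 16 * T * (𝔫 ρ₀ T) ^ 2) * pastEnergy f t :=
      mul_le_mul_of_nonneg_right (by nlinarith [sq_nonneg (𝔫 ρ₀ T : ℝ)])
        (hf.pastEnergy_nonneg t)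
    linarith

end ConstructionLemmas

section TimeSpace

variable {E : Type*} [NormedAddCommGroup E] [NormedSpace ℝ E] [MeasureSpace E] [BorelSpace E]
  [FiniteDimensional ℝ E] [(volume : Measure E).IsAddHaarMeasure]

lemma MeasureTheory.LocallyIntegrableOn.comp_snd_prod {U : Set E} {k : E → ℝ}
    (hk : LocallyIntegrableOn k U volume) (I : Set ℝ) :
    LocallyIntegrableOn (fun p : ℝ × E => k p.2) (I ×ˢ U) volume := by
  rintro ⟨t, x⟩ ⟨-, hx⟩
  obtain ⟨V, hV, hkV⟩ := hk x hx
  refine ⟨Ioo (t - 1) (t + 1) ×ˢ V, ?_, ?_⟩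
  · rw [nhdsWithin_prod_eq]
    exact prod_mem_prod (mem_nhdsWithin_of_mem_nhds (Ioo_mem_nhds (by linarith) (by linarith))) hV
  · rw [IntegrableOn, volume_eq_prod, ← prod_restrict]
    exact Integrable.comp_snd hkV _

lemma IsTestFun.slice {U : Set E} {I : Set ℝ} {φ : ℝ × E → ℝ} (hφ : IsTestFun (I ×ˢ U) φ) (t : ℝ) :
    IsTestFun U fun x => φ (t, x) where
  contDiff := hφ.contDiff.comp (by fun_prop)
  hasCompactSupport := by
    refine HasCompactSupport.intro (hφ.hasCompactSupport.isCompact.image continuous_snd)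
      fun x hx => ?_
    by_contra h
    exact hx ⟨(t, x), subset_tsupport _ h, rfl⟩
  tsupport_subset := by
    have hc : IsClosed (Prod.snd '' tsupport φ) :=
      (hφ.hasCompactSupport.isCompact.image continuous_snd).isClosed
    refine (closure_minimal ?_ hc).trans (?_ : Prod.snd '' tsupport φ ⊆ U)
    · intro x hx
      exact ⟨(t, x), subset_tsupport _ hx, rfl⟩
    · rintro _ ⟨p, hp, rfl⟩
      exact (hφ.tsupport_subset hp).2

lemma IsTestFun.fderiv_slice {U : Set (ℝ × E)} {φ : ℝ × E → ℝ} (hφ : IsTestFun U φ) (t : ℝ)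
    (x e : E) : _root_.fderiv ℝ (fun y => φ (t, y)) x e = _root_.fderiv ℝ φ (t, x) (0, e) := by
  have h1 : HasFDerivAt (fun y : E => (t, y)) (ContinuousLinearMap.inr ℝ ℝ E) x :=
    hasFDerivAt_prodMk_right t x
  have := (hφ.differentiable (t, x)).hasFDerivAt.comp x h1
  have h2 : HasFDerivAt (fun y => φ (t, y)) _ x := this
  rw [h2.fderiv]
  simp

lemma IsTestFun.deriv_time {U : Set (ℝ × E)} {φ : ℝ × E → ℝ} (hφ : IsTestFun U φ) (t : ℝ)
    (x : E) : HasDerivAt (fun s => φ (s, x)) (_root_.fderiv ℝ φ (t, x) (1, 0)) t := by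
  have h1 : HasDerivAt (fun s : ℝ => (s, x)) ((1 : ℝ), (0 : E)) t :=
    (hasDerivAt_id t).prodMk (hasDerivAt_const t x)
  exact (hφ.differentiable (t, x)).hasFDerivAt.comp_hasDerivAt t h1

lemma IsTestFun.integral_deriv_time {U : Set (ℝ × E)} {φ : ℝ × E → ℝ} (hφ : IsTestFun U φ) (x : E) :
    ∫ t, _root_.fderiv ℝ φ (t, x) (1, 0) = 0 := by
  have hcs : HasCompactSupport fun s => φ (s, x) := by
    refine HasCompactSupport.intro (hφ.hasCompactSupport.isCompact.image continuous_fst)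
      fun s hs => ?_
    by_contra h
    exact hs ⟨(s, x), subset_tsupport _ h, rfl⟩
  have hcd : ContDiff ℝ 1 fun s => φ (s, x) := (hφ.contDiff.of_le (by simp)).comp (by fun_prop)
  have hd : deriv (fun s => φ (s, x)) = fun t => _root_.fderiv ℝ φ (t, x) (1, 0) :=
    funext fun t => (hφ.deriv_time t x).deriv
  have h2 : Integrable (deriv fun s => φ (s, x)) :=
    (hcd.continuous_deriv le_rfl).integrable_of_hasCompactSupport hcs.deriv
  rw [hd] at h2
  exact integral_eq_zero_of_hasDerivAt_of_integrable (fun t => hφ.deriv_time t x) h2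
    (hcd.continuous.integrable_of_hasCompactSupport hcs)

lemma hasWeakDeriv_time_comp_snd {k : E → ℝ} {U : Set E} (hk : LocallyIntegrableOn k U volume)
    (I : Set ℝ) :
    HasWeakDeriv (I ×ˢ U) ((1 : ℝ), (0 : E)) (fun p : ℝ × E => k p.2) 𝟘 := by
  have hl := hk.comp_snd_prod I
  refine HasWeakDeriv.of_integral_eq' hl (locallyIntegrableOn_const 0) fun φ hφ => ?_
  have hi := (hφ.fderiv ((1 : ℝ), (0 : E))).integrable_mul hl
  rw [volume_eq_prod] at hi ⊢
  rw [integral_prod_symm _ hi]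
  simp_rw [integral_const_mul, hφ.integral_deriv_time]
  simp

lemma HasWeakDeriv.comp_snd {k k' : E → ℝ} {U : Set E} {e : E} (h : HasWeakDeriv U e k k')
    (I : Set ℝ) :
    HasWeakDeriv (I ×ˢ U) ((0 : ℝ), e) (fun p : ℝ × E => k p.2) fun p => k' p.2 := by
  refine HasWeakDeriv.of_integral_eq' (h.1.comp_snd_prod I) (h.2.comp_snd_prod I) fun φ hφ => ?_
  have hi := (hφ.fderiv ((0 : ℝ), e)).integrable_mul (h.1.comp_snd_prod I)
  have hi' := hφ.integrable_mul (h.2.comp_snd_prod I)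
  rw [volume_eq_prod] at hi hi' ⊢
  rw [integral_prod _ hi, integral_prod _ hi', ← integral_neg]
  refine integral_congr_ae (of_forall fun t => ?_)
  simp only [← hφ.fderiv_slice]
  exact h.integral_eq' (hφ.slice t)

lemma HasWeakDeriv.comp_equiv {F : Type*} [NormedAddCommGroup F] [NormedSpace ℝ F] [MeasureSpace F]
    [BorelSpace F] [FiniteDimensional ℝ F] [(volume : Measure F).IsAddHaarMeasure]
    (A : F ≃L[ℝ] E) (hA : MeasurePreserving A volume volume) {e : F} {f g : E → ℝ}
    (h : HasWeakDeriv univ (A e) f g) : HasWeakDeriv univ e (fun x => f (A x)) fun x => g (A x) := by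
  have hemb : MeasurableEmbedding A := A.toHomeomorph.measurableEmbedding
  have hl : ∀ k : E → ℝ, LocallyIntegrableOn k univ volume →
      LocallyIntegrableOn (fun x => k (A x)) univ volume := by
    intro k hk
    rw [locallyIntegrableOn_univ, locallyIntegrable_iff] at hk ⊢
    intro K hK
    have := hk (A '' K) (hK.image A.continuous)
    rw [← hA.integrableOn_comp_preimage hemb, A.injective.preimage_image] at this
    exact this
  refine HasWeakDeriv.of_integral_eq' (hl f h.1) (hl g h.2) fun φ hφ => ?_
  have hψ : IsTestFun univ fun y => φ (A.symm y) := by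
    refine ⟨hφ.contDiff.comp A.symm.contDiff, ?_, subset_univ _⟩
    exact hφ.hasCompactSupport.comp_homeomorph A.symm.toHomeomorph
  have hd : ∀ y, fderiv ℝ (fun y => φ (A.symm y)) y (A e) = fderiv ℝ φ (A.symm y) e := by
    intro y
    have h1 : HasFDerivAt (fun y => φ (A.symm y)) _ y :=
      (hφ.differentiable (A.symm y)).hasFDerivAt.comp y A.symm.hasFDerivAt
    rw [h1.fderiv]
    simp
  have := h.integral_eq' hψ
  simp_rw [hd] at this
  rw [← hA.integral_comp hemb, ← hA.integral_comp hemb] at this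
  simpa using this

end TimeSpace

lemma IsH1.hasWeakDeriv {h : ℝ → ℝ} (H : IsH1 h) : HasWeakDeriv univ (1 : ℝ) h (deriv h) := by
  have hl : LocallyIntegrable (deriv h) := H.memLp_deriv.locallyIntegrable (by norm_num)
  refine HasWeakDeriv.of_integral_eq'
    (locallyIntegrableOn_univ.2 H.continuous.locallyIntegrable) (locallyIntegrableOn_univ.2 hl)
    fun φ hφ => ?_
  obtain ⟨a, ha⟩ := hφ.hasCompactSupport.isCompact.isBounded.subset_ball 0
  rw [Real.ball_eq_Ioo] at ha
  exact (hasWeakDeriv_of_increment (hl.locallyIntegrableOn _)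
    fun x y _ _ _ => (H.integral_deriv x y).symm).integral_eq' ⟨hφ.1, hφ.2, ha⟩

/-- The map `(t,r) ↦ (t, r + ε t)`. -/
def skewEquiv (ε : ℝ) : ℝ² ≃L[ℝ] ℝ² := LinearEquiv.toContinuousLinearEquiv
    { toFun := fun p => (p.1, p.2 + ε * p.1)
      invFun := fun p => (p.1, p.2 - ε * p.1)
      map_add' := fun p q => by ext <;> simp; ring
      map_smul' := fun c p => by ext <;> simp; ring
      left_inv := fun p => by ext <;> simp
      right_inv := fun p => by ext <;> simp }

lemma skewEquiv_apply (ε : ℝ) (p : ℝ²) : skewEquiv ε p = (p.1, p.2 + ε * p.1) := rfl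

lemma measurePreserving_skewEquiv (ε : ℝ) : MeasurePreserving (skewEquiv ε) volume volume :=
  measurePreserving_skew ε

lemma hasWeakDeriv_travelling {k k' : ℝ → ℝ} (h : HasWeakDeriv univ (1 : ℝ) k k') (ε : ℝ) :
    HasWeakDeriv univ ((0 : ℝ), (1 : ℝ)) (fun p : ℝ² => k (p.2 + ε * p.1))
      fun p => k' (p.2 + ε * p.1) := by
  have := h.comp_snd univ
  rw [univ_prod_univ] at this
  exact HasWeakDeriv.comp_equiv (skewEquiv ε) (measurePreserving_skewEquiv ε) (e := (0, 1))
    (f := fun p => k p.2) (g := fun p => k' p.2) (by simpa [skewEquiv_apply] using this)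

lemma hasWeakDeriv_travelling_zero {k : ℝ → ℝ} (h : LocallyIntegrable k) (ε : ℝ) :
    HasWeakDeriv univ ((1 : ℝ), -ε) (fun p : ℝ² => k (p.2 + ε * p.1)) 𝟘 := by
  have := hasWeakDeriv_time_comp_snd (locallyIntegrableOn_univ.2 h) (univ : Set ℝ)
  rw [univ_prod_univ] at this
  have h2 := HasWeakDeriv.comp_equiv (skewEquiv ε) (measurePreserving_skewEquiv ε)
    (e := (1, -ε)) (f := fun p => k p.2) (g := fun _ => 0) (by simpa [skewEquiv_apply] using this)
  exact h2

/-- A continuous solution `z` of the wave equation `z_tt - z_rr = f` in the whole plane, whose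
characteristic derivatives `p = z_t + z_r` and `q = z_t - z_r` are continuous curves in `L²`. -/
structure IsWave (f z p q : ℝ² → ℝ) : Prop where
  continuous : Continuous z
  deriv_p : HasWeakDeriv univ (1, 1) z p
  deriv_q : HasWeakDeriv univ (1, -1) z q
  deriv_deriv : HasWeakDeriv univ (1, -1) p f
  deriv_deriv' : HasWeakDeriv univ (1, 1) q f
  curve_p : IsL2Curve p
  curve_q : IsL2Curve q

section

variable {R ρ₀ T : ℝ} {ρ W V₀ V₁ : ℝ → ℝ} {f : ℝ² → ℝ}

/-- The derivative of `waveSol` in the direction `(1,1)`. -/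
def wavePlus (ρ₀ T : ℝ) (ρ W V₀ V₁ : ℝ → ℝ) (f : ℝ² → ℝ) (p : ℝ²) : ℝ :=
  charDeriv 1 f p + 2 * deriv (incoming ρ₀ T ρ W V₀ V₁ f) (p.2 + 1 * p.1)

/-- The derivative of `waveSol` in the direction `(1,-1)`. -/
def waveMinus (ρ₀ T : ℝ) (ρ W V₀ V₁ : ℝ → ℝ) (f : ℝ² → ℝ) (p : ℝ²) : ℝ :=
  charDeriv (-1) f p + 2 * deriv (outgoing ρ₀ T ρ W V₀ V₁ f) (-(p.2 + -1 * p.1))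

lemma IsH1.hasWeakDeriv_add {F : ℝ → ℝ} (hF : IsH1 F) :
    HasWeakDeriv univ ((1 : ℝ), (1 : ℝ)) (fun p : ℝ² => F (p.1 + p.2))
      (fun p => 2 * deriv F (p.2 + 1 * p.1)) ∧
    HasWeakDeriv univ ((1 : ℝ), (-1 : ℝ)) (fun p : ℝ² => F (p.1 + p.2)) 𝟘 := by
  have h1 := hasWeakDeriv_travelling hF.hasWeakDeriv 1
  have h2 := hasWeakDeriv_travelling_zero hF.continuous.locallyIntegrable 1
  have he : (fun p : ℝ² => F (p.1 + p.2)) = fun p => F (p.2 + 1 * p.1) := by ext p; congr 1; ring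
  rw [he]
  refine ⟨?_, h2⟩
  convert! h2.comb h1 1 2 using 2
  · simp
  · simp; norm_num
  · simp

lemma IsH1.hasWeakDeriv_sub {G : ℝ → ℝ} (hG : IsH1 G) :
    HasWeakDeriv univ ((1 : ℝ), (-1 : ℝ)) (fun p : ℝ² => G (p.1 - p.2))
      (fun p => 2 * deriv G (-(p.2 + -1 * p.1))) ∧
    HasWeakDeriv univ ((1 : ℝ), (1 : ℝ)) (fun p : ℝ² => G (p.1 - p.2)) 𝟘 := by
  have h1 := hasWeakDeriv_travelling hG.reflect.hasWeakDeriv (-1)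
  have h2 := hasWeakDeriv_travelling_zero hG.reflect.continuous.locallyIntegrable (-1)
  have he : (fun p : ℝ² => G (p.1 - p.2)) = fun p => G (-(p.2 + -1 * p.1)) := by
    ext p; congr 1; ring
  rw [he]
  rw [neg_neg] at h2
  refine ⟨?_, h2⟩
  convert! h2.comb h1 1 (-2) using 2
  · simp
  · simp; norm_num
  · rw [deriv_comp_neg]; ring

lemma isWave_waveSol (hF : Front R ρ₀ T ρ) (hf : IsSource T R f) (hD : IsWaveData ρ₀ W V₀ V₁) :
    IsWave f (waveSol ρ₀ T ρ W V₀ V₁ f) (wavePlus ρ₀ T ρ W V₀ V₁ f)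
      (waveMinus ρ₀ T ρ W V₀ V₁ f) := by
  have hI := isH1_incoming hF hf hD
  have hO := isH1_outgoing hF hf hD
  have n1 := hf.hasWeakDeriv_retarded (Or.inl rfl)
  have n2 := hf.hasWeakDeriv_retarded (Or.inr rfl)
  refine ⟨continuous_waveSol hF hf hD, ?_, ?_, ?_, ?_, ?_, ?_⟩
  · convert! (n1.add hI.hasWeakDeriv_add.1).add hO.hasWeakDeriv_sub.2 using 2
    rw [wavePlus, add_zero]
  · convert! (n2.add hI.hasWeakDeriv_add.2).add hO.hasWeakDeriv_sub.1 using 2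
    rw [waveMinus, add_zero]
  · have h1 := hf.hasWeakDeriv_charDeriv 1
    have h2 := (hasWeakDeriv_travelling_zero
      (hI.memLp_deriv.locallyIntegrable (by norm_num)) 1).const_mul 2
    convert! h1.add h2 using 2
    simp
  · have h1 := hf.hasWeakDeriv_charDeriv (-1)
    have hm : MemLp (fun y => deriv (outgoing ρ₀ T ρ W V₀ V₁ f) (-y)) 2 :=
      hO.memLp_deriv.comp_measurePreserving (measurePreserving_neg volume)
    have h2 := (hasWeakDeriv_travelling_zero (hm.locallyIntegrable (by norm_num)) (-1)).const_mul 2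
    rw [neg_neg] at h1 h2
    convert! h1.add h2 using 2
    simp
  · exact (hf.isL2Curve_charDeriv 1).add (((IsL2Curve.of_static hI.memLp_deriv).translate 1).const_mul 2)
  · refine (hf.isL2Curve_charDeriv (-1)).add (((IsL2Curve.of_static (h := fun y =>
      deriv (outgoing ρ₀ T ρ W V₀ V₁ f) (-y)) ?_).translate (-1)).const_mul 2)
    exact hO.memLp_deriv.comp_measurePreserving (measurePreserving_neg volume)

end

lemma tendsto_eLpNorm_of_lintegral {α ι : Type*} [MeasurableSpace α] {μ : Measure α} {l : Filter ι}
    {g : ι → α → ℝ} (h : Tendsto (fun i => ∫⁻ x, ‖g i x‖ₑ ^ 2 ∂μ) l (𝓝 0)) :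
    Tendsto (fun i => eLpNorm (g i) 2 μ) l (𝓝 0) := by
  simp_rw [← eLpNorm_two_sq] at h
  have h4 := h.ennrpow_const (1 / 2)
  have e : ∀ x : ℝ≥0∞, (x ^ 2) ^ (2⁻¹ : ℝ) = x := fun x => by
    rw [← ENNReal.rpow_natCast, ← ENNReal.rpow_mul]; norm_num
  simpa [e] using h4

namespace IsL2Curve

variable {p q : ℝ² → ℝ}

lemma of_tendsto (hp : ∀ t, MemLp (fun r => p (t, r)) 2)
    (h : ∀ t₀, Tendsto (fun t => eLpNorm (fun r => p (t, r) - p (t₀, r)) 2) (𝓝 t₀) (𝓝 0)) :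
    IsL2Curve p := by
  refine ⟨fun t => (hp t).toLp _, ?_, fun t => (hp t).coeFn_toLp⟩
  rw [continuous_iff_continuousAt]
  intro t₀
  rw [ContinuousAt, Lp.tendsto_Lp_iff_tendsto_eLpNorm']
  refine (h t₀).congr fun t => eLpNorm_congr_ae ?_
  filter_upwards [(hp t).coeFn_toLp, (hp t₀).coeFn_toLp] with r h1 h2
  simp [h1, h2]

lemma sub (hp : IsL2Curve p) (hq : IsL2Curve q) : IsL2Curve fun x => p x - q x := by
  simpa [sub_eq_add_neg] using hp.add (hq.const_mul (-1))

lemma cut (hp : IsL2Curve p) {ρ : ℝ → ℝ} (hρ : Continuous ρ) :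
    IsL2Curve fun x => (Ioo 0 (ρ x.1)).indicator (fun r => p (x.1, r)) x.2 := by
  refine of_tendsto (fun t => ?_) fun t₀ => ?_
  · exact (hp.memLp t).indicator (s := Ioo 0 (ρ t)) measurableSet_Ioo
  have h1 := hp.tendsto_eLpNorm t₀
  set g : ℝ → ℝ := fun r => p (t₀, r)
  have hg : MemLp g 2 := hp.memLp t₀
  have h2 : Tendsto (fun t => eLpNorm (fun r => (Ioo 0 (ρ t)).indicator g r -
      (Ioo 0 (ρ t₀)).indicator g r) 2 volume) (𝓝 t₀) (𝓝 0) := by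
    have h3 : Tendsto (fun t => ∫⁻ r, ‖(Ioo 0 (ρ t)).indicator g r -
      (Ioo 0 (ρ t₀)).indicator g r‖ₑ ^ 2) (𝓝 t₀) (𝓝 (∫⁻ _ : ℝ, 0)) := by
      refine tendsto_lintegral_filter_of_dominated_convergence' (fun r => ‖g r‖ₑ ^ 2)
        (of_forall fun t => ?_) (of_forall fun t => ?_) ?_ ?_
      · exact (((hg.1.indicator measurableSet_Ioo).sub
          (hg.1.indicator measurableSet_Ioo)).enorm).pow_const 2
      · refine of_forall fun r => ?_
        simp only [indicator]
        split_ifs <;> simp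
      · rw [← eLpNorm_two_sq]
        exact ENNReal.pow_ne_top hg.2.ne
      · filter_upwards [Measure.ae_ne volume (ρ t₀)] with r hr
        refine tendsto_const_nhds.congr' ?_
        rcases lt_or_gt_of_ne hr with h | h
        · filter_upwards [hρ.continuousAt.eventually (lt_mem_nhds h)] with t ht
          simp [indicator, h, ht]
        · filter_upwards [hρ.continuousAt.eventually (gt_mem_nhds h)] with t ht
          simp [indicator, h.not_gt, ht.not_gt]
    rw [lintegral_zero] at h3
    exact tendsto_eLpNorm_of_lintegral h3
  have h5 := h1.add h2
  rw [add_zero] at h5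
  refine tendsto_zero_of_le h5 (of_forall fun t => ?_)
  have e1 : (fun r => (Ioo 0 (ρ t)).indicator (fun r => p (t, r)) r -
      (Ioo 0 (ρ t₀)).indicator (fun r => p (t₀, r)) r) =
      (Ioo 0 (ρ t)).indicator (fun r => p (t, r) - p (t₀, r)) +
        fun r => ((Ioo 0 (ρ t)).indicator g r - (Ioo 0 (ρ t₀)).indicator g r) := by
    ext r
    simp only [indicator, Pi.add_apply, g]
    split_ifs <;> simp
  have hd : AEStronglyMeasurable (fun r => p (t, r) - p (t₀, r)) volume :=
    ((hp.memLp t).sub (hp.memLp t₀)).1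
  show eLpNorm (fun r => (Ioo 0 (ρ t)).indicator (fun r => p (t, r)) r -
      (Ioo 0 (ρ t₀)).indicator (fun r => p (t₀, r)) r) 2 volume ≤ _
  rw [e1]
  refine (eLpNorm_add_le (hd.indicator measurableSet_Ioo) ((hg.1.indicator measurableSet_Ioo).sub
    (hg.1.indicator measurableSet_Ioo)) (by norm_num)).trans ?_
  exact add_le_add (eLpNorm_indicator_le _) le_rfl

lemma exists_bound (hp : IsL2Curve p) (a b : ℝ) :
    ∃ C : ℝ, ∀ t ∈ Icc a b, ∫⁻ r, ‖p (t, r)‖ₑ ^ 2 ≤ ofReal C := by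
  obtain ⟨V, hV, hV'⟩ := hp
  obtain ⟨C, hC⟩ := isCompact_Icc.exists_bound_of_continuousOn (s := Icc a b) hV.continuousOn
  refine ⟨C ^ 2, fun t ht => ?_⟩
  have h0 : 0 ≤ C := (norm_nonneg _).trans (hC t ht)
  rw [← eLpNorm_two_sq, ← eLpNorm_congr_ae (hV' t), ofReal_pow h0, ← Lp.enorm_def]
  gcongr
  rw [← ofReal_norm]
  exact ofReal_le_ofReal (hC t ht)

lemma memLp_slab (hp : IsL2Curve p) (hm : AEStronglyMeasurable p volume) (a b : ℝ) :
    MemLp p 2 (vol (Icc a b ×ˢ univ)) := by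
  refine ⟨hm.restrict, ?_⟩
  obtain ⟨C, hC⟩ := hp.exists_bound a b
  have : eLpNorm p 2 (vol (Icc a b ×ˢ univ)) ^ 2 < ⊤ := by
    rw [eLpNorm_two_sq, volume_eq_prod, ← prod_restrict, Measure.restrict_univ]
    refine (lintegral_prod_le _).trans_lt ?_
    refine (setLIntegral_mono' measurableSet_Icc hC).trans_lt ?_
    rw [setLIntegral_const]
    exact ENNReal.mul_lt_top ofReal_lt_top (by simp)
  rw [ENNReal.pow_lt_top_iff] at this
  exact this.resolve_right two_ne_zero

lemma integrableOn_box (hp : IsL2Curve p) (hm : AEStronglyMeasurable p volume) (a b c d : ℝ) :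
    IntegrableOn p (Ioo a b ×ˢ Ioo c d) := by
  have h1 := (hp.memLp_slab hm a b).mono_measure (restrict_mono_set volume
    (Set.prod_mono Ioo_subset_Icc_self (subset_univ (Ioo c d))))
  have : IsFiniteMeasure (vol (Ioo a b ×ˢ Ioo c d)) := by
    refine ⟨?_⟩
    rw [restrict_apply_univ, volume_eq_prod, Measure.prod_prod]
    exact ENNReal.mul_lt_top (by simp) (by simp)
  exact h1.integrable (by norm_num)

lemma intervalIntegrable (hp : IsL2Curve p) (t a b : ℝ) :
    IntervalIntegrable (fun r => p (t, r)) volume a b :=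
  (((hp.memLp t).locallyIntegrable (by norm_num)).integrableOn_isCompact
    isCompact_uIcc).intervalIntegrable

lemma continuous_setIntegral (hp : IsL2Curve p) (a b : ℝ) :
    Continuous fun t => ∫ r in a..b, p (t, r) := by
  have key : ∀ a b, a ≤ b → Continuous fun t => ∫ r in a..b, p (t, r) := by
    intro a b hab
    obtain ⟨V, hV, hV'⟩ := hp
    have h1 : MemLp ((Ioc a b).indicator fun _ : ℝ => (1 : ℝ)) 2 :=
      memLp_indicator_const 2 measurableSet_Ioc 1 (Or.inr (by simp))
    have h2 : Continuous fun t => inner ℝ (h1.toLp _) (V t) := continuous_const.inner hV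
    convert h2 using 2 with t
    rw [L2.inner_def, integral_of_le hab, ← integral_indicator measurableSet_Ioc]
    refine integral_congr_ae ?_
    filter_upwards [hV' t, h1.coeFn_toLp] with r h3 h4
    rw [h3, h4]
    simp [indicator]
  rcases le_total a b with h | h
  · exact key a b h
  · simp_rw [intervalIntegral.integral_symm b a]
    exact (key b a h).neg

end IsL2Curve

namespace IsWave

variable {f z p q : ℝ² → ℝ} (H : IsWave f z p q)

include H

lemma deriv_time : HasWeakDeriv univ (1, 0) z fun x => (p x + q x) / 2 := by
  convert! H.deriv_p.comb H.deriv_q (1 / 2) (1 / 2) using 2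
  · simp; norm_num
  · simp
  · ring

lemma deriv_space : HasWeakDeriv univ (0, 1) z fun x => (p x - q x) / 2 := by
  convert! H.deriv_p.comb H.deriv_q (1 / 2) (-1 / 2) using 2
  · simp; norm_num
  · simp; norm_num
  · ring

lemma curve_time : IsL2Curve fun x => (p x + q x) / 2 := by
  convert! (H.curve_p.add H.curve_q).const_mul (1 / 2) using 2
  ring

lemma curve_space : IsL2Curve fun x => (p x - q x) / 2 := by
  convert! (H.curve_p.sub H.curve_q).const_mul (1 / 2) using 2
  ring

lemma measurable_time : AEStronglyMeasurable (fun x => (p x + q x) / 2) volume :=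
  (locallyIntegrableOn_univ.1 H.deriv_time.2).aestronglyMeasurable

lemma measurable_space : AEStronglyMeasurable (fun x => (p x - q x) / 2) volume :=
  (locallyIntegrableOn_univ.1 H.deriv_space.2).aestronglyMeasurable

lemma space_increment (t a b : ℝ) (hab : a ≤ b) :
    z (t, b) - z (t, a) = ∫ r in a..b, (p (t, r) - q (t, r)) / 2 := by
  set h := b - a
  have hh : 0 ≤ h := sub_nonneg.2 hab
  have h1 := H.deriv_space.increment isOpen_univ hh
  rw [volume_eq_prod] at h1
  have h2 : ∀ᵐ t : ℝ, ∀ x, z (t, x + h) - z (t, x) =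
      ∫ r in x..(x + h), (p (t, r) - q (t, r)) / 2 := by
    filter_upwards [ae_ae_of_ae_prod h1] with t ht
    have hi : ∀ a b, IntervalIntegrable (fun r => (p (t, r) - q (t, r)) / 2) volume a b :=
      fun a b => H.curve_space.intervalIntegrable t a b
    have c1 : Continuous fun x => z (t, x + h) - z (t, x) :=
      (H.continuous.comp (by fun_prop)).sub (H.continuous.comp (by fun_prop))
    have c2 : Continuous fun x => ∫ r in x..(x + h), (p (t, r) - q (t, r)) / 2 := by
      have c3 := intervalIntegral.continuous_primitive hi 0
      have : (fun x => ∫ r in x..(x + h), (p (t, r) - q (t, r)) / 2) = fun x =>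
          (∫ r in (0 : ℝ)..(x + h), (p (t, r) - q (t, r)) / 2) -
            ∫ r in (0 : ℝ)..x, (p (t, r) - q (t, r)) / 2 :=
        funext fun x => (integral_interval_sub_left (hi _ _) (hi _ _)).symm
      rw [this]
      exact (c3.comp (continuous_id.add continuous_const)).sub c3
    refine congr_fun ((c1.ae_eq_iff_eq volume c2).1 ?_)
    filter_upwards [ht] with x hx
    have := hx fun s _ => mem_univ _
    simp only [Prod.smul_mk, smul_eq_mul, mul_zero, mul_one, Prod.mk_add_mk, add_zero] at this
    rw [this, integral_comp_add_left (fun r => (p (t, r) - q (t, r)) / 2) x, add_zero]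
  have h3 : (fun t => z (t, b) - z (t, a)) = fun t => ∫ r in a..b, (p (t, r) - q (t, r)) / 2 := by
    refine (Continuous.ae_eq_iff_eq volume ?_ (H.curve_space.continuous_setIntegral a b)).1 ?_
    · exact (H.continuous.comp (by fun_prop)).sub (H.continuous.comp (by fun_prop))
    · filter_upwards [h2] with t ht
      simpa [h] using ht a
  exact congr_fun h3 t

lemma time_increment {T : ℝ} (hT : 0 ≤ T) : ∀ᵐ r : ℝ,
    IntervalIntegrable (fun s => (p (s, r) + q (s, r)) / 2) volume 0 T ∧
    ∀ a b, 0 ≤ a → a ≤ b → b ≤ T → z (b, r) - z (a, r) = ∫ s in a..b, (p (s, r) + q (s, r)) / 2 := by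
  have key : ∀ n : ℕ, ∀ᵐ r : ℝ, r ∈ Ioo (-n : ℝ) n →
      IntervalIntegrable (fun s => (p (s, r) + q (s, r)) / 2) volume 0 T ∧
      ∀ a b, 0 ≤ a → a ≤ b → b ≤ T →
        z (b, r) - z (a, r) = ∫ s in a..b, (p (s, r) + q (s, r)) / 2 := by
    intro n
    have hU : IsOpen (Ioo (-1 : ℝ) (T + 1) ×ˢ Ioo (-n : ℝ) n) := isOpen_Ioo.prod isOpen_Ioo
    have h1 := (H.deriv_time.mono (subset_univ _)).increment_all hU H.continuous.continuousOn
      (H.curve_time.integrableOn_box H.measurable_time _ _ _ _)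
    rw [volume_eq_prod] at h1
    have h2 := ae_ae_of_ae_prod (Measure.measurePreserving_swap.quasiMeasurePreserving.ae h1)
    filter_upwards [h2] with r hr hrn
    obtain ⟨x, hx1, hx2, hx3⟩ : ∃ x : ℝ, -1 < x ∧ x < 0 ∧ ∀ h : ℝ, 0 ≤ h → x + h < T + 1 →
        IntervalIntegrable (fun s => (p (x + s, r) + q (x + s, r)) / 2) volume 0 h ∧
        z (x + h, r) - z (x, r) = ∫ s in (0 : ℝ)..h, (p (x + s, r) + q (x + s, r)) / 2 := by
      have : ∃ x, x ∈ Ioo (-1 : ℝ) 0 ∧ ∀ h : ℝ, 0 ≤ h → ((x, r) : ℝ²) ∈ segmentInside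
          (Ioo (-1 : ℝ) (T + 1) ×ˢ Ioo (-n : ℝ) n) (1, 0) h →
          IntervalIntegrable (fun s => (p ((x, r) + s • (1, 0)) + q ((x, r) + s • (1, 0))) / 2)
            volume 0 h ∧
          z ((x, r) + h • (1, 0)) - z (x, r) =
            ∫ s in (0 : ℝ)..h, (p ((x, r) + s • (1, 0)) + q ((x, r) + s • (1, 0))) / 2 := by
        by_contra hcon
        push Not at hcon
        have h0 : volume (Ioo (-1 : ℝ) 0) = 0 := by
          refine measure_mono_null (fun x hx => ?_) hr
          intro hx'
          obtain ⟨h, hh, hs, hne⟩ := hcon x hx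
          exact hne (hx' h hh hs).1 (hx' h hh hs).2
        simp at h0
      obtain ⟨x, hx, hx'⟩ := this
      refine ⟨x, hx.1, hx.2, fun h hh hT' => ?_⟩
      have := hx' h hh fun s hs => ⟨⟨by simpa using by linarith [hx.1, hs.1],
        by simpa using by linarith [hs.2]⟩, by simpa using hrn⟩
      simpa using this
    have h4 : ∀ b, x ≤ b → b ≤ T →
        IntervalIntegrable (fun s => (p (s, r) + q (s, r)) / 2) volume x b ∧
        z (b, r) - z (x, r) = ∫ s in x..b, (p (s, r) + q (s, r)) / 2 := by
      intro b hb hbT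
      obtain ⟨h5, h6⟩ := hx3 (b - x) (by linarith) (by linarith)
      constructor
      · have := h5.comp_add_right (-x)
        simpa using this
      · rw [integral_comp_add_left (fun s => (p (s, r) + q (s, r)) / 2) x] at h6
        simpa using h6
    have h7 : ∀ a b, 0 ≤ a → a ≤ b → b ≤ T →
        IntervalIntegrable (fun s => (p (s, r) + q (s, r)) / 2) volume a b := by
      intro a b ha hab hb
      refine (h4 b (by linarith) hb).1.mono_set ?_
      rw [uIcc_of_le hab, uIcc_of_le (by linarith)]
      exact Icc_subset_Icc_left (by linarith)
    refine ⟨h7 0 T le_rfl hT le_rfl, fun a b ha hab hb => ?_⟩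
    rw [← integral_interval_sub_left (h4 b (by linarith) hb).1
      (h4 a (by linarith) (by linarith)).1, ← (h4 b (by linarith) hb).2,
      ← (h4 a (by linarith) (by linarith)).2]
    ring
  filter_upwards [ae_all_iff.2 key] with r hr
  obtain ⟨n, hn⟩ := exists_nat_gt |r|
  exact hr n ⟨by linarith [neg_abs_le r], by linarith [le_abs_self r]⟩

end IsWave

namespace IsL2Curve

variable {u v : ℝ² → ℝ}

lemma of_continuous (hu : Continuous u) (R : ℝ) :
    IsL2Curve fun x => (Ioo 0 R).indicator (fun r => u (x.1, r)) x.2 := by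
  have hb : ∀ t₀ : ℝ, ∃ C : ℝ, ∀ t ∈ Icc (t₀ - 1) (t₀ + 1), ∀ r ∈ Ioo 0 R, |u (t, r)| ≤ C := by
    intro t₀
    obtain ⟨C, hC⟩ := (isCompact_Icc.prod isCompact_Icc).exists_bound_of_continuousOn
      (s := Icc (t₀ - 1) (t₀ + 1) ×ˢ Icc 0 R) hu.continuousOn
    exact ⟨C, fun t ht r hr => hC (t, r) ⟨ht, Ioo_subset_Icc_self hr⟩⟩
  refine of_tendsto (fun t => ?_) fun t₀ => ?_
  · show MemLp ((Ioo 0 R).indicator fun r => u (t, r)) 2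
    rw [memLp_indicator_iff_restrict measurableSet_Ioo]
    obtain ⟨C, hC⟩ := hb t
    refine MemLp.of_bound (hu.comp (by fun_prop)).aestronglyMeasurable C ?_
    rw [ae_restrict_iff' measurableSet_Ioo]
    exact of_forall fun r hr => hC t ⟨by linarith, by linarith⟩ r hr
  · refine tendsto_eLpNorm_of_lintegral ?_
    obtain ⟨C, hC⟩ := hb t₀
    have hcont : ∀ t, Measurable fun r => u (t, r) := fun t => (hu.comp (by fun_prop)).measurable
    have h3 := tendsto_lintegral_filter_of_dominated_convergence' (l := 𝓝 t₀) (μ := volume)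
      (F := fun t r => ‖(Ioo 0 R).indicator (fun r => u (t, r)) r -
        (Ioo 0 R).indicator (fun r => u (t₀, r)) r‖ₑ ^ 2) (f := fun _ => 0)
      ((Ioo 0 R).indicator fun _ => ofReal (2 * C) ^ 2) ?_ ?_ ?_ ?_
    · simpa using h3
    · refine of_forall fun t => ?_
      exact ((((hcont t).indicator measurableSet_Ioo).sub
        ((hcont t₀).indicator measurableSet_Ioo)).enorm.pow_const 2).aemeasurable
    · filter_upwards [Icc_mem_nhds (show t₀ - 1 < t₀ by linarith) (show t₀ < t₀ + 1 by linarith)]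
        with t ht
      refine of_forall fun r => ?_
      by_cases hr : r ∈ Ioo 0 R
      · simp only [hr, indicator_of_mem]
        gcongr
        rw [enorm_eq_ofReal_abs]
        refine ofReal_le_ofReal ((abs_sub _ _).trans ?_)
        linarith [hC t ht r hr, hC t₀ ⟨by linarith, by linarith⟩ r hr]
      · simp [hr]
    · rw [lintegral_indicator measurableSet_Ioo, setLIntegral_const]
      exact ENNReal.mul_ne_top (ENNReal.pow_ne_top ofReal_ne_top) (by simp)
    · refine of_forall fun r => ?_
      have hc : Continuous fun t => ‖(Ioo 0 R).indicator (fun r => u (t, r)) r -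
        (Ioo 0 R).indicator (fun r => u (t₀, r)) r‖ₑ ^ 2 := by
        by_cases hr : r ∈ Ioo 0 R
        · simp only [hr, indicator_of_mem]
          have : Continuous fun t => u (t, r) := hu.comp (by fun_prop)
          exact (ENNReal.continuous_pow 2).comp (this.sub continuous_const).enorm
        · simp only [hr, not_false_eq_true, indicator_of_notMem]
          exact continuous_const
      simpa using hc.tendsto t₀

lemma exists_restrict (hu : IsL2Curve u) (s : Set ℝ) : ∃ V : ℝ → Lp ℝ 2 (vol s), Continuous V ∧
      ∀ t, V t =ᵐ[vol s] fun r => u (t, r) := by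
  obtain ⟨V, hV, hV'⟩ := hu
  exact ⟨fun t => LpToLpRestrictCLM ℝ ℝ ℝ volume 2 s (V t), by fun_prop,
    fun t => (LpToLpRestrictCLM_coeFn ℝ s (V t)).trans (ae_restrict_of_ae (hV' t))⟩

lemma contDiff_of_increment (hu : IsL2Curve u) (hv : IsL2Curve v)
    (hvm : AEStronglyMeasurable v volume) {T : ℝ}
    (h : ∀ᵐ r, ∀ t, 0 ≤ t → t ≤ T → u (t, r) - u (0, r) = ∫ s in (0 : ℝ)..t, v (s, r)) :
    ∃ V : ℝ → Lp ℝ 2 (volume : Measure ℝ), ContDiff ℝ 1 V ∧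
      ∀ t ∈ Icc 0 T, V t =ᵐ[volume] fun r => u (t, r) := by
  obtain ⟨Z, hZ, hZ'⟩ := hu
  obtain ⟨Y, hY, hY'⟩ := hv
  have hd : ∀ t, HasDerivAt (fun t => Z 0 + ∫ s in (0 : ℝ)..t, Y s) (Y t) t := fun t =>
    (intervalIntegral.integral_hasDerivAt_right (hY.intervalIntegrable _ _)
      (hY.stronglyMeasurableAtFilter _ _) hY.continuousAt).const_add _
  refine ⟨fun t => Z 0 + ∫ s in (0 : ℝ)..t, Y s, ?_, fun t ht => ?_⟩
  · rw [contDiff_one_iff_deriv]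
    refine ⟨fun t => (hd t).differentiableAt, ?_⟩
    rwa [funext fun t => (hd t).deriv]
  suffices hs : Z t - Z 0 = ∫ s in (0 : ℝ)..t, Y s by
    show ((Z 0 + ∫ s in (0 : ℝ)..t, Y s : Lp ℝ 2 volume) : ℝ → ℝ) =ᵐ[volume] _
    rw [← hs, add_sub_cancel]
    exact hZ' t
  refine ext_inner_left ℝ fun g => ?_
  have h1 : inner ℝ g (∫ s in (0 : ℝ)..t, Y s) = ∫ s in (0 : ℝ)..t, inner ℝ g (Y s) := by
    have := (innerSL ℝ g).intervalIntegral_comp_comm (hY.intervalIntegrable (μ := volume) 0 t)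
    simpa using this.symm
  have hi : Integrable (fun x : ℝ² => g x.2 * v x) ((vol (Ioc 0 t)).prod volume) := by
    have h2 : MemLp v 2 ((vol (Ioc 0 t)).prod volume) := by
      have := (IsL2Curve.memLp_slab ⟨Y, hY, hY'⟩ hvm 0 t).mono_measure
        (restrict_mono_set volume (Set.prod_mono Ioc_subset_Icc_self (Subset.refl (univ : Set ℝ))))
      rwa [volume_eq_prod, ← prod_restrict, Measure.restrict_univ] at this
    have h3 : MemLp (fun x : ℝ² => g x.2) 2 ((vol (Ioc 0 t)).prod volume) := (Lp.memLp g).comp_snd _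
    exact h3.integrable_mul h2
  rw [h1, L2.inner_def, integral_of_le ht.1]
  have h4 : ∫ r, inner ℝ (g r) ((Z t - Z 0 : Lp ℝ 2 volume) r) =
      ∫ r, ∫ s in Ioc 0 t, g r * v (s, r) := by
    refine integral_congr_ae ?_
    filter_upwards [h, Lp.coeFn_sub (Z t) (Z 0), hZ' t, hZ' 0] with r h5 h6 h7 h8
    rw [h6, Pi.sub_apply, h7, h8, h5 t ht.1 ht.2, integral_const_mul, integral_of_le ht.1]
    simp [mul_comm]
  rw [h4, integral_integral_swap (f := fun r s => g r * v (s, r)) hi.swap]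
  refine setIntegral_congr_fun measurableSet_Ioc fun s _ => ?_
  rw [L2.inner_def]
  refine integral_congr_ae ?_
  filter_upwards [hY' s] with r hr
  rw [hr]
  simp [mul_comm]

end IsL2Curve

/-- The restriction of `z` to the closed strip, extended by zero. -/
def cutWave (T : ℝ) (ρ : ℝ → ℝ) (z : ℝ² → ℝ) : ℝ² → ℝ := (closure (Ω T ρ)).indicator z

section

variable {R ρ₀ T : ℝ} {ρ : ℝ → ℝ} {f z p q : ℝ² → ℝ}

lemma cutWave_eq (hF : Front R ρ₀ T ρ) {t r : ℝ} (ht : t ∈ Icc 0 T) :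
    cutWave T ρ z (t, r) = (Icc 0 (ρ t)).indicator (fun r => z (t, r)) r := by
  have h : (t, r) ∈ closure (Ω T ρ) ↔ r ∈ Icc 0 (ρ t) := by
    rw [hF.closure_strip]
    exact ⟨fun h => h.2.2, fun h => ⟨ht.1, ht.2, h⟩⟩
  by_cases hr : r ∈ Icc 0 (ρ t)
  · rw [cutWave, indicator_of_mem (h.2 hr), indicator_of_mem hr]
  · rw [cutWave, indicator_of_notMem (mt h.1 hr), indicator_of_notMem hr]

lemma cutWave_ae_eq (hF : Front R ρ₀ T ρ) {t : ℝ} (ht : t ∈ Icc 0 T) :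
    (fun r => cutWave T ρ z (t, r)) =ᵐ[volume]
      fun r => (Ioo 0 (ρ t)).indicator (fun r => z (t, r)) r := by
  filter_upwards [Ioo_ae_eq_Icc.mem_iff] with r hr
  rw [cutWave_eq hF ht]
  by_cases h : r ∈ Ioo 0 (ρ t)
  · rw [indicator_of_mem h, indicator_of_mem (hr.1 h)]
  · rw [indicator_of_notMem h, indicator_of_notMem (mt hr.2 h)]

lemma isL2Curve_cut_continuous (hF : Front R ρ₀ T ρ) (hz : Continuous z) :
    IsL2Curve fun x => (Ioo 0 (ρ x.1)).indicator (fun r => z (x.1, r)) x.2 := by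
  have := (IsL2Curve.of_continuous hz R).cut hF.continuous
  convert! this using 2 with x
  have := hF.lt_R x.1
  by_cases h1 : x.2 ∈ Ioo 0 (ρ x.1)
  · have h2 : x.2 ∈ Ioo 0 R := ⟨h1.1, h1.2.trans this⟩
    simp [indicator_of_mem h1, indicator_of_mem h2]
  · simp [indicator_of_notMem h1]

lemma IsWave.isC0W12 (H : IsWave f z p q) (hF : Front R ρ₀ T ρ)
    (hfront : ∀ t, 0 ≤ t → z (t, ρ t) = 0) : IsC0W12 R T (cutWave T ρ z) := by
  obtain ⟨V, hV, hV'⟩ := (isL2Curve_cut_continuous hF H.continuous).exists_restrict (Ioo 0 R)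
  obtain ⟨D, hD, hD'⟩ := (H.curve_space.cut hF.continuous).exists_restrict (Ioo 0 R)
  refine ⟨V, D, hV.continuousOn, hD.continuousOn, fun t ht => ⟨(hV' t).trans
    (ae_restrict_of_ae (cutWave_ae_eq hF ht).symm), ?_⟩⟩
  have hg : LocallyIntegrable ((Ioo 0 (ρ t)).indicator fun r => (p (t, r) - q (t, r)) / 2) :=
    ((H.curve_space.memLp t).indicator measurableSet_Ioo).locallyIntegrable (by norm_num)
  refine (hasWeakDeriv_of_increment (hg.locallyIntegrableOn _) ?_).congr_ae isOpen_Ioo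
    EventuallyEq.rfl (hD' t).symm
  intro a b ha hab hb
  have e : ∀ r, 0 < r → cutWave T ρ z (t, r) = z (t, min r (ρ t)) := by
    intro r hr
    rw [cutWave_eq hF ht]
    by_cases h : r ≤ ρ t
    · rw [indicator_of_mem (mem_Icc.2 ⟨hr.le, h⟩), min_eq_left h]
    · rw [indicator_of_notMem fun h' => h h'.2, min_eq_right (le_of_not_ge h), hfront t ht.1]
  rw [e a ha, e b (ha.trans_le hab), H.space_increment t _ _ (min_le_min_right _ hab),
    integral_of_le (min_le_min_right _ hab), integral_of_le hab,
    setIntegral_indicator measurableSet_Ioo]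
  refine setIntegral_congr_set ?_
  have : (Ioc (min a (ρ t)) (min b (ρ t)) : Set ℝ) = Ioc a b ∩ Ioc 0 (ρ t) := by
    ext x
    simp only [mem_Ioc, mem_inter_iff, le_inf_iff, inf_lt_iff]
    constructor
    · rintro ⟨h1 | h1, h2, h3⟩
      · exact ⟨⟨h1, h2⟩, ha.trans h1, h3⟩
      · exact absurd h1 (not_lt.2 h3)
    · rintro ⟨⟨h1, h2⟩, h3, h4⟩
      exact ⟨Or.inl h1, h2, h4⟩
  rw [this]
  exact ae_eq_rfl.inter Ioo_ae_eq_Ioc.symm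

lemma IsWave.cut_increment (H : IsWave f z p q) (hF : Front R ρ₀ T ρ)
    (hfront : ∀ t, 0 ≤ t → z (t, ρ t) = 0) : ∀ᵐ r, ∀ t, 0 ≤ t → t ≤ T →
      (Ioo 0 (ρ t)).indicator (fun r => z (t, r)) r - (Ioo 0 (ρ 0)).indicator (fun r => z (0, r)) r =
        ∫ s in (0 : ℝ)..t, (Ioo 0 (ρ s)).indicator (fun r => (p (s, r) + q (s, r)) / 2) r := by
  filter_upwards [H.time_increment hF.pos_time.le] with r hr t ht htT
  obtain ⟨-, hr⟩ := hr
  rcases le_or_gt r 0 with h0 | h0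
  · have : ∀ x, r ∉ Ioo 0 x := fun x h => (not_lt.2 h0) h.1
    simp [this]
  have hi : ∀ (g : ℝ → ℝ) (x : ℝ), (Ioo 0 x).indicator g r = if r < x then g r else 0 := by
    intro g x
    by_cases h : r < x
    · rw [if_pos h, indicator_of_mem (mem_Ioo.2 ⟨h0, h⟩)]
    · rw [if_neg h, indicator_of_notMem fun h' => h h'.2]
  simp only [hi]
  rcases lt_or_ge r (ρ 0) with h1 | h1
  · have h2 : ∀ s, 0 ≤ s → r < ρ s := fun s hs => h1.trans_le (hF.mono hs)
    rw [if_pos h1, if_pos (h2 t ht), hr 0 t le_rfl ht htT]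
    refine intervalIntegral.integral_congr fun s hs => ?_
    rw [uIcc_of_le ht] at hs
    rw [if_pos (h2 s hs.1)]
  rw [if_neg h1.not_gt, sub_zero]
  rcases lt_or_ge r (ρ t) with h2 | h2
  · rw [if_pos h2]
    set S : Set ℝ := {s | s ∈ Icc 0 t ∧ ρ s ≤ r} with hS
    have hSc : IsCompact S := isCompact_Icc.inter_right (isClosed_le hF.continuous continuous_const)
    obtain ⟨s₀, hs₀, hmax⟩ := hSc.exists_isGreatest ⟨0, ⟨le_rfl, ht⟩, h1⟩
    have hlt : ∀ s, s₀ < s → s ≤ t → r < ρ s := by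
      intro s h h'
      by_contra hc
      exact not_lt.2 (hmax ⟨⟨hs₀.1.1.trans h.le, h'⟩, not_lt.1 hc⟩) h
    have heq : ρ s₀ = r := by
      refine le_antisymm hs₀.2 ?_
      have hst : s₀ < t := lt_of_le_of_ne hs₀.1.2 fun h => not_lt.2 hs₀.2 (h ▸ h2)
      refine ge_of_tendsto (hF.continuous.continuousAt.tendsto.mono_left nhdsWithin_le_nhds :
        Tendsto ρ (𝓝[>] s₀) _) ?_
      filter_upwards [Ioc_mem_nhdsGT hst] with s hs
      exact (hlt s hs.1 hs.2).le
    have hz0 : z (s₀, r) = 0 := heq ▸ hfront s₀ hs₀.1.1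
    have h3 := hr s₀ t hs₀.1.1 hs₀.1.2 htT
    rw [hz0, sub_zero] at h3
    rw [h3, integral_of_le hs₀.1.2, integral_of_le ht,
      ← Ioc_union_Ioc_eq_Ioc hs₀.1.1 hs₀.1.2, ← integral_indicator measurableSet_Ioc,
      ← integral_indicator (measurableSet_Ioc.union measurableSet_Ioc)]
    congr 1
    ext s
    simp only [indicator, mem_union, mem_Ioc]
    by_cases hs1 : s₀ < s ∧ s ≤ t
    · simp [hs1, hlt s hs1.1 hs1.2]
    · by_cases hs2 : 0 < s ∧ s ≤ s₀
      · have : ¬ r < ρ s := not_lt.2 ((hF.mono hs2.2).trans hs₀.2)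
        simp [hs1, this]
      · simp [hs1, hs2]
  · rw [if_neg h2.not_gt]
    symm
    rw [integral_of_le ht]
    refine setIntegral_eq_zero_of_forall_eq_zero fun s hs => ?_
    rw [if_neg (((hF.mono hs.2).trans h2).not_gt)]

lemma measurableSet_belowFront (hρ : Continuous ρ) : MeasurableSet {x : ℝ² | x.2 ∈ Ioo 0 (ρ x.1)} :=
  ((isOpen_lt continuous_const continuous_snd).inter
    (isOpen_lt continuous_snd (by fun_prop))).measurableSet

lemma IsWave.isC1L2 (H : IsWave f z p q) (hF : Front R ρ₀ T ρ)
    (hfront : ∀ t, 0 ≤ t → z (t, ρ t) = 0) : IsC1L2 R T (cutWave T ρ z) := by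
  have hm : AEStronglyMeasurable (fun x : ℝ² =>
      (Ioo 0 (ρ x.1)).indicator (fun r => (p (x.1, r) + q (x.1, r)) / 2) x.2) volume :=
    H.measurable_time.indicator (measurableSet_belowFront hF.continuous)
  obtain ⟨V, hV, hV'⟩ := (isL2Curve_cut_continuous hF H.continuous).contDiff_of_increment
    (H.curve_time.cut hF.continuous) hm (H.cut_increment hF hfront)
  refine ⟨fun t => LpToLpRestrictCLM ℝ ℝ ℝ volume 2 (Ioo 0 R) (V t),
    ((LpToLpRestrictCLM ℝ ℝ ℝ volume 2 (Ioo 0 R)).contDiff.comp hV).contDiffOn, fun t ht => ?_⟩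
  exact (LpToLpRestrictCLM_coeFn ℝ _ (V t)).trans
    (ae_restrict_of_ae ((hV' t ht).trans (cutWave_ae_eq hF ht).symm))

end

section Generic

variable {E : Type*} [NormedAddCommGroup E] [NormedSpace ℝ E] [MeasureSpace E] [BorelSpace E]
  [FiniteDimensional ℝ E] [(volume : Measure E).IsAddHaarMeasure]

lemma IsTestFun.iteratedDeriv_time {U : Set (ℝ × E)} {φ : ℝ × E → ℝ} (hφ : IsTestFun U φ) (t : ℝ)
    (x : E) : iteratedDeriv 2 (fun s => φ (s, x)) t =
      _root_.fderiv ℝ (fun y => _root_.fderiv ℝ φ y (1, 0)) (t, x) (1, 0) := by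
  rw [iteratedDeriv_succ, iteratedDeriv_one]
  have h1 : deriv (fun s => φ (s, x)) = fun s => _root_.fderiv ℝ φ (s, x) (1, 0) :=
    funext fun s => (hφ.deriv_time s x).deriv
  rw [h1]
  exact ((hφ.fderiv (1, 0)).deriv_time t x).deriv

lemma IsTestFun.deriv_space {U : Set ℝ²} {φ : ℝ² → ℝ} (hφ : IsTestFun U φ) (t r : ℝ) :
    HasDerivAt (fun s => φ (t, s)) (_root_.fderiv ℝ φ (t, r) (0, 1)) r := by
  have h1 : HasDerivAt (fun s : ℝ => (t, s)) ((0 : ℝ), (1 : ℝ)) r :=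
    (hasDerivAt_const r t).prodMk (hasDerivAt_id r)
  exact (hφ.differentiable (t, r)).hasFDerivAt.comp_hasDerivAt r h1

lemma IsTestFun.iteratedDeriv_space {U : Set ℝ²} {φ : ℝ² → ℝ} (hφ : IsTestFun U φ)
    (t r : ℝ) : iteratedDeriv 2 (fun s => φ (t, s)) r =
      _root_.fderiv ℝ (fun y => _root_.fderiv ℝ φ y (0, 1)) (t, r) (0, 1) := by
  rw [iteratedDeriv_succ, iteratedDeriv_one]
  have h1 : deriv (fun s => φ (t, s)) = fun s => _root_.fderiv ℝ φ (t, s) (0, 1) :=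
    funext fun s => (hφ.deriv_space t s).deriv
  rw [h1]
  exact ((hφ.fderiv (0, 1)).deriv_space t r).deriv

lemma fderiv_prod_apply (φ : ℝ² → ℝ) (x : ℝ²) (a b : ℝ) :
    fderiv ℝ φ x (a, b) = a * fderiv ℝ φ x (1, 0) + b * fderiv ℝ φ x (0, 1) := by
  have : ((a, b) : ℝ²) = a • (1, 0) + b • (0, 1) := by simp
  rw [this, map_add, map_smul, map_smul]
  rfl

lemma tendstoZeroW12_zero (U : Set E) {f : E → ℝ} :
    TendstoZeroW12 U fun (_ : ℕ) x => f x - f x := by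
  have h0 : (fun x : E => f x - f x) = fun _ => (0 : ℝ) := by ext; simp
  rw [h0]
  refine ⟨by simp, fun e => ⟨fun _ _ => 0, fun _ => ⟨locallyIntegrableOn_const 0,
    locallyIntegrableOn_const 0, fun φ _ => by simp⟩, by simp⟩⟩

lemma hasTrace_of_continuousOn {P : Type*} [MeasurableSpace P] {U : Set E} {ν : Measure P} {γ : P → E} {f : E → ℝ}
    {g : P → ℝ} (hc : ContinuousOn f (closure U)) (hf : MemW12 U f)
    (h : (fun p => f (γ p)) =ᵐ[ν] g) : HasTrace U ν γ f g := by
  refine ⟨fun _ => f, fun _ => ⟨hc, hf⟩, tendstoZeroW12_zero U, ?_⟩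
  have : eLpNorm (fun p => f (γ p) - g p) 2 ν = 0 := by
    refine (eLpNorm_congr_ae (g := fun _ => (0 : ℝ)) ?_).trans (by simp)
    filter_upwards [h] with p hp
    rw [hp, sub_self]
  simp [this]

lemma negOneNorm_le (U : Set E) {f : E → ℝ} (hf : AEStronglyMeasurable f (vol U)) :
    negOneNorm U f ≤ eLpNorm f 2 (vol U) := by
  refine iSup_le fun ψ => iSup_le fun hψ => iSup_le fun h1 => iSup_le fun _ => ?_
  refine (enorm_integral_le_lintegral_enorm _).trans ?_
  have := eLpNorm_le_eLpNorm_mul_eLpNorm_of_nnnorm (p := 2) (q := 2) (r := 1) (μ := vol U)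
    (f := f) (g := ψ) hf (hψ.contDiff.continuous.aestronglyMeasurable) (fun a b => a * b) 1
    (of_forall fun x => by simp)
  rw [eLpNorm_one_eq_lintegral_enorm] at this
  refine this.trans ?_
  calc _ ≤ 1 * eLpNorm f 2 (vol U) * 1 := by gcongr; simp
    _ = _ := by simp

end Generic

lemma essZeroPlus_le : essZeroPlus ≤ 𝓝 0 := inf_le_left.trans nhdsWithin_le_nhds

lemma mem_essZeroPlus {T : ℝ} (hT : 0 < T) : ∀ᶠ t in essZeroPlus, t ∈ Ioo 0 T :=
  inf_le_left (a := 𝓝[>] (0 : ℝ)) (Ioo_mem_nhdsGT hT)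

lemma eLpNorm_restrict_le_of_eqOn {g h : ℝ → ℝ} (D : Set ℝ) (heq : ∀ᵐ r ∂(vol D), g r = h r) :
    eLpNorm g 2 (vol D) ≤ eLpNorm h 2 volume := by
  rw [eLpNorm_congr_ae heq]
  exact eLpNorm_mono_measure _ Measure.restrict_le_self

section

variable {b α R ρ₀ T : ℝ} {ρ w v₀ v₁ : ℝ → ℝ} {f z p q : ℝ² → ℝ}

lemma cutWave_of_mem {x : ℝ²} (hx : x ∈ Ω T ρ) : cutWave T ρ z x = z x :=
  indicator_of_mem (subset_closure hx) _

lemma cutWave_ae (hF : Front R ρ₀ T ρ) : z =ᵐ[vol (Ω T ρ)] cutWave T ρ z := by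
  filter_upwards [hF.ae_mem] with x hx
  rw [cutWave_of_mem hx]

lemma continuousOn_cutWave (hz : Continuous z) : ContinuousOn (cutWave T ρ z) (closure (Ω T ρ)) :=
  hz.continuousOn.congr fun _ hx => indicator_of_mem hx _

lemma IsWave.hasWeakDeriv_cut_time (H : IsWave f z p q) (hF : Front R ρ₀ T ρ) :
    HasWeakDeriv (Ω T ρ) (1, 0) (cutWave T ρ z) fun x => (p x + q x) / 2 :=
  (H.deriv_time.mono (subset_univ _)).congr_ae hF.isOpen_strip (cutWave_ae hF) EventuallyEq.rfl

lemma IsWave.hasWeakDeriv_cut_space (H : IsWave f z p q) (hF : Front R ρ₀ T ρ) :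
    HasWeakDeriv (Ω T ρ) (0, 1) (cutWave T ρ z) fun x => (p x - q x) / 2 :=
  (H.deriv_space.mono (subset_univ _)).congr_ae hF.isOpen_strip (cutWave_ae hF) EventuallyEq.rfl

lemma Front.memLp_strip (hF : Front R ρ₀ T ρ) {u : ℝ² → ℝ} (hu : IsL2Curve u)
    (hm : AEStronglyMeasurable u volume) : MemLp u 2 (vol (Ω T ρ)) :=
  (hu.memLp_slab hm 0 T).mono_measure (restrict_mono_set volume
    (hF.strip_subset_box.trans (Set.prod_mono Subset.rfl (subset_univ _))))

lemma Front.memLp_strip_of_continuous (hF : Front R ρ₀ T ρ) (hz : Continuous z) :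
    MemLp z 2 (vol (Ω T ρ)) := by
  obtain ⟨C, hC⟩ := (isCompact_Icc.prod isCompact_Icc).exists_bound_of_continuousOn
    (s := Icc 0 T ×ˢ Icc 0 R) hz.continuousOn
  have : IsFiniteMeasure (vol (Ω T ρ)) :=
    ⟨by rw [restrict_apply_univ]; exact hF.volume_strip_lt_top⟩
  refine MemLp.of_bound hz.aestronglyMeasurable C ?_
  filter_upwards [hF.ae_mem] with x hx
  exact hC x (hF.strip_subset_box hx)

lemma IsWave.memW12_cut (H : IsWave f z p q) (hF : Front R ρ₀ T ρ) :
    MemW12 (Ω T ρ) (cutWave T ρ z) := by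
  refine ⟨(hF.memLp_strip_of_continuous H.continuous).ae_eq (cutWave_ae hF), fun e => ?_⟩
  have h1 := (H.hasWeakDeriv_cut_time hF).comb (H.hasWeakDeriv_cut_space hF) e.1 e.2
  have he : e.1 • ((1 : ℝ), (0 : ℝ)) + e.2 • ((0 : ℝ), (1 : ℝ)) = e := by ext <;> simp
  rw [he] at h1
  exact ⟨_, h1, ((hF.memLp_strip H.curve_time H.measurable_time).const_mul e.1).add
    ((hF.memLp_strip H.curve_space H.measurable_space).const_mul e.2)⟩

lemma IsWave.integral_box (H : IsWave f z p q) {φ : ℝ² → ℝ} {U : Set ℝ²} (hφ : IsTestFun U φ) :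
    ∫ x, z x * (□ φ x) = ∫ x, f x * φ x := by
  replace hφ := hφ.mono (subset_univ U)
  have e1 := H.deriv_time.integral_eq' (hφ.fderiv (1, 0))
  have e2 := H.deriv_space.integral_eq' (hφ.fderiv (0, 1))
  have e3 := H.deriv_deriv.integral_eq' hφ
  have e4 := H.deriv_deriv'.integral_eq' hφ
  have i1 := ((hφ.fderiv (1, 0)).fderiv (1, 0)).integrable_mul H.deriv_time.1
  have i2 := ((hφ.fderiv (0, 1)).fderiv (0, 1)).integrable_mul H.deriv_time.1
  have j1 := (hφ.fderiv (1, 0)).integrable_mul H.deriv_time.2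
  have j2 := (hφ.fderiv (0, 1)).integrable_mul H.deriv_space.2
  have j3 := (hφ.fderiv (1, -1)).integrable_mul H.deriv_deriv.1
  have j4 := (hφ.fderiv (1, 1)).integrable_mul H.deriv_deriv'.1
  simp only [hφ.iteratedDeriv_time, hφ.iteratedDeriv_space, mul_sub]
  rw [integral_sub i1 i2, e1, e2]
  have e5 : ∫ x, (p x * fderiv ℝ φ x (1, -1) + q x * fderiv ℝ φ x (1, 1)) =
      ∫ x, 2 * ((p x + q x) / 2 * fderiv ℝ φ x (1, 0) - (p x - q x) / 2 * fderiv ℝ φ x (0, 1)) := by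
    refine integral_congr_ae (of_forall fun x => ?_)
    simp only
    rw [fderiv_prod_apply φ x 1 (-1), fderiv_prod_apply φ x 1 1]
    ring
  rw [integral_add j3 j4, e3, e4, integral_const_mul, integral_sub j1 j2] at e5
  linarith

end

section Transport

variable {U W : Set ℝ²} {e : ℝ²} {u g : ℝ² → ℝ}

lemma ae_shift {P : ℝ² → Prop} (h : ∀ᵐ x : ℝ², P x) (a : ℝ²) : ∀ᵐ x : ℝ², P (x - a) :=
  (measurePreserving_sub_right volume a).quasiMeasurePreserving.ae h

lemma HasWeakDeriv.ae_shift_eq (hU : IsOpen U) (hw : HasWeakDeriv U e u 𝟘) {h : ℝ} (hh : 0 ≤ h) :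
    ∀ᵐ x : ℝ², (∀ s ∈ Icc 0 h, x - s • e ∈ U) → u x = u (x - h • e) := by
  filter_upwards [ae_shift (hw.increment hU hh) (h • e)] with x hx hseg
  have := hx fun s hs => by
    have := hseg (h - s) ⟨by linarith [hs.2], by linarith [hs.1]⟩
    rwa [sub_smul, ← sub_add] at this
  simp only [sub_add_cancel, intervalIntegral.integral_zero] at this
  linarith

lemma HasWeakDeriv.ae_eq_zero_of_propagation (hU : IsOpen U) (hW : IsOpen W)
    (hw : HasWeakDeriv U e u 𝟘) (hu : ∀ᵐ x : ℝ², x ∈ W → u x = 0) :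
    ∀ᵐ x : ℝ², (∃ h : ℝ, 0 < h ∧ x - h • e ∈ W ∧ ∀ s ∈ Icc 0 h, x - s • e ∈ U) → u x = 0 := by
  have h1 : ∀ᵐ x : ℝ², ∀ c : ℚ, 0 ≤ (c : ℝ) → (∀ s ∈ Icc 0 (c : ℝ), x - s • e ∈ U) →
      x - (c : ℝ) • e ∈ W → u x = 0 := by
    refine ae_all_iff.2 fun c => ?_
    by_cases hc : 0 ≤ (c : ℝ)
    · filter_upwards [hw.ae_shift_eq hU hc, ae_shift hu ((c : ℝ) • e)] with x hx1 hx2 _ h3 h4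
      rw [hx1 h3, hx2 h4]
    · exact of_forall fun x h => absurd h hc
  filter_upwards [h1] with x hx ⟨h, hh, hxW, hxU⟩
  have hc : Continuous fun s : ℝ => x - s • e := by fun_prop
  have ho : {s : ℝ | x - s • e ∈ W} ∈ 𝓝[<] h :=
    mem_nhdsWithin_of_mem_nhds ((hW.preimage hc).mem_nhds hxW)
  obtain ⟨l, hl, hl'⟩ := (mem_nhdsLT_iff_exists_Ioo_subset' hh).1 ho
  obtain ⟨c, hc1, hc2⟩ := exists_rat_btwn (max_lt hl hh)
  exact hx c ((le_max_right l 0).trans hc1.le) (fun s hs => hxU s ⟨hs.1, hs.2.trans hc2.le⟩)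
    (hl' ⟨(le_max_left l 0).trans_lt hc1, hc2⟩)

lemma HasWeakDeriv.ae_eq_zero_of_transport (hU : IsOpen U) (hw : HasWeakDeriv U e u 𝟘)
    {τ : ℝ² → ℝ} (hτ : Measurable τ) {M : ℝ} (hτM : ∀ x ∈ U, 0 < τ x ∧ τ x ≤ M)
    (hflow : ∀ x ∈ U, ∀ h, 0 ≤ h → h < τ x → x - h • e ∈ U ∧ τ (x - h • e) = τ x - h) {C : ℝ≥0∞}
    (hC : C ≠ ⊤) (hsmall : ∀ d : ℝ, 0 < d →
      ∫⁻ x in {x | x ∈ U ∧ τ x ≤ d}, ‖u x‖ₑ ^ 2 ≤ ofReal (d ^ 2) * C) :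
    ∀ᵐ x : ℝ², x ∈ U → u x = 0 := by
  have hmeas : ∀ a b : ℝ, MeasurableSet {x | x ∈ U ∧ a < τ x ∧ τ x ≤ b} := fun a b =>
    hU.measurableSet.inter ((measurableSet_lt measurable_const hτ).inter
      (measurableSet_le hτ measurable_const))
  have hk : ∀ d : ℝ, 0 < d → ∀ k : ℕ,
      ∫⁻ x in {x | x ∈ U ∧ k * d < τ x ∧ τ x ≤ (k + 1) * d}, ‖u x‖ₑ ^ 2 ≤ ofReal (d ^ 2) * C := by
    intro d hd k
    have hkd : (0 : ℝ) ≤ k * d := by positivity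
    set A : Set ℝ² := {x | x ∈ U ∧ k * d < τ x ∧ τ x ≤ (k + 1) * d}
    have e1 : ∫⁻ x in A, ‖u x‖ₑ ^ 2 = ∫⁻ x in A, ‖u (x - ((k : ℝ) * d) • e)‖ₑ ^ 2 := by
      refine lintegral_congr_ae ?_
      filter_upwards [ae_restrict_of_ae (hw.ae_shift_eq hU hkd), ae_restrict_mem (hmeas _ _)]
        with x hx hxA
      rw [← hx fun s hs => (hflow x hxA.1 s hs.1 (hs.2.trans_lt hxA.2.1)).1]
    have e2 : ∫⁻ x in A, ‖u (x - ((k : ℝ) * d) • e)‖ₑ ^ 2 ≤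
        ∫⁻ x in (fun x => x - ((k : ℝ) * d) • e) ⁻¹' {x | x ∈ U ∧ τ x ≤ d},
          ‖u (x - ((k : ℝ) * d) • e)‖ₑ ^ 2 := by
      refine lintegral_mono_set fun x hx => ?_
      obtain ⟨h1, h2⟩ := hflow x hx.1 _ hkd hx.2.1
      refine ⟨h1, ?_⟩
      rw [h2]
      linarith [hx.2.2]
    rw [e1]
    refine e2.trans ?_
    have := (measurePreserving_sub_right (volume : Measure ℝ²) (((k : ℝ) * d) • e)
      ).setLIntegral_comp_preimage_emb (MeasurableEquiv.subRight _).measurableEmbedding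
      (fun x => ‖u x‖ₑ ^ 2) {x | x ∈ U ∧ τ x ≤ d}
    rw [this]
    exact hsmall d hd
  have hsum : ∀ n : ℕ, ∫⁻ x in U, ‖u x‖ₑ ^ 2 ≤ ofReal (M ^ 2 / (n + 1)) * C := by
    intro n
    rcases le_or_gt M 0 with hM | hM
    · have : U = ∅ := eq_empty_of_forall_notMem fun x hx => by linarith [hτM x hx]
      simp [this]
    set d : ℝ := M / (n + 1)
    have hn : (0 : ℝ) < n + 1 := by positivity
    have hd : 0 < d := by positivity
    have hcov : U ⊆ ⋃ k : Fin (n + 1),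
        {x | x ∈ U ∧ (k : ℝ) * d < τ x ∧ τ x ≤ ((k : ℝ) + 1) * d} := by
      intro x hx
      have h0 := hτM x hx
      set k := ⌈τ x / d⌉₊ with hkdef
      have hk1 : 0 < k := Nat.ceil_pos.2 (div_pos h0.1 hd)
      have hk2 : k ≤ n + 1 := by
        rw [hkdef, Nat.ceil_le, div_le_iff₀ hd]
        push_cast
        calc τ x ≤ M := h0.2
          _ = (n + 1) * d := by simp only [d]; field_simp
      have hk3 : τ x ≤ k * d := by rw [← div_le_iff₀ hd]; exact Nat.le_ceil _
      have hk4 : ((k - 1 : ℕ) : ℝ) * d < τ x := by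
        rw [← lt_div_iff₀ hd]
        exact Nat.lt_ceil.1 (by omega)
      have hk5 : ((k - 1 : ℕ) : ℝ) + 1 = k := by exact_mod_cast Nat.sub_add_cancel hk1
      exact mem_iUnion.2 ⟨⟨k - 1, by omega⟩, hx, hk4, by rwa [hk5]⟩
    calc ∫⁻ x in U, ‖u x‖ₑ ^ 2 ≤ ∑ k : Fin (n + 1),
          ∫⁻ x in {x | x ∈ U ∧ (k : ℝ) * d < τ x ∧ τ x ≤ ((k : ℝ) + 1) * d}, ‖u x‖ₑ ^ 2 := by
          refine (lintegral_mono_set hcov).trans ?_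
          exact (lintegral_iUnion_le _ _).trans_eq (tsum_fintype _)
      _ ≤ ∑ _k : Fin (n + 1), ofReal (d ^ 2) * C := Finset.sum_le_sum fun k _ => hk d hd k
      _ = ofReal (M ^ 2 / (n + 1)) * C := by
          rw [Finset.sum_const, Finset.card_univ, Fintype.card_fin, nsmul_eq_mul, ← mul_assoc]
          congr 1
          rw [← ofReal_natCast, ← ofReal_mul (by positivity)]
          congr 1
          simp only [d]
          push_cast
          field_simp
  have h0 : ∫⁻ x in U, ‖u x‖ₑ ^ 2 = 0 := by
    refine le_antisymm (ge_of_tendsto' (x := atTop) ?_ hsum) zero_le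
    have t1 : Tendsto (fun n : ℕ => M ^ 2 / ((n : ℝ) + 1)) atTop (𝓝 0) := by
      have := (tendsto_one_div_add_atTop_nhds_zero_nat (𝕜 := ℝ)).const_mul (M ^ 2)
      simpa [div_eq_mul_inv] using this
    have t2 := (ENNReal.tendsto_ofReal t1)
    rw [ofReal_zero] at t2
    have := ENNReal.Tendsto.mul_const t2 (Or.inr hC) (b := C)
    simpa using this
  have hm : AEMeasurable (fun x => ‖u x‖ₑ ^ 2) (vol U) :=
    hw.1.aestronglyMeasurable.enorm.pow_const 2
  rw [lintegral_eq_zero_iff' hm] at h0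
  filter_upwards [(ae_restrict_iff' hU.measurableSet).1 h0] with x hx hxU
  simpa using hx hxU

end Transport

section Poincare

variable {R ρ₀ T : ℝ} {ρ b : ℝ → ℝ} {u g φ : ℝ² → ℝ} (hF : Front R ρ₀ T ρ)

lemma indicator_strip_slice {β : Type*} [Zero β] {t : ℝ} (ht : t ∈ Ioo 0 T) (h : ℝ² → β) :
    (fun r => (Ω T ρ).indicator h (t, r)) = (Ioo 0 (ρ t)).indicator fun r => h (t, r) := by
  ext r
  by_cases hr : r ∈ Ioo 0 (ρ t)
  · rw [indicator_of_mem hr, indicator_of_mem (show (t, r) ∈ Ω T ρ from ⟨ht.1, ht.2, hr⟩)]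
  · rw [indicator_of_notMem hr, indicator_of_notMem]
    exact fun h => hr h.2.2

include hF

lemma Front.measurePreserving_restrict_strip (h : ℝ² → ℝ≥0∞) (hh : AEMeasurable h (vol (Ω T ρ))) :
    ∫⁻ x in Ω T ρ, h x = ∫⁻ t in Ioo 0 T, ∫⁻ r in Ioo 0 (ρ t), h (t, r) := by
  have hm := hF.measurableSet_strip
  rw [← lintegral_indicator hm, volume_eq_prod,
    lintegral_prod _ ((aemeasurable_indicator_iff hm).2 hh), ← lintegral_indicator measurableSet_Ioo]
  refine lintegral_congr fun t => ?_
  by_cases ht : t ∈ Ioo 0 T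
  · rw [indicator_of_mem ht, ← lintegral_indicator measurableSet_Ioo, indicator_strip_slice ht]
  · rw [indicator_of_notMem ht]
    refine (lintegral_congr fun r => ?_).trans lintegral_zero
    rw [indicator_of_notMem]
    exact fun h => ht ⟨h.1, h.2.1⟩

lemma Front.integrable_strip (hg : MemLp g 2 (vol (Ω T ρ))) : IntegrableOn g (Ω T ρ) := by
  have : IsFiniteMeasure (vol (Ω T ρ)) :=
    ⟨by rw [restrict_apply_univ]; exact hF.volume_strip_lt_top⟩
  exact hg.integrable (by norm_num)

lemma Front.ae_slice (hg : MemLp g 2 (vol (Ω T ρ))) :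
    ∀ᵐ t : ℝ, t ∈ Ioo 0 T → MemLp (fun r => g (t, r)) 2 (vol (Ioo 0 (ρ t))) := by
  have hm := hF.measurableSet_strip
  have h1 : MemLp ((Ω T ρ).indicator g) 2 := (memLp_indicator_iff_restrict hm).2 hg
  have h2 := h1.integrable_sq
  have h3 := h1.1
  rw [volume_eq_prod] at h2 h3
  filter_upwards [h2.prod_right_ae, h3.prodMk_left] with t ht1 ht2 ht
  rw [← memLp_indicator_iff_restrict measurableSet_Ioo, ← indicator_strip_slice ht]
  exact (memLp_two_iff_integrable_sq ht2).2 ht1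

lemma Front.ae_oscillation (hφ : ContinuousOn φ (closure (Ω T ρ)))
    (hw : HasWeakDeriv (Ω T ρ) (0, 1) φ g)
    (hg : MemLp g 2 (vol (Ω T ρ))) :
    ∀ᵐ t : ℝ, t ∈ Ioo 0 T → ∀ r ∈ Ioo 0 (ρ t), ∀ c ∈ Icc 0 (ρ t),
      (φ (t, r) - φ (t, c)) ^ 2 ≤ |r - c| * ∫ s in Ioo 0 (ρ t), g (t, s) ^ 2 := by
  have h1 := hw.increment_all hF.isOpen_strip (hφ.mono subset_closure) (hF.integrable_strip hg)
  rw [volume_eq_prod] at h1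
  filter_upwards [ae_ae_of_ae_prod h1, hF.ae_slice hg] with t ht1 ht2 ht
  specialize ht2 ht
  have hρ := hF.front_pos t
  have key : ∀ r ∈ Ioo 0 (ρ t), ∀ c ∈ Ioo 0 (ρ t), r ≤ c →
      (φ (t, r) - φ (t, c)) ^ 2 ≤ |r - c| * ∫ s in Ioo 0 (ρ t), g (t, s) ^ 2 := by
    intro r hr c hc hrc
    obtain ⟨x, hx1, hx2⟩ : ∃ x ∈ Ioo 0 r, ∀ h : ℝ, 0 ≤ h →
        ((t, x) : ℝ²) ∈ segmentInside (Ω T ρ) (0, 1) h →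
        IntervalIntegrable (fun s => g ((t, x) + s • (0, 1))) volume 0 h ∧
        φ ((t, x) + h • (0, 1)) - φ (t, x) = ∫ s in (0 : ℝ)..h, g ((t, x) + s • (0, 1)) := by
      by_contra hcon
      push Not at hcon
      have h0 : volume (Ioo 0 r) = 0 := by
        refine measure_mono_null ?_ ht1
        intro x hx hx'
        obtain ⟨h, hh, hs, hne⟩ := hcon x hx
        exact hne (hx' h hh hs).1 (hx' h hh hs).2
      simp [hr.1.not_ge] at h0
    have hseg : ∀ y, x ≤ y → y < ρ t → IntervalIntegrable (fun s => g (t, s)) volume x y ∧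
        φ (t, y) - φ (t, x) = ∫ s in x..y, g (t, s) := by
      intro y hxy hy
      have := hx2 (y - x) (by linarith) fun s hs => ⟨by simpa using ht.1, by simpa using ht.2,
        by simpa using by linarith [hx1.1, hs.1], by simpa using by linarith [hs.2]⟩
      simp only [Prod.smul_mk, smul_eq_mul, mul_zero, mul_one, Prod.mk_add_mk, add_zero,
        add_sub_cancel] at this
      constructor
      · have h3 := this.1.comp_add_right (-x)
        simpa using h3
      · rw [this.2, integral_comp_add_left (fun s => g (t, s)) x]
        simp
    have hr' := hseg r hx1.2.le hr.2
    have hc' := hseg c (hx1.2.le.trans hrc) hc.2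
    have e1 : φ (t, r) - φ (t, c) = -∫ s in Ioc r c, g (t, s) := by
      rw [← integral_of_le hrc, ← integral_interval_sub_left hc'.1 hr'.1, ← hc'.2, ← hr'.2]
      ring
    have hsub : Ioc r c ⊆ Ioo 0 (ρ t) := fun s hs => ⟨hr.1.trans hs.1, hs.2.trans_lt hc.2⟩
    have h4 := sq_integral_le (ht2.mono_measure (restrict_mono_set volume hsub))
    rw [e1, neg_sq]
    refine h4.trans ?_
    rw [measureReal_restrict_apply_univ, Real.volume_real_Ioc_of_le hrc, abs_sub_comm,
      abs_of_nonneg (by linarith)]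
    refine mul_le_mul_of_nonneg_left ?_ (by linarith)
    exact setIntegral_mono_set ht2.integrable_sq (of_forall fun _ => sq_nonneg _) hsub.eventuallyLE
  have key' : ∀ r ∈ Ioo 0 (ρ t), ∀ c ∈ Ioo 0 (ρ t),
      (φ (t, r) - φ (t, c)) ^ 2 ≤ |r - c| * ∫ s in Ioo 0 (ρ t), g (t, s) ^ 2 := by
    intro r hr c hc
    rcases le_total r c with h | h
    · exact key r hr c hc h
    · have := key c hc r hr h
      rwa [abs_sub_comm, ← neg_sub, neg_sq] at this
  intro r hr c hc
  have hcφ : ContinuousOn (fun c => φ (t, c)) (Icc 0 (ρ t)) := by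
    refine hφ.comp (by fun_prop) fun s hs => ?_
    rw [hF.closure_strip]
    exact ⟨ht.1.le, ht.2.le, hs⟩
  rw [← closure_Ioo hρ.ne] at hc hcφ
  refine le_on_closure (f := fun c => (φ (t, r) - φ (t, c)) ^ 2)
    (g := fun c => |r - c| * ∫ s in Ioo 0 (ρ t), g (t, s) ^ 2) (key' r hr) ?_ ?_ hc
  · exact (continuousOn_const.sub hcφ).pow 2
  · exact Continuous.continuousOn (by fun_prop)

lemma Front.lintegral_near_le (hb : Continuous b) (hb' : ∀ t ∈ Ioo 0 T, b t ∈ Icc 0 (ρ t))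
    (hφ : ContinuousOn φ (closure (Ω T ρ)))
    (hw : HasWeakDeriv (Ω T ρ) (0, 1) φ g)
    (hg : MemLp g 2 (vol (Ω T ρ))) {d : ℝ} (hd : 0 < d) :
    ∫⁻ x in {x | x ∈ Ω T ρ ∧ |x.2 - b x.1| ≤ d}, ‖φ x‖ₑ ^ 2 ≤
      ofReal (2 * d) * (2 * ∫⁻ t in Ioo 0 T, ‖φ (t, b t)‖ₑ ^ 2) +
        ofReal (4 * d ^ 2) * ∫⁻ x in Ω T ρ, ‖g x‖ₑ ^ 2 := by
  have hm := hF.measurableSet_strip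
  have hmN : MeasurableSet {x : ℝ² | |x.2 - b x.1| ≤ d} :=
    (isClosed_le (by fun_prop) continuous_const).measurableSet
  have hφm : AEMeasurable (fun x => ‖φ x‖ₑ ^ 2) (vol (Ω T ρ)) :=
    ((hφ.mono subset_closure).aestronglyMeasurable hm).enorm.pow_const 2
  have hgm : AEMeasurable (fun x => ‖g x‖ₑ ^ 2) (vol (Ω T ρ)) := hg.1.enorm.pow_const 2
  have e1 : ∫⁻ x in {x | x ∈ Ω T ρ ∧ |x.2 - b x.1| ≤ d}, ‖φ x‖ₑ ^ 2 =
      ∫⁻ x in Ω T ρ, {x : ℝ² | |x.2 - b x.1| ≤ d}.indicator (fun x => ‖φ x‖ₑ ^ 2) x := by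
    rw [lintegral_indicator hmN, Measure.restrict_restrict hmN, inter_comm]
    rfl
  rw [e1, hF.measurePreserving_restrict_strip _ (hφm.indicator hmN),
    hF.measurePreserving_restrict_strip _ hgm]
  have hbound : ∀ᵐ t ∂vol (Ioo 0 T), ∫⁻ r in Ioo 0 (ρ t),
      {x : ℝ² | |x.2 - b x.1| ≤ d}.indicator (fun x => ‖φ x‖ₑ ^ 2) (t, r) ≤
      ofReal (2 * d) * (2 * ‖φ (t, b t)‖ₑ ^ 2) +
        ofReal (4 * d ^ 2) * ∫⁻ r in Ioo 0 (ρ t), ‖g (t, r)‖ₑ ^ 2 := by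
    rw [ae_restrict_iff' measurableSet_Ioo]
    filter_upwards [hF.ae_oscillation hφ hw hg, hF.ae_slice hg] with t h1 h2 ht
    specialize h1 ht
    specialize h2 ht
    set I := ∫ s in Ioo 0 (ρ t), g (t, s) ^ 2 with hI
    have hI0 : 0 ≤ I := integral_nonneg fun _ => sq_nonneg _
    have hIe : ∫⁻ r in Ioo 0 (ρ t), ‖g (t, r)‖ₑ ^ 2 = ofReal I := lintegral_enorm_sq h2
    have e2 : ∀ r ∈ Ioo 0 (ρ t), {x : ℝ² | |x.2 - b x.1| ≤ d}.indicator
        (fun x => ‖φ x‖ₑ ^ 2) (t, r) ≤ (Icc (b t - d) (b t + d)).indicator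
          (fun _ => ofReal (2 * φ (t, b t) ^ 2 + 2 * d * I)) r := by
      intro r hr
      by_cases hrd : |r - b t| ≤ d
      · rw [indicator_of_mem (show (t, r) ∈ {x : ℝ² | |x.2 - b x.1| ≤ d} from hrd),
          indicator_of_mem (by rw [abs_le] at hrd; constructor <;> linarith), ← ofReal_sq_eq_enorm]
        refine ofReal_le_ofReal ?_
        have h3 := h1 r hr _ (hb' t ht)
        have h4 := mul_le_mul_of_nonneg_right hrd hI0
        nlinarith [sq_nonneg (φ (t, r) - 2 * φ (t, b t))]
      · rw [indicator_of_notMem (show (t, r) ∉ {x : ℝ² | |x.2 - b x.1| ≤ d} from hrd)]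
        exact zero_le
    calc _ ≤ ∫⁻ r in Ioo 0 (ρ t), (Icc (b t - d) (b t + d)).indicator
          (fun _ => ofReal (2 * φ (t, b t) ^ 2 + 2 * d * I)) r :=
          setLIntegral_mono' measurableSet_Ioo e2
      _ ≤ ∫⁻ r, (Icc (b t - d) (b t + d)).indicator
          (fun _ => ofReal (2 * φ (t, b t) ^ 2 + 2 * d * I)) r :=
          setLIntegral_le_lintegral _ _
      _ = ofReal (2 * φ (t, b t) ^ 2 + 2 * d * I) * ofReal (2 * d) := by
          rw [lintegral_indicator measurableSet_Icc, setLIntegral_const, Real.volume_Icc]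
          congr 2
          ring
      _ = _ := by
          rw [hIe, ← ofReal_sq_eq_enorm, ← ofReal_mul (by positivity), ← ofReal_mul (by positivity),
            show (2 : ℝ≥0∞) = ofReal 2 by simp, ← ofReal_mul (by positivity),
            ← ofReal_mul (by positivity), ← ofReal_add (by positivity) (by positivity)]
          congr 1
          ring
  have hφb : AEMeasurable (fun t => ‖φ (t, b t)‖ₑ ^ 2) (vol (Ioo 0 T)) := by
    refine (ContinuousOn.aestronglyMeasurable ?_ measurableSet_Ioo).enorm.pow_const 2
    refine hφ.comp (by fun_prop) fun t ht => ?_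
    rw [hF.closure_strip]
    exact ⟨ht.1.le, ht.2.le, hb' t ht⟩
  refine (lintegral_mono_ae hbound).trans ?_
  rw [lintegral_add_left' ((hφb.const_mul _).const_mul _), lintegral_const_mul'' _ (hφb.const_mul _),
    lintegral_const_mul'' _ hφb, lintegral_const_mul' _ _ ofReal_ne_top]

end Poincare

lemma enorm_add_sq_le (a b : ℝ) : ‖a + b‖ₑ ^ 2 ≤ 2 * ‖a‖ₑ ^ 2 + 2 * ‖b‖ₑ ^ 2 := by
  rw [← ofReal_sq_eq_enorm, ← ofReal_sq_eq_enorm, ← ofReal_sq_eq_enorm,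
    show (2 : ℝ≥0∞) = ofReal 2 by simp, ← ofReal_mul (by positivity),
    ← ofReal_mul (by positivity), ← ofReal_add (by positivity) (by positivity)]
  exact ofReal_le_ofReal (by nlinarith [sq_nonneg (a - b)])

lemma MemW12.memLp_of_hasWeakDeriv {E : Type*} [NormedAddCommGroup E] [NormedSpace ℝ E]
    [MeasureSpace E] [BorelSpace E] [FiniteDimensional ℝ E] [(volume : Measure E).IsAddHaarMeasure]
    {U : Set E} {e : E} {f g : E → ℝ} (hf : MemW12 U f) (hU : IsOpen U) (hg : HasWeakDeriv U e f g) :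
    MemLp g 2 (vol U) := by
  obtain ⟨g', h1, h2⟩ := hf.2 e
  exact h2.ae_eq (h1.ae_unique hU hg)

section

variable {R ρ₀ T : ℝ} {ρ b : ℝ → ℝ} {u g φ : ℝ² → ℝ}

lemma Front.small_of_trace_zero (hF : Front R ρ₀ T ρ) (hu : MemW12 (Ω T ρ) u)
    (hb : Continuous b) (hb' : ∀ t ∈ Ioo 0 T, b t ∈ Icc 0 (ρ t))
    (ht : HasTrace (Ω T ρ) (vol (Ioo 0 T)) (fun t => (t, b t)) u 𝟘) :
    ∃ C : ℝ≥0∞, C ≠ ⊤ ∧ ∀ d : ℝ, 0 < d → ∫⁻ x in {x | x ∈ Ω T ρ ∧ |x.2 - b x.1| ≤ d}, ‖u x‖ₑ ^ 2 ≤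
        ofReal (d ^ 2) * C := by
  obtain ⟨φ, hφ, ⟨hlim, hderiv⟩, htr⟩ := ht
  obtain ⟨γ, hγ, hγlim⟩ := hderiv (0, 1)
  obtain ⟨v, hv, hvL⟩ := hu.2 (0, 1)
  have hU := hF.isOpen_strip
  refine ⟨16 * eLpNorm v 2 (vol (Ω T ρ)) ^ 2,
    ENNReal.mul_ne_top (by simp) (ENNReal.pow_ne_top hvL.2.ne), fun d hd => ?_⟩
  have hw : ∀ n, HasWeakDeriv (Ω T ρ) (0, 1) (φ n) fun x => v x + γ n x := by
    intro n
    convert! hv.add (hγ n) using 2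
    ring
  have hg : ∀ n, MemLp (fun x => v x + γ n x) 2 (vol (Ω T ρ)) := fun n =>
    (hφ n).2.memLp_of_hasWeakDeriv hU (hw n)
  set N : Set ℝ² := {x | x ∈ Ω T ρ ∧ |x.2 - b x.1| ≤ d}
  have hNsub : N ⊆ Ω T ρ := fun x hx => hx.1
  have key : ∀ n, ∫⁻ x in N, ‖u x‖ₑ ^ 2 ≤ 2 * eLpNorm (fun x => φ n x - u x) 2 (vol (Ω T ρ)) ^ 2 +
      2 * (ofReal (2 * d) * (2 * eLpNorm (fun t => φ n (t, b t) - 0) 2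
        (vol (Ioo 0 T)) ^ 2) + ofReal (4 * d ^ 2) * (2 * eLpNorm v 2 (vol (Ω T ρ)) ^ 2 +
            2 * eLpNorm (γ n) 2 (vol (Ω T ρ)) ^ 2)) := by
    intro n
    have hφm : AEMeasurable (fun x => ‖φ n x - u x‖ₑ ^ 2) (vol (Ω T ρ)) :=
      ((hφ n).2.1.sub hu.1).1.enorm.pow_const 2
    have hγm : AEMeasurable (fun x => ‖v x‖ₑ ^ 2) (vol (Ω T ρ)) := hvL.1.enorm.pow_const 2
    have h1 : ∫⁻ x in N, ‖u x‖ₑ ^ 2 ≤ 2 * (∫⁻ x in N, ‖φ n x - u x‖ₑ ^ 2) +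
        2 * ∫⁻ x in N, ‖φ n x‖ₑ ^ 2 := by
      rw [← lintegral_const_mul'' _ (hφm.mono_measure (restrict_mono_set _ hNsub)),
        ← lintegral_const_mul' _ _ (by simp), ← lintegral_add_left'
          ((hφm.mono_measure (restrict_mono_set _ hNsub)).const_mul _)]
      refine lintegral_mono fun x => ?_
      have := enorm_add_sq_le (-(φ n x - u x)) (φ n x)
      rw [enorm_neg] at this
      simpa using this
    have h2 := hF.lintegral_near_le hb hb' (hφ n).1 (hw n) (hg n) hd
    have h3 : ∫⁻ x in Ω T ρ, ‖v x + γ n x‖ₑ ^ 2 ≤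
        2 * (∫⁻ x in Ω T ρ, ‖v x‖ₑ ^ 2) + 2 * ∫⁻ x in Ω T ρ, ‖γ n x‖ₑ ^ 2 := by
      rw [← lintegral_const_mul'' _ hγm, ← lintegral_const_mul' _ _ (by simp),
        ← lintegral_add_left' (hγm.const_mul _)]
      exact lintegral_mono fun x => enorm_add_sq_le _ _
    simp only [eLpNorm_two_sq, sub_zero]
    refine h1.trans (add_le_add ?_ ?_)
    · gcongr
    · refine mul_le_mul_right (h2.trans ?_) 2
      gcongr
  have cm : ∀ {c : ℝ≥0∞} {a : ℕ → ℝ≥0∞} {l : ℝ≥0∞}, c ≠ ⊤ → Tendsto a atTop (𝓝 l) →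
      Tendsto (fun n => c * a n) atTop (𝓝 (c * l)) := fun hc h =>
    ENNReal.Tendsto.const_mul h (Or.inr hc)
  have sq : ∀ {a : ℕ → ℝ≥0∞}, Tendsto a atTop (𝓝 0) →
      Tendsto (fun n => 2 * a n ^ 2) atTop (𝓝 0) := fun h => by
    simpa using cm ENNReal.ofNat_ne_top (ENNReal.Tendsto.pow (n := 2) h)
  have l4 := (sq hlim).add (cm (c := 2) ENNReal.ofNat_ne_top ((cm (ofReal_ne_top (r := 2 * d))
    (sq htr)).add (cm (ofReal_ne_top (r := 4 * d ^ 2))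
      ((tendsto_const_nhds (x := 2 * eLpNorm v 2 (vol (Ω T ρ)) ^ 2)).add (sq hγlim)))))
  refine (ge_of_tendsto' l4 key).trans (le_of_eq ?_)
  simp only [mul_zero, add_zero, zero_add]
  rw [ofReal_mul (by norm_num)]
  simp only [← mul_assoc, ofReal_ofNat]
  norm_num
  ring

end

/-- A smooth cutoff, zero for `t ≤ 1/n` and one for `t ≥ 2/n`. -/
def cutoff (n : ℕ) (t : ℝ) : ℝ := smoothTransition (n * t - 1)

lemma contDiff_cutoff (n : ℕ) : ContDiff ℝ ∞ (cutoff n) :=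
  smoothTransition.contDiff.comp (by fun_prop)

lemma continuous_deriv_cutoff (n : ℕ) : Continuous (deriv (cutoff n)) :=
  (contDiff_cutoff n).continuous_deriv (by simp)

lemma cutoff_of_le {n : ℕ} {t : ℝ} (h : n * t ≤ 1) : cutoff n t = 0 :=
  smoothTransition.zero_of_nonpos (by linarith)

lemma cutoff_of_ge {n : ℕ} {t : ℝ} (h : 2 ≤ n * t) : cutoff n t = 1 :=
  smoothTransition.one_of_one_le (by linarith)

lemma abs_cutoff_le (n : ℕ) (t : ℝ) : |cutoff n t| ≤ 1 := by
  rw [cutoff, abs_of_nonneg (smoothTransition.nonneg _)]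
  exact smoothTransition.le_one _

lemma deriv_cutoff (n : ℕ) (t : ℝ) :
    deriv (cutoff n) t = n * deriv smoothTransition (n * t - 1) := by
  have h1 : HasDerivAt (fun t : ℝ => n * t - 1) (n : ℝ) t := by
    simpa using ((hasDerivAt_id t).const_mul (n : ℝ)).sub_const 1
  have h2 : DifferentiableAt ℝ smoothTransition (n * t - 1) :=
    (smoothTransition.contDiff (n := 1)).differentiable (by simp) _
  have := h2.hasDerivAt.comp t h1
  rw [mul_comm]
  exact this.deriv

lemma deriv_smoothTransition_eq_zero {x : ℝ} (h : x ∉ Icc (0 : ℝ) 1) :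
    deriv smoothTransition x = 0 := by
  rw [mem_Icc, not_and_or, not_le, not_le] at h
  rcases h with h | h
  · have : smoothTransition =ᶠ[𝓝 x] 𝟘 := by
      filter_upwards [gt_mem_nhds h] with y hy
      exact smoothTransition.zero_of_nonpos hy.le
    rw [this.deriv_eq, deriv_const]
  · have : smoothTransition =ᶠ[𝓝 x] fun _ => 1 := by
      filter_upwards [lt_mem_nhds h] with y hy
      exact smoothTransition.one_of_one_le hy.le
    rw [this.deriv_eq, deriv_const]

lemma deriv_cutoff_eq_zero {n : ℕ} {t : ℝ} (h : n * t ∉ Icc (1 : ℝ) 2) :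
    deriv (cutoff n) t = 0 := by
  rw [deriv_cutoff, deriv_smoothTransition_eq_zero, mul_zero]
  exact fun h' => h ⟨by linarith [h'.1], by linarith [h'.2]⟩

lemma exists_deriv_cutoff_le :
    ∃ M : ℝ, 0 ≤ M ∧ ∀ (n : ℕ) (t : ℝ), |deriv (cutoff n) t| ≤ n * M := by
  have hc : Continuous (deriv smoothTransition) :=
    (smoothTransition.contDiff (n := 1)).continuous_deriv le_rfl
  obtain ⟨M, hM⟩ := isCompact_Icc.exists_bound_of_continuousOn (s := Icc (0 : ℝ) 1) hc.continuousOn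
  have hM0 : 0 ≤ M := (norm_nonneg _).trans (hM 0 ⟨le_rfl, zero_le_one⟩)
  refine ⟨M, hM0, fun n t => ?_⟩
  rw [deriv_cutoff, abs_mul, Nat.abs_cast]
  refine mul_le_mul_of_nonneg_left ?_ (Nat.cast_nonneg n)
  by_cases h : (n * t - 1 : ℝ) ∈ Icc (0 : ℝ) 1
  · exact hM _ h
  · rw [deriv_smoothTransition_eq_zero h, abs_zero]
    exact hM0

lemma tendsto_cutoff {t : ℝ} (ht : 0 < t) : Tendsto (fun n => cutoff n t) atTop (𝓝 1) := by
  refine tendsto_const_nhds.congr' ?_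
  obtain ⟨N, hN⟩ := exists_nat_ge (2 / t)
  filter_upwards [eventually_ge_atTop N] with n hn
  rw [cutoff_of_ge]
  have : (N : ℝ) ≤ n := by exact_mod_cast hn
  rw [div_le_iff₀ ht] at hN
  nlinarith

lemma eventually_essZeroPlus {P : ℝ → Prop} (h : ∀ᶠ t in essZeroPlus, P t) :
    ∃ δ > 0, ∀ᵐ t : ℝ, t ∈ Ioo 0 δ → P t := by
  obtain ⟨s, hs, s', hs', hss⟩ := Filter.mem_inf_iff_superset.1 h
  obtain ⟨δ, hδ, hδ'⟩ := mem_nhdsGT_iff_exists_Ioo_subset.1 hs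
  exact ⟨δ, hδ, by filter_upwards [hs'] with t ht ht'; exact hss ⟨hδ' ht', ht⟩⟩

lemma tendsto_integral_deriv_cutoff {A : ℝ → ℝ} (hA : Tendsto A essZeroPlus (𝓝 0)) {T : ℝ}
    (hT : 0 < T) :
    Tendsto (fun n => ∫ t in Ioo 0 T, deriv (cutoff n) t * A t) atTop (𝓝 0) := by
  obtain ⟨M, hM0, hM⟩ := exists_deriv_cutoff_le
  rw [Metric.tendsto_atTop]
  intro ε hε
  obtain ⟨δ, hδ, hAδ⟩ := eventually_essZeroPlus
    ((Metric.tendsto_nhds.1 hA) (ε / (4 * (M + 1))) (by positivity))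
  obtain ⟨N, hN⟩ := exists_nat_gt (2 / min δ T)
  refine ⟨N, fun n hn => ?_⟩
  have hmin : 0 < min δ T := lt_min hδ hT
  have hNn : (N : ℝ) ≤ n := by exact_mod_cast hn
  have hn0 : (0 : ℝ) < n := lt_of_lt_of_le (lt_trans (by positivity) hN) hNn
  have hn2 : 2 / (n : ℝ) < min δ T := by
    rw [div_lt_comm₀ hn0 hmin]
    exact hN.trans_le hNn
  have e1 : ∫ t in Ioo 0 T, deriv (cutoff n) t * A t =
      ∫ t in Ioc 0 (2 / (n : ℝ)), deriv (cutoff n) t * A t := by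
    refine setIntegral_eq_of_subset_of_forall_sdiff_eq_zero measurableSet_Ioo
      (fun t ht => ⟨ht.1, ht.2.trans_lt (hn2.trans_le (min_le_right _ _))⟩) fun t ht => ?_
    rw [deriv_cutoff_eq_zero, zero_mul]
    intro h
    refine ht.2 ⟨ht.1.1, ?_⟩
    rw [le_div_iff₀ hn0, mul_comm]
    exact h.2
  have h2 : ‖∫ t in Ioc 0 (2 / (n : ℝ)), deriv (cutoff n) t * A t‖ ≤
      (n * M * (ε / (4 * (M + 1)))) * volume.real (Ioc 0 (2 / (n : ℝ))) := by
    refine norm_setIntegral_le_of_norm_le_const_ae' (by simp) ?_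
    filter_upwards [hAδ] with t ht ht'
    rw [norm_mul]
    have := ht ⟨ht'.1, ht'.2.trans_lt (hn2.trans_le (min_le_left _ _))⟩
    rw [dist_zero_right] at this
    exact mul_le_mul (hM n t) this.le (norm_nonneg _) (by positivity)
  rw [dist_zero_right, e1]
  refine h2.trans_lt ?_
  rw [Real.volume_real_Ioc_of_le (by positivity), sub_zero]
  have : n * M * (ε / (4 * (M + 1))) * (2 / n) = (ε / 2) * (M / (M + 1)) := by
    field_simp
    ring
  rw [this]
  have h3 : M / (M + 1) ≤ 1 := by rw [div_le_one (by positivity)]; linarith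
  nlinarith

section Extension

variable {T ρ₀ : ℝ} {e : ℝ²} {f g u ut ur : ℝ² → ℝ}

/-- Extension by zero to negative times. -/
def zeroExt (f : ℝ² → ℝ) : ℝ² → ℝ := {x : ℝ² | 0 < x.1}.indicator f

lemma measurableSet_posTime : MeasurableSet {x : ℝ² | 0 < x.1} :=
  measurableSet_lt measurable_const measurable_fst

lemma setIntegral_zeroExt (h : ℝ² → ℝ) :
    ∫ x in Iio T ×ˢ Ioo 0 ρ₀, zeroExt f x * h x = ∫ x in Ioo 0 T ×ˢ Ioo 0 ρ₀, f x * h x := by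
  have e1 : (fun x => zeroExt f x * h x) = {x : ℝ² | 0 < x.1}.indicator fun x => f x * h x := by
    ext x
    by_cases hx : 0 < x.1 <;> simp [zeroExt, hx]
  have e2 : (Iio T ×ˢ Ioo 0 ρ₀) ∩ {x : ℝ² | 0 < x.1} = Ioo 0 T ×ˢ Ioo 0 ρ₀ := by
    ext x
    simp only [mem_inter_iff, mem_prod, mem_Iio, mem_Ioo, mem_ofPred_eq]
    tauto
  rw [e1, setIntegral_indicator measurableSet_posTime, e2]

lemma integrableOn_zeroExt (hf : IntegrableOn f (Ioo 0 T ×ˢ Ioo 0 ρ₀)) :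
    IntegrableOn (zeroExt f) (Iio T ×ˢ Ioo 0 ρ₀) := by
  rw [zeroExt, integrableOn_indicator_iff measurableSet_posTime]
  refine hf.mono_set fun x hx => ⟨⟨hx.1, hx.2.1⟩, hx.2.2⟩

lemma IsTestFun.cutoff_mul {φ : ℝ² → ℝ} (hφ : IsTestFun (Iio T ×ˢ Ioo 0 ρ₀) φ)
    {c : ℝ → ℝ} (hc : ContDiff ℝ ∞ c) {δ : ℝ} (hδ : 0 < δ) (hcδ : ∀ t, t < δ → c t = 0) :
    IsTestFun (Ioo 0 T ×ˢ Ioo 0 ρ₀) fun x => c x.1 * φ x := by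
  have h1 := hφ.mul_left (χ := fun x : ℝ² => c x.1) (hc.comp contDiff_fst)
  refine ⟨h1.1, h1.2, fun x hx => ?_⟩
  have h2 := h1.3 hx
  refine ⟨⟨?_, h2.1⟩, h2.2⟩
  have h3 : tsupport (fun x : ℝ² => c x.1 * φ x) ⊆ {x : ℝ² | δ ≤ x.1} := by
    refine closure_minimal (fun y hy => ?_) (isClosed_le continuous_const continuous_fst)
    by_contra h
    exact hy (by simp [hcδ y.1 (not_le.1 h)])
  exact hδ.trans_le (h3 hx)

lemma cutoff_vanish (n : ℕ) : ∃ δ : ℝ, 0 < δ ∧ (∀ t, t < δ → cutoff n t = 0) ∧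
    ∀ t, t < δ → deriv (cutoff n) t = 0 := by
  have h : ∀ t : ℝ, t < 1 / (n + 1) → n * t < 1 := by
    intro t ht
    rw [lt_div_iff₀ (by positivity)] at ht
    rcases le_or_gt t 0 with h | h
    · have := mul_nonneg (Nat.cast_nonneg (α := ℝ) n) (neg_nonneg.2 h)
      linarith
    · linarith
  exact ⟨1 / (n + 1), by positivity, fun t ht => cutoff_of_le (h t ht).le,
    fun t ht => deriv_cutoff_eq_zero fun h' => by linarith [h'.1, h t ht]⟩

lemma HasWeakDeriv.zeroExt (hw : HasWeakDeriv (Ioo 0 T ×ˢ Ioo 0 ρ₀) e f g)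
    (hf : IntegrableOn f (Ioo 0 T ×ˢ Ioo 0 ρ₀)) (hg : IntegrableOn g (Ioo 0 T ×ˢ Ioo 0 ρ₀))
    (hlim : ∀ φ, IsTestFun (Iio T ×ˢ Ioo 0 ρ₀) φ → Tendsto (fun n =>
      ∫ x in Ioo 0 T ×ˢ Ioo 0 ρ₀, f x * (deriv (cutoff n) x.1 * φ x)) atTop (𝓝 0)) :
    HasWeakDeriv (Iio T ×ˢ Ioo 0 ρ₀) e (zeroExt f) (zeroExt g) := by
  refine ⟨(integrableOn_zeroExt hf).locallyIntegrableOn, (integrableOn_zeroExt hg).locallyIntegrableOn,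
    fun φ hφ => ?_⟩
  rw [setIntegral_zeroExt, setIntegral_zeroExt]
  set Q := Ioo 0 T ×ˢ Ioo 0 ρ₀
  have hQ : MeasurableSet Q := measurableSet_Ioo.prod measurableSet_Ioo
  obtain ⟨C, hC⟩ := hφ.exists_bound
  obtain ⟨C', hC'⟩ := (hφ.fderiv e).exists_bound
  have hχc : ∀ n, Continuous fun x : ℝ² => cutoff n x.1 := fun n =>
    (contDiff_cutoff n).continuous.comp continuous_fst
  have hlimit : ∀ {k h : ℝ² → ℝ} {D : ℝ}, IntegrableOn k Q → Continuous h → (∀ x, ‖h x‖ ≤ D) →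
      Tendsto (fun n => ∫ x in Q, k x * (cutoff n x.1 * h x)) atTop (𝓝 (∫ x in Q, k x * h x)) := by
    intro k h D hk hh hD
    refine tendsto_integral_of_dominated_convergence (fun x => ‖k x‖ * D) ?_ (hk.norm.mul_const _) ?_ ?_
    · exact fun n => hk.1.mul ((hχc n).mul hh).aestronglyMeasurable
    · refine fun n => of_forall fun x => ?_
      rw [norm_mul, norm_mul]
      refine mul_le_mul_of_nonneg_left ?_ (norm_nonneg _)
      have h1 := abs_cutoff_le n x.1
      have h2 := hD x
      rw [← Real.norm_eq_abs] at h1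
      nlinarith [norm_nonneg (h x)]
    · filter_upwards [ae_restrict_mem hQ] with x hx
      have := ((tendsto_cutoff hx.1.1).mul_const (h x)).const_mul (k x)
      rwa [one_mul] at this
  have t1 := hlimit hf (hφ.fderiv e).continuous hC'
  have t2 := hlimit hg hφ.continuous hC
  have t3 := (hlim φ hφ).const_mul e.1
  have hid : ∀ n, ∫ x in Q, f x * (cutoff n x.1 * fderiv ℝ φ x e) =
      -(∫ x in Q, g x * (cutoff n x.1 * φ x)) -
        e.1 * ∫ x in Q, f x * (deriv (cutoff n) x.1 * φ x) := by
    intro n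
    obtain ⟨δ, hδ, hz, hz'⟩ := cutoff_vanish n
    have hφn := hφ.cutoff_mul (contDiff_cutoff n) hδ hz
    have hd : ∀ x, fderiv ℝ (fun x : ℝ² => cutoff n x.1 * φ x) x e =
        cutoff n x.1 * fderiv ℝ φ x e + e.1 * (deriv (cutoff n) x.1 * φ x) := by
      intro x
      have h0 : HasFDerivAt (Prod.fst : ℝ² → ℝ) (ContinuousLinearMap.fst ℝ ℝ ℝ) x := hasFDerivAt_fst
      have h1 : HasFDerivAt (fun x : ℝ² => cutoff n x.1) _ x :=
        (((contDiff_cutoff n).differentiable (by simp) x.1).hasDerivAt).comp_hasFDerivAt x h0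
      have h2 := h1.mul (hφ.differentiable x).hasFDerivAt
      have h3 : HasFDerivAt (fun x : ℝ² => cutoff n x.1 * φ x) _ x := h2
      rw [h3.fderiv]
      simp
      ring
    have h1 := hw.integral_eq _ hφn
    simp only [hd, mul_add] at h1
    have hχ' : Continuous (deriv (cutoff n)) := continuous_deriv_cutoff n
    obtain ⟨M, -, hM⟩ := exists_deriv_cutoff_le
    have i1 : IntegrableOn (fun x => f x * (cutoff n x.1 * fderiv ℝ φ x e)) Q := by
      refine hf.mul_bdd (c := 1 * C') ((hχc n).mul (hφ.fderiv e).continuous).aestronglyMeasurable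
        (of_forall fun x => ?_)
      rw [norm_mul]
      exact mul_le_mul (abs_cutoff_le n x.1) (hC' x) (norm_nonneg _) zero_le_one
    have i2 : IntegrableOn (fun x => f x * (e.1 * (deriv (cutoff n) x.1 * φ x))) Q := by
      refine hf.mul_bdd (c := |e.1| * (n * M * C)) (continuous_const.mul
        ((hχ'.comp continuous_fst).mul hφ.continuous)).aestronglyMeasurable
        (of_forall fun x => ?_)
      rw [norm_mul, norm_mul]
      refine mul_le_mul_of_nonneg_left ?_ (abs_nonneg _)
      exact mul_le_mul (hM n x.1) (hC x) (norm_nonneg _) ((abs_nonneg _).trans (hM n x.1))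
    rw [integral_add i1 i2] at h1
    have h4 : ∫ x in Q, f x * (e.1 * (deriv (cutoff n) x.1 * φ x)) =
        e.1 * ∫ x in Q, f x * (deriv (cutoff n) x.1 * φ x) := by
      rw [← integral_const_mul]
      exact integral_congr_ae (of_forall fun x => mul_left_comm _ _ _)
    linarith
  have t4 := t2.neg.sub t3
  rw [mul_zero, sub_zero] at t4
  exact tendsto_nhds_unique (t1.congr hid) t4

lemma tendsto_cutoff_of_slices (hT : 0 < T) (hf : IntegrableOn f (Ioo 0 T ×ˢ Ioo 0 ρ₀))
    {φ : ℝ² → ℝ} (hφ : Continuous φ) (hφc : HasCompactSupport φ)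
    (h : Tendsto (fun t => ∫ r in Ioo 0 ρ₀, f (t, r) * φ (t, r)) essZeroPlus (𝓝 0)) :
    Tendsto (fun n => ∫ x in Ioo 0 T ×ˢ Ioo 0 ρ₀, f x * (deriv (cutoff n) x.1 * φ x))
      atTop (𝓝 0) := by
  refine (tendsto_integral_deriv_cutoff h hT).congr fun n => ?_
  obtain ⟨M, -, hM⟩ := exists_deriv_cutoff_le
  obtain ⟨C, hC⟩ := hφc.exists_bound_of_continuous hφ
  have hχ' : Continuous (deriv (cutoff n)) := continuous_deriv_cutoff n
  have i2 : IntegrableOn (fun x => f x * (deriv (cutoff n) x.1 * φ x)) (Ioo 0 T ×ˢ Ioo 0 ρ₀) := by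
    refine hf.mul_bdd (c := n * M * C) (((hχ'.comp continuous_fst).mul hφ)).aestronglyMeasurable
      (of_forall fun x => ?_)
    rw [norm_mul]
    exact mul_le_mul (hM n x.1) (hC x) (norm_nonneg _) ((abs_nonneg _).trans (hM n x.1))
  rw [volume_eq_prod, setIntegral_prod _ (by rwa [volume_eq_prod] at i2)]
  refine setIntegral_congr_fun measurableSet_Ioo fun t _ => ?_
  simp only
  rw [← integral_const_mul]
  refine integral_congr_ae (of_forall fun r => ?_)
  simp only
  ring

end Extension

lemma ae_ne_graph {a : ℝ → ℝ} (ha : Continuous a) : ∀ᵐ x : ℝ², x.2 ≠ a x.1 := by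
  have hm : MeasurableSet {x : ℝ² | x.2 = a x.1} :=
    (isClosed_eq continuous_snd (by fun_prop)).measurableSet
  have : volume {x : ℝ² | x.2 = a x.1} = 0 := by
    rw [volume_eq_prod, Measure.measure_prod_null hm]
    refine of_forall fun t => ?_
    have : Prod.mk t ⁻¹' {x : ℝ² | x.2 = a x.1} = {a t} := by
      ext r
      simp
    show volume (Prod.mk t ⁻¹' {x : ℝ² | x.2 = a x.1}) = 0
    rw [this]
    simp
  rw [ae_iff]
  simpa using this

lemma fderiv_fderiv_comm {E : Type*} [NormedAddCommGroup E] [NormedSpace ℝ E] {φ : E → ℝ}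
    (hφ : ContDiff ℝ ∞ φ) (x e e' : E) :
    fderiv ℝ (fun y => fderiv ℝ φ y e) x e' = fderiv ℝ (fun y => fderiv ℝ φ y e') x e := by
  have h1 : DifferentiableAt ℝ (fderiv ℝ φ) x :=
    (hφ.fderiv_right (m := ∞) le_rfl).differentiable (by simp) x
  have h2 : ∀ v w : E, fderiv ℝ (fun y => fderiv ℝ φ y v) x w = fderiv ℝ (fderiv ℝ φ) x w v := by
    intro v w
    rw [fderiv_clm_apply h1 (differentiableAt_const v)]
    simp
  rw [h2, h2]
  exact (hφ.contDiffAt.isSymmSndFDerivAt (by simpa using WithTop.coe_le_coe.2 (le_top : (2 : ℕ∞) ≤ ⊤))).eq e' e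

lemma IsTestFun.box {U : Set ℝ²} {φ : ℝ² → ℝ} (hφ : IsTestFun U φ) : IsTestFun U fun x =>
    □ φ x := by
  have h1 := (hφ.fderiv (1, 0)).fderiv (1, 0)
  have h2 := (hφ.fderiv (0, 1)).fderiv (0, 1)
  simp only [hφ.iteratedDeriv_time, hφ.iteratedDeriv_space]
  exact ⟨h1.1.sub h2.1, h1.2.sub h2.2, (tsupport_sub _ _).trans (union_subset h1.3 h2.3)⟩

section

variable {U : Set ℝ²} {u ut ur : ℝ² → ℝ}

lemma hasWeakDeriv_char (hut : HasWeakDeriv U (1, 0) u ut) (hur : HasWeakDeriv U (0, 1) u ur)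
    (heq : ∀ φ : ℝ² → ℝ, IsTestFun U φ → ∫ x in U, u x * (□ φ x) = 0)
    {ε : ℝ} (hε : ε * ε = 1) : HasWeakDeriv U (1, -ε) (fun x => ut x + ε * ur x) 𝟘 := by
  refine HasWeakDeriv.of_integral_eq' (hut.2.add (hur.2.smul ε)) (locallyIntegrableOn_const 0)
    fun φ hφ => ?_
  have hb := hφ.box
  have e0 := heq φ hφ
  rw [hb.setIntegral_mul] at e0
  have i1 := ((hφ.fderiv (1, 0)).fderiv (1, 0)).integrable_mul hut.1
  have i2 := ((hφ.fderiv (0, 1)).fderiv (0, 1)).integrable_mul hut.1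
  simp only [hφ.iteratedDeriv_time, hφ.iteratedDeriv_space, mul_sub] at e0
  rw [integral_sub i1 i2] at e0
  have e1 := hut.integral_eq' (hφ.fderiv (1, 0))
  have e2 := hut.integral_eq' (hφ.fderiv (0, 1))
  have e3 := hur.integral_eq' (hφ.fderiv (1, 0))
  have e4 := hur.integral_eq' (hφ.fderiv (0, 1))
  simp only [fderiv_fderiv_comm hφ.contDiff _ (0, 1) (1, 0)] at e2
  have j1 := (hφ.fderiv (1, 0)).integrable_mul hut.2
  have j2 := (hφ.fderiv (0, 1)).integrable_mul hut.2
  have j3 := (hφ.fderiv (1, 0)).integrable_mul hur.2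
  have j4 := (hφ.fderiv (0, 1)).integrable_mul hur.2
  have e5 : ∀ x, (ut x + ε * ur x) * fderiv ℝ φ x (1, -ε) =
      (ut x * fderiv ℝ φ x (1, 0) - ε * (ut x * fderiv ℝ φ x (0, 1))) +
        (ε * (ur x * fderiv ℝ φ x (1, 0)) - ur x * fderiv ℝ φ x (0, 1)) := by
    intro x
    rw [fderiv_prod_apply φ x 1 (-ε)]
    linear_combination (-(ur x * fderiv ℝ φ x (0, 1))) * hε
  simp_rw [e5]
  have k1 : Integrable fun x => ut x * fderiv ℝ φ x (1, 0) - ε * (ut x * fderiv ℝ φ x (0, 1)) :=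
    j1.sub (j2.const_mul ε)
  have k2 : Integrable fun x => ε * (ur x * fderiv ℝ φ x (1, 0)) - ur x * fderiv ℝ φ x (0, 1) :=
    (j3.const_mul ε).sub j4
  rw [integral_add k1 k2, integral_sub j1 (j2.const_mul ε), integral_sub (j3.const_mul ε) j4, integral_const_mul,
    integral_const_mul]
  simp only [zero_mul, integral_zero, neg_zero]
  linear_combination -e0 + e1 - e4 - ε * e2 + ε * e3

end

section

variable {R ρ₀ T : ℝ} {ρ : ℝ → ℝ} {u ut ur : ℝ² → ℝ}

lemma Front.cylinder_subset (hF : Front R ρ₀ T ρ) : Ioo 0 T ×ˢ Ioo 0 ρ₀ ⊆ Ω T ρ := fun _ hx =>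
  ⟨hx.1.1, hx.1.2, hx.2.1, hx.2.2.trans_le (hF.ge _)⟩

lemma IsTestFun.enorm_integral_le_negOneNorm {E : Type*} [NormedAddCommGroup E] [NormedSpace ℝ E]
    [MeasureSpace E] {U : Set E} {h Ψ : E → ℝ} (hΨ : IsTestFun U Ψ) {M : ℝ} (hM : 0 < M)
    (b1 : eLpNorm Ψ 2 (vol U) ≤ ofReal M)
    (b2 : eLpNorm (_root_.fderiv ℝ Ψ) 2 (vol U) ≤ ofReal M) :
    ‖∫ x in U, h x * Ψ x‖ₑ ≤ ofReal M * negOneNorm U h := by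
  have hs : IsTestFun U fun x => M⁻¹ * Ψ x := hΨ.mul_left (χ := fun _ => M⁻¹) contDiff_const
  have hc : ∀ {q : ℝ≥0∞}, q ≤ ofReal M → ofReal M⁻¹ * q ≤ 1 := fun hq => by
    rw [ofReal_inv_of_pos hM]
    exact (mul_le_mul_right hq _).trans (ENNReal.inv_mul_le_one _)
  have h1 : ‖∫ x in U, h x * (M⁻¹ * Ψ x)‖ₑ ≤ negOneNorm U h := by
    refine le_iSup₂_of_le _ hs (le_iSup₂_of_le ?_ ?_ le_rfl)
    · refine (eLpNorm_const_smul M⁻¹ Ψ _ _).trans_le ?_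
      rw [enorm_of_nonneg (inv_pos.2 hM).le]
      exact hc b1
    · refine (eLpNorm_le_mul_eLpNorm_of_ae_le_mul (c := M⁻¹) (of_forall fun x => ?_) 2).trans
        (hc b2)
      rw [fderiv_const_mul (hΨ.differentiable x), norm_smul, norm_of_nonneg (inv_pos.2 hM).le]
  have e : ∫ x in U, h x * Ψ x = M * ∫ x in U, h x * (M⁻¹ * Ψ x) := by
    rw [← integral_const_mul]
    congr 1
    ext x
    field_simp
  rw [e, enorm_mul, enorm_of_nonneg hM.le]
  exact mul_le_mul_right h1 _

lemma tendsto_slice_integral (hi : InitialNegOne (Ioo 0 ρ₀) u 𝟘) {φ : ℝ² → ℝ}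
    (hφ : IsTestFun (Iio T ×ˢ Ioo 0 ρ₀) φ) :
    Tendsto (fun t => ∫ r in Ioo 0 ρ₀, u (t, r) * φ (t, r)) essZeroPlus (𝓝 0) := by
  obtain ⟨C, hC⟩ := hφ.exists_bound
  obtain ⟨C', hC'⟩ := (hφ.fderiv (0, 1)).exists_bound
  set a : ℝ≥0∞ := volume (Ioo 0 ρ₀) ^ ((2 : ℝ≥0∞).toReal)⁻¹
  have haT : a ≠ ⊤ := ENNReal.rpow_ne_top_of_nonneg (by norm_num) (by simp)
  have hC0 : 0 ≤ max C C' := ((norm_nonneg _).trans (hC 0)).trans (le_max_left _ _)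
  have hb : ∀ c ≤ max C C', a * ofReal c ≤ ofReal (a.toReal * max C C' + 1) := fun c hc => by
    have e : a * ofReal c = ofReal (a.toReal * c) := by
      rw [ofReal_mul ENNReal.toReal_nonneg, ofReal_toReal haT]
    rw [e]
    exact ofReal_le_ofReal
      ((mul_le_mul_of_nonneg_left hc ENNReal.toReal_nonneg).trans (by linarith))
  rw [tendsto_zero_iff_enorm_tendsto_zero]
  refine tendsto_zero_of_le_mul (c := ofReal (a.toReal * max C C' + 1)) ofReal_ne_top hi
    (of_forall fun t => ?_)
  simp only [sub_zero]
  refine (hφ.slice t).enorm_integral_le_negOneNorm (h := fun r => u (t, r)) (by positivity)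
    ((eLpNorm_le_of_ae_bound (of_forall fun r => hC _)).trans ?_)
    ((eLpNorm_le_of_ae_bound (C := C') (of_forall fun r => ?_)).trans ?_)
  · rw [restrict_apply_univ]
    exact hb _ (le_max_left _ _)
  · refine ContinuousLinearMap.opNorm_le_bound _ ((norm_nonneg _).trans (hC' 0)) fun x => ?_
    have : fderiv ℝ (fun r => φ (t, r)) r x = x * fderiv ℝ φ (t, r) (0, 1) := by
      rw [← hφ.fderiv_slice, ← smul_eq_mul, ← map_smul, smul_eq_mul, mul_one]
    rw [this, norm_mul, mul_comm]
    exact mul_le_mul_of_nonneg_right (hC' _) (norm_nonneg _)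
  · rw [restrict_apply_univ]
    exact hb _ (le_max_right _ _)

lemma Front.eventually_slice (hF : Front R ρ₀ T ρ) {g : ℝ² → ℝ} (hg : MemLp g 2 (vol (Ω T ρ))) :
    ∀ᶠ t in essZeroPlus, MemLp (fun r => g (t, r)) 2 (vol (Ioo 0 ρ₀)) := by
  have hae : ∀ᶠ t in essZeroPlus, t ∈ Ioo 0 T → MemLp (fun r => g (t, r)) 2 (vol (Ioo 0 (ρ t))) :=
    Eventually.filter_mono inf_le_right (hF.ae_slice hg)
  filter_upwards [hae, mem_essZeroPlus hF.pos_time] with t ht htT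
  exact (ht htT).mono_measure (restrict_mono_set volume (Ioo_subset_Ioo_right (hF.ge t)))

variable (hF : Front R ρ₀ T ρ) (hu : MemLp u 2 (vol (Ω T ρ))) (hutL : MemLp ut 2 (vol (Ω T ρ)))
  (hurL : MemLp ur 2 (vol (Ω T ρ)))
  (hur : HasWeakDeriv (Ω T ρ) (0, 1) u ur)
  (hi : InitialL2 (Ioo 0 ρ₀) u 𝟘) (hi1 : InitialNegOne (Ioo 0 ρ₀) ut 𝟘)

include hF hu hi in
lemma Front.initialNegOne_of_initialL2 : InitialNegOne (Ioo 0 ρ₀) u 𝟘 := by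
  refine tendsto_zero_of_le hi ?_
  filter_upwards [hF.eventually_slice hu] with t ht
  exact negOneNorm_le _ (ht.1.sub aestronglyMeasurable_const)

include hF hu hi in
lemma Front.zeroExt_of_initial {g : ℝ² → ℝ} {e : ℝ²} (hg : MemLp g 2 (vol (Ω T ρ)))
    (hw : HasWeakDeriv (Ω T ρ) e u g) :
    HasWeakDeriv (Iio T ×ˢ Ioo 0 ρ₀) e (zeroExt u) (zeroExt g) := by
  have hui : IntegrableOn u (Ioo 0 T ×ˢ Ioo 0 ρ₀) := (hF.integrable_strip hu).mono_set hF.cylinder_subset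
  refine (hw.mono hF.cylinder_subset).zeroExt hui
    ((hF.integrable_strip hg).mono_set hF.cylinder_subset) fun φ hφ => ?_
  exact tendsto_cutoff_of_slices hF.pos_time hui hφ.continuous hφ.hasCompactSupport
    (tendsto_slice_integral (hF.initialNegOne_of_initialL2 hu hi) hφ)

include hF hu hutL hurL hur hi hi1 in
lemma Front.zeroExt_char {ε : ℝ} {e : ℝ²}
    (hw : HasWeakDeriv (Ω T ρ) e (fun x => ut x + ε * ur x) 𝟘) :
    HasWeakDeriv (Iio T ×ˢ Ioo 0 ρ₀) e (zeroExt fun x => ut x + ε * ur x) 𝟘 := by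
  set Q := Ioo 0 T ×ˢ Ioo 0 ρ₀
  have hQ := hF.cylinder_subset
  have hui : IntegrableOn u Q := (hF.integrable_strip hu).mono_set hQ
  have huti : IntegrableOn ut Q := (hF.integrable_strip hutL).mono_set hQ
  have huri : IntegrableOn ur Q := (hF.integrable_strip hurL).mono_set hQ
  have h0 : zeroExt 𝟘 = 𝟘 := by
    ext x
    simp [zeroExt]
  rw [← h0]
  refine (hw.mono hQ).zeroExt (huti.add (huri.const_mul ε)) integrableOn_zero fun φ hφ => ?_
  have t1 := tendsto_cutoff_of_slices hF.pos_time huti hφ.continuous hφ.hasCompactSupport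
    (tendsto_slice_integral hi1 hφ)
  have hφ' := hφ.fderiv (0, 1)
  have t2 := tendsto_cutoff_of_slices hF.pos_time hui hφ'.continuous hφ'.hasCompactSupport
    (tendsto_slice_integral (hF.initialNegOne_of_initialL2 hu hi) hφ')
  have t3 := t1.sub (t2.const_mul ε)
  rw [mul_zero, sub_zero] at t3
  refine t3.congr fun n => ?_
  obtain ⟨δ, hδ, -, hz⟩ := cutoff_vanish n
  have hc : ContDiff ℝ ∞ (deriv (cutoff n)) := (contDiff_infty_iff_deriv.1 (contDiff_cutoff n)).2
  have hψ := hφ.cutoff_mul hc hδ hz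
  have hd : ∀ x, fderiv ℝ (fun x : ℝ² => deriv (cutoff n) x.1 * φ x) x (0, 1) =
      deriv (cutoff n) x.1 * fderiv ℝ φ x (0, 1) := by
    rintro ⟨t, r⟩
    rw [← (hψ.deriv_space t r).deriv, ← (hφ.deriv_space t r).deriv]
    simp only [deriv_const_mul_field]
  have e1 := (hur.mono hQ).integral_eq _ hψ
  simp only [hd] at e1
  rw [e1]
  have j1 := hψ.integrable_mul huti.locallyIntegrableOn
  have j2 := hψ.integrable_mul huri.locallyIntegrableOn
  simp only [add_mul, mul_assoc]
  rw [integral_add j1.integrableOn (j2.const_mul ε).integrableOn, integral_const_mul]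
  ring

end

section

variable {U : Set ℝ²} {e : ℝ²} {u g : ℝ² → ℝ}

lemma HasWeakDeriv.ae_eq_zero_deriv (hU : IsOpen U) (hw : HasWeakDeriv U e u g)
    (hu : ∀ᵐ x : ℝ², x ∈ U → u x = 0) : ∀ᵐ x : ℝ², x ∈ U → g x = 0 := by
  have h1 : HasWeakDeriv U e u 𝟘 := by
    have h0 : HasWeakDeriv U e (fun _ => (0 : ℝ)) 𝟘 :=
      HasWeakDeriv.of_integral_eq' (locallyIntegrableOn_const 0) (locallyIntegrableOn_const 0)
        (by simp)
    refine h0.congr_ae hU ?_ EventuallyEq.rfl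
    rw [EventuallyEq, ae_restrict_iff' hU.measurableSet]
    exact hu.mono fun x hx hxU => (hx hxU).symm
  exact (ae_restrict_iff' hU.measurableSet).1 (hw.ae_unique hU h1)

lemma HasWeakDeriv.congr_zero (hU : IsOpen U) (hw : HasWeakDeriv U e u g)
    (hg : ∀ᵐ x : ℝ², x ∈ U → g x = 0) : HasWeakDeriv U e u 𝟘 := by
  refine hw.congr_ae hU EventuallyEq.rfl ?_
  rw [EventuallyEq, ae_restrict_iff' hU.measurableSet]
  exact hg

end

section

variable {R ρ₀ T : ℝ} {ρ : ℝ → ℝ} {u p q : ℝ² → ℝ}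

lemma exists_between_max {a b c : ℝ} (h : a < c) (h' : b < c) : ∃ k, a < k ∧ b < k ∧ k < c :=
  (exists_between (max_lt h h')).imp fun _ hk => ⟨(le_max_left _ _).trans_lt hk.1,
    (le_max_right _ _).trans_lt hk.1, hk.2⟩

namespace Front

variable (hF : Front R ρ₀ T ρ)

include hF

lemma lt_frontTime {t r : ℝ} (h : r < ρ t) : frontTime ρ (t + r) < t := by
  by_contra! h1
  have h2 : t + ρ t ≤ _ := hF.strictMono_psi.monotone h1
  beta_reduce at h2
  rw [hF.frontTime_spec] at h2
  linarith

lemma lt_of_frontTime_lt {s ξ : ℝ} (h : frontTime ρ ξ < s) : ξ - s < ρ s := by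
  have h2 := hF.strictMono_psi h
  simp only at h2
  rw [hF.frontTime_spec] at h2
  linarith

lemma back_up_mem {x : ℝ²} (hx : x ∈ Ω T ρ) {s : ℝ} (hs : 0 ≤ s) (h1 : s < x.1)
    (h2 : s < x.2) : x - s • ((1, 1) : ℝ²) ∈ Ω T ρ := by
  obtain ⟨t, r⟩ := x
  obtain ⟨h3, h4, h5, h6⟩ := hx
  have := hF.lip (t - s) t (by linarith)
  simp only at h1 h2 h3 h4 h5 h6
  refine ⟨?_, ?_, ?_, ?_⟩ <;> simp <;> linarith

lemma back_down_mem {x : ℝ²} (hx : x ∈ Ω T ρ) {s : ℝ} (hs : 0 ≤ s)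
    (h0 : ρ₀ ≤ x.1 + x.2) (h1 : s < x.1 - frontTime ρ (x.1 + x.2)) :
    x - s • ((1, -1) : ℝ²) ∈ Ω T ρ := by
  obtain ⟨t, r⟩ := x
  obtain ⟨h3, h4, h5, h6⟩ := hx
  simp only at h0 h1 h3 h4 h5 h6
  have h7 := hF.frontTime_nonneg h0
  have := hF.lt_of_frontTime_lt (s := t - s) (ξ := t + r) (by linarith)
  refine ⟨?_, ?_, ?_, ?_⟩ <;> simp <;> linarith

lemma ae_eq_zero_of_char (hup : HasWeakDeriv (Ω T ρ) (1, 1) u p)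
    (huq : HasWeakDeriv (Ω T ρ) (1, -1) u q)
    (hp : HasWeakDeriv (Ω T ρ) (1, -1) p 𝟘)
    (hq : HasWeakDeriv (Ω T ρ) (1, 1) q 𝟘) {C₀ C₁ : ℝ≥0∞} (hC₀ : C₀ ≠ ⊤)
    (hC₁ : C₁ ≠ ⊤)
    (haxis : ∀ d : ℝ, 0 < d → ∫⁻ x in {x | x ∈ Ω T ρ ∧ |x.2 - 0| ≤ d}, ‖u x‖ₑ ^ 2 ≤
        ofReal (d ^ 2) * C₀)
    (hfront : ∀ d : ℝ, 0 < d → ∫⁻ x in {x | x ∈ Ω T ρ ∧ |x.2 - ρ x.1| ≤ d}, ‖u x‖ₑ ^ 2 ≤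
        ofReal (d ^ 2) * C₁)
    (hp0 : ∀ᵐ x : ℝ², x ∈ Ω T ρ → x.1 + x.2 < ρ₀ → p x = 0)
    (hq0 : ∀ᵐ x : ℝ², x ∈ Ω T ρ → x.1 < x.2 → q x = 0)
    (hu0 : ∀ᵐ x : ℝ², x ∈ Ω T ρ → x.1 < x.2 → x.1 + x.2 < ρ₀ → u x = 0) :
    ∀ᵐ x : ℝ², x ∈ Ω T ρ → u x = 0 := by
  have hS := hF.isOpen_strip
  set U₁ : ℝ → Set ℝ² := fun s => {x | x ∈ Ω T ρ ∧ x.1 + x.2 < s ∧ x.2 < x.1}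
  set U₂ : ℝ → Set ℝ² := fun s => {x | x ∈ Ω T ρ ∧ x.1 - x.2 < s ∧ ρ₀ < x.1 + x.2}
  have oU₁ : ∀ s, IsOpen (U₁ s) := fun s => hS.inter
    ((isOpen_lt (continuous_fst.add continuous_snd) continuous_const).inter
      (isOpen_lt continuous_snd continuous_fst))
  have oU₂ : ∀ s, IsOpen (U₂ s) := fun s => hS.inter
    ((isOpen_lt (continuous_fst.sub continuous_snd) continuous_const).inter
      (isOpen_lt continuous_const (continuous_fst.add continuous_snd)))
  have sU₁ : ∀ s, U₁ s ⊆ Ω T ρ := fun s x hx => hx.1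
  have sU₂ : ∀ s, U₂ s ⊆ Ω T ρ := fun s x hx => hx.1
  have neη : ∀ᵐ x : ℝ², x.2 ≠ x.1 := ae_ne_graph continuous_id
  have neξ : ∀ᵐ x : ℝ², x.2 ≠ ρ₀ - x.1 := ae_ne_graph (a := fun t => ρ₀ - t) (by fun_prop)
  have step1 : ∀ s, (∀ᵐ x : ℝ², x ∈ Ω T ρ → x.1 + x.2 < s → p x = 0) →
      ∀ᵐ x : ℝ², x ∈ U₁ s → u x = 0 := by
    intro s hs
    refine ((hup.mono (sU₁ s)).congr_zero (oU₁ s) (hs.mono fun x hx hxU => hx hxU.1 hxU.2.1)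
      ).ae_eq_zero_of_transport (oU₁ s) measurable_snd (M := R)
      (fun x hx => ⟨hx.1.2.2.1, (hx.1.2.2.2.trans (hF.lt_R _)).le⟩) ?_ hC₀ fun d hd => ?_
    · intro x hx h hh hhx
      refine ⟨⟨hF.back_up_mem hx.1 hh (hhx.trans hx.2.2) hhx, ?_, ?_⟩, ?_⟩
      · have := hx.2.1
        simp
        linarith
      · simpa using hx.2.2
      · simp
    · refine (lintegral_mono_set fun x hx => ?_).trans (haxis d hd)
      refine ⟨hx.1.1, ?_⟩
      rw [sub_zero, abs_of_pos hx.1.1.2.2.1]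
      exact hx.2
  have step2 : ∀ s, (∀ᵐ x : ℝ², x ∈ Ω T ρ → x.1 + x.2 < s → p x = 0) →
      ∀ᵐ x : ℝ², x ∈ Ω T ρ → x.1 - x.2 < s → q x = 0 := by
    intro s hs
    have h1 := (huq.mono (sU₁ s)).ae_eq_zero_deriv (oU₁ s) (step1 s hs)
    filter_upwards [hq.ae_eq_zero_of_propagation hS (oU₁ s) h1, hq0, neη] with x hx hx0 hxη hxS hxs
    rcases lt_or_gt_of_ne hxη with h | h
    · obtain ⟨k, hk0, hk3, hk2⟩ := exists_between_max hxS.2.2.1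
        (by linarith : (x.1 + x.2 - s) / 2 < x.2)
      refine hx ⟨k, hk0, ⟨hF.back_up_mem hxS hk0.le (hk2.trans h) hk2, ?_, ?_⟩, fun s hs => ?_⟩
      · simp
        linarith
      · simpa using h
      · exact hF.back_up_mem hxS hs.1 (hs.2.trans_lt (hk2.trans h)) (hs.2.trans_lt hk2)
    · exact hx0 hxS h
  have step3 : ∀ s, (∀ᵐ x : ℝ², x ∈ Ω T ρ → x.1 - x.2 < s → q x = 0) →
      ∀ᵐ x : ℝ², x ∈ U₂ s → u x = 0 := by
    intro s hs
    have hm : Measurable fun x : ℝ² => x.1 - frontTime ρ (x.1 + x.2) :=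
      measurable_fst.sub (hF.monotone_frontTime.measurable.comp (measurable_fst.add measurable_snd))
    refine ((huq.mono (sU₂ s)).congr_zero (oU₂ s) (hs.mono fun x hx hxU => hx hxU.1 hxU.2.1)
      ).ae_eq_zero_of_transport (oU₂ s) hm (M := T) (C := 4 * C₁)
      (fun x hx => ⟨?_, ?_⟩) ?_ (ENNReal.mul_ne_top (by simp) hC₁) fun d hd => ?_
    · exact sub_pos.2 (hF.lt_frontTime hx.1.2.2.2)
    · linarith [hF.frontTime_nonneg hx.2.2.le, hx.1.2.1]
    · intro x hx h hh hhx
      refine ⟨⟨hF.back_down_mem hx.1 hh hx.2.2.le hhx, ?_, ?_⟩, ?_⟩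
      · have := hx.2.1
        simp
        linarith
      · have := hx.2.2
        simp
        linarith
      · have : x.1 - h + (x.2 + h) = x.1 + x.2 := by ring
        simp [this]
        ring
    · refine (lintegral_mono_set fun x hx => ?_).trans ((hfront (2 * d) (by linarith)).trans_eq ?_)
      · refine ⟨hx.1.1, ?_⟩
        have h1 := hF.frontTime_spec (x.1 + x.2)
        have h2 := hF.lip _ _ (hF.frontTime_le (ρ := ρ) hx.1.1.2.2.2.le)
        have h3 : x.1 - frontTime ρ (x.1 + x.2) ≤ d := hx.2
        rw [abs_of_neg (by linarith [hx.1.1.2.2.2])]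
        linarith
      · rw [mul_pow, ofReal_mul (by positivity)]
        norm_num
        ring
  have step4 : ∀ s, (∀ᵐ x : ℝ², x ∈ Ω T ρ → x.1 - x.2 < s → q x = 0) →
      ∀ᵐ x : ℝ², x ∈ Ω T ρ → x.1 + x.2 < s + 2 * ρ₀ → p x = 0 := by
    intro s hs
    have h1 := (hup.mono (sU₂ s)).ae_eq_zero_deriv (oU₂ s) (step3 s hs)
    filter_upwards [hp.ae_eq_zero_of_propagation hS (oU₂ s) h1, hp0, neξ] with x hx hx0 hxξ hxS hxs
    rcases lt_or_gt_of_ne hxξ with h | h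
    · exact hx0 hxS (by linarith)
    · have h2 := hF.reflected_le (x.1 + x.2)
      rw [hF.reflected_eq] at h2
      obtain ⟨k, hk0, hk3, hk2⟩ := exists_between_max (sub_pos.2 (hF.lt_frontTime hxS.2.2.2))
        (by linarith : (x.1 - x.2 - s) / 2 < _)
      refine hx ⟨k, hk0, ⟨hF.back_down_mem hxS hk0.le (by linarith) hk2, ?_, ?_⟩, fun s hs => ?_⟩
      · simp
        linarith
      · simp
        linarith
      · exact hF.back_down_mem hxS hs.1 (by linarith) (hs.2.trans_lt hk2)
  have all : ∀ n : ℕ, ∀ᵐ x : ℝ², x ∈ Ω T ρ → x.1 + x.2 < ρ₀ + n * (2 * ρ₀) → p x = 0 := by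
    intro n
    induction n with
    | zero => simpa using hp0
    | succ n ih =>
      refine (step4 _ (step2 _ ih)).mono fun x hx hxS hxs => hx hxS (hxs.trans_eq ?_)
      push_cast
      ring
  obtain ⟨n, hn⟩ := exists_nat_gt ((T + R) / (2 * ρ₀))
  rw [div_lt_iff₀ (by linarith [hF.pos])] at hn
  have hpn := all n
  have h0 := hF.pos
  filter_upwards [step1 _ hpn, step3 _ (step2 _ hpn), hu0, neη, neξ] with x h1 h2 h3 h4 h5 hxS
  have hb1 := hxS.2.1
  have hb2 := hxS.2.2.2.trans (hF.lt_R x.1)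
  have hb3 := hxS.2.2.1
  rcases lt_or_gt_of_ne h5 with h | h
  · rcases lt_or_gt_of_ne h4 with h' | h'
    · exact h1 ⟨hxS, by linarith, h'⟩
    · exact h3 hxS h' (by linarith)
  · exact h2 ⟨hxS, by linarith, by linarith⟩

theorem ae_eq_zero_of_wave {ut ur : ℝ² → ℝ} (hu : MemW12 (Ω T ρ) u)
    (htr0 : HasTrace (Ω T ρ) (vol (Ioo 0 T)) (fun t => (t, (0 : ℝ))) u 𝟘)
    (htr1 : HasTrace (Ω T ρ) (vol (Ioo 0 T)) (fun t => (t, ρ t)) u 𝟘)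
    (hi : InitialL2 (Ioo 0 ρ₀) u 𝟘) (hi1 : InitialNegOne (Ioo 0 ρ₀) ut 𝟘)
    (hut : HasWeakDeriv (Ω T ρ) (1, 0) u ut)
    (hur : HasWeakDeriv (Ω T ρ) (0, 1) u ur)
    (heq : ∀ φ : ℝ² → ℝ, IsTestFun (Ω T ρ) φ → ∫ x in Ω T ρ, u x * (□ φ x) = 0) :
    ∀ᵐ x : ℝ², x ∈ Ω T ρ → u x = 0 := by
  have hS := hF.isOpen_strip
  have hutL := hu.memLp_of_hasWeakDeriv hS hut
  have hurL := hu.memLp_of_hasWeakDeriv hS hur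
  obtain ⟨C₀, hC₀, haxis⟩ := hF.small_of_trace_zero hu (continuous_const (y := (0 : ℝ)))
    (fun t _ => ⟨le_rfl, (hF.front_pos t).le⟩) htr0
  obtain ⟨C₁, hC₁, hfront⟩ := hF.small_of_trace_zero hu hF.continuous
    (fun t _ => ⟨(hF.front_pos t).le, le_rfl⟩) htr1
  have hup : HasWeakDeriv (Ω T ρ) (1, 1) u fun x => ut x + 1 * ur x := by
    convert! hut.comb hur 1 1 using 2 <;> simp
  have huq : HasWeakDeriv (Ω T ρ) (1, -1) u fun x => ut x + -1 * ur x := by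
    convert! hut.comb hur 1 (-1) using 2 <;> simp
  have hp := hasWeakDeriv_char hut hur heq (ε := 1) (by norm_num)
  have hq := hasWeakDeriv_char hut hur heq (ε := -1) (by norm_num)
  rw [neg_neg] at hq
  have hupL : MemLp (fun x => ut x + 1 * ur x) 2 (vol (Ω T ρ)) := hutL.add (hurL.const_mul 1)
  set Q : Set ℝ² := Iio T ×ˢ Ioo 0 ρ₀ with hQ
  have oQ : IsOpen Q := isOpen_Iio.prod isOpen_Ioo
  set W : Set ℝ² := {x | x ∈ Q ∧ x.1 < 0}
  have oW : IsOpen W := oQ.inter (isOpen_lt continuous_fst continuous_const)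
  have hW : ∀ f : ℝ² → ℝ, ∀ᵐ x : ℝ², x ∈ W → zeroExt f x = 0 := fun f =>
    of_forall fun x hx => indicator_of_notMem (show x ∉ {x : ℝ² | 0 < x.1} from fun h => lt_asymm h hx.2) _
  have hz : ∀ (f : ℝ² → ℝ) {x : ℝ²}, x ∈ Ω T ρ → zeroExt f x = f x := fun f x hx =>
    indicator_of_mem (show x ∈ {x : ℝ² | 0 < x.1} from hx.1) _
  have hp0 : ∀ᵐ x : ℝ², x ∈ Ω T ρ → x.1 + x.2 < ρ₀ → ut x + 1 * ur x = 0 := by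
    filter_upwards [(hF.zeroExt_char hu.1 hutL hurL hur hi hi1 hp).ae_eq_zero_of_propagation oQ oW
      (hW _)] with x hx hxS hxs
    rw [← hz (fun x => ut x + 1 * ur x) hxS]
    obtain ⟨k, hk1, hk2⟩ := exists_between (show x.1 < ρ₀ - x.2 by linarith)
    obtain ⟨a1, a2, a3, -⟩ := hxS
    refine hx ⟨k, by linarith, ⟨⟨?_, ?_, ?_⟩, ?_⟩, fun s hs => ⟨?_, ?_, ?_⟩⟩ <;> simp <;>
      first | linarith | linarith [hs.1, hs.2]
  have hq00 : ∀ᵐ x : ℝ², x ∈ Ω T ρ → x.2 < ρ₀ → x.1 < x.2 → ut x + -1 * ur x = 0 := by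
    filter_upwards [(hF.zeroExt_char hu.1 hutL hurL hur hi hi1 hq).ae_eq_zero_of_propagation oQ oW
      (hW _)] with x hx hxS hxs hxr
    rw [← hz (fun x => ut x + -1 * ur x) hxS]
    obtain ⟨k, hk1, hk2⟩ := exists_between hxr
    obtain ⟨a1, a2, a3, -⟩ := hxS
    refine hx ⟨k, by linarith, ⟨⟨?_, ?_, ?_⟩, ?_⟩, fun s hs => ⟨?_, ?_, ?_⟩⟩ <;> simp <;>
      first | linarith | linarith [hs.1, hs.2]
  have hq0 : ∀ᵐ x : ℝ², x ∈ Ω T ρ → x.1 < x.2 → ut x + -1 * ur x = 0 := by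
    set V : Set ℝ² := {x | x ∈ Ω T ρ ∧ x.2 < ρ₀ ∧ x.1 < x.2}
    have oV : IsOpen V := hS.inter ((isOpen_lt continuous_snd continuous_const).inter
      (isOpen_lt continuous_fst continuous_snd))
    filter_upwards [hq.ae_eq_zero_of_propagation hS oV
      (hq00.mono fun x hx hxV => hx hxV.1 hxV.2.1 hxV.2.2)] with x hx hxS hxr
    have h1 := hF.lip 0 x.1 hxS.1.le
    rw [hF.init 0 le_rfl] at h1
    obtain ⟨k, hk0, hk3, hk2⟩ := exists_between_max hxS.1 (by linarith [hxS.2.2.2] : x.2 - ρ₀ < x.1)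
    refine hx ⟨k, hk0, ⟨hF.back_up_mem hxS hk0.le hk2 (hk2.trans hxr), ?_, ?_⟩, fun s hs => ?_⟩
    · simp
      linarith
    · simpa using hxr
    · exact hF.back_up_mem hxS hs.1 (hs.2.trans_lt hk2) (hs.2.trans_lt (hk2.trans hxr))
  refine hF.ae_eq_zero_of_char hup huq hp hq hC₀ hC₁ haxis hfront hp0 hq0 ?_
  set V : Set ℝ² := {x | x ∈ Q ∧ x.1 + x.2 < ρ₀}
  have oV : IsOpen V := oQ.inter (isOpen_lt (continuous_fst.add continuous_snd) continuous_const)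
  have hzu : HasWeakDeriv V (1, 1) (zeroExt u) 𝟘 := by
    refine ((hF.zeroExt_of_initial hu.1 hi hupL hup).mono fun x hx => hx.1).congr_zero oV ?_
    filter_upwards [hp0] with x hx hxV
    by_cases h : 0 < x.1
    · have hxS : x ∈ Ω T ρ := hF.cylinder_subset ⟨⟨h, hxV.1.1⟩, hxV.1.2⟩
      rw [hz _ hxS]
      exact hx hxS hxV.2
    · exact indicator_of_notMem (show x ∉ {x : ℝ² | 0 < x.1} from h) _
  filter_upwards [hzu.ae_eq_zero_of_propagation oV (oV.inter oW)
    ((hW u).mono fun x hx hxV => hx hxV.2)] with x hx hxS hxr hxs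
  rw [← hz u hxS]
  obtain ⟨k, hk1, hk2⟩ := exists_between hxr
  obtain ⟨a1, a2, a3, -⟩ := hxS
  refine hx ⟨k, by linarith, ⟨⟨⟨?_, ?_, ?_⟩, ?_⟩, ⟨⟨?_, ?_, ?_⟩, ?_⟩⟩, fun s hs => ⟨⟨?_, ?_, ?_⟩, ?_⟩⟩ <;>
    simp <;> first | linarith | linarith [hs.1, hs.2]

end Front

end

section Generic

variable {E : Type*} [NormedAddCommGroup E] [NormedSpace ℝ E] [MeasureSpace E] [BorelSpace E]
  [FiniteDimensional ℝ E] {U D : Set E}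

lemma MemW12.sub {f g : E → ℝ} (hf : MemW12 U f) (hg : MemW12 U g) :
    MemW12 U fun x => f x - g x := by
  refine ⟨hf.1.sub hg.1, fun e => ?_⟩
  obtain ⟨f', h1, h2⟩ := hf.2 e
  obtain ⟨g', h3, h4⟩ := hg.2 e
  exact ⟨_, h1.sub h3, h2.sub h4⟩

lemma HasTrace.sub_continuousOn {P : Type*} [MeasurableSpace P] {ν : Measure P} {γ : P → E}
    {f h : E → ℝ} {g : P → ℝ} (hf : HasTrace U ν γ f g) (hc : ContinuousOn h (closure U))
    (hh : MemW12 U h) : HasTrace U ν γ (fun x => f x - h x) fun p => g p - h (γ p) := by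
  obtain ⟨φ, h1, h2, h3⟩ := hf
  refine ⟨fun n x => φ n x - h x, fun n => ⟨(h1 n).1.sub hc, (h1 n).2.sub hh⟩, ?_, ?_⟩
  · simpa only [sub_sub_sub_cancel_right] using h2
  · simpa only [sub_sub_sub_cancel_right] using h3

lemma HasTrace.congr_ae {P : Type*} [MeasurableSpace P] {ν : Measure P} {γ : P → E}
    {f : E → ℝ} {g g' : P → ℝ} (hf : HasTrace U ν γ f g) (hg : ∀ᵐ p ∂ν, g p = g' p) :
    HasTrace U ν γ f g' := by
  obtain ⟨φ, h1, h2, h3⟩ := hf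
  refine ⟨φ, h1, h2, h3.congr fun n => eLpNorm_congr_ae ?_⟩
  filter_upwards [hg] with p hp
  rw [hp]

lemma negOneNorm_sub_le {f g : E → ℝ} (hf : LocallyIntegrableOn f U) (hg : LocallyIntegrableOn g U) :
    negOneNorm U (fun x => f x - g x) ≤ negOneNorm U f + negOneNorm U g := by
  refine iSup_le fun ψ => iSup_le fun hψ => iSup_le fun h1 => iSup_le fun h2 => ?_
  simp only [sub_mul]
  rw [integral_sub (hψ.integrable_mul hf).integrableOn (hψ.integrable_mul hg).integrableOn]
  refine enorm_sub_le.trans (add_le_add ?_ ?_) <;>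
  exact le_iSup_of_le ψ (le_iSup_of_le hψ (le_iSup_of_le h1 (le_iSup_of_le h2 le_rfl)))

lemma InitialNegOne.sub {f g : ℝ × E → ℝ} {f₁ : E → ℝ} (hf : InitialNegOne D f f₁)
    (hg : InitialNegOne D g f₁) (h₁ : LocallyIntegrableOn f₁ D)
    (hf' : ∀ᶠ t in essZeroPlus, LocallyIntegrableOn (fun x => f (t, x)) D)
    (hg' : ∀ᶠ t in essZeroPlus, LocallyIntegrableOn (fun x => g (t, x)) D) :
    InitialNegOne D (fun x => f x - g x) 𝟘 := by
  refine tendsto_zero_of_le (by simpa using Tendsto.add hf hg) ?_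
  filter_upwards [hf', hg'] with t h1 h2
  refine le_trans (le_of_eq ?_) (negOneNorm_sub_le (h1.sub h₁) (h2.sub h₁))
  congr 1
  ext x
  simp

lemma InitialL2.sub {f g : ℝ × E → ℝ} {f₀ : E → ℝ} (hf : InitialL2 D f f₀)
    (hg : InitialL2 D g f₀) (h₀ : AEStronglyMeasurable f₀ (vol D))
    (hf' : ∀ᶠ t in essZeroPlus, AEStronglyMeasurable (fun x => f (t, x)) (vol D))
    (hg' : ∀ᶠ t in essZeroPlus, AEStronglyMeasurable (fun x => g (t, x)) (vol D)) :
    InitialL2 D (fun x => f x - g x) 𝟘 := by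
  refine tendsto_zero_of_le (by simpa using Tendsto.add hf hg) ?_
  filter_upwards [hf', hg'] with t h1 h2
  refine le_trans (le_of_eq ?_) (eLpNorm_sub_le (h1.sub h₀) (h2.sub h₀) (by norm_num))
  congr 1
  ext x
  simp

end Generic

/-- Solutions of the wave equation with source `f` in the strip. -/
structure IsForced (ρ₀ T : ℝ) (ρ w v₀ v₁ : ℝ → ℝ) (f v : ℝ² → ℝ) : Prop where
  memW12 : MemW12 (Ω T ρ) v
  trace_zero : HasTrace (Ω T ρ) (vol (Ioo 0 T)) (fun t => (t, (0 : ℝ))) v w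
  trace_front : HasTrace (Ω T ρ) (vol (Ioo 0 T)) (fun t => (t, ρ t)) v 𝟘
  initial : InitialL2 (Ioo 0 ρ₀) v v₀
  equation : ∃ vt : ℝ² → ℝ, HasWeakDeriv (Ω T ρ) (1, 0) v vt ∧ (∀ φ : ℝ² → ℝ, IsTestFun (Ω T ρ) φ →
      ∫ p in Ω T ρ, (v p * (□ φ p) - f p * φ p) = 0) ∧
    InitialNegOne (Ioo 0 ρ₀) vt v₁

section

variable {b α R ρ₀ T : ℝ} {ρ w v₀ v₁ : ℝ → ℝ} {f z p q : ℝ² → ℝ}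

lemma IsWave.isForced (H : IsWave f z p q) (hF : Front R ρ₀ T ρ)
    (haxis : ∀ t ∈ Ioo 0 T, z (t, 0) = w t) (hfront : ∀ t, 0 ≤ t → z (t, ρ t) = 0)
    (hinit : ∀ r ∈ Ioo 0 ρ₀, z (0, r) = v₀ r)
    (hvel : ∀ᵐ r ∂vol (Ioo 0 ρ₀), (p (0, r) + q (0, r)) / 2 = v₁ r) :
    IsForced ρ₀ T ρ w v₀ v₁ f (cutWave T ρ z) where
  memW12 := H.memW12_cut hF
  trace_zero := by
    refine hasTrace_of_continuousOn (continuousOn_cutWave H.continuous) (H.memW12_cut hF) ?_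
    filter_upwards [ae_restrict_mem measurableSet_Ioo] with t ht
    rw [cutWave_eq hF (Ioo_subset_Icc_self ht), indicator_of_mem, haxis t ht]
    exact ⟨le_rfl, (hF.front_pos t).le⟩
  trace_front := by
    refine hasTrace_of_continuousOn (continuousOn_cutWave H.continuous) (H.memW12_cut hF) ?_
    filter_upwards [ae_restrict_mem measurableSet_Ioo] with t ht
    rw [cutWave_eq hF (Ioo_subset_Icc_self ht), indicator_of_mem, hfront t ht.1.le]
    exact ⟨(hF.front_pos t).le, le_rfl⟩
  initial := by
    have h1 := ((isL2Curve_cut_continuous hF H.continuous).tendsto_eLpNorm 0).mono_left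
      essZeroPlus_le
    refine tendsto_zero_of_le h1 ?_
    filter_upwards [mem_essZeroPlus hF.pos_time] with t ht
    refine eLpNorm_restrict_le_of_eqOn _ ?_
    filter_upwards [ae_restrict_mem measurableSet_Ioo] with r hr
    have h2 : r ∈ Ioo 0 (ρ t) := ⟨hr.1, hr.2.trans_le (hF.ge t)⟩
    have h3 : r ∈ Ioo 0 (ρ 0) := ⟨hr.1, hr.2.trans_le (hF.ge 0)⟩
    rw [cutWave_of_mem (show (t, r) ∈ Ω T ρ from ⟨ht.1, ht.2, h2⟩), ← hinit r hr, indicator_of_mem h2, indicator_of_mem h3]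
  equation := by
    refine ⟨_, H.hasWeakDeriv_cut_time hF, fun φ hφ => ?_, ?_⟩
    · have i1 := H.integral_box hφ
      have hl1 : LocallyIntegrableOn z (Ω T ρ) := H.deriv_time.1.mono_set (subset_univ _)
      have hl2 : LocallyIntegrableOn f (Ω T ρ) := H.deriv_deriv.2.mono_set (subset_univ _)
      have hb := hφ.box
      rw [← hφ.setIntegral_mul, ← hb.setIntegral_mul, ← sub_eq_zero, ← integral_sub
        (hb.integrable_mul hl1).integrableOn (hφ.integrable_mul hl2).integrableOn] at i1
      rw [← i1]
      refine integral_congr_ae ?_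
      filter_upwards [hF.ae_mem] with x hx
      rw [cutWave_of_mem hx]
    · have h1 := (H.curve_time.tendsto_eLpNorm 0).mono_left essZeroPlus_le
      refine tendsto_zero_of_le h1 (of_forall fun t => ?_)
      have h2 : (fun r => (p (t, r) + q (t, r)) / 2 - v₁ r) =ᵐ[vol (Ioo 0 ρ₀)]
          fun r => (p (t, r) + q (t, r)) / 2 - (p (0, r) + q (0, r)) / 2 := by
        filter_upwards [hvel] with r hr
        rw [hr]
      refine (negOneNorm_le _ ?_).trans (eLpNorm_restrict_le_of_eqOn _ h2)
      exact (((H.curve_time.memLp t).sub (H.curve_time.memLp 0)).1.restrict).congr h2.symm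

lemma IsForced.isStripSolution {v vt vr : ℝ² → ℝ} (h : IsForced ρ₀ T ρ w v₀ v₁ f v)
    (hS : IsOpen (Ω T ρ)) (hvt : HasWeakDeriv (Ω T ρ) (1, 0) v vt)
    (hvr : HasWeakDeriv (Ω T ρ) (0, 1) v vr)
    (heq : ∀ᵐ x ∂vol (Ω T ρ),
      f x = -(b / (R - x.2) * vr x) - α * vt x) : IsStripSolution b α R ρ₀ T ρ w v₀ v₁ v := by
  obtain ⟨vt', h1, h2, h3⟩ := h.equation
  refine ⟨h.1, h.2, h.3, h.4, vt', vr, h1, hvr, fun φ hφ => ?_, h3⟩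
  rw [← h2 φ hφ]
  refine integral_congr_ae ?_
  filter_upwards [heq, hvt.ae_unique hS h1] with x hx hx'
  rw [hx, hx']
  ring

lemma IsStripSolution.isForced {v vt vr : ℝ² → ℝ} (h : IsStripSolution b α R ρ₀ T ρ w v₀ v₁ v)
    (hS : IsOpen (Ω T ρ)) (hvt : HasWeakDeriv (Ω T ρ) (1, 0) v vt)
    (hvr : HasWeakDeriv (Ω T ρ) (0, 1) v vr)
    (heq : ∀ᵐ x ∂vol (Ω T ρ),
      f x = -(b / (R - x.2) * vr x) - α * vt x) : IsForced ρ₀ T ρ w v₀ v₁ f v := by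
  obtain ⟨vt', vr', h1, h2, h3, h4⟩ := h.equation
  refine ⟨h.1, h.2, h.3, h.4, vt', h1, fun φ hφ => ?_, h4⟩
  rw [← h3 φ hφ]
  refine integral_congr_ae ?_
  filter_upwards [heq, hvt.ae_unique hS h1, hvr.ae_unique hS h2] with x hx hx1 hx2
  rw [hx, hx1, hx2]
  ring

lemma IsForced.ae_eq (hF : Front R ρ₀ T ρ) {v v' : ℝ² → ℝ}
    (h' : IsForced ρ₀ T ρ w v₀ v₁ f v') (h : IsForced ρ₀ T ρ w v₀ v₁ f v)
    (hf : LocallyIntegrableOn f (Ω T ρ))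
    (hc : ContinuousOn v (closure (Ω T ρ))) (haxis : ∀ t ∈ Ioo 0 T, v (t, 0) = w t)
    (hfront : ∀ t ∈ Ioo 0 T, v (t, ρ t) = 0) (h₀ : MemLp v₀ 2 (vol (Ioo 0 ρ₀)))
    (h₁ : MemLp v₁ 2 (vol (Ioo 0 ρ₀))) :
    v' =ᵐ[vol (Ω T ρ)] v := by
  have hS := hF.isOpen_strip
  obtain ⟨vt', a1, a2, a3⟩ := h'.equation
  obtain ⟨vt, b1, b2, b3⟩ := h.equation
  obtain ⟨vr, c1, c2⟩ := h.memW12.2 (0, 1)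
  obtain ⟨vr', c1', c2'⟩ := h'.memW12.2 (0, 1)
  have hvt := h.memW12.memLp_of_hasWeakDeriv hS b1
  have hvt' := h'.memW12.memLp_of_hasWeakDeriv hS a1
  have loc : ∀ {g : ℝ → ℝ}, MemLp g 2 (vol (Ioo 0 ρ₀)) → LocallyIntegrableOn g (Ioo 0 ρ₀) :=
    fun hg => IntegrableOn.locallyIntegrableOn (hg.integrable (by norm_num))
  have key := hF.ae_eq_zero_of_wave (h'.memW12.sub h.memW12)
    ((h'.trace_zero.sub_continuousOn hc h.memW12).congr_ae (by
      filter_upwards [ae_restrict_mem measurableSet_Ioo] with t ht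
      rw [haxis t ht, sub_self]))
    ((h'.trace_front.sub_continuousOn hc h.memW12).congr_ae (by
      filter_upwards [ae_restrict_mem measurableSet_Ioo] with t ht
      rw [hfront t ht, sub_self]))
    (h'.initial.sub h.initial h₀.1 ((hF.eventually_slice h'.memW12.1).mono fun t ht => ht.1)
      ((hF.eventually_slice h.memW12.1).mono fun t ht => ht.1))
    (a3.sub b3 (loc h₁) ((hF.eventually_slice hvt').mono fun t ht => loc ht)
      ((hF.eventually_slice hvt).mono fun t ht => loc ht))
    (a1.sub b1) (c1'.sub c1) fun φ hφ => ?_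
  · rw [EventuallyEq, ae_restrict_iff' hS.measurableSet]
    exact key.mono fun x hx hxS => sub_eq_zero.1 (hx hxS)
  · have i1 := (hφ.box.integrable_mul b1.1).sub (hφ.integrable_mul hf)
    have i2 := (hφ.box.integrable_mul a1.1).sub (hφ.integrable_mul hf)
    have e := integral_sub i2.integrableOn (i1.integrableOn (s := Ω T ρ))
    simp only [Pi.sub_apply] at e
    rw [a2 φ hφ, b2 φ hφ, sub_zero] at e
    rw [← e]
    refine integral_congr_ae (of_forall fun x => ?_)
    simp only
    ring

end

section Data

lemma exists_primitive {a b : ℝ} {g : ℝ → ℝ} (c : ℝ) (hg : MemLp g 2)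
    (h0 : ∀ x, x ∉ Ioo a b → g x = 0) :
    ∃ G : ℝ → ℝ, IsH1 G ∧ (∀ x, G x = c + ∫ s in a..x, g s) ∧ (∀ x, x ≤ a → G x = c) ∧
      (∀ x, b ≤ x → G x = G b) ∧ ∀ x y, G y - G x = ∫ s in x..y, g s := by
  have hi : ∀ x y, IntervalIntegrable g volume x y := fun x y =>
    ((hg.locallyIntegrable (by norm_num)).integrableOn_isCompact isCompact_uIcc).intervalIntegrable
  have hd : ∀ x y, (c + ∫ s in a..y, g s) - (c + ∫ s in a..x, g s) = ∫ s in x..y, g s := by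
    intro x y
    rw [add_sub_add_left_eq_sub, integral_interval_sub_left (hi _ _) (hi _ _)]
  have hz : ∀ x y, (∀ s ∈ uIcc x y, s ∉ Ioo a b) → ∫ s in x..y, g s = 0 := by
    intro x y h
    rw [intervalIntegral.integral_congr (g := fun _ => (0 : ℝ)) fun s hs => h0 s (h s hs)]
    simp
  refine ⟨fun x => c + ∫ s in a..x, g s, IsH1.of_primitive hg hd, fun x => rfl, fun x hx => ?_,
    fun x hx => ?_, hd⟩
  · show c + _ = c
    rw [hz, add_zero]
    rw [uIcc_of_ge hx]
    exact fun s hs hs' => absurd hs'.1 (not_lt.2 hs.2)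
  · refine sub_eq_zero.1 ?_
    rw [hd, hz]
    rw [uIcc_of_le hx]
    exact fun s hs hs' => absurd hs'.2 (not_lt.2 hs.1)

lemma exists_waveData {ρ₀ T : ℝ} {w v₀ v₁ : ℝ → ℝ} (hρ₀ : 0 < ρ₀) (hT : 0 < T)
    (hw : MemW12 (Ioo 0 T) w) (hwc : ContinuousOn w (Icc 0 T)) (hv₀ : MemW12 (Ioo 0 ρ₀) v₀)
    (hvc : ContinuousOn v₀ (Icc 0 ρ₀)) (hv₁ : MemLp v₁ 2 (vol (Ioo 0 ρ₀)))
    (h0 : v₀ 0 = w 0) (h1 : v₀ ρ₀ = 0) :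
    ∃ W V₀ V₁ : ℝ → ℝ, IsWaveData ρ₀ W V₀ V₁ ∧ (∀ t ∈ Icc 0 T, W t = w t) ∧
      (∀ r ∈ Icc 0 ρ₀, V₀ r = v₀ r) ∧
      (∀ a ∈ Icc 0 ρ₀, ∀ b ∈ Icc 0 ρ₀, V₁ b - V₁ a = ∫ s in a..b, v₁ s) ∧
      ∀ᵐ r ∂vol (Ioo 0 ρ₀), deriv V₁ r = v₁ r := by
  obtain ⟨gw, a1, a2, a3⟩ := exists_primitive_of_memW12 hw hwc hT.le
  obtain ⟨gv, b1, b2, b3⟩ := exists_primitive_of_memW12 hv₀ hvc hρ₀.le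
  obtain ⟨W, W1, W2, W3, -, -⟩ := exists_primitive (w 0) a1 a2
  obtain ⟨V₀, A1, A2, A3, A4, -⟩ := exists_primitive (v₀ 0) b1 b2
  have g1 : MemLp ((Ioo 0 ρ₀).indicator v₁) 2 := (memLp_indicator_iff_restrict measurableSet_Ioo).2 hv₁
  obtain ⟨V₁, B1, B2, B3, B4, B5⟩ := exists_primitive 0 g1 fun x hx => indicator_of_notMem hx _
  have hint : ∀ a ∈ Icc 0 ρ₀, ∀ b ∈ Icc 0 ρ₀, V₁ b - V₁ a = ∫ s in a..b, v₁ s := by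
    intro a ha b hb
    rw [B5]
    refine intervalIntegral.integral_congr_ae ?_
    have hne : ∀ᵐ s : ℝ, s ≠ ρ₀ := by simp [ae_iff]
    filter_upwards [hne] with s hs hsab
    refine indicator_of_mem (mem_Ioo.2 ⟨?_, ?_⟩) _
    · exact (le_min ha.1 hb.1).trans_lt hsab.1
    · exact lt_of_le_of_ne (hsab.2.trans (max_le ha.2 hb.2)) hs
  have hW0 := W3 0 le_rfl
  have hV0 := A3 0 le_rfl
  have hVρ : V₀ ρ₀ = 0 := by rw [A2, ← b3 ρ₀ ⟨hρ₀.le, le_rfl⟩, h1]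
  refine ⟨W, V₀, V₁, ⟨W1, A1, B1, fun t ht => by rw [W3 t ht, hW0], fun x hx => by rw [A3 x hx, hV0],
    fun x hx => by rw [A4 x hx, hVρ], B3, B4, by rw [hW0, hV0, h0]⟩,
    fun t ht => by rw [W2, ← a3 t ht], fun r hr => by rw [A2, ← b3 r hr], hint, ?_⟩
  have hl : LocallyIntegrableOn v₁ (Ioo 0 ρ₀) :=
    IntegrableOn.locallyIntegrableOn (hv₁.integrable (by norm_num))
  exact (B1.hasWeakDeriv.mono (subset_univ _)).ae_unique isOpen_Ioo
    (hasWeakDeriv_of_increment hl fun a b ha hab hb =>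
      hint a ⟨ha.le, hab.trans hb.le⟩ b ⟨ha.le.trans hab, hb.le⟩)

end Data

section

variable {R ρ₀ T : ℝ} {ρ W V₀ V₁ : ℝ → ℝ} {f g : ℝ² → ℝ}
local notation "𝒢" => outgoing ρ₀ T ρ W V₀ V₁
local notation "𝒲" => waveSol ρ₀ T ρ W V₀ V₁
local notation "𝒵" => wavePlus ρ₀ T ρ W V₀ V₁
local notation "ℳ" => waveMinus ρ₀ T ρ W V₀ V₁

lemma waveSol_vel (hF : Front R ρ₀ T ρ) (hf : IsSource T R f) (hD : IsWaveData ρ₀ W V₀ V₁) :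
    ∀ᵐ r ∂vol (Ioo 0 ρ₀), (𝒵 f (0, r) + ℳ f (0, r)) / 2 = deriv V₁ r := by
  have d0 : ∀ᵐ r : ℝ, DifferentiableAt ℝ V₀ r := by
    obtain ⟨E, M, h, -⟩ := hD.isH1_pos
    exact h.ae_differentiableAt
  have d1 : ∀ᵐ r : ℝ, DifferentiableAt ℝ V₁ r := by
    obtain ⟨E, M, h, -⟩ := hD.isH1_vel
    exact h.ae_differentiableAt
  filter_upwards [ae_restrict_of_ae d0, ae_restrict_of_ae d1, ae_restrict_mem measurableSet_Ioo]
    with r h0 h1 hr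
  have e1 : incoming ρ₀ T ρ W V₀ V₁ f =ᶠ[𝓝 r] incomingInit ρ₀ V₀ V₁ := by
    filter_upwards [Iio_mem_nhds hr.2] with x hx
    exact incoming_of_le hF hf hD (le_of_lt hx)
  have e2 : 𝒢 f =ᶠ[𝓝 (-r)] outgoingInit ρ₀ V₀ V₁ := by
    filter_upwards [Iio_mem_nhds (neg_lt_zero.2 hr.1)] with x hx
    exact outgoing_of_nonpos hF hf hD (le_of_lt hx)
  have i1 : HasDerivAt (incomingInit ρ₀ V₀ V₁) ((deriv V₀ r + deriv V₁ r) / 2) r := by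
    exact ((h0.hasDerivAt.add h1.hasDerivAt).div_const 2).sub_const (V₁ ρ₀ / 2)
  have i2 : HasDerivAt (outgoingInit ρ₀ V₀ V₁) ((-deriv V₀ r + deriv V₁ r) / 2) (-r) := by
    have k0 : HasDerivAt (fun x => V₀ (-x)) (-deriv V₀ r) (-r) := by
      have := HasDerivAt.comp (-r) (h₂ := V₀) (h := fun x => -x) (h₂' := deriv V₀ r)
        (by rw [neg_neg]; exact h0.hasDerivAt) (hasDerivAt_neg (-r))
      simpa [Function.comp_def] using this
    have k1 : HasDerivAt (fun x => V₁ (-x)) (-deriv V₁ r) (-r) := by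
      have := HasDerivAt.comp (-r) (h₂ := V₁) (h := fun x => -x) (h₂' := deriv V₁ r)
        (by rw [neg_neg]; exact h1.hasDerivAt) (hasDerivAt_neg (-r))
      simpa [Function.comp_def] using this
    have := ((k0.sub k1).div_const 2).add_const (V₁ ρ₀ / 2)
    convert! this using 1
    ring
  have a1 : r + 1 * 0 = r := by ring
  have a2 : -(r + -1 * 0) = -r := by ring
  simp only [wavePlus, waveMinus]
  rw [hf.charDeriv_eq_zero 1 le_rfl, hf.charDeriv_eq_zero (-1) le_rfl, a1, a2, e1.deriv_eq, e2.deriv_eq,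
    i1.deriv, i2.deriv]
  ring

lemma retarded_congr (h : f =ᵐ[volume] g) : retarded f = retarded g := by
  ext p
  rw [retarded, retarded, integral_congr_ae (ae_restrict_of_ae h)]

lemma waveSol_congr (h : f =ᵐ[volume] g) : 𝒲 f = 𝒲 g := by
  have h0 := retarded_congr h
  ext p
  simp only [waveSol, incoming, outgoing, outgoingJump, axisTrace, frontTrace, h0]

lemma IsSource.sub (hf : IsSource T R f) (hg : IsSource T R g) : IsSource T R fun x => f x - g x :=
  ⟨hf.measurable.sub hg.measurable, hf.memLp.sub hg.memLp, fun p hp => by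
    rw [hf.zero p hp, hg.zero p hp, sub_zero]⟩

lemma IsSource.retarded_sub (hf : IsSource T R f) (hg : IsSource T R g) (p : ℝ²) :
    retarded (fun x => f x - g x) p = retarded f p - retarded g p := by
  rw [retarded, retarded, retarded,
    integral_sub hf.integrable.integrableOn hg.integrable.integrableOn]
  ring

lemma waveSol_sub (hf : IsSource T R f) (hg : IsSource T R g) (p : ℝ²) :
    waveSol ρ₀ T ρ 𝟘 𝟘 𝟘 (fun x => f x - g x) p = 𝒲 f p - 𝒲 g p := by
  have hJ : ∀ x, outgoingJump ρ₀ ρ 𝟘 𝟘 𝟘 (fun x => f x - g x) x =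
      outgoingJump ρ₀ ρ W V₀ V₁ f x - outgoingJump ρ₀ ρ W V₀ V₁ g x := by
    intro x
    simp only [outgoingJump, outgoingInit, incomingInit, axisTrace, frontTrace, hf.retarded_sub hg]
    ring
  have hO : ∀ x, outgoing ρ₀ T ρ 𝟘 𝟘 𝟘 (fun x => f x - g x) x = 𝒢 f x - 𝒢 g x := by
    intro x
    simp only [outgoing, hJ, Finset.sum_sub_distrib]
  simp only [waveSol, incoming, incomingInit, frontTrace, hf.retarded_sub hg, hO]
  ring

lemma wavePlus_sub (hF : Front R ρ₀ T ρ) (hD : IsWaveData ρ₀ W V₀ V₁) (hf : IsSource T R f)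
    (hg : IsSource T R g) :
    (∀ᵐ p, wavePlus ρ₀ T ρ 𝟘 𝟘 𝟘 (fun x => f x - g x) p = 𝒵 f p - 𝒵 g p) ∧
    ∀ᵐ p, waveMinus ρ₀ T ρ 𝟘 𝟘 𝟘 (fun x => f x - g x) p = ℳ f p - ℳ g p := by
  have H0 := isWave_waveSol hF (hf.sub hg) (IsWaveData.zero ρ₀)
  have H1 := isWave_waveSol hF hf hD
  have H2 := isWave_waveSol hF hg hD
  have he : waveSol ρ₀ T ρ 𝟘 𝟘 𝟘 (fun x => f x - g x) = fun p => 𝒲 f p - 𝒲 g p :=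
    funext fun p => waveSol_sub hf hg p
  have k1 := H0.deriv_p
  have k2 := H0.deriv_q
  rw [he] at k1 k2
  have e1 := k1.ae_unique isOpen_univ (H1.deriv_p.sub H2.deriv_p)
  have e2 := k2.ae_unique isOpen_univ (H1.deriv_q.sub H2.deriv_q)
  rw [Measure.restrict_univ] at e1 e2
  exact ⟨e1, e2⟩

theorem exists_energy_bound (ρ₀ T : ℝ) : ∃ C : ℝ, 0 ≤ C ∧ ∀ {R : ℝ} {ρ : ℝ → ℝ} {f : ℝ² → ℝ},
    Front R ρ₀ T ρ → IsSource T R f → ∀ t ∈ Ioo 0 T, (∫⁻ r in Ioo 0 (ρ t),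
        ‖wavePlus ρ₀ T ρ 𝟘 𝟘 𝟘 f (t, r)‖ₑ ^ 2 ≤ ofReal (C * pastEnergy f t)) ∧
      ∫⁻ r in Ioo 0 (ρ t), ‖waveMinus ρ₀ T ρ 𝟘 𝟘 𝟘 f (t, r)‖ₑ ^ 2 ≤
          ofReal (C * pastEnergy f t) := by
  obtain ⟨C, hC, hb⟩ := exists_travelling_bound ρ₀ T
  refine ⟨2 * |T| + 8 * C, by positivity, ?_⟩
  intro R ρ f hF hf t ht
  obtain ⟨b1, b2⟩ := hb hF hf t ht.1.le
  have he := hf.pastEnergy_nonneg t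
  have key : ∀ (ε : ℝ) (D : ℝ → ℝ), Measurable D →
      ∫⁻ r in Ioo 0 (ρ t), ‖D r‖ₑ ^ 2 ≤ ofReal (C * pastEnergy f t) →
      ∫⁻ r in Ioo 0 (ρ t), ‖charDeriv ε f (t, r) + 2 * D r‖ₑ ^ 2 ≤
        ofReal ((2 * |T| + 8 * C) * pastEnergy f t) := by
    intro ε D hDm hD
    have h1 : ∫⁻ r in Ioo 0 (ρ t), ‖charDeriv ε f (t, r)‖ₑ ^ 2 ≤ ofReal (|T| * pastEnergy f t) := by
      refine (setLIntegral_le_lintegral _ _).trans ((hf.lintegral_charDeriv_le ε ht.1.le).trans ?_)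
      exact ofReal_le_ofReal (mul_le_mul_of_nonneg_right (ht.2.le.trans (le_abs_self T)) he)
    calc ∫⁻ r in Ioo 0 (ρ t), ‖charDeriv ε f (t, r) + 2 * D r‖ₑ ^ 2
        ≤ ∫⁻ r in Ioo 0 (ρ t), (2 * ‖charDeriv ε f (t, r)‖ₑ ^ 2 + 8 * ‖D r‖ₑ ^ 2) := by
          refine lintegral_mono fun r => (enorm_add_sq_le _ _).trans_eq ?_
          rw [enorm_mul, mul_pow]
          congr 1
          rw [← mul_assoc]
          congr 1
          rw [Real.enorm_eq_ofReal (by norm_num), ← ofReal_pow (by norm_num)]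
          norm_num
      _ = 2 * (∫⁻ r in Ioo 0 (ρ t), ‖charDeriv ε f (t, r)‖ₑ ^ 2) +
          8 * ∫⁻ r in Ioo 0 (ρ t), ‖D r‖ₑ ^ 2 := by
          rw [lintegral_add_right _ ((hDm.enorm.pow_const 2).const_mul 8),
            lintegral_const_mul' _ _ (by simp), lintegral_const_mul' _ _ (by simp)]
      _ ≤ 2 * ofReal (|T| * pastEnergy f t) + 8 * ofReal (C * pastEnergy f t) := by gcongr
      _ = _ := by
          rw [show (2 : ℝ≥0∞) = ofReal 2 by simp, show (8 : ℝ≥0∞) = ofReal 8 by simp,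
            ← ofReal_mul (by norm_num), ← ofReal_mul (by norm_num),
            ← ofReal_add (by positivity) (by positivity)]
          congr 1
          ring
  constructor
  · refine key 1 _ ((measurable_deriv _).comp (by fun_prop)) (le_trans ?_ b1)
    set h : ℝ → ℝ≥0∞ := fun x => ‖deriv (incoming ρ₀ T ρ 𝟘 𝟘 𝟘 f) x‖ₑ ^ 2
    have e1 := (measurePreserving_add_right volume (1 * t)).setLIntegral_comp_preimage
      (measurableSet_Iic (a := t + ρ t)) ((measurable_deriv _).enorm.pow_const 2 : Measurable h)
    rw [← e1]
    refine lintegral_mono_set fun r hr => ?_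
    show r + 1 * t ≤ t + ρ t
    linarith [hr.2]
  · refine key (-1) _ ((measurable_deriv _).comp (by fun_prop)) (le_trans ?_ b2)
    set h : ℝ → ℝ≥0∞ := fun x => ‖deriv (outgoing ρ₀ T ρ 𝟘 𝟘 𝟘 f) x‖ₑ ^ 2
    have hmp : MeasurePreserving (fun r : ℝ => -(r + -1 * t)) volume volume :=
      (measurePreserving_neg volume).comp (measurePreserving_add_right volume (-1 * t))
    have e1 := hmp.setLIntegral_comp_preimage
      (measurableSet_Iic (a := t)) ((measurable_deriv _).enorm.pow_const 2 : Measurable h)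
    rw [← e1]
    refine lintegral_mono_set fun r hr => ?_
    show -(r + -1 * t) ≤ t
    linarith [hr.1]

end

lemma lintegral_exp_Ici {μ : ℝ} (hμ : 0 < μ) (a : ℝ) : ∫⁻ t in Ici a, ofReal (exp (-(μ * t))) =
      ofReal μ⁻¹ * ofReal (exp (-(μ * a))) := by
  rw [setLIntegral_congr Ioi_ae_eq_Ici.symm]
  simp_rw [← neg_mul]
  rw [← ofReal_integral_eq_lintegral_ofReal (integrableOn_exp_mul_Ioi (by linarith) a)
    (of_forall fun _ => (Real.exp_pos _).le), integral_exp_mul_Ioi (by linarith),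
    ← ofReal_mul (by positivity)]
  congr 1
  field_simp

/-- The source that the lower order terms of the equation generate. -/
def dampedSource (b α R ρ₀ T : ℝ) (ρ W V₀ V₁ : ℝ → ℝ) (f : ℝ² → ℝ) (x : ℝ²) : ℝ := -(b / (R - x.2) *
      ((wavePlus ρ₀ T ρ W V₀ V₁ f x - waveMinus ρ₀ T ρ W V₀ V₁ f x) / 2)) -
    α * ((wavePlus ρ₀ T ρ W V₀ V₁ f x + waveMinus ρ₀ T ρ W V₀ V₁ f x) / 2)

section

variable {b α R ρ₀ T : ℝ} {ρ W V₀ V₁ : ℝ → ℝ} {f g : ℝ² → ℝ}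
local notation:max "𝒮" b:max α:max => dampedSource b α R ρ₀ T ρ W V₀ V₁

lemma Front.abs_coeff_le (hF : Front R ρ₀ T ρ) {x : ℝ²} (hx : x ∈ Ω T ρ) :
    |b / (R - x.2)| ≤ |b| / (R - ρ T) := by
  have h1 : R - ρ T ≤ R - x.2 := by linarith [hx.2.2.2, hF.le x.1]
  have h2 : 0 < R - ρ T := sub_pos.2 hF.lt
  rw [abs_div, abs_of_pos (h2.trans_le h1)]
  gcongr

lemma Front.memLp_lower_order (hF : Front R ρ₀ T ρ) {ut ur : ℝ² → ℝ} (b α : ℝ)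
    (hut : MemLp ut 2 (vol (Ω T ρ)))
    (hur : MemLp ur 2 (vol (Ω T ρ))) :
    MemLp (fun x => -(b / (R - x.2) * ur x) - α * ut x) 2 (vol (Ω T ρ)) := by
  refine MemLp.sub (MemLp.neg ?_) (hut.const_mul α)
  refine hur.of_le_mul (c := |b| / (R - ρ T)) ?_ ?_
  · refine AEStronglyMeasurable.mul ?_ hur.1
    have : Measurable fun x : ℝ² => b / (R - x.2) :=
      measurable_const.div (measurable_const.sub measurable_snd)
    exact this.aestronglyMeasurable
  · filter_upwards [hF.ae_mem] with x hx
    rw [norm_mul]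
    exact mul_le_mul_of_nonneg_right (hF.abs_coeff_le hx) (norm_nonneg _)

lemma memLp_dampedSource (hF : Front R ρ₀ T ρ) (hD : IsWaveData ρ₀ W V₀ V₁)
    (hf : IsSource T R f) (b α : ℝ) :
    MemLp (𝒮 b α f) 2 (vol (Ω T ρ)) := by
  have H := isWave_waveSol hF hf hD
  exact hF.memLp_lower_order b α (hF.memLp_strip H.curve_time H.measurable_time)
    (hF.memLp_strip H.curve_space H.measurable_space)

lemma lintegral_pastEnergy_le (hf : IsSource T R f) {μ : ℝ} (hμ : 0 < μ) :
    ∫⁻ t in Ioo 0 T, ofReal (exp (-(μ * t))) * ofReal (pastEnergy f t) ≤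
      ofReal μ⁻¹ * ∫⁻ q, ofReal (exp (-(μ * q.1))) * ‖f q‖ₑ ^ 2 := by
  have hS : MeasurableSet {x : ℝ × ℝ² | x.2.1 ≤ x.1} :=
    measurableSet_le (measurable_fst.comp measurable_snd) measurable_fst
  set k : ℝ → ℝ² → ℝ≥0∞ := fun t q => {x : ℝ × ℝ² | x.2.1 ≤ x.1}.indicator
    (fun x => ofReal (exp (-(μ * x.1))) * ‖f x.2‖ₑ ^ 2) (t, q) with hk
  have hkm : Measurable (Function.uncurry k) := by
    refine Measurable.indicator (f := fun x : ℝ × ℝ² =>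
      ofReal (exp (-(μ * x.1))) * ‖f x.2‖ₑ ^ 2) ?_ hS
    exact (by fun_prop : Measurable fun x : ℝ × ℝ² =>
      ofReal (exp (-(μ * x.1)))).mul
      ((hf.measurable.comp measurable_snd).enorm.pow_const 2)
  have e1 : ∀ t, ofReal (exp (-(μ * t))) * ofReal (pastEnergy f t) = ∫⁻ q, k t q := by
    intro t
    rw [pastEnergy, ← hf.lintegral_sq_eq, ← lintegral_const_mul' _ _ ofReal_ne_top,
      ← lintegral_indicator (measurableSet_le measurable_fst measurable_const)]
    rfl
  have e2 : ∀ q : ℝ², ∫⁻ t, k t q = ofReal μ⁻¹ * (ofReal (exp (-(μ * q.1))) * ‖f q‖ₑ ^ 2) := by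
    intro q
    rw [← mul_assoc, ← lintegral_exp_Ici hμ, ← lintegral_mul_const' _ _ (by simp),
      ← lintegral_indicator measurableSet_Ici]
    rfl
  calc _ ≤ ∫⁻ t, ∫⁻ q, k t q := by
        simp_rw [e1]
        exact setLIntegral_le_lintegral _ _
    _ = ∫⁻ q, ∫⁻ t, k t q := lintegral_lintegral_swap hkm.aemeasurable
    _ = _ := by
        simp_rw [e2]
        rw [lintegral_const_mul' _ _ ofReal_ne_top]

lemma exists_weighted_bound (hF : Front R ρ₀ T ρ) (hD : IsWaveData ρ₀ W V₀ V₁) (b α : ℝ) :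
    ∃ K : ℝ, 0 ≤ K ∧ ∀ {f g : ℝ² → ℝ} {μ : ℝ}, 0 < μ → IsSource T R f → IsSource T R g →
      ∫⁻ x in Ω T ρ, ofReal (exp (-(μ * x.1))) * ‖𝒮 b α f x - 𝒮 b α g x‖ₑ ^ 2 ≤
      ofReal (K / μ) * ∫⁻ x, ofReal (exp (-(μ * x.1))) * ‖f x - g x‖ₑ ^ 2 := by
  obtain ⟨C, hC, hb⟩ := exists_energy_bound ρ₀ T
  have hS := hF.measurableSet_strip
  set A : ℝ := |b| / (R - ρ T) + |α|
  have hA : 0 ≤ A := add_nonneg (div_nonneg (abs_nonneg _) (sub_pos.2 hF.lt).le) (abs_nonneg _)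
  refine ⟨4 * A ^ 2 * C, by positivity, ?_⟩
  intro f g μ hμ hf hg
  have hh := hf.sub hg
  set P := wavePlus ρ₀ T ρ 𝟘 𝟘 𝟘 fun x => f x - g x with hP
  set Q := waveMinus ρ₀ T ρ 𝟘 𝟘 𝟘 fun x => f x - g x with hQ
  have H := isWave_waveSol hF hh (IsWaveData.zero ρ₀)
  obtain ⟨d1, d2⟩ := wavePlus_sub hF hD hf hg
  have hPm : AEStronglyMeasurable P volume :=
    (locallyIntegrableOn_univ.1 H.deriv_p.2).aestronglyMeasurable
  have hQm : AEStronglyMeasurable Q volume :=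
    (locallyIntegrableOn_univ.1 H.deriv_q.2).aestronglyMeasurable
  have hw : Measurable fun x : ℝ² => ofReal (exp (-(μ * x.1))) := by fun_prop
  have hbound : ∀ᵐ x ∂vol (Ω T ρ), ‖𝒮 b α f x - 𝒮 b α g x‖ₑ ^ 2 ≤
        ofReal (2 * A ^ 2) * (‖P x‖ₑ ^ 2 + ‖Q x‖ₑ ^ 2) := by
    filter_upwards [ae_restrict_of_ae d1, ae_restrict_of_ae d2, ae_restrict_mem hS] with x h1 h2 hx
    rw [← hP] at h1
    rw [← hQ] at h2
    have e : 𝒮 b α f x - 𝒮 b α g x =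
        -(b / (R - x.2) * ((P x - Q x) / 2)) - α * ((P x + Q x) / 2) := by
      rw [h1, h2, dampedSource, dampedSource]
      ring
    rw [e, ← ofReal_sq_eq_enorm, ← ofReal_sq_eq_enorm, ← ofReal_sq_eq_enorm,
      ← ofReal_add (sq_nonneg _) (sq_nonneg _), ← ofReal_mul (by positivity)]
    refine ofReal_le_ofReal ?_
    have hc := hF.abs_coeff_le (b := b) hx
    have k1 : |(P x - Q x) / 2| ≤ (|P x| + |Q x|) / 2 := by
      rw [abs_div, abs_two]
      linarith [abs_sub (P x) (Q x)]
    have k2 : |(P x + Q x) / 2| ≤ (|P x| + |Q x|) / 2 := by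
      rw [abs_div, abs_two]
      linarith [abs_add_le (P x) (Q x)]
    have k3 : |(-(b / (R - x.2) * ((P x - Q x) / 2)) - α * ((P x + Q x) / 2))| ≤
        A * ((|P x| + |Q x|) / 2) := by
      refine (abs_sub _ _).trans ?_
      rw [abs_neg, abs_mul, abs_mul, add_mul]
      refine add_le_add (mul_le_mul hc k1 (abs_nonneg _) ((abs_nonneg _).trans hc))
        (mul_le_mul_of_nonneg_left k2 (abs_nonneg _))
    rw [← sq_abs]
    refine (pow_le_pow_left₀ (abs_nonneg _) k3 2).trans ?_
    rw [mul_pow]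
    have k4 : ((|P x| + |Q x|) / 2) ^ 2 ≤ P x ^ 2 + Q x ^ 2 := by
      rw [← sq_abs (P x), ← sq_abs (Q x)]
      nlinarith [sq_nonneg (|P x| - |Q x|), sq_nonneg (|P x| + |Q x|)]
    nlinarith [mul_le_mul_of_nonneg_left k4 (sq_nonneg A), sq_nonneg A, sq_nonneg (P x),
      sq_nonneg (Q x), mul_nonneg (sq_nonneg A) (add_nonneg (sq_nonneg (P x)) (sq_nonneg (Q x)))]
  have hm : AEMeasurable (fun x : ℝ² => ofReal (exp (-(μ * x.1))) *
      (ofReal (2 * A ^ 2) * (‖P x‖ₑ ^ 2 + ‖Q x‖ₑ ^ 2))) (vol (Ω T ρ)) :=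
    hw.aemeasurable.mul (((hPm.restrict.enorm.pow_const 2).add
      (hQm.restrict.enorm.pow_const 2)).const_mul _)
  calc _ ≤ ∫⁻ x in Ω T ρ, ofReal (exp (-(μ * x.1))) *
      (ofReal (2 * A ^ 2) * (‖P x‖ₑ ^ 2 + ‖Q x‖ₑ ^ 2)) := by
        refine lintegral_mono_ae ?_
        filter_upwards [hbound] with x hx
        gcongr
    _ = ∫⁻ t in Ioo 0 T, ∫⁻ r in Ioo 0 (ρ t), ofReal (exp (-(μ * t))) *
      (ofReal (2 * A ^ 2) * (‖P (t, r)‖ₑ ^ 2 + ‖Q (t, r)‖ₑ ^ 2)) :=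
        hF.measurePreserving_restrict_strip _ hm
    _ ≤ ∫⁻ t in Ioo 0 T, ofReal (4 * A ^ 2 * C) * (ofReal (exp (-(μ * t))) *
          ofReal (pastEnergy (fun x => f x - g x) t)) := by
        refine setLIntegral_mono' measurableSet_Ioo fun t ht => ?_
        obtain ⟨b1, b2⟩ := hb hF hh t ht
        have he := hh.pastEnergy_nonneg t
        rw [lintegral_const_mul' _ _ ofReal_ne_top, lintegral_const_mul' _ _ ofReal_ne_top,
          lintegral_add_left' ((H.curve_p.memLp t).1.restrict.enorm.pow_const 2),
          mul_left_comm (ofReal (4 * A ^ 2 * C))]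
        refine mul_le_mul' le_rfl ?_
        calc _ ≤ ofReal (2 * A ^ 2) * (ofReal (C * pastEnergy (fun x => f x - g x) t) +
              ofReal (C * pastEnergy (fun x => f x - g x) t)) := by
              gcongr
          _ = _ := by
              rw [← ofReal_add (by positivity) (by positivity), ← ofReal_mul (by positivity),
                ← ofReal_mul (mul_nonneg (mul_nonneg (by norm_num) (sq_nonneg A)) hC)]
              congr 1
              ring
    _ ≤ _ := by
        rw [lintegral_const_mul' _ _ ofReal_ne_top]
        refine (mul_le_mul_right (lintegral_pastEnergy_le hh hμ) _).trans_eq ?_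
        rw [← mul_assoc, ← ofReal_mul (by positivity), div_eq_mul_inv]

lemma Front.isSource_indicator (hF : Front R ρ₀ T ρ) (hf : Measurable f)
    (hf2 : MemLp f 2 (vol (Ω T ρ))) :
    IsSource T R ((Ω T ρ).indicator f) := by
  have hS := hF.measurableSet_strip
  refine ⟨hf.indicator hS, (memLp_indicator_iff_restrict hS).2 hf2, fun p hp =>
    indicator_of_notMem (fun h => hp ⟨⟨h.1, h.2.1⟩, h.2.2.1, h.2.2.2.trans (hF.lt_R _)⟩) _⟩

end

section

variable {b α R ρ₀ T : ℝ} {ρ w v₀ v₁ W V₀ V₁ : ℝ → ℝ} {f g : ℝ² → ℝ}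
local notation "𝒲" => waveSol ρ₀ T ρ W V₀ V₁
local notation:max "𝒮" b:max α:max => dampedSource b α R ρ₀ T ρ W V₀ V₁

lemma ae_eq_of_weighted_bound {μ : ℝ} (hf : IsSource T R f) (hg : IsSource T R g) (hμ : 0 < μ)
    (h : ∫⁻ x, ofReal (exp (-(μ * x.1))) * ‖f x - g x‖ₑ ^ 2 ≤
      ofReal (1 / 4) * ∫⁻ x, ofReal (exp (-(μ * x.1))) * ‖f x - g x‖ₑ ^ 2) :
    f =ᵐ[volume] g := by
  set I := ∫⁻ x, ofReal (exp (-(μ * x.1))) * ‖f x - g x‖ₑ ^ 2 with hI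
  have hfin : I ≠ ⊤ := by
    have hlt : ∫⁻ x, ‖f x - g x‖ₑ ^ 2 < ⊤ := by
      rw [← eLpNorm_two_sq]
      exact ENNReal.pow_lt_top (hf.sub hg).memLp.2
    refine ((lintegral_mono fun x => ?_).trans_lt hlt).ne
    by_cases hx : x ∈ Ioo 0 T ×ˢ Ioo 0 R
    · refine mul_le_of_le_one_left zero_le ?_
      rw [ofReal_le_one, Real.exp_le_one_iff]
      have := mul_pos hμ hx.1.1
      linarith
    · rw [hf.zero x hx, hg.zero x hx]
      simp
  have h0 : I = 0 := by
    by_contra hne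
    have h1 : ofReal (1 / 4) * I < 1 * I := by
      refine ENNReal.mul_lt_mul_left hne hfin ?_
      rw [ofReal_lt_one]
      norm_num
    rw [one_mul] at h1
    exact absurd h (not_le.2 h1)
  have hm : Measurable fun x : ℝ² => ofReal (exp (-(μ * x.1))) * ‖f x - g x‖ₑ ^ 2 :=
    (by fun_prop : Measurable fun x : ℝ² => ofReal (exp (-(μ * x.1)))).mul
      ((hf.measurable.sub hg.measurable).enorm.pow_const 2)
  rw [hI, lintegral_eq_zero_iff hm] at h0
  filter_upwards [h0] with x hx
  have h1 : ofReal (exp (-(μ * x.1))) ≠ 0 := by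
    rw [Ne, ofReal_eq_zero, not_le]
    exact Real.exp_pos _
  have h2 := (mul_eq_zero.1 hx).resolve_left h1
  exact sub_eq_zero.1 (by simpa using h2)

variable (hF : Front R ρ₀ T ρ) (hD : IsWaveData ρ₀ W V₀ V₁)
include hF hD

lemma dampedSource_unique
    (hf : IsSource T R f) (hg : IsSource T R g) (hf0 : ∀ x, x ∉ Ω T ρ → f x = 0)
    (hg0 : ∀ x, x ∉ Ω T ρ → g x = 0)
    (hf1 : ∀ᵐ x ∂vol (Ω T ρ), f x = 𝒮 b α f x)
    (hg1 : ∀ᵐ x ∂vol (Ω T ρ), g x = 𝒮 b α g x) :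
    f =ᵐ[volume] g := by
  obtain ⟨K, hK, hb⟩ := exists_weighted_bound hF hD b α
  have hμ : 0 < 4 * K + 1 := by positivity
  refine ae_eq_of_weighted_bound hf hg hμ (le_trans (le_of_eq ?_) ((hb hμ hf hg).trans
    (mul_le_mul_left (ofReal_le_ofReal ?_) _)))
  · rw [← setLIntegral_eq_of_support_subset (s := Ω T ρ)]
    · refine lintegral_congr_ae ?_
      filter_upwards [hf1, hg1] with x h1 h2
      rw [← h1, ← h2]
    · intro x hx
      by_contra hx'
      exact hx (by simp [hf0 x hx', hg0 x hx'])
  · rw [div_le_div_iff₀ hμ (by norm_num)]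
    linarith

theorem exists_dampedSource (b α : ℝ) :
    ∃ f, IsSource T R f ∧ (∀ x, x ∉ Ω T ρ → f x = 0) ∧ ∀ᵐ x ∂vol (Ω T ρ), f x = 𝒮 b α f x := by
  obtain ⟨K, hK, hb⟩ := exists_weighted_bound hF hD b α
  have hS := hF.measurableSet_strip
  set μ : ℝ := 4 * K + 1 with hμ'
  have hμ : 0 < μ := by positivity
  set S := Ω T ρ with hSdef
  set X := Lp ℝ 2 (vol S)
  have hexp : ∀ (c : ℝ) {h : ℝ² → ℝ}, MemLp h 2 (vol S) →
      MemLp (fun x => exp (c * x.1) * h x) 2 (vol S) := by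
    intro c h hh
    refine hh.of_le_mul (c := exp (|c| * T)) ?_ ?_
    · refine AEStronglyMeasurable.mul ?_ hh.1
      exact (by fun_prop : Continuous fun x : ℝ² => exp (c * x.1)).aestronglyMeasurable
    · filter_upwards [ae_restrict_mem hS] with x hx
      rw [norm_mul, norm_of_nonneg (Real.exp_pos _).le]
      refine mul_le_mul_of_nonneg_right (Real.exp_le_exp.2 ?_) (norm_nonneg _)
      exact mul_le_mul (le_abs_self c) hx.2.1.le hx.1.le (abs_nonneg _)
  set src : X → ℝ² → ℝ := fun F => S.indicator fun x => exp (μ / 2 * x.1) * F x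
  have hsrc : ∀ F, IsSource T R (src F) := fun F =>
    hF.isSource_indicator ((by fun_prop : Measurable fun x : ℝ² => exp (μ / 2 * x.1)).mul
      (Lp.stronglyMeasurable F).measurable) (hexp _ (Lp.memLp F))
  have hΦ : ∀ F, MemLp (fun x => exp (-(μ / 2) * x.1) * 𝒮 b α (src F) x) 2 (vol S) := fun F =>
    hexp _ (memLp_dampedSource hF hD (hsrc F) b α)
  set Ψ : X → X := fun F => (hΦ F).toLp _
  have hsq : ∀ (x : ℝ²) (a : ℝ), ‖exp (-(μ / 2) * x.1) * a‖ₑ ^ 2 =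
      ofReal (exp (-(μ * x.1))) * ‖a‖ₑ ^ 2 := by
    intro x a
    rw [enorm_mul, mul_pow, Real.enorm_eq_ofReal (Real.exp_pos _).le,
      ← ofReal_pow (Real.exp_pos _).le, ← Real.exp_nat_mul]
    congr 3
    push_cast
    ring
  have hcontr : ContractingWith (1 / 2) Ψ := by
    refine ⟨by norm_num, fun F G => ?_⟩
    rw [Lp.edist_toLp_toLp, Lp.edist_def]
    refine (ENNReal.pow_le_pow_left_iff two_ne_zero).1 ?_
    rw [eLpNorm_two_sq, mul_pow, eLpNorm_two_sq]
    simp only [Pi.sub_apply, ← mul_sub, hsq]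
    refine (hb hμ (hsrc F) (hsrc G)).trans (mul_le_mul' ?_ (le_of_eq ?_))
    · rw [show ((1 / 2 : NNReal) : ℝ≥0∞) = ofReal (1 / 2) by
          rw [← ofReal_coe_nnreal]; push_cast; rfl,
        ← ofReal_pow (by norm_num)]
      refine ofReal_le_ofReal ?_
      rw [hμ', div_le_iff₀ (by positivity)]
      linarith
    · rw [← setLIntegral_eq_of_support_subset (s := S)]
      · refine setLIntegral_congr_fun hS fun x hx => ?_
        simp only [src, indicator_of_mem hx]
        rw [← hsq, ← mul_sub, ← mul_assoc, ← Real.exp_add]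
        simp
      · intro x hx
        by_contra hx'
        exact hx (by simp [src, indicator_of_notMem hx'])
  obtain ⟨F, hfix, -⟩ := hcontr.exists_fixedPoint 0 (edist_ne_top _ _)
  refine ⟨src F, hsrc F, fun x hx => indicator_of_notMem hx _, ?_⟩
  have h1 : (fun x => exp (-(μ / 2) * x.1) * 𝒮 b α (src F) x) =ᵐ[vol S] F := by
    conv_rhs => rw [← hfix.eq]
    exact (hΦ F).coeFn_toLp.symm
  filter_upwards [h1, ae_restrict_mem hS] with x hx hxS
  simp only [src]
  rw [indicator_of_mem hxS, ← hx, ← mul_assoc, ← Real.exp_add]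
  simp [src]

theorem exists_stripSolution (b α : ℝ)
    (hw : ∀ t ∈ Icc 0 T, W t = w t) (hv₀ : ∀ r ∈ Icc 0 ρ₀, V₀ r = v₀ r)
    (hv₁ : ∀ᵐ r ∂vol (Ioo 0 ρ₀), deriv V₁ r = v₁ r) :
    ∃ f, IsSource T R f ∧ (∀ x, x ∉ Ω T ρ → f x = 0) ∧ (∀ᵐ x ∂vol (Ω T ρ), f x = 𝒮 b α f x) ∧
      IsStripSolution b α R ρ₀ T ρ w v₀ v₁ (cutWave T ρ (𝒲 f)) ∧
      ∀ v', IsStripSolution b α R ρ₀ T ρ w v₀ v₁ v' → v' =ᵐ[vol (Ω T ρ)] cutWave T ρ (𝒲 f) := by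
  obtain ⟨f, hf, hf0, hfix⟩ := exists_dampedSource hF hD b α
  have hS := hF.isOpen_strip
  have hforced : ∀ {g : ℝ² → ℝ}, IsSource T R g →
      IsForced ρ₀ T ρ w v₀ v₁ g (cutWave T ρ (𝒲 g)) := by
    intro g hg
    refine (isWave_waveSol hF hg hD).isForced hF (fun t ht => ?_) (fun t ht => waveSol_front hF hg hD ht)
      (fun r hr => ?_) ?_
    · rw [waveSol_axis hF hg hD (Ioo_subset_Icc_self ht), hw t (Ioo_subset_Icc_self ht)]
    · rw [waveSol_init hF hg hD hr.1.le hr.2.le, hv₀ r (Ioo_subset_Icc_self hr)]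
    · filter_upwards [waveSol_vel hF hg hD, hv₁] with r h1 h2
      rw [h1, h2]
  have hL0 : MemLp v₀ 2 (vol (Ioo 0 ρ₀)) := by
    have h1 : MemLp V₀ 2 (vol (Ioo 0 ρ₀)) := by
      obtain ⟨C, hC⟩ := (isCompact_Icc (a := (0 : ℝ)) (b := ρ₀)).exists_bound_of_continuousOn
        hD.isH1_pos.continuous.continuousOn
      refine MemLp.of_bound hD.isH1_pos.continuous.aestronglyMeasurable C ?_
      filter_upwards [ae_restrict_mem measurableSet_Ioo] with x hx
      exact hC x (Ioo_subset_Icc_self hx)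
    refine h1.ae_eq ?_
    filter_upwards [ae_restrict_mem measurableSet_Ioo] with x hx
    exact hv₀ x (Ioo_subset_Icc_self hx)
  have hL1 : MemLp v₁ 2 (vol (Ioo 0 ρ₀)) := (hD.isH1_vel.memLp_deriv.restrict _).ae_eq hv₁
  refine ⟨f, hf, hf0, hfix, ?_, fun v' hv' => ?_⟩
  · have H := isWave_waveSol hF hf hD
    exact (hforced hf).isStripSolution hS (H.hasWeakDeriv_cut_time hF) (H.hasWeakDeriv_cut_space hF) hfix
  · obtain ⟨vt, a1, a2⟩ := hv'.memW12.2 (1, 0)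
    obtain ⟨vr, b1, b2⟩ := hv'.memW12.2 (0, 1)
    have hg2 := hF.memLp_lower_order b α a2 b2
    obtain ⟨g', hg', hgg'⟩ := hg2.1
    have hgS := hF.isSource_indicator hg'.measurable (hg2.ae_eq hgg')
    set g := (Ω T ρ).indicator g' with hg
    have hg1 : ∀ᵐ x ∂vol (Ω T ρ), g x = -(b / (R - x.2) * vr x) - α * vt x := by
      filter_upwards [hgg', ae_restrict_mem hS.measurableSet] with x h1 h2
      rw [hg, indicator_of_mem h2, ← h1]
    have H := isWave_waveSol hF hgS hD
    have hcl0 : ∀ t ∈ Ioo 0 T, ((t, 0) : ℝ²) ∈ closure (Ω T ρ) ∧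
        ((t, ρ t) : ℝ²) ∈ closure (Ω T ρ) := by
      intro t ht
      rw [hF.closure_strip]
      exact ⟨⟨ht.1.le, ht.2.le, le_rfl, (hF.front_pos t).le⟩,
        ⟨ht.1.le, ht.2.le, (hF.front_pos t).le, le_rfl⟩⟩
    have e1 := (hv'.isForced hS a1 b1 hg1).ae_eq hF (hforced hgS)
      ((hgS.memLp.locallyIntegrable (by norm_num)).locallyIntegrableOn _)
      (continuousOn_cutWave H.continuous)
      (fun t ht => by
        rw [cutWave, indicator_of_mem (hcl0 t ht).1, waveSol_axis hF hgS hD (Ioo_subset_Icc_self ht),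
          hw t (Ioo_subset_Icc_self ht)])
      (fun t ht => by
        rw [cutWave, indicator_of_mem (hcl0 t ht).2, waveSol_front hF hgS hD ht.1.le]) hL0 hL1
    have e2 := (a1.congr_ae hS e1 EventuallyEq.rfl).ae_unique hS (H.hasWeakDeriv_cut_time hF)
    have e3 := (b1.congr_ae hS e1 EventuallyEq.rfl).ae_unique hS (H.hasWeakDeriv_cut_space hF)
    have e4 : g =ᵐ[volume] f := by
      refine dampedSource_unique hF hD hgS hf (fun x hx => indicator_of_notMem hx _) hf0 ?_ hfix
      filter_upwards [hg1, e2, e3] with x h1 h2 h3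
      rw [h1, h2, h3, dampedSource]
    rw [← waveSol_congr e4]
    exact e1

end

section Front

variable {b α R ρ₀ T : ℝ} {ρ ρ' w v₀ v₁ : ℝ → ℝ} {v : ℝ² → ℝ}

lemma IsStripSolution.congr_front (h : IsStripSolution b α R ρ₀ T ρ w v₀ v₁ v)
    (hag : ∀ t ∈ Icc 0 T, ρ t = ρ' t) : IsStripSolution b α R ρ₀ T ρ' w v₀ v₁ v := by
  have e := stripDomain_congr hag
  refine ⟨e ▸ h.memW12, e ▸ h.trace_zero, ?_, h.initial, e ▸ h.equation⟩
  obtain ⟨φ, h1, h2, h3⟩ := h.trace_front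
  rw [← e]
  refine ⟨φ, h1, h2, h3.congr fun n => eLpNorm_congr_ae ?_⟩
  filter_upwards [ae_restrict_mem measurableSet_Ioo] with t ht
  rw [hag t (Ioo_subset_Icc_self ht)]

lemma depCone_eq (t r : ℝ) : depCone T ρ t r = Ω T ρ ∩ cone (t, r) := by
  ext q
  constructor
  · rintro ⟨h1, h2, h3, h4, h5⟩
    exact ⟨h1, by simp only; linarith, by simp only; linarith⟩
  · rintro ⟨h1, h2, h3⟩
    simp only at h2 h3
    exact ⟨h1, h1.1.le, by linarith, by linarith, by linarith⟩

end Front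

section Formula

open Front

variable {R ρ₀ T : ℝ} {ρ ρ' w v₀ v₁ W V₀ V₁ : ℝ → ℝ} {f : ℝ² → ℝ}

lemma Front.psiInv_eq (hF : Front R ρ₀ T ρ') (hag : ∀ t ∈ Icc 0 T, ρ t = ρ' t) {s : ℝ}
    (hs : frontTime ρ' s ∈ Icc 0 T) : psiInv T ρ s = frontTime ρ' s := by
  have hex : ∃ t ∈ Icc 0 T, t + ρ t = s := ⟨_, hs, by rw [hag _ hs, hF.frontTime_spec]⟩
  have h1 : psiInv T ρ s ∈ Icc 0 T := Function.invFunOn_mem hex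
  have h2 : psiInv T ρ s + ρ (psiInv T ρ s) = s := Function.invFunOn_eq (f := fun t => t + ρ t) hex
  rw [hag _ h1] at h2
  rw [← hF.frontTime_psi (psiInv T ρ s), h2]

lemma setIntegral_depCone (hf0 : ∀ x, x ∉ Ω T ρ → f x = 0) (t r : ℝ) :
    ∫ q in depCone T ρ t r, f q = 2 * retarded f (t, r) := by
  rw [depCone_eq, retarded, mul_div_cancel₀ _ two_ne_zero]
  exact (setIntegral_eq_of_subset_of_forall_sdiff_eq_zero (measurableSet_cone _) inter_subset_right
    fun x hx => hf0 x fun h => hx.2 ⟨h, hx.1⟩).symm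

lemma setIntegral_depCone_diff (hf : Integrable f) (hS : MeasurableSet (Ω T ρ))
    (hf0 : ∀ x, x ∉ Ω T ρ → f x = 0) {t r t' r' : ℝ} (h1 : t' + r' ≤ t + r)
    (h2 : t' - r' ≤ t - r) :
    ∫ q in depCone T ρ t r \ depCone T ρ t' r', f q =
      2 * retarded f (t, r) - 2 * retarded f (t', r') := by
  rw [setIntegral_sdiff _ hf.integrableOn, setIntegral_depCone hf0, setIntegral_depCone hf0]
  · rw [depCone_eq, depCone_eq]
    exact inter_subset_inter_right _ (cone_mono h1 h2)
  · rw [depCone_eq]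
    exact hS.inter (measurableSet_cone _)

lemma waveSol_eq_dAlembert (hF : Front R ρ₀ T ρ') (hag : ∀ t ∈ Icc 0 T, ρ t = ρ' t)
    (hf : IsSource T R f) (hf0 : ∀ x, x ∉ Ω T ρ → f x = 0) (hD : IsWaveData ρ₀ W V₀ V₁)
    (hw : ∀ t ∈ Icc 0 T, W t = w t) (hv₀ : ∀ r ∈ Icc 0 ρ₀, V₀ r = v₀ r)
    (hv₁ : ∀ a ∈ Icc 0 ρ₀, ∀ b ∈ Icc 0 ρ₀, V₁ b - V₁ a = ∫ s in a..b, v₁ s) :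
    ∀ᵐ p ∂vol (omegaPrime ρ₀ T ρ), waveSol ρ₀ T ρ' W V₀ V₁ f p =
      dAlembert ρ₀ T ρ w v₀ v₁ p + (∫ q in coneP ρ₀ T ρ p.1 p.2, f q) / 2 := by
  have hSeq := stripDomain_congr hag
  have hS : IsOpen (Ω T ρ) := by
    rw [hSeq]
    exact hF.isOpen_strip
  have hSm := hS.measurableSet
  have hO : MeasurableSet (omegaPrime ρ₀ T ρ) := by
    have m1 : Measurable fun p : ℝ² => p.1 + p.2 := measurable_fst.add measurable_snd
    exact ((hSm.inter ((measurableSet_le measurable_fst measurable_snd).inter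
      (measurableSet_le m1 measurable_const))).union
      (hSm.inter ((measurableSet_lt measurable_snd measurable_fst).inter
      (measurableSet_lt m1 measurable_const)))).union
      (hSm.inter ((measurableSet_lt measurable_fst measurable_snd).inter
      (measurableSet_lt measurable_const m1)))
  have neη : ∀ᵐ x : ℝ², x.2 ≠ x.1 := ae_ne_graph continuous_id
  have neξ : ∀ᵐ x : ℝ², x.2 ≠ ρ₀ - x.1 := ae_ne_graph (a := fun t => ρ₀ - t) (by fun_prop)
  have h0 := hF.pos
  filter_upwards [ae_restrict_mem hO, ae_restrict_of_ae neη, ae_restrict_of_ae neξ] with p hp hη hξ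
  obtain ⟨t, r⟩ := p
  have hξ' : t + r ≠ ρ₀ := fun h => hξ (by simp only; linarith)
  simp only at hη
  rcases hp with (⟨hpS, h1, h2⟩ | ⟨hpS, h1, h2⟩) | ⟨hpS, h1, h2⟩ <;> simp only at h1 h2 <;>
    have a1 := hpS.1 <;> have a2 := hpS.2.1 <;> have a3 := hpS.2.2.1 <;> simp only at a1 a2 a3
  · have h1' : t < r := lt_of_le_of_ne h1 (Ne.symm hη)
    have h2' : t + r < ρ₀ := lt_of_le_of_ne h2 hξ'
    rw [dAlembert, if_pos ⟨hpS, h1, h2⟩, coneP, if_pos ⟨h1', h2'⟩, setIntegral_depCone hf0,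
      waveSol, incoming_of_le hF hf hD h2, outgoing_of_nonpos hF hf hD (by simp only; linarith),
      incomingInit, outgoingInit]
    simp only [neg_sub]
    rw [← hv₁ (r - t) ⟨by linarith, by linarith⟩ (r + t) ⟨by linarith, by linarith⟩,
      ← hv₀ (r - t) ⟨by linarith, by linarith⟩, ← hv₀ (r + t) ⟨by linarith, by linarith⟩, add_comm t r]
    ring
  · have n1 : (t, r) ∉ omegaOne ρ₀ T ρ := fun h => absurd h.2.1 (not_le.2 h1)
    have hle : reflectBack ρ' (t - r) ≤ -ρ₀ := by
      have := hF.reflectBack_le (t - r)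
      rw [max_eq_left (by linarith)] at this
      linarith
    rw [dAlembert, if_neg n1, if_pos ⟨hpS, h1, h2⟩, coneP, if_neg (fun h => absurd h.1 (not_lt.2 h1.le)),
      if_pos ⟨h1, h2⟩, setIntegral_depCone_diff hf.integrable hSm hf0 (by linarith) (by linarith),
      waveSol, incoming_of_le hF hf hD h2.le]
    simp only
    rw [outgoing_eq hF hf hD (by linarith), outgoing_of_le hF hf hD hle, outgoingJump,
      max_eq_left (by linarith), frontTrace_of_le hF hf (by linarith), outgoingInit, incomingInit,
      incomingInit, incomingInit, axisTrace, hD.compat, hD.pos_left (-(t - r)) (by linarith),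
      hD.vel_left (-(t - r)) (by linarith), hD.vel_left 0 le_rfl, hw (t - r) ⟨by linarith, by linarith⟩]
    rw [← hv₁ (t - r) ⟨by linarith, by linarith⟩ (t + r) ⟨by linarith, by linarith⟩,
      ← hv₀ (t - r) ⟨by linarith, by linarith⟩, ← hv₀ (r + t) ⟨by linarith, by linarith⟩, add_comm r t]
    ring
  · have n1 : (t, r) ∉ omegaOne ρ₀ T ρ := fun h => absurd h.2.2 (not_le.2 h2)
    have n2 : (t, r) ∉ omegaTwo ρ₀ T ρ := fun h => absurd h.2.1 (not_lt.2 h1.le)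
    have hft : frontTime ρ' (t + r) ≤ t := hF.frontTime_le (by
      rw [hSeq] at hpS
      exact hpS.2.2.2.le)
    have hft0 := hF.frontTime_nonneg h2.le
    have hftm : frontTime ρ' (t + r) ∈ Icc 0 T := ⟨hft0, hft.trans a2.le⟩
    have hpsi := hF.psiInv_eq hag hftm
    have hpsi' : psiInv T ρ (r + t) = frontTime ρ' (t + r) := by rw [add_comm r t, hpsi]
    have hrefl : omegaRefl ρ₀ T ρ (r + t) = reflected ρ' (t + r) := by
      rw [omegaRefl, if_pos (by linarith), hpsi', hag _ hftm, reflected]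
    have hr1 := hF.reflected_eq (t + r)
    have hr2 : -ρ₀ ≤ reflected ρ' (t + r) := by
      have := hF.monotone_reflected h2.le
      rw [hF.reflected_eq ρ₀, hF.frontTime_init] at this
      linarith
    have hspec := hF.frontTime_spec (t + r)
    rw [dAlembert, if_neg n1, if_neg n2, if_pos ⟨hpS, h1, h2⟩, coneP,
      if_neg (fun h => absurd h.2 (not_lt.2 h2.le)), if_neg (fun h => absurd h.2 (not_lt.2 h2.le)),
      if_pos ⟨h1, h2⟩]
    simp only
    rw [hrefl, hpsi, hag _ hftm, setIntegral_depCone_diff hf.integrable hSm hf0 hspec.le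
      (by rw [reflected] at hr1; linarith), waveSol]
    simp only
    rw [incoming_of_ge hF hf hD h2.le, outgoing_of_nonpos hF hf hD (by linarith),
      outgoing_of_nonpos hF hf hD (by linarith), outgoingInit, outgoingInit, frontTrace]
    rw [← hv₁ (r - t) ⟨by linarith, by linarith⟩ (-reflected ρ' (t + r)) ⟨by linarith, by linarith⟩,
      ← hv₀ (r - t) ⟨by linarith, by linarith⟩, ← hv₀ (-reflected ρ' (t + r)) ⟨by linarith, by linarith⟩,
      neg_sub]
    ring

end Formula

theorem strip_wellposed {R ρ₀ T α : ℝ} (hρ₀ : 0 < ρ₀) (hT : 0 < T) {ρ : ℝ → ℝ}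
    (hρ : IsFront R ρ₀ T ρ) {w : ℝ → ℝ} (hw : MemW12 (Ioo 0 T) w) (hwc : ContinuousOn w (Icc 0 T))
    {v₀ v₁ : ℝ → ℝ} (hv₀ : MemW12 (Ioo 0 ρ₀) v₀) (hvc : ContinuousOn v₀ (Icc 0 ρ₀))
    (hv₁ : MemLp v₁ 2 (vol (Ioo 0 ρ₀))) (h0 : v₀ 0 = w 0) (h1 : v₀ ρ₀ = 0) :
    ∃ v : ℝ² → ℝ, IsStripSolution 1 α R ρ₀ T ρ w v₀ v₁ v ∧
      (∀ v' : ℝ² → ℝ, IsStripSolution 1 α R ρ₀ T ρ w v₀ v₁ v' → v' =ᵐ[vol (Ω T ρ)] v) ∧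
      (∃ vFree : ℝ² → ℝ, IsStripSolution 0 0 R ρ₀ T ρ w v₀ v₁ vFree ∧
        (∀ v' : ℝ² → ℝ, IsStripSolution 0 0 R ρ₀ T ρ w v₀ v₁ v' → v' =ᵐ[vol (Ω T ρ)] vFree) ∧
        (∀ᵐ p ∂vol (omegaPrime ρ₀ T ρ), vFree p = dAlembert ρ₀ T ρ w v₀ v₁ p) ∧
        ∀ vt vr : ℝ² → ℝ, HasWeakDeriv (Ω T ρ) (1, 0) v vt → HasWeakDeriv (Ω T ρ) (0, 1) v vr →
          ∀ᵐ p ∂vol (omegaPrime ρ₀ T ρ), v p = vFree p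
              + (∫ q in coneP ρ₀ T ρ p.1 p.2, (-(vr q / (R - q.2)) - α * vt q)) / 2) ∧
      ContinuousOn v (closure (Ω T ρ)) ∧
      (∀ p, p ∉ closure (Ω T ρ) → v p = 0) ∧
      IsC0W12 R T v ∧ IsC1L2 R T v := by
  set ρ' := frontExt T ρ with hρ'
  have hF : Front R ρ₀ T ρ' := hρ.front hρ₀ hT
  have hag : ∀ t ∈ Icc 0 T, ρ t = ρ' t := fun t ht => (frontExt_eq ht).symm
  have hag' : ∀ t ∈ Icc 0 T, ρ' t = ρ t := fun t ht => frontExt_eq ht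
  have hSeq := stripDomain_congr hag
  obtain ⟨W, V₀, V₁, hD, dW, dV, dV1, dV1'⟩ := exists_waveData hρ₀ hT hw hwc hv₀ hvc hv₁ h0 h1
  obtain ⟨f, hf, hf0, hfix, hsol, huniq⟩ := exists_stripSolution hF hD 1 α dW dV dV1'
  obtain ⟨g, hg, hg0, hgfix, hgsol, hguniq⟩ := exists_stripSolution hF hD 0 0 dW dV dV1'
  have hS := hF.isOpen_strip
  have H := isWave_waveSol hF hf hD
  have hfront : ∀ t, 0 ≤ t → waveSol ρ₀ T ρ' W V₀ V₁ f (t, ρ' t) = 0 := fun t ht =>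
    waveSol_front hF hf hD ht
  have hsub : omegaPrime ρ₀ T ρ ⊆ Ω T ρ' := by
    rw [← hSeq]
    rintro p ((hp | hp) | hp) <;> exact hp.1
  have hg_zero : g =ᵐ[volume] 𝟘 := by
    filter_upwards [(ae_restrict_iff' hS.measurableSet).1 hgfix] with x hx
    by_cases h : x ∈ Ω T ρ'
    · rw [hx h, dampedSource]
      simp
    · exact hg0 x h
  have hdA := waveSol_eq_dAlembert hF hag hf (by rwa [hSeq]) hD dW dV dV1
  have hdA0 := waveSol_eq_dAlembert hF hag hg (by rwa [hSeq]) hD dW dV dV1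
  have hmem : ∀ᵐ p ∂vol (omegaPrime ρ₀ T ρ), p ∈ Ω T ρ' := by
    have := ae_restrict_mem (μ := volume) hS.measurableSet
    exact ae_restrict_of_ae_restrict_of_subset hsub this
  have hfree : ∀ᵐ p ∂vol (omegaPrime ρ₀ T ρ),
      cutWave T ρ' (waveSol ρ₀ T ρ' W V₀ V₁ g) p = dAlembert ρ₀ T ρ w v₀ v₁ p := by
    filter_upwards [hdA0, hmem] with p hp hpS
    rw [cutWave_of_mem hpS, hp, integral_congr_ae (ae_restrict_of_ae hg_zero)]
    simp
  refine ⟨cutWave T ρ' (waveSol ρ₀ T ρ' W V₀ V₁ f), hsol.congr_front hag', fun v' hv' => ?_,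
    ⟨cutWave T ρ' (waveSol ρ₀ T ρ' W V₀ V₁ g), hgsol.congr_front hag', fun v' hv' => ?_, hfree,
      fun vt vr hvt hvr => ?_⟩, ?_, fun p hp => ?_, H.isC0W12 hF hfront, H.isC1L2 hF hfront⟩
  · rw [hSeq]
    exact huniq v' (hv'.congr_front hag)
  · rw [hSeq]
    exact hguniq v' (hv'.congr_front hag)
  · rw [hSeq] at hvt hvr
    have e1 := hvt.ae_unique hS (H.hasWeakDeriv_cut_time hF)
    have e2 := hvr.ae_unique hS (H.hasWeakDeriv_cut_space hF)
    filter_upwards [hdA, hmem, hfree] with p hp hpS hpf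
    rw [cutWave_of_mem hpS, hp, hpf]
    congr 2
    have hsubC : coneP ρ₀ T ρ p.1 p.2 ⊆ Ω T ρ' := by
      rw [← hSeq, coneP]
      split_ifs
      · exact fun x hx => hx.1
      · exact fun x hx => hx.1.1
      · exact fun x hx => hx.1.1
      · exact empty_subset _
    refine integral_congr_ae (ae_restrict_of_ae_restrict_of_subset hsubC ?_)
    filter_upwards [hfix, e1, e2] with x hx h2 h3
    rw [hx, dampedSource, h2, h3]
    ring
  · rw [hSeq]
    exact continuousOn_cutWave H.continuous
  · rw [hSeq] at hp
    exact indicator_of_notMem hp _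

lemma polarPoint_apply_zero (s θ : ℝ) : polarPoint s θ 0 = s * Real.cos θ := rfl

lemma polarPoint_apply_one (s θ : ℝ) : polarPoint s θ 1 = s * Real.sin θ := rfl

lemma norm_polarPoint (s θ : ℝ) : ‖polarPoint s θ‖ = |s| := by
  rw [EuclideanSpace.norm_eq, Fin.sum_univ_two, polarPoint_apply_zero, polarPoint_apply_one,
    Real.norm_eq_abs, Real.norm_eq_abs, sq_abs, sq_abs, ← Real.sqrt_sq_eq_abs]
  congr 1
  linear_combination s ^ 2 * Real.sin_sq_add_cos_sq θ

lemma continuous_polarPoint : Continuous fun q : ℝ² => polarPoint q.1 q.2 := by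
  unfold polarPoint
  fun_prop

lemma lintegral_plane (h : Plane → ℝ≥0∞) : ∫⁻ x, h x = ∫⁻ p : ℝ², h !₂[p.1, p.2] := by
  have hmp := (volume_preserving_finTwoArrow ℝ).comp
    (EuclideanSpace.volume_preserving_symm_measurableEquiv_toLp (Fin 2))
  have := hmp.lintegral_comp_emb (MeasurableEquiv.finTwoArrow.measurableEmbedding.comp
    (MeasurableEquiv.toLp 2 (Fin 2 → ℝ)).symm.measurableEmbedding) fun p => h !₂[p.1, p.2]
  rw [← this]
  refine lintegral_congr fun x => ?_
  congr 1
  ext i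
  fin_cases i <;> rfl

lemma lintegral_polar {h : Plane → ℝ≥0∞} (hh : Measurable h) (R : ℝ) :
    ∫⁻ x, h x = ∫⁻ r in Iio R, ∫⁻ θ in Ioo 0 (2 * π),
      ofReal (R - r) * h (polarPoint (R - r) θ) := by
  have hm : Measurable fun q : ℝ² => ofReal q.1 * h (polarPoint q.1 q.2) :=
    (ENNReal.measurable_ofReal.comp measurable_fst).mul (hh.comp continuous_polarPoint.measurable)
  set g : ℝ → ℝ → ℝ≥0∞ := fun s θ => ofReal s * h (polarPoint s θ)
  have hg : ∀ s, Measurable (g s) := fun s => hm.comp measurable_prodMk_left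
  have hG : Measurable fun s => ∫⁻ θ in Ioo 0 (2 * π), g s θ := hm.lintegral_prod_right'
  have e1 : ∫⁻ x, h x = ∫⁻ p : ℝ² in Ioi 0 ×ˢ Ioo (-π) π, g p.1 (p.2 + π) := by
    rw [← lintegral_neg_eq_self, lintegral_plane, ← lintegral_comp_polarCoord_symm, polarCoord_target]
    refine lintegral_congr fun p => ?_
    rw [polarCoord_symm_apply, smul_eq_mul]
    simp only [g]
    congr 2
    ext i
    fin_cases i
    · simp [polarPoint_apply_zero, Real.cos_add_pi]
    · simp [polarPoint_apply_one, Real.sin_add_pi]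
  have e2 : ∀ s, ∫⁻ θ in Ioo (-π) π, g s (θ + π) = ∫⁻ θ in Ioo 0 (2 * π), g s θ := by
    intro s
    rw [← (measurePreserving_add_right volume π).setLIntegral_comp_preimage measurableSet_Ioo
      (hg s)]
    congr 2
    ext θ
    simp only [mem_preimage, mem_Ioo]
    constructor <;> rintro ⟨h1, h2⟩ <;> constructor <;> linarith
  have e3 : ∫⁻ r in Iio R, ∫⁻ θ in Ioo 0 (2 * π), g (R - r) θ =
      ∫⁻ s in Ioi 0, ∫⁻ θ in Ioo 0 (2 * π), g s θ := by
    have hs : MeasurePreserving (fun r : ℝ => R - r) volume volume := by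
      simpa only [sub_eq_add_neg] using! (measurePreserving_add_left volume R).comp
        (measurePreserving_neg (volume : Measure ℝ))
    rw [← hs.setLIntegral_comp_preimage measurableSet_Ioi hG]
    congr 2
    ext θ
    simp
  rw [e1, e3, volume_eq_prod, ← prod_restrict, lintegral_prod]
  · exact lintegral_congr e2
  · exact (hm.comp (measurable_fst.prodMk (measurable_snd.add_const _))).aemeasurable

/-- Polar coordinates on the annular domain; the first space coordinate is the distance to the outer
boundary. -/
def polarMap (R : ℝ) (y : ℝ² × ℝ) : ℝ × Plane := (y.1.1, polarPoint (R - y.1.2) y.2)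

lemma continuous_polarMap (R : ℝ) : Continuous (polarMap R) :=
  (continuous_fst.comp continuous_fst).prodMk (continuous_polarPoint.comp
    ((continuous_const.sub (continuous_snd.comp continuous_fst)).prodMk continuous_snd))

/-- Time and the distance to the outer boundary. -/
def radial (R : ℝ) (p : ℝ × Plane) : ℝ² := (p.1, R - ‖p.2‖)

lemma continuous_radial (R : ℝ) : Continuous (radial R) :=
  continuous_fst.prodMk (continuous_const.sub continuous_snd.norm)

lemma radial_polarMap {R : ℝ} {x : ℝ²} (hx : x.2 ≤ R) (θ : ℝ) : radial R (polarMap R (x, θ)) = x := by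
  simp only [radial, polarMap, norm_polarPoint, abs_of_nonneg (sub_nonneg.2 hx), sub_sub_cancel]

abbrev angleMeasure : Measure ℝ := vol (Ioo 0 (2 * π))

def polarMeasure (R T : ℝ) (ρ : ℝ → ℝ) : Measure ℝ² :=
  (vol (Ω T ρ)).withDensity fun x => ofReal (R - x.2)

instance (R T : ℝ) (ρ : ℝ → ℝ) : SFinite (polarMeasure R T ρ) := by
  unfold polarMeasure
  infer_instance

lemma mem_annularDomain {R T : ℝ} {ρ : ℝ → ℝ} {p : ℝ × Plane} :
    p ∈ 𝒪 R T ρ ↔ radial R p ∈ Ω T ρ := by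
  simp only [annularDomain, annulus, stripDomain, radial, mem_ofPred_eq]
  refine and_congr_right fun _ => and_congr_right fun _ => ?_
  constructor <;> rintro ⟨h1, h2⟩ <;> constructor <;> linarith

namespace Front

variable {R ρ₀ T : ℝ} {ρ : ℝ → ℝ} (hF : Front R ρ₀ T ρ)

include hF

lemma strip_lt {x : ℝ²} (hx : x ∈ Ω T ρ) : x.2 < R := hx.2.2.2.trans (hF.lt_R _)

lemma isOpen_annular : IsOpen (𝒪 R T ρ) := by
  have : 𝒪 R T ρ = radial R ⁻¹' Ω T ρ := by
    ext p
    exact mem_annularDomain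
  rw [this]
  exact hF.isOpen_strip.preimage (continuous_radial R)

lemma lintegral_annular {H : ℝ × Plane → ℝ≥0∞} (hH : Measurable H) :
    ∫⁻ p in 𝒪 R T ρ, H p = ∫⁻ x in Ω T ρ, ∫⁻ θ in Ioo 0 (2 * π),
      ofReal (R - x.2) * H (polarMap R (x, θ)) := by
  have hO := hF.isOpen_annular.measurableSet
  have hS := hF.measurableSet_strip
  have hHi := hH.indicator hO
  have hm : Measurable fun x : ℝ² => ∫⁻ θ in Ioo 0 (2 * π),
      ofReal (R - x.2) * H (polarMap R (x, θ)) := by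
    refine Measurable.lintegral_prod_right' (f := fun y : ℝ² × ℝ =>
      ofReal (R - y.1.2) * H (polarMap R y)) ?_
    exact (ENNReal.measurable_ofReal.comp (measurable_const.sub
      (measurable_snd.comp measurable_fst))).mul (hH.comp (continuous_polarMap R).measurable)
  rw [← lintegral_indicator hO, ← lintegral_indicator hS, volume_eq_prod,
    lintegral_prod _ hHi.aemeasurable, volume_eq_prod, lintegral_prod _ (hm.indicator hS).aemeasurable]
  refine lintegral_congr fun t => ?_
  refine (lintegral_polar (hHi.comp (measurable_prodMk_left (x := t))) R).trans ?_
  rw [← lintegral_indicator measurableSet_Iio]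
  refine lintegral_congr fun r => ?_
  by_cases hr : r < R
  · rw [indicator_of_mem (mem_Iio.2 hr)]
    have hmem : ∀ θ, (t, polarPoint (R - r) θ) ∈ 𝒪 R T ρ ↔ (t, r) ∈ Ω T ρ := by
      intro θ
      have := radial_polarMap (x := (t, r)) hr.le θ
      rw [mem_annularDomain, ← this]
      rfl
    by_cases h : (t, r) ∈ Ω T ρ
    · rw [indicator_of_mem h]
      refine lintegral_congr fun θ => ?_
      rw [Function.comp_apply, indicator_of_mem ((hmem θ).2 h)]
      rfl
    · rw [indicator_of_notMem h]
      refine (lintegral_congr fun θ => ?_).trans lintegral_zero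
      rw [Function.comp_apply, indicator_of_notMem (fun h' => h ((hmem θ).1 h')), mul_zero]
  · rw [indicator_of_notMem (by simpa using hr), indicator_of_notMem fun h => hr (hF.strip_lt h)]

lemma measurePreserving_polarMap : MeasurePreserving (polarMap R)
    ((polarMeasure R T ρ).prod angleMeasure) (vol (𝒪 R T ρ)) := by
  have hpm := (continuous_polarMap R).measurable
  refine ⟨hpm, Measure.ext fun A hA => ?_⟩
  have hd : Measurable fun x : ℝ² => ofReal (R - x.2) := by fun_prop
  rw [Measure.map_apply hpm hA, Measure.prod_apply (hpm hA), polarMeasure,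
    lintegral_withDensity_eq_lintegral_mul _ hd (measurable_measure_prodMk_left (hpm hA)),
    ← lintegral_indicator_one hA, hF.lintegral_annular (measurable_one.indicator hA)]
  refine lintegral_congr fun x => ?_
  rw [lintegral_const_mul' _ _ ofReal_ne_top, Pi.mul_apply]
  congr 1
  rw [← lintegral_indicator_one (measurable_prodMk_left (hpm hA))]
  rfl

lemma polarMeasure_le : polarMeasure R T ρ ≤ ofReal R • vol (Ω T ρ) := by
  rw [polarMeasure, ← withDensity_const]
  refine withDensity_mono ?_
  filter_upwards [hF.ae_mem] with x hx
  exact ofReal_le_ofReal (by linarith [hx.2.2.1])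

lemma le_polarMeasure : vol (Ω T ρ) ≤ ofReal (R - ρ T)⁻¹ • polarMeasure R T ρ := by
  have h0 : 0 < R - ρ T := sub_pos.2 hF.lt
  rw [polarMeasure, ← withDensity_smul _ (by fun_prop : Measurable fun x : ℝ² => ofReal (R - x.2))]
  conv_lhs => rw [← withDensity_one (μ := vol (Ω T ρ))]
  refine withDensity_mono ?_
  filter_upwards [hF.ae_mem] with x hx
  rw [Pi.one_apply, Pi.smul_apply, smul_eq_mul, ← ofReal_mul (by positivity), ← ofReal_one]
  refine ofReal_le_ofReal ?_
  rw [inv_mul_eq_div, one_le_div h0]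
  linarith [hx.2.2.2, hF.le x.1]

end Front

lemma IsTestFun.comp_mul {E E' : Type*} [NormedAddCommGroup E] [NormedSpace ℝ E]
    [NormedAddCommGroup E'] [NormedSpace ℝ E'] {U : Set E} {U' K : Set E'} {φ : E → ℝ}
    (hφ : IsTestFun U φ) {F : E' → E} {m : E' → ℝ} (hF : Continuous F) (hK : IsCompact K)
    (hKU : K ⊆ U') (hsub : F ⁻¹' tsupport φ ⊆ K)
    (hs : ∀ y ∈ F ⁻¹' tsupport φ, ContDiffAt ℝ ∞ F y ∧ ContDiffAt ℝ ∞ m y) :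
    IsTestFun U' fun y => φ (F y) * m y := by
  have hcl : IsClosed (F ⁻¹' tsupport φ) := (isClosed_tsupport φ).preimage hF
  have hts : tsupport (fun y => φ (F y) * m y) ⊆ F ⁻¹' tsupport φ :=
    closure_minimal (fun y hy => subset_tsupport φ (left_ne_zero_of_mul hy)) hcl
  refine ⟨contDiff_iff_contDiffAt.2 fun y => ?_, hK.of_isClosed_subset (isClosed_tsupport _)
    (hts.trans hsub), (hts.trans hsub).trans hKU⟩
  by_cases hy : y ∈ F ⁻¹' tsupport φ
  · exact (hφ.contDiff.contDiffAt.comp y (hs y hy).1).mul (hs y hy).2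
  · refine (contDiffAt_const (c := (0 : ℝ))).congr_of_eventuallyEq ?_
    filter_upwards [hcl.isOpen_compl.mem_nhds hy] with z hz
    rw [image_eq_zero_of_notMem_tsupport hz, zero_mul]

lemma contDiffAt_radial {R : ℝ} {p : ℝ × Plane} (hp : p.2 ≠ 0) : ContDiffAt ℝ ∞ (radial R) p :=
  contDiffAt_fst.prodMk (contDiffAt_const.sub (contDiffAt_snd.norm ℝ hp))

lemma hasFDerivAt_norm_plane {x : Plane} (hx : x ≠ 0) :
    HasFDerivAt (fun x : Plane => ‖x‖) (‖x‖⁻¹ • innerSL ℝ x) x := by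
  have h := (hasStrictFDerivAt_norm_sq x).hasFDerivAt.sqrt (by positivity)
  simp only [Real.sqrt_sq (norm_nonneg _)] at h
  refine h.congr_fderiv ?_
  ext e
  simp only [_root_.smul_apply, smul_eq_mul, nsmul_eq_mul]
  field_simp
  push_cast
  ring

lemma fderiv_comp_radial {R : ℝ} {φ : ℝ² → ℝ} (hφ : Differentiable ℝ φ) {p : ℝ × Plane}
    (hp : p.2 ≠ 0) (a : ℝ) (e : Plane) : fderiv ℝ (fun p => φ (radial R p)) p (a, e) =
      a * fderiv ℝ φ (radial R p) (1, 0) - inner ℝ p.2 e / ‖p.2‖ * fderiv ℝ φ (radial R p) (0, 1) := by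
  have h1 : HasFDerivAt (fun p : ℝ × Plane => ‖p.2‖) _ p :=
    (hasFDerivAt_norm_plane hp).comp p hasFDerivAt_snd
  have h2 := (hφ (radial R p)).hasFDerivAt.comp p (hasFDerivAt_fst.prodMk (h1.const_sub R))
  have h3 : fderiv ℝ (fun p => φ (radial R p)) p = _ := h2.fderiv
  rw [h3]
  have e1 : inner ℝ p.2 e / ‖p.2‖ = ‖p.2‖⁻¹ * inner ℝ p.2 e := by rw [div_eq_inv_mul]
  rw [e1, sub_eq_add_neg, ← neg_mul, ← fderiv_prod_apply]
  rfl

lemma polarPoint_eq_smul (s θ : ℝ) : polarPoint s θ = s • polarPoint 1 θ := by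
  ext i
  fin_cases i <;> simp [polarPoint]

lemma fderiv_polar {R : ℝ} {Φ : ℝ × Plane → ℝ} (hΦ : Differentiable ℝ Φ) (x : ℝ²) (θ a b : ℝ) :
    fderiv ℝ (fun x => Φ (polarMap R (x, θ))) x (a, b) =
      fderiv ℝ Φ (polarMap R (x, θ)) (a, -b • polarPoint 1 θ) := by
  have h1 : HasFDerivAt (fun x : ℝ² => polarMap R (x, θ)) ((ContinuousLinearMap.fst ℝ ℝ ℝ).prod
      (-((ContinuousLinearMap.snd ℝ ℝ ℝ).smulRight (polarPoint 1 θ)))) x := by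
    have e : (fun x : ℝ² => polarMap R (x, θ)) = fun x => (x.1, (R - x.2) • polarPoint 1 θ) := by
      funext x
      rw [polarMap, polarPoint_eq_smul]
    rw [e]
    refine hasFDerivAt_fst.prodMk ?_
    have := ((hasFDerivAt_snd (𝕜 := ℝ) (p := x)).const_sub R).smul_const (polarPoint 1 θ)
    refine this.congr_fderiv ?_
    ext y <;> simp
  have h3 : fderiv ℝ (fun x => Φ (polarMap R (x, θ))) x = _ := ((hΦ _).hasFDerivAt.comp x h1).fderiv
  rw [h3]
  simp

lemma hasDerivAt_polarPoint (s θ : ℝ) :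
    HasDerivAt (polarPoint s) (s • polarPoint 1 (θ + π / 2)) θ := by
  have e : ∀ s, polarPoint s = fun θ => (s * Real.cos θ) • polarPoint 1 0 +
      (s * Real.sin θ) • polarPoint 1 (π / 2) := fun s => by
    funext θ
    ext i
    fin_cases i <;> simp [polarPoint]
  rw [e s, e 1]
  refine ((((Real.hasDerivAt_cos θ).const_mul s).smul_const _).add
    (((Real.hasDerivAt_sin θ).const_mul s).smul_const _)).congr_deriv ?_
  simp only [Real.cos_add_pi_div_two, Real.sin_add_pi_div_two, smul_add, smul_smul, one_mul]
  simp

lemma inner_polarPoint (e : Plane) (θ : ℝ) :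
    inner ℝ e (polarPoint 1 θ) = e 0 * Real.cos θ + e 1 * Real.sin θ := by
  simp [PiLp.inner_apply, Fin.sum_univ_two, polarPoint, mul_comm]

lemma eq_polar_frame (e : Plane) (θ : ℝ) : e = inner ℝ e (polarPoint 1 θ) • polarPoint 1 θ +
    inner ℝ e (polarPoint 1 (θ + π / 2)) • polarPoint 1 (θ + π / 2) := by
  rw [inner_polarPoint, inner_polarPoint, Real.cos_add_pi_div_two, Real.sin_add_pi_div_two]
  have := Real.sin_sq_add_cos_sq θ
  ext i
  fin_cases i
  · simp [polarPoint, Real.cos_add_pi_div_two]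
    linear_combination -e 0 * this
  · simp [polarPoint, Real.sin_add_pi_div_two]
    linear_combination -e 1 * this

lemma integral_circle_fderiv {Φ : ℝ × Plane → ℝ} (hΦ : ContDiff ℝ ∞ Φ) (t s : ℝ) (e : Plane) :
    ∫ θ in Ioo 0 (2 * π), s * fderiv ℝ Φ (t, polarPoint s θ) (0, e) =
      ∫ θ in Ioo 0 (2 * π), inner ℝ e (polarPoint 1 θ) *
        (fderiv ℝ Φ (t, polarPoint s θ) (0, polarPoint 1 θ) * s + Φ (t, polarPoint s θ)) := by
  have hd := hΦ.differentiable (by simp)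
  have hc : ∀ s, Continuous (polarPoint s) := fun s =>
    continuous_polarPoint.comp (continuous_const.prodMk continuous_id)
  have hcf : Continuous fun q : (ℝ × Plane) × (ℝ × Plane) => fderiv ℝ Φ q.1 q.2 :=
    ((hΦ.continuous_fderiv (by simp)).comp continuous_fst).clm_apply continuous_snd
  have hpt : Continuous fun θ => ((t, polarPoint s θ) : ℝ × Plane) := continuous_const.prodMk (hc s)
  have hder : ∀ θ, HasDerivAt (fun θ => inner ℝ e (polarPoint 1 (θ + π / 2)) * Φ (t, polarPoint s θ))
      (s * fderiv ℝ Φ (t, polarPoint s θ) (0, e) - inner ℝ e (polarPoint 1 θ) *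
        (fderiv ℝ Φ (t, polarPoint s θ) (0, polarPoint 1 θ) * s + Φ (t, polarPoint s θ))) θ := by
    intro θ
    have h1 : HasDerivAt (fun θ => inner ℝ e (polarPoint 1 (θ + π / 2)))
        (-inner ℝ e (polarPoint 1 θ)) θ := by
      simp only [inner_polarPoint, Real.cos_add_pi_div_two, Real.sin_add_pi_div_two]
      have := ((Real.hasDerivAt_sin θ).neg.const_mul (e 0)).add
        ((Real.hasDerivAt_cos θ).const_mul (e 1))
      refine this.congr_deriv ?_
      ring
    have h2 : HasDerivAt (fun θ => Φ (t, polarPoint s θ))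
        (fderiv ℝ Φ (t, polarPoint s θ) (0, s • polarPoint 1 (θ + π / 2))) θ :=
      (hd _).hasFDerivAt.comp_hasDerivAt θ ((hasDerivAt_const θ t).prodMk (hasDerivAt_polarPoint s θ))
    refine (h1.mul h2).congr_deriv ?_
    have e1 : ((0 : ℝ), s • polarPoint 1 (θ + π / 2)) =
      s • ((0 : ℝ), polarPoint 1 (θ + π / 2)) := by simp
    have e2 : ((0 : ℝ), e) = inner ℝ e (polarPoint 1 θ) • ((0 : ℝ), polarPoint 1 θ) +
        inner ℝ e (polarPoint 1 (θ + π / 2)) • ((0 : ℝ), polarPoint 1 (θ + π / 2)) := by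
      rw [Prod.smul_mk, Prod.smul_mk, Prod.mk_add_mk, ← eq_polar_frame]
      simp
    rw [e1, e2, map_smul, map_add, map_smul, map_smul]
    simp only [smul_eq_mul]
    ring
  have c1 : Continuous fun θ => s * fderiv ℝ Φ (t, polarPoint s θ) (0, e) :=
    continuous_const.mul (hcf.comp (hpt.prodMk continuous_const))
  have c2 : Continuous fun θ => inner ℝ e (polarPoint 1 θ) *
      (fderiv ℝ Φ (t, polarPoint s θ) (0, polarPoint 1 θ) * s + Φ (t, polarPoint s θ)) :=
    (continuous_const.inner (hc 1)).mul (((hcf.comp (hpt.prodMk (continuous_const.prodMk (hc 1)))).mul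
      continuous_const).add (hΦ.continuous.comp hpt))
  have h := integral_eq_sub_of_hasDerivAt (a := 0) (b := 2 * π)
    (fun θ _ => hder θ) ((c1.sub c2).intervalIntegrable _ _)
  rw [intervalIntegral.integral_sub (c1.intervalIntegrable _ _) (c2.intervalIntegrable _ _)] at h
  have hp : ∀ s θ, polarPoint s (2 * π + θ) = polarPoint s θ := fun s θ => by
    simp [polarPoint, add_comm (2 * π)]
  have hp0 := hp s 0
  rw [add_zero] at hp0
  rw [hp, hp0, zero_add, sub_self, sub_eq_zero] at h
  simpa only [integral_of_le two_pi_pos.le, integral_Ioc_eq_integral_Ioo] using h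

lemma IsTestFun.laplacian_slice {U : Set (ℝ × Plane)} {Φ : ℝ × Plane → ℝ} (hΦ : IsTestFun U Φ) (t : ℝ)
    (x : Plane) : Laplacian.laplacian (fun x => Φ (t, x)) x =
      ∑ i : Fin 2, _root_.fderiv ℝ (fun p => _root_.fderiv ℝ Φ p (0, EuclideanSpace.single i 1)) (t, x)
        (0, EuclideanSpace.single i 1) := by
  have hs : ContDiff ℝ ∞ fun x => Φ (t, x) := hΦ.contDiff.comp (contDiff_const.prodMk contDiff_id)
  rw [InnerProductSpace.laplacian_eq_iteratedFDeriv_orthonormalBasis _ (EuclideanSpace.basisFun (Fin 2) ℝ)]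
  refine Finset.sum_congr rfl fun i _ => ?_
  rw [iteratedFDeriv_two_apply, ← (hΦ.fderiv _).fderiv_slice]
  simp only [EuclideanSpace.basisFun_apply, Matrix.cons_val_zero, Matrix.cons_val_one,
    ← hΦ.fderiv_slice]
  have hdd : DifferentiableAt ℝ (_root_.fderiv ℝ fun x => Φ (t, x)) x :=
    (hs.fderiv_right (m := 1) (by norm_cast)).differentiable (by simp) x
  rw [fderiv_clm_apply hdd (differentiableAt_const _)]
  simp

namespace Front

variable {R ρ₀ T : ℝ} {ρ : ℝ → ℝ} (hF : Front R ρ₀ T ρ)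

include hF

lemma ne_zero_of_mem {p : ℝ × Plane} (hp : p ∈ 𝒪 R T ρ) : p.2 ≠ 0 := by
  have := hF.strip_lt (mem_annularDomain.1 hp)
  simp only [radial] at this
  exact norm_pos_iff.1 (by linarith)

lemma isTestFun_lift {φ : ℝ² → ℝ} (hφ : IsTestFun (Ω T ρ) φ) {m : ℝ × Plane → ℝ}
    (hm : ContDiff ℝ ∞ m) : IsTestFun (𝒪 R T ρ) fun p => φ (radial R p) * m p := by
  have hKU : radial R ⁻¹' tsupport φ ⊆ 𝒪 R T ρ :=
    fun p hp => mem_annularDomain.2 (hφ.tsupport_subset hp)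
  refine hφ.comp_mul (continuous_radial R) ?_ hKU Subset.rfl
    fun p hp => ⟨contDiffAt_radial (hF.ne_zero_of_mem (hKU hp)), hm.contDiffAt⟩
  refine (isCompact_Icc.prod (isCompact_closedBall (0 : Plane) R)).of_isClosed_subset
    ((isClosed_tsupport φ).preimage (continuous_radial R))
    fun p hp => (⟨⟨(hKU hp).1.le, (hKU hp).2.1.le⟩, ?_⟩ : p ∈ Icc 0 T ×ˢ _)
  rw [mem_closedBall_zero_iff]
  exact (hKU hp).2.2.2.le

lemma exists_isTestFun_mul {φ : ℝ² → ℝ} (hφ : IsTestFun (Ω T ρ) φ) :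
    ∃ κ, IsTestFun (Ω T ρ) κ ∧ φ = fun x => (R - x.2) * κ x := by
  refine ⟨_, hφ.comp_mul (F := id) (m := fun x => (R - x.2)⁻¹) continuous_id hφ.hasCompactSupport
    hφ.tsupport_subset Subset.rfl fun y hy => ⟨contDiffAt_id, ?_⟩, funext fun x => ?_⟩
  · have := hF.strip_lt (hφ.tsupport_subset hy)
    exact (contDiffAt_const.sub contDiffAt_snd).inv (sub_pos.2 this).ne'
  · by_cases h : x ∈ Ω T ρ
    · have := (sub_pos.2 (hF.strip_lt h)).ne'
      simp only [id]
      field_simp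
    · simp [hφ.eq_zero h]

lemma exists_isTestFun_polar {Φ : ℝ × Plane → ℝ} (hΦ : IsTestFun (𝒪 R T ρ) Φ) (θ : ℝ) :
    ∃ κ, IsTestFun (Ω T ρ) κ ∧ (∀ x ∈ Ω T ρ, κ x = Φ (polarMap R (x, θ))) ∧ ∀ x ∈ Ω T ρ, ∀ a b : ℝ,
        fderiv ℝ κ x (a, b) = fderiv ℝ Φ (polarMap R (x, θ)) (a, -b • polarPoint 1 θ) := by
  set F : ℝ² → ℝ × Plane := fun x => (x.1, polarPoint (max (R - x.2) 0) θ)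
  have hFc : Continuous F := continuous_fst.prodMk (continuous_polarPoint.comp
    (((continuous_const.sub continuous_snd).max continuous_const).prodMk continuous_const))
  have hlt : ∀ x, F x ∈ 𝒪 R T ρ → x.2 < R := by
    intro x hx
    have := hF.ne_zero_of_mem hx
    by_contra h
    refine this (norm_eq_zero.1 ?_)
    rw [norm_polarPoint, max_eq_right (by linarith), abs_zero]
  have heq : ∀ x : ℝ², x.2 < R → F x = polarMap R (x, θ) := fun x hx => by
    simp only [F, polarMap, max_eq_left (sub_pos.2 hx).le]
  refine ⟨fun x => Φ (F x) * 1, hΦ.comp_mul (m := fun _ => 1) (K := radial R '' tsupport Φ) hFc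
    (hΦ.hasCompactSupport.isCompact.image (continuous_radial R)) ?_ (fun x hx => ?_)
    fun x hx => ⟨?_, contDiffAt_const⟩, fun x hx => by simp only [mul_one, heq x (hF.strip_lt hx)],
    fun x hx a b => ?_⟩
  · rintro _ ⟨p, hp, rfl⟩
    exact mem_annularDomain.1 (hΦ.tsupport_subset hp)
  · have h := hlt x (hΦ.tsupport_subset hx)
    exact ⟨F x, hx, by rw [heq x h, radial_polarMap h.le]⟩
  · have h := hlt x (hΦ.tsupport_subset hx)
    have hsm : ContDiff ℝ ∞ fun x : ℝ² => polarMap R (x, θ) := by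
      have e : (fun x : ℝ² => polarMap R (x, θ)) = fun x => (x.1, (R - x.2) • polarPoint 1 θ) :=
        funext fun x => by rw [polarMap, polarPoint_eq_smul]
      rw [e]
      fun_prop
    refine hsm.contDiffAt.congr_of_eventuallyEq ?_
    filter_upwards [(isOpen_lt continuous_snd continuous_const).mem_nhds (show x.2 < R from h)] with y hy
    exact heq y hy
  · rw [← fderiv_polar hΦ.differentiable, Filter.EventuallyEq.fderiv_eq]
    filter_upwards [hF.isOpen_strip.mem_nhds hx] with y hy
    simp only [mul_one, heq y (hF.strip_lt hy)]

end Front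

lemma angleMeasure_real_univ : angleMeasure.real univ = 2 * π := by
  rw [measureReal_restrict_apply_univ, Real.volume_real_Ioo_of_le two_pi_pos.le, sub_zero]

lemma eLpNorm_angle_average_le {X : Type*} [MeasurableSpace X] {μ : Measure X} [SFinite μ]
    {f : X × ℝ → ℝ} (hf : AEStronglyMeasurable f (μ.prod angleMeasure)) :
    eLpNorm (fun x => (2 * π)⁻¹ * ∫ θ in Ioo 0 (2 * π), f (x, θ)) 2 μ ≤
      eLpNorm f 2 (μ.prod angleMeasure) := by
  rw [← ENNReal.pow_le_pow_left_iff two_ne_zero, eLpNorm_two_sq, eLpNorm_two_sq,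
    lintegral_prod _ (hf.enorm.pow_const 2)]
  refine lintegral_mono_ae ?_
  filter_upwards [hf.prodMk_left] with x hx
  have hpi := two_pi_pos
  have h1 : angleMeasure univ = ofReal (2 * π) := by
    rw [← angleMeasure_real_univ, ofReal_measureReal]
  rw [enorm_mul, mul_pow]
  calc ‖(2 * π)⁻¹‖ₑ ^ 2 * ‖∫ θ in Ioo 0 (2 * π), f (x, θ)‖ₑ ^ 2
      ≤ ‖(2 * π)⁻¹‖ₑ ^ 2 * (∫⁻ θ in Ioo 0 (2 * π), ‖f (x, θ)‖ₑ) ^ 2 := by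
        gcongr
        exact enorm_integral_le_lintegral_enorm _
    _ ≤ ‖(2 * π)⁻¹‖ₑ ^ 2 * (ofReal (2 * π) * ∫⁻ θ in Ioo 0 (2 * π), ‖f (x, θ)‖ₑ ^ 2) := by
        gcongr
        rw [← h1]
        exact sq_lintegral_le hx.enorm
    _ ≤ _ := by
        rw [← mul_assoc]
        refine mul_le_of_le_one_left' ?_
        rw [enorm_of_nonneg (by positivity), ← ofReal_pow (by positivity),
          ← ofReal_mul (by positivity), ← ofReal_one]
        refine ofReal_le_ofReal ?_
        rw [sq, mul_assoc, inv_mul_cancel₀ hpi.ne', mul_one]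
        exact inv_le_one_of_one_le₀ (by linarith [Real.pi_gt_three])

/-- The average over circles around the origin. -/
def circleAvg (R : ℝ) (h : ℝ × Plane → ℝ) (x : ℝ²) : ℝ :=
  (2 * π)⁻¹ * ∫ θ in Ioo 0 (2 * π), h (polarMap R (x, θ))

lemma circleAvg_mul_radial {R : ℝ} {h : ℝ × Plane → ℝ} {k : ℝ² → ℝ} {x : ℝ²} (hx : x.2 ≤ R) :
    circleAvg R (fun p => h p * k (radial R p)) x = circleAvg R h x * k x := by
  simp only [circleAvg, radial_polarMap hx]
  rw [integral_mul_const, mul_assoc]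

lemma circleAvg_radial {R : ℝ} {k : ℝ² → ℝ} {x : ℝ²} (hx : x.2 ≤ R) :
    circleAvg R (fun p => k (radial R p)) x = k x := by
  simp only [circleAvg, radial_polarMap hx]
  rw [integral_const, measureReal_restrict_apply_univ, Real.volume_real_Ioo_of_le two_pi_pos.le,
    smul_eq_mul, sub_zero, inv_mul_cancel_left₀ two_pi_pos.ne']

lemma fderiv_sub_mul {R : ℝ} {κ : ℝ² → ℝ} (hκ : Differentiable ℝ κ) (x : ℝ²) (a b : ℝ) :
    fderiv ℝ (fun x => (R - x.2) * κ x) x (a, b) = (R - x.2) * fderiv ℝ κ x (a, b) - b * κ x := by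
  rw [fderiv_fun_mul (by fun_prop) (hκ x)]
  simp [fderiv_const_sub, fderiv_snd]
  ring

/-- The radial component of a vector field. -/
def radialPart (g : Fin 2 → ℝ × Plane → ℝ) (p : ℝ × Plane) : ℝ := ∑ i, p.2 i / ‖p.2‖ * g i p

/-- The coordinate directions of the plane. -/
abbrev spaceDir (i : Fin 2) : ℝ × Plane := (0, EuclideanSpace.single i 1)

lemma abs_coord_div_norm_le (x : Plane) (i : Fin 2) : |x i / ‖x‖| ≤ 1 := by
  rw [abs_div, abs_norm]
  exact div_le_one_of_le₀ (PiLp.norm_apply_le x i) (norm_nonneg _)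

lemma measurable_coord_div_norm (i : Fin 2) : Measurable fun p : ℝ × Plane => p.2 i / ‖p.2‖ := by
  fun_prop

lemma eLpNorm_coord_mul_le {μ : Measure (ℝ × Plane)} (g : ℝ × Plane → ℝ) (i : Fin 2) :
    eLpNorm (fun p => p.2 i / ‖p.2‖ * g p) 2 μ ≤ eLpNorm g 2 μ := by
  refine eLpNorm_mono fun p => ?_
  rw [norm_mul]
  exact mul_le_of_le_one_left (norm_nonneg _) (abs_coord_div_norm_le p.2 i)

lemma memLp_coord_mul {μ : Measure (ℝ × Plane)} {g : ℝ × Plane → ℝ} (hg : MemLp g 2 μ) (i : Fin 2) :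
    MemLp (fun p => p.2 i / ‖p.2‖ * g p) 2 μ :=
  ⟨(measurable_coord_div_norm i).aestronglyMeasurable.mul hg.1,
    (eLpNorm_coord_mul_le g i).trans_lt hg.2⟩

lemma memLp_radialPart {μ : Measure (ℝ × Plane)} {g : Fin 2 → ℝ × Plane → ℝ}
    (hg : ∀ i, MemLp (g i) 2 μ) : MemLp (radialPart g) 2 μ :=
  memLp_finsetSum _ fun i _ => memLp_coord_mul (hg i) i

lemma eLpNorm_radialPart_le {μ : Measure (ℝ × Plane)} {g : Fin 2 → ℝ × Plane → ℝ}
    (hg : ∀ i, AEStronglyMeasurable (g i) μ) :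
    eLpNorm (radialPart g) 2 μ ≤ eLpNorm (g 0) 2 μ + eLpNorm (g 1) 2 μ := by
  have h : radialPart g = fun p => p.2 0 / ‖p.2‖ * g 0 p + p.2 1 / ‖p.2‖ * g 1 p :=
    funext fun p => Fin.sum_univ_two _
  rw [h]
  refine (eLpNorm_add_le ((measurable_coord_div_norm 0).aestronglyMeasurable.mul (hg 0))
    ((measurable_coord_div_norm 1).aestronglyMeasurable.mul (hg 1)) one_le_two).trans ?_
  exact add_le_add (eLpNorm_coord_mul_le _ 0) (eLpNorm_coord_mul_le _ 1)

lemma sum_coord_mul_coord_div (x : Plane) : x 0 / ‖x‖ * x 0 + x 1 / ‖x‖ * x 1 = ‖x‖ := by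
  have h : ‖x‖ ^ 2 = x 0 ^ 2 + x 1 ^ 2 := by
    rw [EuclideanSpace.norm_sq_eq, Fin.sum_univ_two, Real.norm_eq_abs, Real.norm_eq_abs, sq_abs, sq_abs]
  by_cases h0 : ‖x‖ = 0
  · simp [h0]
  · field_simp
    linarith

namespace Front

variable {R ρ₀ T : ℝ} {ρ : ℝ → ℝ} (hF : Front R ρ₀ T ρ)

include hF

lemma absolutelyContinuous_polarMeasure : vol (Ω T ρ) ≪ polarMeasure R T ρ :=
  absolutelyContinuous_of_le_smul hF.le_polarMeasure

lemma aestronglyMeasurable_comp_polarMap {h : ℝ × Plane → ℝ}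
    (hh : AEStronglyMeasurable h (vol (𝒪 R T ρ))) :
    AEStronglyMeasurable (fun y => h (polarMap R y)) ((polarMeasure R T ρ).prod angleMeasure) :=
  hh.comp_measurePreserving hF.measurePreserving_polarMap

lemma aestronglyMeasurable_circleAvg {h : ℝ × Plane → ℝ}
    (hh : AEStronglyMeasurable h (vol (𝒪 R T ρ))) :
    AEStronglyMeasurable (circleAvg R h) (vol (Ω T ρ)) :=
  ((hF.aestronglyMeasurable_comp_polarMap hh).integral_prod_right'.const_mul _).mono_ac
    hF.absolutelyContinuous_polarMeasure

lemma exists_eLpNorm_circleAvg_le : ∃ C : ℝ≥0∞, C ≠ ⊤ ∧ ∀ h : ℝ × Plane → ℝ,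
    AEStronglyMeasurable h (vol (𝒪 R T ρ)) →
    eLpNorm (circleAvg R h) 2 (vol (Ω T ρ)) ≤ C * eLpNorm h 2 (vol (𝒪 R T ρ)) := by
  refine ⟨ofReal (R - ρ T)⁻¹ ^ (1 / (2 : ℝ≥0∞)).toReal,
    ENNReal.rpow_ne_top_of_nonneg ENNReal.toReal_nonneg ofReal_ne_top, fun h hh => ?_⟩
  refine (eLpNorm_mono_measure _ hF.le_polarMeasure).trans ?_
  rw [eLpNorm_smul_measure_of_ne_top (by simp), smul_eq_mul]
  gcongr
  refine (eLpNorm_angle_average_le (hF.aestronglyMeasurable_comp_polarMap hh)).trans ?_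
  exact (eLpNorm_comp_measurePreserving hh hF.measurePreserving_polarMap).le

lemma memLp_circleAvg {h : ℝ × Plane → ℝ} (hh : MemLp h 2 (vol (𝒪 R T ρ))) :
    MemLp (circleAvg R h) 2 (vol (Ω T ρ)) := by
  obtain ⟨C, hC, hle⟩ := hF.exists_eLpNorm_circleAvg_le
  exact ⟨hF.aestronglyMeasurable_circleAvg hh.1,
    (hle h hh.1).trans_lt (ENNReal.mul_lt_top hC.lt_top hh.2)⟩

lemma integrable_comp_polarMap {h : ℝ × Plane → ℝ} (hh : IntegrableOn h (𝒪 R T ρ)) :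
    Integrable (fun y => h (polarMap R y)) ((polarMeasure R T ρ).prod angleMeasure) :=
  hF.measurePreserving_polarMap.integrable_comp_of_integrable hh

lemma integral_polarMeasure (k : ℝ² → ℝ) :
    ∫ x, k x ∂(polarMeasure R T ρ) = ∫ x in Ω T ρ, (R - x.2) * k x := by
  rw [polarMeasure, integral_withDensity_eq_integral_toReal_smul (by fun_prop)
    (of_forall fun _ => ofReal_lt_top)]
  refine hF.integral_congr fun x hx => ?_
  simp only [ENNReal.toReal_ofReal (sub_pos.2 (hF.strip_lt hx)).le, smul_eq_mul]

lemma integral_annular {h : ℝ × Plane → ℝ} (hh : IntegrableOn h (𝒪 R T ρ)) : ∫ p in 𝒪 R T ρ, h p =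
      2 * π * ∫ x in Ω T ρ, (R - x.2) * circleAvg R h x := by
  have hm := hF.measurePreserving_polarMap
  rw [← hF.integral_polarMeasure, ← hm.map_eq, integral_map hm.aemeasurable (hm.map_eq ▸ hh.1),
    integral_prod _ (hF.integrable_comp_polarMap hh), ← integral_const_mul]
  refine integral_congr_ae (of_forall fun x => ?_)
  simp only [circleAvg]
  rw [mul_inv_cancel_left₀ two_pi_pos.ne']

lemma integral_annular_symm {h : ℝ × Plane → ℝ} (hh : IntegrableOn h (𝒪 R T ρ)) :
    ∫ p in 𝒪 R T ρ, h p = ∫ θ in Ioo 0 (2 * π), ∫ x in Ω T ρ,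
      (R - x.2) * h (polarMap R (x, θ)) := by
  have hm := hF.measurePreserving_polarMap
  rw [← hm.map_eq, integral_map hm.aemeasurable (hm.map_eq ▸ hh.1),
    integral_prod_symm _ (hF.integrable_comp_polarMap hh)]
  exact integral_congr_ae (of_forall fun θ => hF.integral_polarMeasure _)

lemma integral_mul_radial {h : ℝ × Plane → ℝ} (hh : LocallyIntegrableOn h (𝒪 R T ρ))
    {κ : ℝ² → ℝ} (hκ : IsTestFun (Ω T ρ) κ) :
    ∫ p in 𝒪 R T ρ, h p * κ (radial R p) =
      2 * π * ∫ x in Ω T ρ, circleAvg R h x * ((R - x.2) * κ x) := by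
  have ht := hF.isTestFun_lift hκ (contDiff_const (c := (1 : ℝ)))
  simp only [mul_one] at ht
  rw [hF.integral_annular (ht.integrable_mul hh).integrableOn]
  congr 1
  refine hF.integral_congr fun x hx => ?_
  simp only [circleAvg_mul_radial (hF.strip_lt hx).le]
  ring

lemma volume_annular_lt_top : volume (𝒪 R T ρ) < ⊤ := by
  refine lt_of_le_of_lt (measure_mono fun p hp => (⟨⟨hp.1.le, hp.2.1.le⟩, ?_⟩ : p ∈ Icc 0 T ×ˢ _))
    (isCompact_Icc.prod (isCompact_closedBall (0 : Plane) R)).measure_lt_top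
  rw [mem_closedBall_zero_iff]
  exact hp.2.2.2.le

lemma hasWeakDeriv_time_circleAvg {u g : ℝ × Plane → ℝ} (hu : MemLp u 2 (vol (𝒪 R T ρ)))
    (hg : MemLp g 2 (vol (𝒪 R T ρ)))
    (h : HasWeakDeriv (𝒪 R T ρ) (1, 0) u g) :
    HasWeakDeriv (Ω T ρ) (1, 0) (circleAvg R u) (circleAvg R g) := by
  refine ⟨(hF.memLp_circleAvg hu).locallyIntegrableOn_two,
    (hF.memLp_circleAvg hg).locallyIntegrableOn_two, fun φ hφ => ?_⟩
  obtain ⟨κ, hκ, rfl⟩ := hF.exists_isTestFun_mul hφ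
  have ht := hF.isTestFun_lift hκ (contDiff_const (c := (1 : ℝ)))
  simp only [mul_one] at ht
  have h1 := h.integral_eq _ ht
  rw [hF.integral_mul_radial h.2 hκ, setIntegral_congr_fun (g := fun p => u p *
    (fun x => fderiv ℝ κ x (1, 0)) (radial R p)) hF.isOpen_annular.measurableSet fun p hp => ?_,
    hF.integral_mul_radial h.1 (hκ.fderiv (1, 0)), ← mul_neg] at h1
  · rw [← mul_left_cancel₀ two_pi_pos.ne' h1]
    refine hF.integral_congr fun x hx => ?_
    rw [fderiv_sub_mul hκ.differentiable, zero_mul, sub_zero]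
  · rw [fderiv_comp_radial hκ.differentiable (hF.ne_zero_of_mem hp)]
    simp

lemma hasWeakDeriv_space_circleAvg {u : ℝ × Plane → ℝ} {g : Fin 2 → ℝ × Plane → ℝ}
    (hu : MemLp u 2 (vol (𝒪 R T ρ)))
    (hg : ∀ i, MemLp (g i) 2 (vol (𝒪 R T ρ)))
    (h : ∀ i, HasWeakDeriv (𝒪 R T ρ) (spaceDir i) u (g i)) :
    HasWeakDeriv (Ω T ρ) (0, 1) (circleAvg R u) fun x => -1 * circleAvg R (radialPart g) x := by
  have hG := memLp_radialPart hg
  refine ⟨(hF.memLp_circleAvg hu).locallyIntegrableOn_two,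
    ((hF.memLp_circleAvg hG).const_mul _).locallyIntegrableOn_two, fun φ hφ => ?_⟩
  obtain ⟨κ₁, hκ₁, rfl⟩ := hF.exists_isTestFun_mul hφ
  obtain ⟨κ, hκ, rfl⟩ := hF.exists_isTestFun_mul hκ₁
  obtain ⟨K, hK, hKeq⟩ := hF.exists_isTestFun_mul (hφ.fderiv (0, 1))
  have ht : ∀ i : Fin 2, IsTestFun (𝒪 R T ρ) fun p => κ (radial R p) * p.2 i := fun i =>
    hF.isTestFun_lift hκ (by fun_prop)
  have hd : ∀ p ∈ 𝒪 R T ρ, ∀ i, fderiv ℝ (fun p => κ (radial R p) * p.2 i) p (spaceDir i) =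
      κ (radial R p) - p.2 i / ‖p.2‖ * p.2 i * fderiv ℝ κ (radial R p) (0, 1) := by
    intro p hp i
    have h0 := hF.ne_zero_of_mem hp
    have hdr : DifferentiableAt ℝ (fun p => κ (radial R p)) p :=
      (hκ.differentiable _).comp p ((contDiffAt_radial h0).differentiableAt (by simp))
    have hdi : HasFDerivAt (fun p : ℝ × Plane => p.2 i)
      ((EuclideanSpace.proj i).comp (ContinuousLinearMap.snd ℝ ℝ Plane)) p :=
      ((EuclideanSpace.proj i).comp (ContinuousLinearMap.snd ℝ ℝ Plane)).hasFDerivAt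
    rw [fderiv_fun_mul hdr hdi.differentiableAt, hdi.fderiv]
    simp only [_root_.add_apply, _root_.smul_apply, fderiv_comp_radial hκ.differentiable h0,
      ContinuousLinearMap.comp_apply, ContinuousLinearMap.coe_snd', smul_eq_mul,
      EuclideanSpace.inner_single_right]
    simp
    ring
  have hsum : ∫ p in 𝒪 R T ρ, u p * K (radial R p) =
      ∫ p in 𝒪 R T ρ, radialPart g p * ((R - (radial R p).2) * κ (radial R p)) := by
    have i1 := fun i => (((ht i).fderiv (spaceDir i)).integrable_mul (h i).1).integrableOn
      (s := 𝒪 R T ρ)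
    have i2 := fun i => ((ht i).integrable_mul (h i).2).integrableOn (s := 𝒪 R T ρ)
    have e := congrArg₂ (· + ·) ((h 0).integral_eq _ (ht 0)) ((h 1).integral_eq _ (ht 1))
    simp only at e
    rw [← integral_add (i1 0) (i1 1), ← neg_add, ← integral_add (i2 0) (i2 1)] at e
    rw [← neg_inj, ← integral_neg]
    refine Eq.trans ?_ (e.trans ?_)
    · refine setIntegral_congr_fun hF.isOpen_annular.measurableSet fun p hp => ?_
      have h0 := norm_ne_zero_iff.2 (hF.ne_zero_of_mem hp)
      have hr : R - (radial R p).2 = ‖p.2‖ := by simp [radial]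
      have e2 := congrFun hKeq (radial R p)
      have hKr : fderiv ℝ (fun x : ℝ² => (R - x.2) * κ x) (radial R p) (0, 1) = _ :=
        fderiv_sub_mul hκ.differentiable _ _ _
      rw [fderiv_sub_mul hκ₁.differentiable, hKr, hr] at e2
      have e3 : K (radial R p) = ‖p.2‖ * fderiv ℝ κ (radial R p) (0, 1) - 2 * κ (radial R p) := by
        refine mul_left_cancel₀ h0 ?_
        linear_combination -e2
      simp only [hd p hp, e3]
      linear_combination (u p * fderiv ℝ κ (radial R p) (0, 1)) * sum_coord_mul_coord_div p.2
    · congr 1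
      refine setIntegral_congr_fun hF.isOpen_annular.measurableSet fun p hp => ?_
      have h0 := norm_ne_zero_iff.2 (hF.ne_zero_of_mem hp)
      simp only [radialPart, Fin.sum_univ_two, radial, sub_sub_cancel]
      field_simp
  have l1 := hF.integral_mul_radial (h 0).1 hK
  have l2 := hF.integral_mul_radial (hG.locallyIntegrableOn_two) hκ₁
  have l3 := mul_left_cancel₀ two_pi_pos.ne' (l1.symm.trans (hsum.trans l2))
  have l4 : ∀ x, fderiv ℝ (fun x : ℝ² => (R - x.2) * ((R - x.2) * κ x)) x (0, 1) = (R - x.2) * K x :=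
    congrFun hKeq
  simp only [l4, l3, neg_mul, one_mul, integral_neg, neg_neg]

lemma memW12_circleAvg {u : ℝ × Plane → ℝ} (hu : MemW12 (𝒪 R T ρ) u) :
    MemW12 (Ω T ρ) (circleAvg R u) := by
  obtain ⟨gt, h1, h1'⟩ := hu.2 (1, 0)
  choose g hg hg' using fun i => hu.2 (spaceDir i)
  have k1 := hF.hasWeakDeriv_time_circleAvg hu.1 h1' h1
  have k2 := hF.hasWeakDeriv_space_circleAvg hu.1 hg' hg
  have he : ∀ e : ℝ², e.1 • ((1 : ℝ), (0 : ℝ)) + e.2 • ((0 : ℝ), (1 : ℝ)) = e := fun e => by simp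
  refine ⟨hF.memLp_circleAvg hu.1, fun e => ⟨_, he e ▸ k1.comb k2 e.1 e.2, ?_⟩⟩
  exact ((hF.memLp_circleAvg h1').const_mul _).add
    (((hF.memLp_circleAvg (memLp_radialPart hg')).const_mul _).const_mul _)

end Front

section WeakForm

variable {R T α : ℝ} {ρ : ℝ → ℝ}

lemma strip_weakForm {v vt vr φ κ : ℝ² → ℝ} {U : Set ℝ²} (hU : IsOpen U)
    (hUR : ∀ x ∈ U, x.2 < R) (ht : HasWeakDeriv U (1, 0) v vt) (hr : HasWeakDeriv U (0, 1) v vr)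
    (hκ : IsTestFun U κ) (hφκ : φ = fun x => (R - x.2) * κ x) : ∫ x in U, (v x * (□ φ x)
        + 1 / (R - x.2) * vr x * φ x + α * vt x * φ x) =
      ∫ x in U, (R - x.2) * (-(vt x * fderiv ℝ κ x (1, 0)) + vr x * fderiv ℝ κ x (0, 1)
        + α * (vt x * κ x)) := by
  have hφ : IsTestFun U fun x => (R - x.2) * κ x := hκ.mul_left (by fun_prop)
  subst hφκ
  have i1 := ((hφ.fderiv (1, 0)).fderiv (1, 0)).integrable_mul ht.1 |>.integrableOn (s := U)
  have i2 := ((hφ.fderiv (0, 1)).fderiv (0, 1)).integrable_mul hr.1 |>.integrableOn (s := U)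
  have i3 := (hφ.fderiv (1, 0)).integrable_mul ht.2 |>.integrableOn (s := U)
  have i4 := (hφ.fderiv (0, 1)).integrable_mul hr.2 |>.integrableOn (s := U)
  have i5 := hκ.integrable_mul hr.2 |>.integrableOn (s := U)
  have i6 := (hφ.integrable_mul ht.2 |>.integrableOn (s := U)).const_mul α
  have f1 := ht.integral_eq _ (hφ.fderiv (1, 0))
  have f2 := hr.integral_eq _ (hφ.fderiv (0, 1))
  have hL := integral_add ((i1.sub i2).add i5) i6
  have hR := integral_add ((i3.neg.add i4).add i5) i6
  rw [integral_add' (i1.sub i2) i5, integral_sub' i1 i2, f1, f2] at hL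
  rw [integral_add' (i3.neg.add i4) i5, integral_add' i3.neg i4, integral_neg'] at hR
  simp only [Pi.add_apply, Pi.sub_apply, Pi.neg_apply] at hL hR
  refine Eq.trans ?_ (hL.trans (Eq.trans (by rw [sub_neg_eq_add]) (hR.symm.trans ?_)))
  · refine setIntegral_congr_fun hU.measurableSet fun x hx => ?_
    have h0 := (sub_pos.2 (hUR x hx)).ne'
    have e1 := hφ.iteratedDeriv_time x.1 x.2
    have e2 := hφ.iteratedDeriv_space x.1 x.2
    simp only at e1 e2 ⊢
    rw [e1, e2]
    field_simp
  · refine setIntegral_congr_fun hU.measurableSet fun x hx => ?_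
    simp only [fderiv_sub_mul hκ.differentiable]
    ring

lemma annular_weakForm {u ut Φ : ℝ × Plane → ℝ} {g : Fin 2 → ℝ × Plane → ℝ} {U : Set (ℝ × Plane)}
    (ht : HasWeakDeriv U (1, 0) u ut)
    (hg : ∀ i, HasWeakDeriv U (spaceDir i) u (g i)) (hΦ : IsTestFun U Φ) : ∫ p in U,
      (u p * (iteratedDeriv 2 (fun t => Φ (t, p.2)) p.1
        - Laplacian.laplacian (fun x => Φ (p.1, x)) p.2) + α * ut p * Φ p) =
      ∫ p in U, (-(ut p * fderiv ℝ Φ p (1, 0)) + ∑ i, g i p * fderiv ℝ Φ p (spaceDir i)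
        + α * (ut p * Φ p)) := by
  have i1 := ((hΦ.fderiv (1, 0)).fderiv (1, 0)).integrable_mul ht.1 |>.integrableOn (s := U)
  have i2 := fun i => ((hΦ.fderiv (spaceDir i)).fderiv (spaceDir i)).integrable_mul (hg i).1
    |>.integrableOn (s := U)
  have i3 := (hΦ.fderiv (1, 0)).integrable_mul ht.2 |>.integrableOn (s := U)
  have i4 := fun i => (hΦ.fderiv (spaceDir i)).integrable_mul (hg i).2 |>.integrableOn (s := U)
  have i6 := (hΦ.integrable_mul ht.2 |>.integrableOn (s := U)).const_mul α
  have f1 := ht.integral_eq _ (hΦ.fderiv (1, 0))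
  have f2 := fun i => (hg i).integral_eq _ (hΦ.fderiv (spaceDir i))
  have hL := integral_add (i1.sub ((i2 0).add (i2 1))) i6
  have hR := integral_add (i3.neg.add ((i4 0).add (i4 1))) i6
  rw [integral_sub' i1 ((i2 0).add (i2 1)), integral_add' (i2 0) (i2 1), f1, f2, f2] at hL
  rw [integral_add' i3.neg ((i4 0).add (i4 1)), integral_add' (i4 0) (i4 1), integral_neg'] at hR
  simp only [Pi.add_apply, Pi.sub_apply, Pi.neg_apply] at hL hR
  refine Eq.trans ?_ (hL.trans (Eq.trans (by ring) (hR.symm.trans ?_)))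
  · refine integral_congr_ae (of_forall fun p => ?_)
    have e1 := hΦ.iteratedDeriv_time p.1 p.2
    have e2 := hΦ.laplacian_slice p.1 p.2
    rw [Fin.sum_univ_two] at e2
    simp only at e1 e2 ⊢
    rw [e1, e2]
    ring
  · refine integral_congr_ae (of_forall fun p => ?_)
    simp only [Fin.sum_univ_two]

end WeakForm

lemma integral_neg_add_add_const_mul {X : Type*} [MeasurableSpace X] {μ : Measure X} {a b c : X → ℝ}
    (ha : Integrable a μ) (hb : Integrable b μ) (hc : Integrable c μ) (α : ℝ) :
    ∫ x, (-a x + b x + α * c x) ∂μ = -∫ x, a x ∂μ + ∫ x, b x ∂μ + α * ∫ x, c x ∂μ := by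
  rw [← integral_neg, ← integral_const_mul]
  exact (integral_add (ha.neg.add hb) (hc.const_mul α)).trans
    (congrArg (· + _) (integral_add ha.neg hb))

namespace Front

variable {R ρ₀ T : ℝ} {ρ : ℝ → ℝ} (hF : Front R ρ₀ T ρ)

include hF

lemma map_radial : (vol (𝒪 R T ρ)).map (radial R) = ofReal (2 * π) • polarMeasure R T ρ := by
  rw [← hF.measurePreserving_polarMap.map_eq,
    Measure.map_map (continuous_radial R).measurable (continuous_polarMap R).measurable]
  have h : radial R ∘ polarMap R =ᵐ[(polarMeasure R T ρ).prod angleMeasure] Prod.fst := by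
    have h1 : ∀ᵐ x ∂(polarMeasure R T ρ), x.2 ≤ R :=
      withDensity_absolutelyContinuous _ _ ((hF.ae_mem).mono fun x hx => (hF.strip_lt hx).le)
    filter_upwards [Measure.quasiMeasurePreserving_fst.ae h1] with y hy
    exact radial_polarMap hy y.2
  rw [Measure.map_congr h, Measure.map_fst_prod, ← angleMeasure_real_univ, ofReal_measureReal]

lemma map_radial_le : (vol (𝒪 R T ρ)).map (radial R) ≤
    (ofReal (2 * π) * ofReal R) • vol (Ω T ρ) := by
  rw [hF.map_radial, mul_smul]
  exact smul_le_smul_left _ hF.polarMeasure_le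

lemma ae_comp_radial {P : ℝ² → Prop} (h : ∀ᵐ x ∂vol (Ω T ρ), P x) :
    ∀ᵐ p ∂vol (𝒪 R T ρ), P (radial R p) :=
  ae_of_ae_map (continuous_radial R).measurable.aemeasurable
    ((absolutelyContinuous_of_le_smul hF.map_radial_le).ae_le h)

lemma memLp_comp_radial {k : ℝ² → ℝ} (hk : MemLp k 2 (vol (Ω T ρ))) :
    MemLp (fun p => k (radial R p)) 2 (vol (𝒪 R T ρ)) :=
  (hk.of_measure_le_smul (ENNReal.mul_ne_top ofReal_ne_top ofReal_ne_top)
    hF.map_radial_le).comp_of_map (continuous_radial R).measurable.aemeasurable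

lemma hasWeakDeriv_time_radial {k kt : ℝ² → ℝ} (hk : MemLp k 2 (vol (Ω T ρ)))
    (hkt : MemLp kt 2 (vol (Ω T ρ)))
    (h : HasWeakDeriv (Ω T ρ) (1, 0) k kt) :
    HasWeakDeriv (𝒪 R T ρ) (1, 0) (fun p => k (radial R p)) fun p => kt (radial R p) := by
  have l1 := (hF.memLp_comp_radial hk).locallyIntegrableOn_two
  have l2 := (hF.memLp_comp_radial hkt).locallyIntegrableOn_two
  refine ⟨l1, l2, fun Φ hΦ => ?_⟩
  rw [hF.integral_annular_symm ((hΦ.fderiv (1, 0)).integrable_mul l1).integrableOn,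
    hF.integral_annular_symm (hΦ.integrable_mul l2).integrableOn, ← integral_neg]
  refine integral_congr_ae (of_forall fun θ => ?_)
  obtain ⟨κ, hκ, hv, hd⟩ := hF.exists_isTestFun_polar hΦ θ
  have hφ : IsTestFun (Ω T ρ) fun x => (R - x.2) * κ x := hκ.mul_left (by fun_prop)
  refine Eq.trans ?_ ((h.integral_eq _ hφ).trans ?_)
  · refine hF.integral_congr fun x hx => ?_
    simp only [radial_polarMap (hF.strip_lt hx).le, fderiv_sub_mul hκ.differentiable, hd x hx]
    simp
    ring
  · congr 1
    refine hF.integral_congr fun x hx => ?_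
    simp only [radial_polarMap (hF.strip_lt hx).le, hv x hx]
    ring

lemma polarMap_snd_div {x : ℝ²} (hx : x.2 < R) (θ : ℝ) (e : Plane) :
    inner ℝ e (polarMap R (x, θ)).2 / ‖(polarMap R (x, θ)).2‖ = inner ℝ e (polarPoint 1 θ) := by
  have h := (sub_pos.2 hx)
  rw [polarMap, norm_polarPoint, abs_of_pos h, polarPoint_eq_smul, inner_smul_right,
    mul_div_cancel_left₀ _ h.ne']

lemma memLp_direction_mul {k : ℝ × Plane → ℝ} (hk : MemLp k 2 (vol (𝒪 R T ρ))) (e : Plane) :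
    MemLp (fun p : ℝ × Plane => -(inner ℝ e p.2 / ‖p.2‖) * k p) 2 (vol (𝒪 R T ρ)) := by
  refine hk.of_le_mul (c := ‖e‖) ((by fun_prop :
    Measurable fun p : ℝ × Plane => -(inner ℝ e p.2 / ‖p.2‖)).aestronglyMeasurable.mul
      hk.1) (of_forall fun p => ?_)
  rw [norm_mul, norm_neg, norm_div, norm_norm]
  gcongr
  exact div_le_of_le_mul₀ (norm_nonneg _) (norm_nonneg _) (norm_inner_le_norm e p.2)

lemma hasWeakDeriv_space_radial {k kr : ℝ² → ℝ} (hk : MemLp k 2 (vol (Ω T ρ)))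
    (hkr : MemLp kr 2 (vol (Ω T ρ)))
    (h : HasWeakDeriv (Ω T ρ) (0, 1) k kr) (e : Plane) :
    HasWeakDeriv (𝒪 R T ρ) (0, e) (fun p => k (radial R p))
      fun p => -(inner ℝ e p.2 / ‖p.2‖) * kr (radial R p) := by
  have l1 := (hF.memLp_comp_radial hk).locallyIntegrableOn_two
  have m2 := hF.memLp_direction_mul (hF.memLp_comp_radial hkr) e
  have l2 := m2.locallyIntegrableOn_two
  refine ⟨l1, l2, fun Φ hΦ => ?_⟩
  have hsm : ∀ {Ψ : ℝ × Plane → ℝ}, IsTestFun (𝒪 R T ρ) Ψ → ∀ {m : ℝ × Plane → ℝ},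
      (∀ p ∈ 𝒪 R T ρ, ContDiffAt ℝ ∞ m p) →
      IsTestFun (𝒪 R T ρ) fun p => Ψ p * m p := fun hΨ m hm =>
    hΨ.comp_mul (F := id) continuous_id hΨ.hasCompactSupport hΨ.tsupport_subset Subset.rfl
      fun p hp => ⟨contDiffAt_id, hm p (hΨ.tsupport_subset hp)⟩
  have hn : ∀ p ∈ 𝒪 R T ρ, ContDiffAt ℝ ∞ (fun p : ℝ × Plane => (‖p.2‖ ^ 2)⁻¹) p :=
    fun p hp => ((contDiffAt_snd.norm_sq ℝ).inv
      (pow_ne_zero 2 (norm_ne_zero_iff.2 (hF.ne_zero_of_mem hp))))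
  have hM := hsm hΦ (m := fun p => inner ℝ e p.2 * (‖p.2‖ ^ 2)⁻¹) fun p hp =>
    (contDiffAt_const.inner ℝ contDiffAt_snd).mul (hn p hp)
  have hMi := fun i => hsm (hΦ.fderiv (spaceDir i)) (m := fun p => inner ℝ e p.2 * p.2 i * (‖p.2‖ ^ 2)⁻¹)
    fun p hp => ((contDiffAt_const.inner ℝ contDiffAt_snd).mul
      (by fun_prop : ContDiff ℝ ∞ fun p : ℝ × Plane => p.2 i).contDiffAt).mul (hn p hp)
  obtain ⟨H, iH, hH⟩ : ∃ H, IntegrableOn H (𝒪 R T ρ) ∧ ∀ x ∈ Ω T ρ, ∀ θ,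
      (R - x.2) * H (polarMap R (x, θ)) = k x * (inner ℝ e (polarPoint 1 θ) *
        (fderiv ℝ Φ (polarMap R (x, θ)) (0, polarPoint 1 θ) * (R - x.2) + Φ (polarMap R (x, θ)))) := by
    refine ⟨_, (((hMi 0).integrable_mul l1).add ((hMi 1).integrable_mul l1)).add
      (hM.integrable_mul l1) |>.integrableOn, ?_⟩
    intro x hx θ
    have h0 := (sub_pos.2 (hF.strip_lt hx))
    have hdir : ((0 : ℝ), polarPoint 1 θ) = Real.cos θ • spaceDir 0 + Real.sin θ • spaceDir 1 := by
      simp only [Prod.smul_mk, Prod.mk_add_mk, smul_zero, add_zero, Prod.mk.injEq, true_and]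
      ext i
      fin_cases i <;> simp [polarPoint]
    simp only [Pi.add_apply]
    rw [radial_polarMap (hF.strip_lt hx).le, hdir, map_add, map_smul, map_smul]
    have e0 : (polarMap R (x, θ)).2 = (R - x.2) • polarPoint 1 θ := polarPoint_eq_smul _ _
    have e1 : ‖(polarMap R (x, θ)).2‖ = R - x.2 := by rw [polarMap, norm_polarPoint, abs_of_pos h0]
    have e2 : (polarMap R (x, θ)).2 0 = (R - x.2) * Real.cos θ := rfl
    have e3 : (polarMap R (x, θ)).2 1 = (R - x.2) * Real.sin θ := rfl
    rw [e1, e2, e3, e0, inner_smul_right]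
    simp only [smul_eq_mul]
    field_simp
  trans ∫ p in 𝒪 R T ρ, H p
  · rw [hF.integral_annular ((hΦ.fderiv (0, e)).integrable_mul l1).integrableOn,
      hF.integral_annular iH]
    congr 1
    refine hF.integral_congr fun x hx => ?_
    simp only [circleAvg]
    rw [mul_left_comm, mul_left_comm (R - x.2)]
    congr 1
    rw [← integral_const_mul, ← integral_const_mul]
    simp only [hH x hx, radial_polarMap (hF.strip_lt hx).le, mul_left_comm (R - x.2)]
    rw [integral_const_mul, integral_const_mul, ← integral_const_mul (R - x.2), integral_const_mul (k x)]
    congr 1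
    exact integral_circle_fderiv hΦ.contDiff x.1 (R - x.2) e
  · rw [hF.integral_annular_symm iH, hF.integral_annular_symm (hΦ.integrable_mul l2).integrableOn,
      ← integral_neg]
    refine integral_congr_ae (of_forall fun θ => ?_)
    obtain ⟨κ, hκ, hv, hd⟩ := hF.exists_isTestFun_polar hΦ θ
    have hφ : IsTestFun (Ω T ρ) fun x => (R - x.2) * κ x := hκ.mul_left (by fun_prop)
    have h1 := congrArg (fun y => -inner ℝ e (polarPoint 1 θ) * y) (h.integral_eq _ hφ)
    rw [← integral_neg, ← integral_const_mul, ← integral_const_mul] at h1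
    refine Eq.trans ?_ (h1.trans ?_)
    · refine hF.integral_congr fun x hx => ?_
      have hneg : ((0 : ℝ), -(1 : ℝ) • polarPoint 1 θ) = -((0 : ℝ), polarPoint 1 θ) := by simp
      simp only [hH x hx, fderiv_sub_mul hκ.differentiable, hd x hx, hneg, map_neg, hv x hx]
      ring
    · simp only
      rw [← integral_neg]
      refine hF.integral_congr fun x hx => ?_
      simp only [radial_polarMap (hF.strip_lt hx).le, hv x hx, hF.polarMap_snd_div (hF.strip_lt hx)]
      ring

lemma memW12_radial {k : ℝ² → ℝ} (hk : MemW12 (Ω T ρ) k) :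
    MemW12 (𝒪 R T ρ) fun p => k (radial R p) := by
  obtain ⟨kt, h1, h1'⟩ := hk.2 (1, 0)
  obtain ⟨kr, h2, h2'⟩ := hk.2 (0, 1)
  refine ⟨hF.memLp_comp_radial hk.1, fun e => ?_⟩
  have he : e.1 • ((1 : ℝ), (0 : Plane)) + (1 : ℝ) • ((0 : ℝ), e.2) = e := by simp
  exact ⟨_, he ▸ (hF.hasWeakDeriv_time_radial hk.1 h1' h1).comb
    (hF.hasWeakDeriv_space_radial hk.1 h2' h2 e.2) e.1 1,
    ((hF.memLp_comp_radial h1').const_mul _).add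
      ((hF.memLp_direction_mul (hF.memLp_comp_radial h2') e.2).const_mul _)⟩

variable {α : ℝ}

lemma annular_equation_of_strip {v vt vr : ℝ² → ℝ} (hv : MemLp v 2 (vol (Ω T ρ)))
    (hvt : MemLp vt 2 (vol (Ω T ρ)))
    (hvr : MemLp vr 2 (vol (Ω T ρ)))
    (ht : HasWeakDeriv (Ω T ρ) (1, 0) v vt)
    (hr : HasWeakDeriv (Ω T ρ) (0, 1) v vr)
    (heq : ∀ φ : ℝ² → ℝ, IsTestFun (Ω T ρ) φ → ∫ p in Ω T ρ, (v p * (□ φ p)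
        + 1 / (R - p.2) * vr p * φ p + α * vt p * φ p) = 0)
    {Φ : ℝ × Plane → ℝ} (hΦ : IsTestFun (𝒪 R T ρ) Φ) :
    ∫ p in 𝒪 R T ρ, (v (radial R p) * (iteratedDeriv 2 (fun t => Φ (t, p.2)) p.1
      - Laplacian.laplacian (fun x => Φ (p.1, x)) p.2) + α * vt (radial R p) * Φ p) = 0 := by
  have ht' := hF.hasWeakDeriv_time_radial hv hvt ht
  have hr' := fun i : Fin 2 => hF.hasWeakDeriv_space_radial hv hvr hr (EuclideanSpace.single i 1)
  rw [annular_weakForm ht' hr' hΦ]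
  have i1 := (hΦ.fderiv (1, 0)).integrable_mul ht'.2 |>.integrableOn (s := 𝒪 R T ρ)
  have i2 := fun i : Fin 2 => (hΦ.fderiv (spaceDir i)).integrable_mul (hr' i).2
    |>.integrableOn (s := 𝒪 R T ρ)
  have i3 := (hΦ.integrable_mul ht'.2 |>.integrableOn (s := 𝒪 R T ρ)).const_mul α
  obtain ⟨H, hi, hH⟩ : ∃ H : ℝ × Plane → ℝ, IntegrableOn H (𝒪 R T ρ) ∧ ∀ p, H p =
      -(vt (radial R p) * fderiv ℝ Φ p (1, 0)) + ∑ i : Fin 2,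
        -(inner ℝ (EuclideanSpace.single i 1) p.2 / ‖p.2‖) * vr (radial R p) * fderiv ℝ Φ p (spaceDir i)
        + α * (vt (radial R p) * Φ p) :=
    ⟨_, (i1.neg.add ((i2 0).add (i2 1))).add i3, fun p => by
      simp only [Fin.sum_univ_two, Pi.add_apply, Pi.neg_apply]⟩
  simp only [← hH]
  rw [hF.integral_annular_symm hi]
  refine (integral_congr_ae (of_forall fun θ => ?_)).trans (integral_zero _ _)
  obtain ⟨κ, hκ, hκv, hκd⟩ := hF.exists_isTestFun_polar hΦ θ
  obtain ⟨φ, hφκ⟩ : ∃ φ : ℝ² → ℝ, φ = fun x => (R - x.2) * κ x := ⟨_, rfl⟩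
  have hφ : IsTestFun (Ω T ρ) φ := hφκ ▸ hκ.mul_left (by fun_prop)
  have h0 := heq φ hφ
  rw [strip_weakForm hF.isOpen_strip (fun x => hF.strip_lt) ht hr hκ hφκ] at h0
  refine Eq.trans ?_ h0
  refine hF.integral_congr fun x hx => ?_
  have hlt := hF.strip_lt hx
  have hdir : ((0 : ℝ), -(1 : ℝ) • polarPoint 1 θ) =
      -(Real.cos θ • spaceDir 0 + Real.sin θ • spaceDir 1) := by
    simp only [Prod.smul_mk, Prod.mk_add_mk, smul_zero, add_zero, Prod.neg_mk, neg_zero,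
      Prod.mk.injEq, true_and]
    ext i
    fin_cases i <;> simp [polarPoint]
  simp only [hH, Fin.sum_univ_two, radial_polarMap hlt.le, hF.polarMap_snd_div hlt, hκv x hx,
    hκd x hx, hdir, map_neg, map_add, map_smul, smul_eq_mul, inner_polarPoint, neg_zero, zero_smul]
  refine congrArg (fun y => (R - x.2) * y) ?_
  simp
  ring

lemma strip_equation_of_annular {u ut : ℝ × Plane → ℝ} {g : Fin 2 → ℝ × Plane → ℝ}
    (hu : MemLp u 2 (vol (𝒪 R T ρ)))
    (hut : MemLp ut 2 (vol (𝒪 R T ρ)))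
    (hgL : ∀ i, MemLp (g i) 2 (vol (𝒪 R T ρ)))
    (ht : HasWeakDeriv (𝒪 R T ρ) (1, 0) u ut)
    (hg : ∀ i, HasWeakDeriv (𝒪 R T ρ) (spaceDir i) u (g i))
    (heq : ∀ Φ : ℝ × Plane → ℝ, IsTestFun (𝒪 R T ρ) Φ →
      ∫ p in 𝒪 R T ρ, (u p * (iteratedDeriv 2 (fun t => Φ (t, p.2)) p.1
        - Laplacian.laplacian (fun x => Φ (p.1, x)) p.2) + α * ut p * Φ p) = 0)
    {φ : ℝ² → ℝ} (hφ : IsTestFun (Ω T ρ) φ) : ∫ p in Ω T ρ, (circleAvg R u p * (□ φ p)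
        + 1 / (R - p.2) * (-1 * circleAvg R (radialPart g) p) * φ p
        + α * circleAvg R ut p * φ p) = 0 := by
  obtain ⟨κ, hκ, hφκ⟩ := hF.exists_isTestFun_mul hφ
  have hG := memLp_radialPart hgL
  have ht' := hF.hasWeakDeriv_time_circleAvg hu hut ht
  have hr' := hF.hasWeakDeriv_space_circleAvg hu hgL hg
  rw [strip_weakForm hF.isOpen_strip (fun x => hF.strip_lt) ht' hr' hκ hφκ]
  obtain ⟨Φ, hΦeq⟩ : ∃ Φ : ℝ × Plane → ℝ, Φ = fun p => κ (radial R p) := ⟨_, rfl⟩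
  have hl : IsTestFun (𝒪 R T ρ) Φ := by
    simpa only [hΦeq, mul_one] using hF.isTestFun_lift hκ (contDiff_const (c := (1 : ℝ)))
  have e := heq Φ hl
  rw [annular_weakForm ht hg hl] at e
  have lut := hut.locallyIntegrableOn_two
  have lG := hG.locallyIntegrableOn_two
  have i0 : ∀ {k h}, IsTestFun (Ω T ρ) k → LocallyIntegrableOn h (𝒪 R T ρ) →
      IntegrableOn (fun p => h p * k (radial R p)) (𝒪 R T ρ) := fun hk hh => by
    have := hF.isTestFun_lift hk (contDiff_const (c := (1 : ℝ)))
    simp only [mul_one] at this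
    exact (this.integrable_mul hh).integrableOn
  have j0 : ∀ {k h : ℝ² → ℝ}, IsTestFun (Ω T ρ) k → LocallyIntegrableOn h (Ω T ρ) →
      IntegrableOn (fun x => h x * ((R - x.2) * k x)) (Ω T ρ) := fun hk hh =>
    ((hk.mul_left (by fun_prop : ContDiff ℝ ∞ fun x : ℝ² => R - x.2)).integrable_mul hh).integrableOn
  have hkt := hκ.fderiv (1, 0)
  have hkr := hκ.fderiv (0, 1)
  have hi := integral_neg_add_add_const_mul (i0 hkt lut) (i0 hkr lG).neg (i0 hκ lut) α
  have hj := integral_neg_add_add_const_mul (j0 hkt ht'.2) (j0 hkr hr'.2) (j0 hκ ht'.2) α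
  rw [integral_neg', hF.integral_mul_radial lut hkt, hF.integral_mul_radial lG hkr,
    hF.integral_mul_radial lut hκ] at hi
  simp only [neg_mul, one_mul, integral_neg] at hj
  have e0 : ∫ p in 𝒪 R T ρ, (-(ut p * fderiv ℝ κ (radial R p) (1, 0)) +
      (-fun p => radialPart g p * fderiv ℝ κ (radial R p) (0, 1)) p + α * (ut p * κ (radial R p))) = 0 := by
    refine Eq.trans (setIntegral_congr_fun hF.isOpen_annular.measurableSet fun p hp => ?_) e
    have h0 := hF.ne_zero_of_mem hp
    simp only [hΦeq, fderiv_comp_radial hκ.differentiable h0, Pi.neg_apply, radialPart, Fin.sum_univ_two,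
      EuclideanSpace.inner_single_right]
    simp
    ring
  have h2 : 2 * π ≠ 0 := two_pi_pos.ne'
  rw [e0] at hi
  refine Eq.trans (Eq.trans ?_ hj) (mul_left_cancel₀ h2 (Eq.trans ?_ (hi.symm.trans (mul_zero _).symm)))
  · refine hF.integral_congr fun x hx => ?_
    ring
  · ring

end Front

section Static

variable {E : Type*} [NormedAddCommGroup E] [NormedSpace ℝ E] [MeasureSpace E] [BorelSpace E]
  [FiniteDimensional ℝ E] [(volume : Measure E).IsAddHaarMeasure] {U : Set E} {k k' : E → ℝ}

instance isProbabilityMeasure_unit_interval :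
    IsProbabilityMeasure ((volume : Measure ℝ).restrict (Ioo 0 1)) := ⟨by simp⟩

lemma restrict_unit_prod (U : Set E) : (volume : Measure (ℝ × E)).restrict (Ioo 0 1 ×ˢ U) =
    (vol (Ioo 0 1)).prod (vol U) := by
  rw [volume_eq_prod, prod_restrict]

lemma ae_comp_snd_iff {P : E → Prop} : (∀ᵐ p ∂((volume : Measure (ℝ × E)).restrict (Ioo 0 1 ×ˢ U)),
    P p.2) ↔ ∀ᵐ x ∂(vol U), P x := by
  rw [restrict_unit_prod]
  refine ⟨fun h => ?_, fun h => Measure.quasiMeasurePreserving_snd.ae h⟩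
  exact (ae_ae_of_ae_prod h).exists.choose_spec

lemma memLp_comp_snd_iff : MemLp (fun p : ℝ × E => k p.2) 2 (vol (Ioo 0 1 ×ˢ U)) ↔
      MemLp k 2 (vol U) := by
  rw [restrict_unit_prod]
  refine ⟨fun h => ?_, fun h => h.comp_snd _⟩
  have hm : AEStronglyMeasurable k (vol U) := h.1.prodMk_left.exists.choose_spec
  exact ⟨hm, (eLpNorm_comp_measurePreserving hm measurePreserving_snd).symm.trans_lt h.2⟩

lemma HasWeakDeriv.of_comp_snd {e : E} (hk : LocallyIntegrableOn k U) (hk' : LocallyIntegrableOn k' U)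
    (h : HasWeakDeriv (Ioo 0 1 ×ˢ U) ((0 : ℝ), e) (fun p => k p.2) fun p => k' p.2) :
    HasWeakDeriv U e k k' := by
  obtain ⟨f, hf⟩ : ∃ f : ContDiffBump (1 / 2 : ℝ), f.rOut < 1 / 2 :=
    ⟨⟨1 / 8, 1 / 4, by norm_num, by norm_num⟩, by norm_num⟩
  refine HasWeakDeriv.of_integral_eq' hk hk' fun φ hφ => ?_
  have hts : tsupport (fun p : ℝ × E => f p.1 * φ p.2) ⊆ tsupport f ×ˢ tsupport φ :=
    closure_minimal (fun p hp => ⟨subset_tsupport _ (left_ne_zero_of_mul hp),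
      subset_tsupport _ (right_ne_zero_of_mul hp)⟩) ((isClosed_tsupport _).prod (isClosed_tsupport _))
  have hΦ : IsTestFun (Ioo 0 1 ×ˢ U) fun p : ℝ × E => f p.1 * φ p.2 := by
    refine ⟨(f.contDiff.comp contDiff_fst).mul (hφ.contDiff.comp contDiff_snd),
      (f.hasCompactSupport.isCompact.prod hφ.hasCompactSupport.isCompact).of_isClosed_subset
        (isClosed_tsupport _) hts, hts.trans (prod_mono ?_ hφ.tsupport_subset)⟩
    rw [f.tsupport_eq, Real.closedBall_eq_Icc]
    exact fun t ht => ⟨by linarith [ht.1], by linarith [ht.2]⟩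
  have h1 := h.integral_eq' hΦ
  have hd : ∀ p : ℝ × E, fderiv ℝ (fun p : ℝ × E => f p.1 * φ p.2) p (0, e) =
      f p.1 * fderiv ℝ φ p.2 e := by
    intro p
    rw [← hΦ.fderiv_slice p.1 p.2 e]
    simp only
    rw [fderiv_const_mul (hφ.differentiable p.2)]
    rfl
  simp only [hd, volume_eq_prod] at h1
  have h2 := integral_prod_mul (μ := volume) (ν := volume) f fun x => k x * fderiv ℝ φ x e
  have h3 := integral_prod_mul (μ := volume) (ν := volume) f fun x => k' x * φ x
  simp only [mul_left_comm (k _), mul_left_comm (k' _)] at h1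
  rw [h2, h3, ← mul_neg] at h1
  exact mul_left_cancel₀ f.integral_pos.ne' h1

end Static

lemma front_const {R a : ℝ} (ha : 0 < a) (haR : a < R) : Front R a 1 fun _ => a :=
  ⟨ha, one_pos, monotone_const, fun _ _ h => by simpa using h, fun _ _ => rfl, fun _ _ => rfl, haR⟩

lemma stripDomain_const (a : ℝ) : Ω 1 (fun _ => a) = Ioo 0 1 ×ˢ Ioo 0 a := by
  ext x
  simp only [stripDomain, mem_ofPred_eq, mem_prod, mem_Ioo, and_assoc]

lemma annularDomain_const (R a : ℝ) : 𝒪 R 1 (fun _ => a) = Ioo 0 1 ×ˢ annulus (R - a) R := by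
  ext x
  simp only [annularDomain, annulus, mem_ofPred_eq, mem_prod, mem_Ioo, and_assoc]

section Annulus

variable {R a : ℝ} (ha : 0 < a) (haR : a < R)

include ha haR

lemma isOpen_annulus : IsOpen (annulus (R - a) R) :=
  (isOpen_lt continuous_const continuous_norm).inter (isOpen_lt continuous_norm continuous_const)

lemma IsRadialAE.ae_eq_circleAvg {f : Plane → ℝ} (h : IsRadialAE (R - a) R f) :
    ∀ᵐ x ∂vol (annulus (R - a) R), f x = circleAvg R (fun p => f p.2) (0, R - ‖x‖) := by
  obtain ⟨F, h⟩ := h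
  have hF := front_const ha haR
  rw [← ae_comp_snd_iff, ← annularDomain_const] at h ⊢
  have h1 := ae_ae_of_ae_prod (hF.measurePreserving_polarMap.quasiMeasurePreserving.ae h)
  have h2 : ∀ᵐ x ∂vol (Ω 1 fun _ => a), circleAvg R (fun p => f p.2) (0, x.2) = F (R - x.2) := by
    filter_upwards [hF.absolutelyContinuous_polarMeasure.ae_le h1, hF.ae_mem] with x hx hxS
    have hle := (hF.strip_lt hxS).le
    rw [← circleAvg_radial (k := fun x => F (R - x.2)) (x := (0, x.2)) hle, circleAvg, circleAvg,
      integral_congr_ae (g := fun θ => F (R - (radial R (polarMap R ((0, x.2), θ))).2))]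
    filter_upwards [hx] with θ hθ
    refine Eq.trans hθ ?_
    rw [radial_polarMap (x := (0, x.2)) hle, polarMap, norm_polarPoint, abs_of_nonneg (sub_nonneg.2 hle)]
  filter_upwards [h, hF.ae_comp_radial h2] with p hp1 hp2
  simp only [radial, sub_sub_cancel] at hp2
  rw [hp1, hp2]

lemma memLp_circleAvg_static {f : Plane → ℝ} (hf : MemLp f 2 (vol (annulus (R - a) R))) :
    MemLp (fun r => circleAvg R (fun p => f p.2) (0, r)) 2 (vol (Ioo 0 a)) := by
  have hF := front_const ha haR
  rw [← memLp_comp_snd_iff, ← stripDomain_const]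
  refine hF.memLp_circleAvg (h := fun p => f p.2) ?_
  rwa [annularDomain_const, memLp_comp_snd_iff]

lemma memW12_circleAvg_static {f : Plane → ℝ} (hf : MemW12 (annulus (R - a) R) f) :
    MemW12 (Ioo 0 a) fun r => circleAvg R (fun p => f p.2) (0, r) := by
  have hF := front_const ha haR
  have hL := memLp_circleAvg_static ha haR hf.1
  choose g hg hg' using hf.2
  have hc := fun {k : Plane → ℝ} (hk : MemLp k 2 (vol (annulus (R - a) R))) =>
    (by rwa [annularDomain_const, memLp_comp_snd_iff] : MemLp (fun p : ℝ × Plane => k p.2) 2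
      (vol (𝒪 R 1 fun _ => a)))
  have hd := hF.hasWeakDeriv_space_circleAvg (g := fun i p => g (EuclideanSpace.single i 1) p.2)
    (hc hf.1) (fun i => hc (hg' _)) fun i => by
      rw [annularDomain_const]
      exact (hg _).comp_snd _
  have hdL := ((hF.memLp_circleAvg (memLp_radialPart fun i : Fin 2 =>
    hc (hg' (EuclideanSpace.single i 1)))).const_mul (-1))
  rw [stripDomain_const] at hd hdL
  have hdL' := (memLp_comp_snd_iff (k := fun r => -1 * circleAvg R
    (radialPart fun i p => g (EuclideanSpace.single i 1) p.2) (0, r))).1 hdL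
  have h1 := HasWeakDeriv.of_comp_snd hL.locallyIntegrableOn_two hdL'.locallyIntegrableOn_two hd
  exact ⟨hL, fun e => ⟨_, by simpa only [smul_eq_mul, mul_one, zero_mul, add_zero] using h1.comb h1 e 0,
    hdL'.const_mul e⟩⟩

lemma memLp_radial_static {k : ℝ → ℝ} (hk : MemLp k 2 (vol (Ioo 0 a))) :
    MemLp (fun x => k (R - ‖x‖)) 2 (vol (annulus (R - a) R)) := by
  rw [← memLp_comp_snd_iff, ← stripDomain_const] at hk
  have h := (front_const ha haR).memLp_comp_radial hk
  rw [annularDomain_const] at h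
  exact (memLp_comp_snd_iff (k := fun x => k (R - ‖x‖))).1 h

lemma memW12_radial_static {k : ℝ → ℝ} (hk : MemW12 (Ioo 0 a) k) :
    MemW12 (annulus (R - a) R) fun x => k (R - ‖x‖) := by
  have hF := front_const ha haR
  obtain ⟨k', hd, hL'⟩ := hk.2 1
  have hc := fun {k : ℝ → ℝ} (hk : MemLp k 2 (vol (Ioo 0 a))) =>
    (by rwa [stripDomain_const, memLp_comp_snd_iff] : MemLp (fun p : ℝ² => k p.2) 2
      (vol (Ω 1 fun _ => a)))
  have hL := memLp_radial_static ha haR hk.1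
  refine ⟨hL, fun e => ?_⟩
  have h2 := hF.memLp_direction_mul (hF.memLp_comp_radial (hc hL')) e
  have h3 := hF.hasWeakDeriv_space_radial (hc hk.1) (hc hL') (by
    rw [stripDomain_const]
    exact hd.comp_snd _) e
  rw [annularDomain_const] at h2 h3
  have h4 := (memLp_comp_snd_iff (k := fun x => -(inner ℝ e x / ‖x‖) * k' (R - ‖x‖))).1 h2
  exact ⟨_, HasWeakDeriv.of_comp_snd hL.locallyIntegrableOn_two h4.locallyIntegrableOn_two h3, h4⟩

lemma exists_eLpNorm_annulus_le : ∃ C : ℝ≥0∞, C ≠ ⊤ ∧ ∀ k : ℝ → ℝ,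
    AEStronglyMeasurable k (vol (Ioo 0 a)) →
    eLpNorm (fun x => k (R - ‖x‖)) 2 (vol (annulus (R - a) R)) ≤ C * eLpNorm k 2 (vol (Ioo 0 a)) ∧
    eLpNorm k 2 (vol (Ioo 0 a)) ≤
      C * eLpNorm (fun x => k (R - ‖x‖)) 2 (vol (annulus (R - a) R)) := by
  have hF := front_const ha haR
  obtain ⟨C, hC, hle⟩ := hF.exists_eLpNorm_circleAvg_le
  have hne : ofReal (2 * π) * ofReal R ≠ ⊤ := ENNReal.mul_ne_top ofReal_ne_top ofReal_ne_top
  refine ⟨max C ((ofReal (2 * π) * ofReal R) ^ (1 / (2 : ℝ≥0∞)).toReal),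
    max_ne_top hC (ENNReal.rpow_ne_top_of_nonneg ENNReal.toReal_nonneg hne), fun k hk => ?_⟩
  have hk2 : AEStronglyMeasurable (fun x : ℝ² => k x.2) (vol (Ω 1 fun _ => a)) := by
    rw [stripDomain_const, restrict_unit_prod]
    exact hk.comp_snd
  have hk3 : AEStronglyMeasurable (fun x : ℝ² => k x.2) ((vol (𝒪 R 1 fun _ => a)).map (radial R)) :=
    hk2.mono_ac (absolutelyContinuous_of_le_smul hF.map_radial_le)
  have hk4 := hk3.comp_measurable (continuous_radial R).measurable
  have e1 : eLpNorm (fun x : ℝ² => k x.2) 2 (vol (Ω 1 fun _ => a)) =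
      eLpNorm k 2 (vol (Ioo 0 a)) := by
    rw [stripDomain_const, restrict_unit_prod]
    exact eLpNorm_comp_measurePreserving hk measurePreserving_snd
  have e2 : eLpNorm (fun p => k (radial R p).2) 2 (vol (𝒪 R 1 fun _ => a)) =
      eLpNorm (fun x => k (R - ‖x‖)) 2 (vol (annulus (R - a) R)) := by
    have h : AEStronglyMeasurable (fun p : ℝ × Plane => k (R - ‖p.2‖))
      (vol (𝒪 R 1 fun _ => a)) := hk4
    rw [annularDomain_const, restrict_unit_prod] at h ⊢
    exact eLpNorm_comp_measurePreserving (g := fun x => k (R - ‖x‖)) h.prodMk_left.exists.choose_spec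
      measurePreserving_snd
  rw [← e1, ← e2]
  constructor
  · refine (eLpNorm_map_measure hk3 (continuous_radial R).measurable.aemeasurable).symm.trans_le
      ((eLpNorm_mono_measure _ hF.map_radial_le).trans ?_)
    rw [eLpNorm_smul_measure_of_ne_top (by simp), smul_eq_mul]
    exact mul_le_mul' (le_max_right _ _) le_rfl
  · refine le_trans (le_of_eq (eLpNorm_congr_ae ?_))
      ((hle _ hk4).trans (mul_le_mul' (le_max_left _ _) le_rfl))
    filter_upwards [hF.ae_mem] with x hx
    exact (circleAvg_radial (k := fun x => k x.2) (hF.strip_lt hx).le).symm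

lemma integral_annulus {k : ℝ → ℝ} (hk : MemLp k 2 (vol (Ioo 0 a))) :
    ∫ x in annulus (R - a) R, k (R - ‖x‖) = 2 * π * ∫ r in Ioo 0 a, (R - r) * k r := by
  have hF := front_const ha haR
  have h1 : MemLp (fun x : ℝ² => k x.2) 2 (vol (Ω 1 fun _ => a)) := by
    rwa [stripDomain_const, memLp_comp_snd_iff]
  have : IsFiniteMeasure (vol (𝒪 R 1 fun _ => a)) :=
    ⟨by rw [restrict_apply_univ]; exact hF.volume_annular_lt_top⟩
  have h2 := hF.integral_annular ((hF.memLp_comp_radial h1).integrable one_le_two)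
  rw [setIntegral_congr_fun (g := fun x : ℝ² => (R - x.2) * k x.2) hF.measurableSet_strip
    fun x hx => by simp only [circleAvg_radial (k := fun x => k x.2) (hF.strip_lt hx).le],
    annularDomain_const, stripDomain_const, restrict_unit_prod, restrict_unit_prod] at h2
  simpa only [radial, integral_fun_snd (f := fun x : Plane => k (R - ‖x‖)), probReal_univ, one_smul,
    integral_fun_snd (f := fun r => (R - r) * k r)] using h2

end Annulus

namespace Front

variable {R ρ₀ T : ℝ} {ρ : ℝ → ℝ} (hF : Front R ρ₀ T ρ)

include hF

lemma polarMap_mem_closure {x : ℝ²} (hx : x ∈ closure (Ω T ρ)) (θ : ℝ) :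
    polarMap R (x, θ) ∈ closure (𝒪 R T ρ) := by
  refine map_mem_closure (f := fun x => polarMap R (x, θ))
    ((continuous_polarMap R).comp (continuous_id.prodMk continuous_const)) hx fun y hy => ?_
  rw [mem_annularDomain, radial_polarMap (hF.strip_lt hy).le]
  exact hy

lemma radial_mem_closure {p : ℝ × Plane} (hp : p ∈ closure (𝒪 R T ρ)) :
    radial R p ∈ closure (Ω T ρ) :=
  map_mem_closure (continuous_radial R) hp fun _ hy => mem_annularDomain.1 hy

lemma continuousOn_circleAvg {φ : ℝ × Plane → ℝ} (hφ : ContinuousOn φ (closure (𝒪 R T ρ))) :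
    ContinuousOn (circleAvg R φ) (closure (Ω T ρ)) := by
  rw [continuousOn_iff_continuous_domRestrict]
  have h : Continuous (Function.uncurry fun (x : closure (Ω T ρ)) θ => φ (polarMap R (x, θ))) :=
    hφ.comp_continuous ((continuous_polarMap R).comp
      ((continuous_subtype_val.comp continuous_fst).prodMk continuous_snd))
      fun y => hF.polarMap_mem_closure y.1.2 y.2
  have := (intervalIntegral.continuous_parametric_intervalIntegral_of_continuous' (μ := volume) h 0
    (2 * π)).const_mul (2 * π)⁻¹
  simp only [integral_of_le two_pi_pos.le, integral_Ioc_eq_integral_Ioo] at this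
  exact this

lemma circleAvg_sub_ae {f g : ℝ × Plane → ℝ} (hf : MemLp f 2 (vol (𝒪 R T ρ)))
    (hg : MemLp g 2 (vol (𝒪 R T ρ))) :
    circleAvg R (fun p => f p - g p) =ᵐ[vol (Ω T ρ)]
      fun x => circleAvg R f x - circleAvg R g x := by
  have : IsFiniteMeasure (vol (𝒪 R T ρ)) :=
    ⟨by rw [restrict_apply_univ]; exact hF.volume_annular_lt_top⟩
  filter_upwards [hF.absolutelyContinuous_polarMeasure.ae_le
      (hF.integrable_comp_polarMap (hf.integrable one_le_two)).prod_right_ae,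
    hF.absolutelyContinuous_polarMeasure.ae_le
      (hF.integrable_comp_polarMap (hg.integrable one_le_two)).prod_right_ae] with x h1 h2
  simp only [circleAvg]
  rw [integral_sub h1 h2, mul_sub]

lemma tendstoZeroW12_circleAvg {u : ℝ × Plane → ℝ} {φ : ℕ → ℝ × Plane → ℝ}
    (hu : MemW12 (𝒪 R T ρ) u) (hφ : ∀ n, MemW12 (𝒪 R T ρ) (φ n))
    (h : TendstoZeroW12 (𝒪 R T ρ) fun n p => φ n p - u p) :
    TendstoZeroW12 (Ω T ρ) fun n x => circleAvg R (φ n) x - circleAvg R u x := by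
  have hO := hF.isOpen_annular
  have hS := hF.isOpen_strip
  obtain ⟨C, hC, hle⟩ := hF.exists_eLpNorm_circleAvg_le
  have hd := fun n => (hφ n).sub hu
  have hae := fun n => hF.circleAvg_sub_ae (hφ n).1 hu.1
  have hz : ∀ {a : ℕ → ℝ≥0∞} (c : ℝ≥0∞), c ≠ ⊤ → Tendsto a atTop (𝓝 0) →
      Tendsto (fun n => c * a n) atTop (𝓝 0) := fun c hc ha => by
    simpa using ENNReal.Tendsto.const_mul ha (Or.inr hc)
  refine ⟨tendsto_zero_of_le_mul hC h.1 (of_forall fun n => ?_), fun e => ?_⟩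
  · rw [← eLpNorm_congr_ae (hae n)]
    exact hle _ (hd n).1.1
  obtain ⟨gt, ht, ht0⟩ := h.2 (1, 0)
  choose g hg hg0 using fun i => h.2 (spaceDir i)
  have htL := fun n => (hd n).memLp_of_hasWeakDeriv hO (ht n)
  have hgL := fun i n => (hd n).memLp_of_hasWeakDeriv hO (hg i n)
  have k1 := fun n => (hF.hasWeakDeriv_time_circleAvg (hd n).1 (htL n) (ht n))
  have k2 := fun n => (hF.hasWeakDeriv_space_circleAvg (g := fun i => g i n) (hd n).1
    (fun i => hgL i n) (fun i => hg i n))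
  have he : e.1 • ((1 : ℝ), (0 : ℝ)) + e.2 • ((0 : ℝ), (1 : ℝ)) = e := by simp
  refine ⟨_, fun n => (he ▸ (k1 n).comb (k2 n) e.1 e.2).congr_ae hS (hae n) EventuallyEq.rfl, ?_⟩
  have hg2 := (hg0 0).add (hg0 1)
  rw [add_zero] at hg2
  have hr := (hz ‖e.1‖ₑ (by simp) (hz C hC ht0)).add (hz ‖e.2‖ₑ (by simp) (hz C hC hg2))
  rw [add_zero] at hr
  refine tendsto_zero_of_le hr (of_forall fun n => ?_)
  have m1 := hF.memLp_circleAvg (htL n)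
  have m0 := memLp_radialPart (g := fun i => g i n) fun i => hgL i n
  have m2 := (hF.memLp_circleAvg m0).const_mul (-1)
  refine (eLpNorm_add_le (m1.const_mul e.1).1 (m2.const_mul e.2).1 one_le_two).trans
    (add_le_add ?_ ?_)
  · refine (eLpNorm_const_smul e.1 _ _ _).trans_le ?_
    gcongr
    exact hle _ (htL n).1
  · refine (eLpNorm_const_smul e.2 _ _ _).trans_le ?_
    gcongr
    refine (eLpNorm_const_smul (-1 : ℝ) _ _ _).trans_le ?_
    rw [enorm_neg, enorm_one, one_mul]
    refine (hle _ m0.1).trans ?_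
    gcongr
    exact eLpNorm_radialPart_le (g := fun i => g i n) fun i => (hgL i n).1

lemma hasTrace_circleAvg {u : ℝ × Plane → ℝ} {b g : ℝ → ℝ} (hu : MemW12 (𝒪 R T ρ) u)
    (hb : Continuous b) (hbc : ∀ t ∈ Ioo 0 T, (t, b t) ∈ closure (Ω T ρ))
    (hg : AEStronglyMeasurable g (vol (Ioo 0 T)))
    (h : HasTrace (𝒪 R T ρ) (lateralMeasure T)
      (fun q => (q.1, polarPoint (R - b q.1) q.2)) u fun q => g q.1) :
    HasTrace (Ω T ρ) (vol (Ioo 0 T)) (fun t => (t, b t)) (circleAvg R u) g := by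
  obtain ⟨φ, hφ, hz, htr⟩ := h
  refine ⟨fun n => circleAvg R (φ n), fun n => ⟨hF.continuousOn_circleAvg (hφ n).1,
    hF.memW12_circleAvg (hφ n).2⟩, hF.tendstoZeroW12_circleAvg hu (fun n => (hφ n).2) hz,
    tendsto_zero_of_le htr (of_forall fun n => ?_)⟩
  have hc : ContinuousOn (fun q : ℝ² => φ n (q.1, polarPoint (R - b q.1) q.2)) (Ioo 0 T ×ˢ univ) :=
    (hφ n).1.comp (continuous_fst.prodMk (continuous_polarPoint.comp ((continuous_const.sub
      (hb.comp continuous_fst)).prodMk continuous_snd))).continuousOn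
      fun q hq => hF.polarMap_mem_closure (hbc q.1 hq.1) q.2
  have hm : AEStronglyMeasurable (fun q : ℝ² => φ n (q.1, polarPoint (R - b q.1) q.2) - g q.1)
      ((vol (Ioo 0 T)).prod angleMeasure) := by
    refine AEStronglyMeasurable.sub ?_ hg.comp_fst
    rw [prod_restrict]
    exact (hc.mono (prod_mono Subset.rfl (subset_univ _))).aestronglyMeasurable
      (measurableSet_Ioo.prod measurableSet_Ioo)
  refine le_trans (le_of_eq (eLpNorm_congr_ae ?_)) (eLpNorm_angle_average_le hm)
  filter_upwards [ae_restrict_mem measurableSet_Ioo] with t ht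
  have hct : Continuous fun θ => φ n (t, polarPoint (R - b t) θ) :=
    hc.comp_continuous (continuous_const.prodMk continuous_id) fun θ => ⟨ht, mem_univ _⟩
  have hi : IntegrableOn (fun θ => φ n (t, polarPoint (R - b t) θ)) (Ioo 0 (2 * π)) :=
    (hct.integrableOn_Icc (a := 0) (b := 2 * π)).mono_set Ioo_subset_Icc_self
  rw [integral_sub hi (integrable_const _), integral_const, mul_sub, smul_eq_mul, angleMeasure_real_univ,
    inv_mul_cancel_left₀ two_pi_pos.ne']
  rfl

end Front

section Initial

variable {R a : ℝ} (ha : 0 < a) (haR : a < R)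

include ha haR

lemma initialL2_radial_iff {F : ℝ × Plane → ℝ} {f : ℝ² → ℝ} {F₀ : Plane → ℝ} {f₀ : ℝ → ℝ}
    (h : ∀ᶠ t in essZeroPlus, ∀ᵐ x ∂vol (annulus (R - a) R), F (t, x) = f (t, R - ‖x‖))
    (h₀ : ∀ᵐ x ∂vol (annulus (R - a) R), F₀ x = f₀ (R - ‖x‖))
    (hm : ∀ᶠ t in essZeroPlus, AEStronglyMeasurable (fun r => f (t, r)) (vol (Ioo 0 a)))
    (hm₀ : AEStronglyMeasurable f₀ (vol (Ioo 0 a))) :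
    InitialL2 (annulus (R - a) R) F F₀ ↔ InitialL2 (Ioo 0 a) f f₀ := by
  obtain ⟨C, hC, hle⟩ := exists_eLpNorm_annulus_le ha haR
  have he : ∀ᶠ t in essZeroPlus, eLpNorm (fun x => F (t, x) - F₀ x) 2 (vol (annulus (R - a) R)) =
      eLpNorm (fun x => (fun r => f (t, r) - f₀ r) (R - ‖x‖)) 2 (vol (annulus (R - a) R)) := by
    filter_upwards [h] with t ht
    refine eLpNorm_congr_ae ?_
    filter_upwards [ht, h₀] with x h1 h2
    rw [h1, h2]
  constructor <;> intro hl <;> refine tendsto_zero_of_le_mul hC hl ?_ <;>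
    filter_upwards [he, hm] with t ht hmt
  · exact ht ▸ (hle _ (hmt.sub hm₀)).2
  · exact ht ▸ (hle _ (hmt.sub hm₀)).1

lemma exists_negOneNorm_le : ∃ C : ℝ≥0∞, C ≠ ⊤ ∧ ∀ (k : ℝ → ℝ) (h : Plane → ℝ),
    MemLp k 2 (vol (Ioo 0 a)) →
    (∀ᵐ x ∂vol (annulus (R - a) R), h x = k (R - ‖x‖)) →
    negOneNorm (Ioo 0 a) k ≤ C * negOneNorm (annulus (R - a) R) h := by
  obtain ⟨C, hC, hle⟩ := exists_eLpNorm_annulus_le ha haR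
  set L := (R - a)⁻¹
  have hR : 0 < R - a := sub_pos.2 haR
  have hL : 0 < L := inv_pos.2 hR
  set M := C.toReal * (L + L * L) + 1
  have hM : 0 < M := by positivity
  refine ⟨ofReal ((2 * π)⁻¹ * M), ofReal_ne_top, fun k h hk hh => ?_⟩
  refine iSup_le fun ψ => iSup_le fun hψ => iSup_le fun h1 => iSup_le fun h2 => ?_
  have hlt : ∀ r ∈ Ioo 0 a, 0 < R - r ∧ (R - r)⁻¹ ≤ L := fun r hr =>
    ⟨by linarith [hr.2], inv_anti₀ hR (by linarith [hr.2])⟩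
  have hκ : IsTestFun (Ioo 0 a) fun r => ψ r * (R - r)⁻¹ :=
    hψ.comp_mul (F := id) continuous_id hψ.hasCompactSupport hψ.tsupport_subset Subset.rfl
      fun r hr => ⟨contDiffAt_id, (contDiffAt_const.sub contDiffAt_id).inv
        (hlt r (hψ.tsupport_subset hr)).1.ne'⟩
  set κ := fun r => ψ r * (R - r)⁻¹ with hκdef
  have hpos : ∀ x : Plane, R - ‖x‖ ∈ tsupport κ → x ∈ annulus (R - a) R ∧ x ≠ 0 := fun x hx => by
    have := hκ.tsupport_subset hx
    exact ⟨⟨by linarith [this.2], by linarith [this.1]⟩, norm_pos_iff.1 (by linarith [this.2])⟩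
  have hFc : Continuous fun x : Plane => R - ‖x‖ := continuous_const.sub continuous_norm
  have hΨ : IsTestFun (annulus (R - a) R) fun x : Plane => κ (R - ‖x‖) * 1 :=
    hκ.comp_mul (m := fun _ => 1) hFc ((isCompact_closedBall (0 : Plane) R).of_isClosed_subset
      ((isClosed_tsupport κ).preimage hFc) fun x hx => by
        rw [mem_closedBall_zero_iff]
        exact (hpos x hx).1.2.le) (fun x hx => (hpos x hx).1) Subset.rfl
      fun x hx => ⟨contDiffAt_const.sub (contDiffAt_norm ℝ (hpos x hx).2), contDiffAt_const⟩
  simp only [mul_one] at hΨ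
  have hdκ : ∀ r ∈ Ioo 0 a, ‖deriv κ r‖ ≤ L * ‖deriv ψ r‖ + L * L * ‖ψ r‖ := by
    intro r hr
    obtain ⟨h3, h4⟩ := hlt r hr
    have hi : HasDerivAt (fun r => (R - r)⁻¹) ((R - r)⁻¹ * (R - r)⁻¹) r := by
      refine (((hasDerivAt_id r).const_sub R).inv h3.ne').congr_deriv ?_
      simp only [id]
      field_simp
    have hd : HasDerivAt κ _ r := (hψ.differentiable r).hasDerivAt.mul hi
    rw [hd.deriv]
    have h5 : 0 ≤ (R - r)⁻¹ := (inv_pos.2 h3).le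
    refine (norm_add_le _ _).trans ?_
    rw [norm_mul, norm_mul, norm_mul, norm_of_nonneg h5, mul_comm ‖deriv ψ r‖, mul_comm ‖ψ r‖]
    gcongr
  have hψd : ∀ r, ‖fderiv ℝ ψ r‖ = ‖deriv ψ r‖ := fun r => norm_deriv_eq_norm_fderiv.symm
  have hmψ := hψ.continuous.aestronglyMeasurable (μ := vol (Ioo 0 a))
  have hmψ' := (hψ.contDiff.continuous_deriv (by simp)).aestronglyMeasurable (μ := vol (Ioo 0 a))
  have h2' : eLpNorm (deriv ψ) 2 (vol (Ioo 0 a)) ≤ 1 :=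
    (eLpNorm_congr_norm_ae (of_forall fun r => (hψd r).symm)).trans_le h2
  have hMC : C * ofReal (L + L * L) ≤ ofReal M := by
    rw [← ofReal_toReal hC, ← ofReal_mul ENNReal.toReal_nonneg]
    exact ofReal_le_ofReal (le_add_of_nonneg_right zero_le_one)
  have c1 : eLpNorm κ 2 (vol (Ioo 0 a)) ≤ ofReal (L + L * L) := by
    refine (eLpNorm_le_mul_eLpNorm_of_ae_le_mul (g := ψ) (c := L) ?_ 2).trans ?_
    · filter_upwards [ae_restrict_mem measurableSet_Ioo] with r hr
      obtain ⟨h3, h4⟩ := hlt r hr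
      rw [hκdef, norm_mul, norm_of_nonneg (inv_pos.2 h3).le, mul_comm]
      gcongr
    · refine (mul_le_mul_right h1 _).trans ?_
      rw [mul_one]
      exact ofReal_le_ofReal (le_add_of_nonneg_right (by positivity))
  have c2 : eLpNorm (deriv κ) 2 (vol (Ioo 0 a)) ≤ ofReal (L + L * L) := by
    refine (eLpNorm_mono_ae (g := fun r => L * ‖deriv ψ r‖ + L * L * ‖ψ r‖) ?_).trans ?_
    · filter_upwards [ae_restrict_mem measurableSet_Ioo] with r hr
      exact (hdκ r hr).trans (le_abs_self _)
    · refine (eLpNorm_add_le (hmψ'.norm.const_mul L) (hmψ.norm.const_mul (L * L)) one_le_two).trans ?_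
      rw [ofReal_add hL.le (by positivity)]
      refine add_le_add ((eLpNorm_const_smul L (fun r => ‖deriv ψ r‖) _ _).trans_le ?_)
        ((eLpNorm_const_smul (L * L) (fun r => ‖ψ r‖) _ _).trans_le ?_)
      · rw [eLpNorm_norm, enorm_of_nonneg hL.le]
        exact mul_le_of_le_one_right' h2'
      · rw [eLpNorm_norm, enorm_of_nonneg (by positivity)]
        exact mul_le_of_le_one_right' h1
  have hκm := hκ.continuous.aestronglyMeasurable (μ := vol (Ioo 0 a))
  have hκm' := (hκ.contDiff.continuous_deriv (by simp)).aestronglyMeasurable (μ := vol (Ioo 0 a))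
  have b2 : eLpNorm (fderiv ℝ fun x : Plane => κ (R - ‖x‖)) 2 (vol (annulus (R - a) R)) ≤
      ofReal M := by
    refine (eLpNorm_mono_ae (g := fun x => deriv κ (R - ‖x‖)) ?_).trans
      ((hle _ hκm').1.trans ((mul_le_mul_right c2 _).trans hMC))
    filter_upwards [ae_restrict_mem (isOpen_annulus ha haR).measurableSet] with x hx
    have hx0 : x ≠ 0 := norm_pos_iff.1 (hR.trans hx.1)
    have hd : HasFDerivAt (fun x : Plane => κ (R - ‖x‖)) _ x :=
      (hκ.differentiable _).hasDerivAt.comp_hasFDerivAt x ((hasFDerivAt_norm_plane hx0).const_sub R)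
    rw [hd.fderiv, norm_smul, norm_neg, norm_smul, norm_inv, norm_norm, innerSL_apply_norm,
      inv_mul_cancel₀ (norm_ne_zero_iff.2 hx0), mul_one]
  have hI := hΨ.enorm_integral_le_negOneNorm (h := h) hM
    ((hle _ hκm).1.trans ((mul_le_mul_right c1 _).trans hMC)) b2
  obtain ⟨B, hB⟩ := hκ.exists_bound
  have hkκ : MemLp (fun r => k r * κ r) 2 (vol (Ioo 0 a)) := by
    refine hk.of_le_mul (c := B) (hk.1.mul hκm) (of_forall fun r => ?_)
    rw [norm_mul, mul_comm]
    exact mul_le_mul_of_nonneg_right (hB r) (norm_nonneg _)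
  have e1 : ∫ x in annulus (R - a) R, h x * κ (R - ‖x‖) = 2 * π * ∫ r in Ioo 0 a, k r * ψ r := by
    rw [integral_congr_ae (g := fun x => (fun r => k r * κ r) (R - ‖x‖)) (by
      filter_upwards [hh] with x hx
      rw [hx]), integral_annulus ha haR hkκ]
    congr 1
    refine setIntegral_congr_fun measurableSet_Ioo fun r hr => ?_
    have := (hlt r hr).1.ne'
    simp only [hκdef]
    field_simp
  have h2π := two_pi_pos
  rw [ofReal_mul (by positivity), mul_assoc, ← inv_mul_cancel_left₀ h2π.ne'
    (∫ r in Ioo 0 a, k r * ψ r), ← e1, enorm_mul, enorm_of_nonneg (inv_pos.2 h2π).le]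
  exact mul_le_mul_right hI _

end Initial

section Radial

variable {α R ρ₀ T : ℝ} {ρ ρ' w v₀ v₁ : ℝ → ℝ} {u₀ u₁ : Plane → ℝ} {u : ℝ × Plane → ℝ}

lemma annularDomain_congr (hag : ∀ t ∈ Icc 0 T, ρ t = ρ' t) : 𝒪 R T ρ = 𝒪 R T ρ' := by
  ext p
  rw [mem_annularDomain, mem_annularDomain, stripDomain_congr hag]

lemma IsRadialSolution.congr_front (h : IsRadialSolution α R ρ₀ T ρ w u₀ u₁ u)
    (hag : ∀ t ∈ Icc 0 T, ρ t = ρ' t) : IsRadialSolution α R ρ₀ T ρ' w u₀ u₁ u := by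
  have e := annularDomain_congr (R := R) hag
  refine ⟨⟨e ▸ h.memW12, e ▸ h.trace_outer, ?_, h.initial, e ▸ h.equation⟩, ?_⟩
  · obtain ⟨φ, h1, h2, h3⟩ := h.trace_front
    rw [← e]
    refine ⟨φ, h1, h2, h3.congr fun n => eLpNorm_congr_ae ?_⟩
    filter_upwards [Measure.quasiMeasurePreserving_fst.ae (ae_restrict_mem measurableSet_Ioo)] with q hq
    rw [hag q.1 (Ioo_subset_Icc_self hq)]
  · filter_upwards [h.radial, ae_restrict_mem measurableSet_Icc] with t ht htT
    rwa [← hag t htT]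

variable (hF : Front R ρ₀ T ρ)

include hF

lemma Front.front_lt (t : ℝ) : ρ t < R := by
  rcases le_total t T with h | h
  · exact (hF.mono h).trans_lt hF.lt
  · rw [hF.final t h]
    exact hF.lt

lemma Front.ae_slice_annular {P : ℝ × Plane → Prop} (h : ∀ᵐ p ∂vol (𝒪 R T ρ), P p) :
    ∀ᵐ t : ℝ, t ∈ Ioo 0 T → ∀ᵐ x ∂vol (annulus (R - ρ t) R), P (t, x) := by
  rw [ae_restrict_iff' hF.isOpen_annular.measurableSet, volume_eq_prod] at h
  filter_upwards [ae_ae_of_ae_prod h] with t ht htT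
  rw [ae_restrict_iff' (isOpen_annulus (hF.front_pos t) (hF.front_lt t)).measurableSet]
  filter_upwards [ht] with x hx hxA
  exact hx ⟨htT.1, htT.2, hxA⟩

lemma Front.eventually_slice_annular {P : ℝ × Plane → Prop} (h : ∀ᵐ p ∂vol (𝒪 R T ρ), P p) :
    ∀ᶠ t in essZeroPlus, ∀ᵐ x ∂vol (annulus (R - ρ₀) R), P (t, x) := by
  filter_upwards [Eventually.filter_mono inf_le_right (hF.ae_slice_annular h),
    mem_essZeroPlus hF.pos_time] with t ht htT
  exact ae_restrict_of_ae_restrict_of_subset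
    (t := annulus (R - ρ t) R) (fun x hx => ⟨(sub_le_sub_left (hF.ge t) R).trans_lt hx.1, hx.2⟩) (ht htT)

lemma Front.ae_eq_circleAvg (hu : MemLp u 2 (vol (𝒪 R T ρ)))
    (hrad : ∀ᵐ t ∂vol (Icc 0 T), IsRadialAE (R - ρ t) R fun x => u (t, x)) :
    ∀ᵐ p ∂vol (𝒪 R T ρ), u p = circleAvg R u (_root_.radial R p) := by
  have hO := hF.isOpen_annular.measurableSet
  obtain ⟨G, hG, hGe⟩ := (hu.sub (hF.memLp_comp_radial (hF.memLp_circleAvg hu))).1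
  suffices h : ∀ᵐ p ∂vol (𝒪 R T ρ), G p = 0 by
    filter_upwards [h, hGe] with p h1 h2
    exact sub_eq_zero.1 (h2.trans h1)
  rw [ae_restrict_iff' hO, volume_eq_prod]
  have hm : MeasurableSet {p | p ∈ 𝒪 R T ρ → G p = 0} := by
    have : {p | p ∈ 𝒪 R T ρ → G p = 0} = (𝒪 R T ρ)ᶜ ∪ G ⁻¹' {0} := by
      ext p
      exact imp_iff_not_or
    rw [this]
    exact hO.compl.union (hG.measurable (measurableSet_singleton 0))
  rw [Measure.ae_prod_iff_ae_ae hm]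
  filter_upwards [hF.ae_slice_annular hGe, (ae_restrict_iff' measurableSet_Icc).1 hrad] with t h1 h2
  by_cases htT : t ∈ Ioo 0 T
  · have h3 := (h2 (Ioo_subset_Icc_self htT)).ae_eq_circleAvg (hF.front_pos t) (hF.front_lt t)
    have hA := (isOpen_annulus (hF.front_pos t) (hF.front_lt t)).measurableSet
    filter_upwards [(ae_restrict_iff' hA).1 (h1 htT), (ae_restrict_iff' hA).1 h3] with x h4 h5 hx
    rw [← h4 hx.2.2]
    exact sub_eq_zero.2 (h5 hx.2.2)
  · exact of_forall fun x hx => absurd ⟨hx.1, hx.2.1⟩ htT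

lemma IsRadialSolution.isStripSolution (h : IsRadialSolution α R ρ₀ T ρ w u₀ u₁ u)
    (hw : AEStronglyMeasurable w (vol (Ioo 0 T)))
    (hv₀ : AEStronglyMeasurable v₀ (vol (Ioo 0 ρ₀)))
    (hv₁ : MemLp v₁ 2 (vol (Ioo 0 ρ₀)))
    (h₀ : ∀ᵐ x ∂vol (annulus (R - ρ₀) R), u₀ x = v₀ (R - ‖x‖))
    (h₁ : ∀ᵐ x ∂vol (annulus (R - ρ₀) R), u₁ x = v₁ (R - ‖x‖))
    (hrad : ∀ᵐ p ∂vol (𝒪 R T ρ), u p = circleAvg R u (_root_.radial R p)) :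
    IsStripSolution 1 α R ρ₀ T ρ w v₀ v₁ (circleAvg R u) := by
  have hlt : ρ₀ < R := (hF.ge 0).trans_lt (hF.front_lt 0)
  have hO := hF.isOpen_annular
  obtain ⟨ut, ht, heq, hinit⟩ := h.equation
  have htL := h.memW12.memLp_of_hasWeakDeriv hO ht
  choose g hg hgL using fun i => h.memW12.2 (spaceDir i)
  have hW := hF.memW12_circleAvg h.memW12
  have ht' := hF.hasWeakDeriv_time_circleAvg h.memW12.1 htL ht
  have htL' := hF.memLp_circleAvg htL
  have hrad' : ∀ᵐ p ∂vol (𝒪 R T ρ), ut p = circleAvg R ut (_root_.radial R p) :=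
    (ht.congr_ae hO hrad EventuallyEq.rfl).ae_unique hO (hF.hasWeakDeriv_time_radial hW.1 htL' ht')
  refine ⟨hW, hF.hasTrace_circleAvg h.memW12 continuous_const (fun t ht => ?_) hw
    (by simpa only [sub_zero] using h.trace_outer),
    hF.hasTrace_circleAvg h.memW12 hF.continuous (fun t ht => ?_) aestronglyMeasurable_const h.trace_front,
    (initialL2_radial_iff hF.pos hlt (hF.eventually_slice_annular hrad) h₀
      ((hF.eventually_slice hW.1).mono fun t ht => ht.1) hv₀).1 h.initial,
    circleAvg R ut, _, ht', hF.hasWeakDeriv_space_circleAvg h.memW12.1 hgL hg,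
    fun φ hφ => hF.strip_equation_of_annular h.memW12.1 htL hgL ht hg heq hφ, ?_⟩
  · rw [hF.closure_strip]
    exact ⟨ht.1.le, ht.2.le, le_rfl, (hF.front_pos t).le⟩
  · rw [hF.closure_strip]
    exact ⟨ht.1.le, ht.2.le, (hF.front_pos t).le, le_rfl⟩
  · obtain ⟨C, hC, hle⟩ := exists_negOneNorm_le hF.pos hlt
    refine tendsto_zero_of_le_mul hC hinit ?_
    filter_upwards [hF.eventually_slice htL', hF.eventually_slice_annular hrad'] with t h1 h2
    refine hle (fun r => circleAvg R ut (t, r) - v₁ r) _ (h1.sub hv₁) ?_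
    filter_upwards [h2, h₁] with x h3 h4
    rw [h3, h4]
    rfl

lemma IsWave.isRadialSolution {f z p q : ℝ² → ℝ} (H : IsWave f z p q)
    (haxis : ∀ t ∈ Ioo 0 T, z (t, 0) = w t) (hfront : ∀ t, 0 ≤ t → z (t, ρ t) = 0)
    (hvel : ∀ᵐ r ∂vol (Ioo 0 ρ₀), (p (0, r) + q (0, r)) / 2 = v₁ r)
    (hsol : IsStripSolution 1 α R ρ₀ T ρ w v₀ v₁ (cutWave T ρ z))
    (hv₀ : AEStronglyMeasurable v₀ (vol (Ioo 0 ρ₀)))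
    (hv₁ : MemLp v₁ 2 (vol (Ioo 0 ρ₀)))
    (h₀ : ∀ᵐ x ∂vol (annulus (R - ρ₀) R), u₀ x = v₀ (R - ‖x‖))
    (h₁ : ∀ᵐ x ∂vol (annulus (R - ρ₀) R), u₁ x = v₁ (R - ‖x‖)) :
    IsRadialSolution α R ρ₀ T ρ w u₀ u₁ fun x => cutWave T ρ z (radial R x) := by
  have hlt : ρ₀ < R := (hF.ge 0).trans_lt (hF.front_lt 0)
  have hR : 0 < R := hF.pos.trans hlt
  have hS := hF.isOpen_strip
  have hW := H.memW12_cut hF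
  have hU := hF.memW12_radial hW
  have ht := H.hasWeakDeriv_cut_time hF
  have hr := H.hasWeakDeriv_cut_space hF
  have htL := hW.memLp_of_hasWeakDeriv hS ht
  have hc : ContinuousOn (fun x => cutWave T ρ z (radial R x)) (closure (𝒪 R T ρ)) :=
    (continuousOn_cutWave H.continuous).comp (continuous_radial R).continuousOn
      fun x hx => hF.radial_mem_closure hx
  have htime : ∀ᵐ x ∂(lateralMeasure T), x.1 ∈ Ioo 0 T :=
    Measure.quasiMeasurePreserving_fst.ae (ae_restrict_mem measurableSet_Ioo)
  refine ⟨⟨hU, hasTrace_of_continuousOn hc hU ?_, hasTrace_of_continuousOn hc hU ?_,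
    (initialL2_radial_iff hF.pos hlt (of_forall fun t => of_forall fun x => rfl) h₀
      ((hF.eventually_slice hW.1).mono fun t ht => ht.1) hv₀).2 hsol.initial,
    _, hF.hasWeakDeriv_time_radial hW.1 htL ht, fun Φ hΦ => ?_, ?_⟩, ?_⟩
  · filter_upwards [htime] with x hx
    rw [radial, norm_polarPoint, abs_of_pos hR, sub_self, cutWave_eq hF (Ioo_subset_Icc_self hx),
      indicator_of_mem, haxis x.1 hx]
    exact ⟨le_rfl, (hF.front_pos _).le⟩
  · filter_upwards [htime] with x hx
    rw [radial, norm_polarPoint, abs_of_pos (sub_pos.2 (hF.front_lt _)), sub_sub_cancel,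
      cutWave_eq hF (Ioo_subset_Icc_self hx), indicator_of_mem, hfront x.1 hx.1.le]
    exact ⟨(hF.front_pos _).le, le_rfl⟩
  · obtain ⟨vt, vr, h2, h3, h4, -⟩ := hsol.equation
    refine hF.annular_equation_of_strip hW.1 htL (hW.memLp_of_hasWeakDeriv hS hr) ht hr
      (fun φ hφ => ?_) hΦ
    rw [← h4 φ hφ]
    refine integral_congr_ae ?_
    filter_upwards [ht.ae_unique hS h2, hr.ae_unique hS h3] with x h5 h6
    rw [h5, h6]
  · have h2 : InitialL2 (Ioo 0 ρ₀) (fun x => (p x + q x) / 2) v₁ := by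
      refine tendsto_zero_of_le ((H.curve_time.tendsto_eLpNorm 0).mono_left essZeroPlus_le)
        (of_forall fun t => ?_)
      refine eLpNorm_restrict_le_of_eqOn _ ?_
      filter_upwards [hvel] with r hr
      rw [hr]
    have h3 := (initialL2_radial_iff hF.pos hlt (F := fun x => (fun x => (p x + q x) / 2) (radial R x))
      (of_forall fun t => of_forall fun x => rfl) h₁
      ((hF.eventually_slice htL).mono fun t ht => ht.1) hv₁.1).2 h2
    refine tendsto_zero_of_le h3 ?_
    filter_upwards [hF.eventually_slice htL] with t ht
    exact negOneNorm_le _ ((memLp_radial_static hF.pos hlt ht).1.sub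
      ((memLp_radial_static hF.pos hlt hv₁).1.congr (EventuallyEq.symm h₁)))
  · obtain ⟨V, D, -, -, hVD⟩ := H.isC0W12 hF hfront
    filter_upwards [ae_restrict_mem measurableSet_Icc] with t ht
    obtain ⟨h2, h3⟩ := hVD t ht
    have hsub : Ioo 0 (ρ t) ⊆ Ioo 0 R := Ioo_subset_Ioo_right (hF.front_lt t).le
    have hm : ∀ {k : ℝ → ℝ}, MemLp k 2 (vol (Ioo 0 R)) → MemLp k 2 (vol (Ioo 0 (ρ t))) := fun hk =>
        hk.mono_measure (restrict_mono_set volume hsub)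
    have h4 := h3.mono hsub
    refine ⟨memW12_radial_static (hF.front_pos t) (hF.front_lt t)
      ⟨hm ((Lp.memLp (V t)).ae_eq h2), fun e => ⟨_, by
        simpa only [smul_eq_mul, mul_one, zero_mul, add_zero] using h4.comb h4 e 0,
        (hm (Lp.memLp (D t))).const_mul e⟩⟩, fun s => cutWave T ρ z (t, R - s),
      of_forall fun x => rfl⟩

end Radial

lemma exists_profiles {R ρ₀ c : ℝ} (hρ₀ : 0 < ρ₀) (hR : ρ₀ < R) {u₀ u₁ : Plane → ℝ}
    (hu₀ : MemW12rad (R - ρ₀) R u₀) (hu₁ : MemL2rad (R - ρ₀) R u₁) {U₀ : ℝ → ℝ}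
    (hUc : ContinuousOn U₀ (Icc (R - ρ₀) R))
    (hU : ∀ᵐ x ∂vol (annulus (R - ρ₀) R), u₀ x = U₀ ‖x‖) (h0 : U₀ R = c)
    (h1 : U₀ (R - ρ₀) = 0) :
    ∃ v₀ v₁ : ℝ → ℝ, MemW12 (Ioo 0 ρ₀) v₀ ∧ ContinuousOn v₀ (Icc 0 ρ₀) ∧
      MemLp v₁ 2 (vol (Ioo 0 ρ₀)) ∧ v₀ 0 = c ∧ v₀ ρ₀ = 0 ∧
      (∀ᵐ x ∂vol (annulus (R - ρ₀) R), u₀ x = v₀ (R - ‖x‖)) ∧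
      ∀ᵐ x ∂vol (annulus (R - ρ₀) R), u₁ x = v₁ (R - ‖x‖) := by
  have hc : ContinuousOn (fun r => U₀ (R - r)) (Icc 0 ρ₀) :=
    hUc.comp (by fun_prop) fun r hr => ⟨by linarith [hr.2], by linarith [hr.1]⟩
  have hm := (hc.mono Ioo_subset_Icc_self).aestronglyMeasurable (μ := volume) measurableSet_Ioo
  have hW := memW12_circleAvg_static hρ₀ hR hu₀.1
  refine ⟨fun r => U₀ (R - r), _, ?_, hc, memLp_circleAvg_static hρ₀ hR hu₁.1, by simpa only [sub_zero] using h0, h1,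
    by simpa only [sub_sub_cancel] using hU, hu₁.2.ae_eq_circleAvg hρ₀ hR⟩
  have he : (fun r => circleAvg R (fun p => u₀ p.2) (0, r)) =ᵐ[vol (Ioo 0 ρ₀)]
      fun r => U₀ (R - r) := by
    obtain ⟨C, -, hle⟩ := exists_eLpNorm_annulus_le hρ₀ hR
    have h2 : (fun x : Plane => circleAvg R (fun p => u₀ p.2) (0, R - ‖x‖) - U₀ (R - (R - ‖x‖)))
        =ᵐ[vol (annulus (R - ρ₀) R)] fun _ => (0 : ℝ) := by
      filter_upwards [hU, hu₀.2.ae_eq_circleAvg hρ₀ hR] with x h3 h4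
      rw [← h4, h3, sub_sub_cancel, sub_self]
    have h3 := (hle _ (hW.1.1.sub hm)).2.trans_eq (congrArg _ ((eLpNorm_congr_ae h2).trans eLpNorm_zero'))
    rw [mul_zero, nonpos_iff_eq_zero, eLpNorm_eq_zero_iff (hW.1.1.sub hm) two_ne_zero] at h3
    exact h3.mono fun r hr => sub_eq_zero.1 hr
  refine ⟨hW.1.ae_eq he, fun e => ?_⟩
  obtain ⟨g, hg, hg'⟩ := hW.2 e
  exact ⟨g, hg.congr_ae isOpen_Ioo he EventuallyEq.rfl, hg'⟩

theorem annular_wellposed {R ρ₀ T α : ℝ} (hρ₀ : 0 < ρ₀) (hR : ρ₀ < R) (hT : 0 < T) {ρ : ℝ → ℝ}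
    (hρ : IsFront R ρ₀ T ρ) {w : ℝ → ℝ} (hw : MemW12 (Ioo 0 T) w) (hwc : ContinuousOn w (Icc 0 T))
    {u₀ u₁ : Plane → ℝ} (hu₀ : MemW12rad (R - ρ₀) R u₀) (hu₁ : MemL2rad (R - ρ₀) R u₁) {U₀ : ℝ → ℝ}
    (hUc : ContinuousOn U₀ (Icc (R - ρ₀) R))
    (hU : ∀ᵐ x ∂vol (annulus (R - ρ₀) R), u₀ x = U₀ ‖x‖) (h0 : U₀ R = w 0)
    (h1 : U₀ (R - ρ₀) = 0) :
    ∃ u : ℝ × Plane → ℝ, IsRadialSolution α R ρ₀ T ρ w u₀ u₁ u ∧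
      ∀ u' : ℝ × Plane → ℝ, IsRadialSolution α R ρ₀ T ρ w u₀ u₁ u' → u' =ᵐ[vol (𝒪 R T ρ)] u := by
  have hF : Front R ρ₀ T (frontExt T ρ) := hρ.front hρ₀ hT
  obtain ⟨v₀, v₁, hv₀, hvc, hv₁, h2, h3, e₀, e₁⟩ := exists_profiles hρ₀ hR hu₀ hu₁ hUc hU h0 h1
  obtain ⟨W, V₀, V₁, hD, dW, dV, -, dV1⟩ := exists_waveData hρ₀ hT hw hwc hv₀ hvc hv₁ h2 h3
  obtain ⟨f, hf, -, -, hsol, huniq⟩ := exists_stripSolution hF hD 1 α dW dV dV1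
  have hu := (isWave_waveSol hF hf hD).isRadialSolution hF
    (fun t ht => (waveSol_axis hF hf hD (Ioo_subset_Icc_self ht)).trans (dW t (Ioo_subset_Icc_self ht)))
    (fun t ht => waveSol_front hF hf hD ht) (EventuallyEq.trans (waveSol_vel hF hf hD) dV1) hsol hv₀.1.1 hv₁ e₀ e₁
  refine ⟨_, hu.congr_front fun t ht => frontExt_eq ht, fun u' hu' => ?_⟩
  have hag : ∀ t ∈ Icc 0 T, ρ t = frontExt T ρ t := fun t ht => (frontExt_eq ht).symm
  replace hu' := hu'.congr_front hag
  have hrad := hF.ae_eq_circleAvg hu'.memW12.1 (hu'.radial.mono fun t ht => ht.2)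
  rw [annularDomain_congr hag]
  exact EventuallyEq.trans hrad (hF.ae_comp_radial
    (huniq _ (hu'.isStripSolution hF hw.1.1 hv₀.1.1 hv₁ e₀ e₁ hrad)))

end

theorem corollary1p5 (R ρ₀ T α : ℝ) (hρ₀ : 0 < ρ₀) (hR : ρ₀ < R) (hT : 0 < T) (hα : 0 ≤ α)
    (ρ : ℝ → ℝ) (hρ : IsFront R ρ₀ T ρ)
    -- the load, identified with its continuous representative
    (w : ℝ → ℝ) (hw : MemW12 (Ioo 0 T) w) (hwc : ContinuousOn w (Icc 0 T)) :
    -- (i)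
    (∀ v₀ v₁ : ℝ → ℝ,
      MemW12 (Ioo 0 ρ₀) v₀ → ContinuousOn v₀ (Icc 0 ρ₀) →
      MemLp v₁ 2 (volume.restrict (Ioo 0 ρ₀)) →
      v₀ 0 = w 0 → v₀ ρ₀ = 0 →
      ∃ v : ℝ × ℝ → ℝ,
        IsStripSolution 1 α R ρ₀ T ρ w v₀ v₁ v ∧
        (∀ v' : ℝ × ℝ → ℝ, IsStripSolution 1 α R ρ₀ T ρ w v₀ v₁ v' →
          v' =ᵐ[volume.restrict (stripDomain T ρ)] v) ∧
        (∃ vFree : ℝ × ℝ → ℝ,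
          IsStripSolution 0 0 R ρ₀ T ρ w v₀ v₁ vFree ∧
          (∀ v' : ℝ × ℝ → ℝ, IsStripSolution 0 0 R ρ₀ T ρ w v₀ v₁ v' →
            v' =ᵐ[volume.restrict (stripDomain T ρ)] vFree) ∧
          (∀ᵐ p ∂(volume.restrict (omegaPrime ρ₀ T ρ)),
            vFree p = dAlembert ρ₀ T ρ w v₀ v₁ p) ∧
          ∀ vt vr : ℝ × ℝ → ℝ,
            HasWeakDeriv (stripDomain T ρ) (1, 0) v vt →
            HasWeakDeriv (stripDomain T ρ) (0, 1) v vr →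
            ∀ᵐ p ∂(volume.restrict (omegaPrime ρ₀ T ρ)),
              v p = vFree p
                + (∫ q in coneP ρ₀ T ρ p.1 p.2, (-(vr q / (R - q.2)) - α * vt q)) / 2) ∧
        ContinuousOn v (closure (stripDomain T ρ)) ∧
        (∀ p, p ∉ closure (stripDomain T ρ) → v p = 0) ∧
        IsC0W12 R T v ∧ IsC1L2 R T v) ∧
    -- (ii)
    (∀ u₀ u₁ : Plane → ℝ,
      MemW12rad (R - ρ₀) R u₀ → MemL2rad (R - ρ₀) R u₁ →
      (∃ U₀ : ℝ → ℝ, ContinuousOn U₀ (Icc (R - ρ₀) R) ∧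
        (∀ᵐ x ∂(volume.restrict (annulus (R - ρ₀) R)), u₀ x = U₀ ‖x‖) ∧
        U₀ R = w 0 ∧ U₀ (R - ρ₀) = 0) →
      ∃ u : ℝ × Plane → ℝ,
        IsRadialSolution α R ρ₀ T ρ w u₀ u₁ u ∧
        ∀ u' : ℝ × Plane → ℝ, IsRadialSolution α R ρ₀ T ρ w u₀ u₁ u' →
          u' =ᵐ[volume.restrict (annularDomain R T ρ)] u) :=
  ⟨fun _ _ hv₀ hvc hv₁ h0 h1 => strip_wellposed hρ₀ hT hρ hw hwc hv₀ hvc hv₁ h0 h1,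
    fun _ _ hu₀ hu₁ ⟨_, hUc, hU, h0, h1⟩ => annular_wellposed hρ₀ hR hT hρ hw hwc hu₀ hu₁ hUc hU h0 h1⟩
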